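/- Let $\mathcal A=\mathbb C[[\hbar]]$. Let $\mathcal D Y_\hbar(\mathfrak{gl}_2)$ be the topological ($\hbar$-adically complete) $\mathcal A$-algebra generated by $t_{ij}^k$ ($1\le i,j\le 2$, $k\in\mathbb Z$) and a central element $c$ such that, with $T^\pm(u)=(t^\pm_{ij}(u))$, $t_{ij}^{+}(u)=\delta_{ij}-\hbar\sum_{k\ge 0}t_{ij}^k u^{-k-1}$, $t_{ij}^{-}(u)=\delta_{ij}+\hbar\sum_{k<0}t_{ij}^k u^{-k-1}$, $R(u)=\frac{1}{u+\hbar}(uI+\hbar\mathcal P)$ ($\mathcal P$ the permutation operator on $V\otimes V$, $\dim V=2$), $\overset1T=T\otimes \mathrm{id}$, $\overset2T=\mathrm{id}\otimes T$ and $u_\pm=u\pm\frac14\hbar c$, $$R(u-v)\overset{1}{T^{\pm}}(u)\overset{2}{T^{\pm}}(v)=\overset{2}{T^{\pm}}(v)\overset{1}{T^{\pm}}(u)R(u-v),\qquad R(u_--v_+)\overset{1}{T^{+}}(u)\overset{2}{T^{-}}(v)=\overset{2}{T^{-}}(v)\overset{1}{T^{+}}(u)R(u_+-v_-).$$ Put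 $k_1^\pm(u)=t_{11}^\pm(u)$, $k_2^\pm(u)=t_{22}^\pm(u)-t_{21}^\pm(u)t_{11}^\pm(u)^{-1}t_{12}^\pm(u)$, and $$X^+(u)=t_{11}^+(u_-)^{-1}t_{12}^+(u_-)-t_{11}^-(u_+)^{-1}t_{12}^-(u_+),\qquad X^-(u)=t_{21}^+(u_+)t_{11}^+(u_+)^{-1}-t_{21}^-(u_-)t_{11}^-(u_-)^{-1}.$$ Let $\varepsilon_1,\varepsilon_2$ be an orthonormal basis of $\mathbb C^2$ for a symmetric bilinear form $(\cdot,\cdot)$, $\alpha=\varepsilon_1-\varepsilon_2$, $\overline Q=\mathbb Z\alpha$, $\overline\Lambda_0=0$, $\overline\Lambda_1=\alpha/2$. For $i\in\{0,1\}$ and $s\in\mathbb C$ let $\mathcal F_{i,s}$ be the $\hbar$-adic completion of $$\mathcal A[a_{j,-k}\,(j=1,2,\ k>0)]\otimes\mathcal A[\overline Q]\,e^{\overline\Lambda_i+\frac s2(\varepsilon_1+\varepsilon_2)} .$$ On it, for $k>0$, $a_{j,-k}$ acts by multiplication and $a_{j,k}$ by $k\,\partial/\partial a_{j,-k}$ (so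 $[a_{i,k},a_{j,l}]=k\delta_{ij}\delta_{k+l,0}$), while $\partial_{\gamma}(f\otimes e^\beta)=(\gamma,\beta)f\otimes e^\beta$ and $e^{\gamma}(f\otimes e^\beta)=f\otimes e^{\beta+\gamma}$. Then there is exactly one $\mathcal D Y_\hbar(\mathfrak{gl}_2)$-module structure on $\mathcal F_{i,s}$, extending its $\mathcal A$-module structure, in which $c$ acts as $1$ (level $1$) and, for $j=1,2$, $$k_j^+(u)\mapsto\exp\Big[-\sum_{k>0}\frac{a_{j,k}}{k}\{(u+\tfrac12\hbar)^{-k}-(u-\tfrac12\hbar)^{-k}\}\Big]\Big(\frac{u-\frac12\hbar}{u+\frac12\hbar}\Big)^{\partial_{\varepsilon_j}},$$ $$k_j^-(u)\mapsto\exp\Big[\sum_{k>0,\,r<j}\frac{a_{r,-k}}{k}\{u^k-(u-\hbar)^k\}+\sum_{k>0,\,r>j}\frac{a_{r,-k}}{k}\{(u+\hbar)^k-u^k\}\Big],$$ $$\tfrac1\hbar X^+(u)\mapsto\exp\Big[-\sum_{k>0}\frac{a_{1,-k}}{k}(u-\tfrac34\hbar)^k+\sum_{k>0}\frac{a_{2,-k}}{k}(u+\tfrac14\hbar)^k\Big]\exp\Big[\sum_{k>0}\frac{a_{1,k}-a_{2,k}}{k}(u+\tfrac14\hbar)^{-k}\Big]e^{\alpha}\,[u+\tfrac14\hbar]^{\partial_\alpha},$$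 $$\tfrac1\hbar X^-(u)\mapsto\exp\Big[\sum_{k>0}\frac{a_{1,-k}}{k}(u-\tfrac14\hbar)^k-\sum_{k>0}\frac{a_{2,-k}}{k}(u+\tfrac34\hbar)^k\Big]\exp\Big[\sum_{k>0}\frac{-a_{1,k}+a_{2,k}}{k}(u-\tfrac14\hbar)^{-k}\Big]e^{-\alpha}\,[u-\tfrac14\hbar]^{-\partial_\alpha}.$$ All powers of $u+b\hbar$ are expanded in non-negative powers of $\hbar$, and the identities are between the coefficients of powers of $u$, as operators on $\mathcal F_{i,s}$. -/

import Mathlib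

open scoped Kronecker

noncomputable section

namespace YangianDouble

/-! ### The algebra -/

/-- The base ring `𝒜 = ℂ[[ħ]]`. -/
abbrev Base : Type := PowerSeries ℂ

/-- The formal variable `ħ`. -/
def hbar : Base := PowerSeries.X

section RTT

variable {B : Type*} [Ring B] [Algebra Base B]

/-- The coefficient of `u ^ n` in `T⁺(u)`, where
`t⁺ᵢⱼ(u) = δᵢⱼ - ħ ∑_{k ≥ 0} tᵢⱼᵏ u^(-k-1)`. -/
def Tplus (t : Fin 2 → Fin 2 → ℤ → B) (n : ℤ) : Matrix (Fin 2) (Fin 2) B :=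
  Matrix.of fun i j =>
    (if n = 0 ∧ i = j then 1 else 0) - (if n < 0 then hbar • t i j (-n - 1) else 0)

/-- The coefficient of `u ^ n` in `T⁻(u)`, where
`t⁻ᵢⱼ(u) = δᵢⱼ + ħ ∑_{k < 0} tᵢⱼᵏ u^(-k-1)`. -/
def Tminus (t : Fin 2 → Fin 2 → ℤ → B) (n : ℤ) : Matrix (Fin 2) (Fin 2) B :=
  Matrix.of fun i j =>
    (if n = 0 ∧ i = j then 1 else 0) + (if 0 ≤ n then hbar • t i j (-n - 1) else 0)

/-- A formal series in `u^{±1}, v^{±1}` with coefficients in `End (V ⊗ V) ⊗ B`, `V` of rank two: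
`D m n` is the coefficient of `u ^ m v ^ n`. -/
abbrev Dist (B : Type*) : Type _ := ℤ → ℤ → Matrix (Fin 2 × Fin 2) (Fin 2 × Fin 2) B

/-- The permutation operator `v ⊗ w ↦ w ⊗ v`. -/
def perm : Matrix (Fin 2 × Fin 2) (Fin 2 × Fin 2) B :=
  Matrix.of fun x y => if x = y.swap then 1 else 0

/-- `T(u) ⊗ id`, coefficientwise. -/
def leg₁ (M : Matrix (Fin 2) (Fin 2) B) : Matrix (Fin 2 × Fin 2) (Fin 2 × Fin 2) B := M ⊗ₖ 1

/-- `id ⊗ T(u)`, coefficientwise. -/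
def leg₂ (M : Matrix (Fin 2) (Fin 2) B) : Matrix (Fin 2 × Fin 2) (Fin 2 × Fin 2) B := 1 ⊗ₖ M

/-- Multiplication by the scalar `u - v + y`. -/
def mulScalar (y : B) (D : Dist B) : Dist B :=
  fun m n => D (m - 1) n - D m (n - 1) + y • D m n

/-- Left multiplication by `x I + ħ P`, where `x = u - v + y`. -/
def mulYangLeft (y : B) (D : Dist B) : Dist B :=
  fun m n => mulScalar y D m n + hbar • (perm * D m n)

/-- Right multiplication by `x I + ħ P`, where `x = u - v + y`. -/
def mulYangRight (y : B) (D : Dist B) : Dist B :=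
  fun m n => mulScalar y D m n + hbar • (D m n * perm)

/-- The product `(T(u) ⊗ id) (id ⊗ T'(v))`. -/
def prod₁₂ (T T' : ℤ → Matrix (Fin 2) (Fin 2) B) : Dist B := fun m n => leg₁ (T m) * leg₂ (T' n)

/-- The product `(id ⊗ T'(v)) (T(u) ⊗ id)`. -/
def prod₂₁ (T T' : ℤ → Matrix (Fin 2) (Fin 2) B) : Dist B := fun m n => leg₂ (T' n) * leg₁ (T m)

end RTT

/-- The generators `tᵢⱼᵏ` (`k ∈ ℤ`) and `c`. -/
inductive Gen : Type
  | t (i j : Fin 2) (k : ℤ) : Gen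
  | c : Gen

/-- The generator `tᵢⱼᵏ` in the free algebra. -/
def freeT (i j : Fin 2) (k : ℤ) : FreeAlgebra Base Gen := FreeAlgebra.ι Base (Gen.t i j k)

/-- The generator `c` in the free algebra. -/
def freeC : FreeAlgebra Base Gen := FreeAlgebra.ι Base Gen.c

/-- `(ħ / 2) c` in the free algebra. -/
def halfHC : FreeAlgebra Base Gen := (PowerSeries.C (1 / 2 : ℂ) * hbar) • freeC

/-- The defining relations, coefficient by coefficient in `u, v` and entry by entry in
`End (V ⊗ V)`, for the `R`-matrix `R(u) = (u I + ħ P) / (u + ħ)`: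
* `c` is central;
* `R(u-v) T₁^±(u) T₂^±(v) = T₂^±(v) T₁^±(u) R(u-v)`; the common denominator `u - v + ħ` is removed;
* `R(u₋-v₊) T₁⁺(u) T₂⁻(v) = T₂⁻(v) T₁⁺(u) R(u₊-v₋)` with `u_± = u ± ħ c / 4`. Here
  `u₋ - v₊ = u - v - ħ c / 2`, `u₊ - v₋ = u - v + ħ c / 2`, and the two scalar denominators are
  cleared. They are expanded in non-negative powers of `u⁻¹` and `v`, the only expansion for which
  the products are defined; as `u - v + y` (`y` divisible by `ħ`) is then invertible, clearing
  them loses nothing. -/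
inductive Rel : FreeAlgebra Base Gen → FreeAlgebra Base Gen → Prop
  | central (i j : Fin 2) (k : ℤ) : Rel (freeC * freeT i j k) (freeT i j k * freeC)
  | plus_plus (m n : ℤ) (x y : Fin 2 × Fin 2) :
      Rel (mulYangLeft 0 (prod₁₂ (Tplus freeT) (Tplus freeT)) m n x y)
        (mulYangRight 0 (prod₂₁ (Tplus freeT) (Tplus freeT)) m n x y)
  | minus_minus (m n : ℤ) (x y : Fin 2 × Fin 2) :
      Rel (mulYangLeft 0 (prod₁₂ (Tminus freeT) (Tminus freeT)) m n x y)
        (mulYangRight 0 (prod₂₁ (Tminus freeT) (Tminus freeT)) m n x y)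
  | plus_minus (m n : ℤ) (x y : Fin 2 × Fin 2) :
      Rel
        (mulScalar (halfHC + algebraMap Base _ hbar)
          (mulYangLeft (-halfHC) (prod₁₂ (Tplus freeT) (Tminus freeT))) m n x y)
        (mulScalar (-halfHC + algebraMap Base _ hbar)
          (mulYangRight halfHC (prod₂₁ (Tplus freeT) (Tminus freeT))) m n x y)

/-- The `𝒜`-algebra presented by the generators `tᵢⱼᵏ, c` and the relations above. The topological
algebra `𝒟Y_ħ(𝔤𝔩₂)` is its `ħ`-adic completion. An `𝒜`-linear operator is `ħ`-adically continuous,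
so that on an `ħ`-adically complete module the module structures over the completion and over
this dense subalgebra are the same thing: `𝒜`-algebra homomorphisms from `DY`
to the `𝒜`-linear endomorphisms. -/
abbrev DY : Type := RingQuot Rel

/-- The generator `tᵢⱼᵏ` of `DY`. -/
def DY.t (i j : Fin 2) (k : ℤ) : DY := RingQuot.mkAlgHom Base Rel (freeT i j k)

/-- The central generator `c` of `DY`. -/
def DY.c : DY := RingQuot.mkAlgHom Base Rel freeC

/-! ### The Fock space -/

/-- Power series in `ħ` with coefficients in a vector space `V`: the `ħ`-adic completion of
`𝒜 ⊗ V`. The coefficient of `ħ ^ m` of `x` is `x.coeff m`. -/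
@[ext]
structure HSeries (V : Type*) where
  /-- The coefficients. -/
  coeff : ℕ → V

namespace HSeries

variable {V : Type*}

/-- A series is the same as the family of its coefficients. -/
def equiv : HSeries V ≃ (ℕ → V) where
  toFun := coeff
  invFun := mk
  left_inv _ := rfl
  right_inv _ := rfl

variable [AddCommGroup V]

instance : AddCommGroup (HSeries V) := equiv.addCommGroup

theorem coeff_add (x y : HSeries V) (m : ℕ) : (x + y).coeff m = x.coeff m + y.coeff m := rfl

theorem coeff_zero (m : ℕ) : (0 : HSeries V).coeff m = 0 := rfl

/-- A vector of `V` as a constant series. -/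
def const (x : V) : HSeries V := ⟨fun m => if m = 0 then x else 0⟩

variable [Module ℂ V]

/-- Multiplication of power series. -/
instance : SMul Base (HSeries V) where
  smul a x := ⟨fun m =>
    ∑ p ∈ Finset.HasAntidiagonal.antidiagonal m, PowerSeries.coeff p.1 a • x.coeff p.2⟩

theorem coeff_smul (a : Base) (x : HSeries V) (m : ℕ) :
    (a • x).coeff m =
      ∑ p ∈ Finset.HasAntidiagonal.antidiagonal m, PowerSeries.coeff p.1 a • x.coeff p.2 := rfl

instance : Module Base (HSeries V) where
  one_smul x := by
    ext m
    rw [coeff_smul, Finset.sum_eq_single (0, m)]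
    · simp
    · rintro ⟨p, q⟩ hp hne
      have hp0 : p ≠ 0 := by
        rintro rfl
        simp_all
      simp [PowerSeries.coeff_one, hp0]
    · simp
  mul_smul a b x := by
    ext m
    simp only [coeff_smul, PowerSeries.coeff_mul, Finset.sum_smul, Finset.smul_sum, mul_smul,
      Finset.sum_sigma']
    apply Finset.sum_nbij' (fun ⟨⟨_, j⟩, ⟨k, l⟩⟩ => ⟨(k, l + j), (l, j)⟩)
      (fun ⟨⟨i, _⟩, ⟨k, l⟩⟩ => ⟨(i + k, l), (i, k)⟩) <;> aesop
    all_goals omega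
  smul_zero a := by
    ext m
    simp [coeff_smul, coeff_zero]
  zero_smul x := by
    ext m
    simp [coeff_smul, coeff_zero]
  smul_add a x y := by
    ext m
    simp [coeff_smul, coeff_add, Finset.sum_add_distrib]
  add_smul a b x := by
    ext m
    simp [coeff_smul, coeff_add, Finset.sum_add_distrib, add_smul]

end HSeries

/-- `ℂ[a_{j,-k} (j = 1, 2, k > 0)] ⊗ ℂ[Q̄] e^λ`, the part of order zero in `ħ` of the Fock space.
The index `j = 1, 2` is `0, 1 : Fin 2`; the variable `(j, k)` of the polynomial ring is
`a_{j,-k}`. The vector `f ⊗ e^(λ + q α)` is `Finsupp.single q f`, where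
`λ = Λ̄ᵢ + (s / 2) (ε₁ + ε₂)`; the vector space does not depend on `i, s`, but the operators `∂`
below do. -/
abbrev Fock₀ : Type := ℤ →₀ MvPolynomial (Fin 2 × ℕ+) ℂ

/-- The (`ħ`-adically complete) Fock space. -/
abbrev Fock : Type := HSeries Fock₀

/-- Linear operators on `Fock₀`. -/
abbrev Op₀ : Type := Module.End ℂ Fock₀

/-- `𝒜`-linear operators on the Fock space. -/
abbrev Op : Type := Module.End Base Fock

/-- The boson `a_{j,k}`: multiplication by the variable `a_{j,k}` for `k < 0`, and
`f ↦ [a_{j,k}, f] = k ∂f / ∂a_{j,-k}` for `k > 0`. (There is no `a_{j,0}`; it is set to `0`.) -/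
def boson (j : Fin 2) (k : ℤ) : Op₀ :=
  Finsupp.mapRange.linearMap <|
    if k < 0 then LinearMap.mulLeft ℂ (MvPolynomial.X (j, k.natAbs.toPNat'))
    else (k : ℂ) • (MvPolynomial.pderiv (R := ℂ) (j, k.natAbs.toPNat')).toLinearMap

/-- Multiplication by `e^(p α)`. -/
def latticeShift (p : ℤ) : Op₀ := Finsupp.lmapDomain _ ℂ (fun q => p + q)

/-- The operator that multiplies `f ⊗ e^(λ + q α)` by `g q`. -/
def latticeDiag (g : ℤ → ℂ) : Op₀ := Finsupp.lsum ℂ fun q => g q • Finsupp.lsingle q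

/-- The point `Λ̄ᵢ + (s / 2) (ε₁ + ε₂) + q α` in the basis `ε₁, ε₂`, where `α = ε₁ - ε₂`,
`Λ̄₀ = 0`, `Λ̄₁ = α / 2`. Its coordinates are the eigenvalues of `∂_{ε₁}, ∂_{ε₂}`. -/
def latticePoint (i : Fin 2) (s : ℂ) (q : ℤ) : Fin 2 → ℂ :=
  ((i : ℕ) / 2 : ℂ) • ![1, -1] + (s / 2) • ![1, 1] + (q : ℂ) • ![1, -1]

/-- The eigenvalue of `∂_α` at `Λ̄ᵢ + (s / 2) (ε₁ + ε₂) + q α`, an integer. -/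
def alphaWeight (i : Fin 2) (q : ℤ) : ℤ := (i : ℕ) + 2 * q

theorem alphaWeight_eq (i : Fin 2) (s : ℂ) (q : ℤ) :
    (alphaWeight i q : ℂ) = latticePoint i s q 0 - latticePoint i s q 1 := by
  simp [alphaWeight, latticePoint]; ring

/-! ### The vertex operators

Power series in two variables: the variable `0` is `ħ`, the variable `1` is either `u` or `u⁻¹`. -/

/-- The monomial exponent of `ħ ^ m z ^ n`. -/
def expo (m n : ℕ) : Fin 2 →₀ ℕ := Finsupp.single 0 m + Finsupp.single 1 n

/-- Scalar power series in `ħ` and `z`, where `z` is `u` or `u⁻¹`. -/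
abbrev Scalar : Type := MvPowerSeries (Fin 2) ℂ

/-- Operator-valued power series in `ħ` and `z`, where `z` is `u` or `u⁻¹`. -/
abbrev OpSeries : Type := MvPowerSeries (Fin 2) Op₀

/-- `(u + b ħ) ^ k`, where `z = u`. -/
def posPow (b : ℂ) (k : ℕ) : Scalar :=
  (MvPowerSeries.X 1 + MvPowerSeries.C b * MvPowerSeries.X 0) ^ k

/-- `1 + b ħ u⁻¹`, where `z = u⁻¹`. -/
def onePlus (b : ℂ) : Scalar :=
  1 + MvPowerSeries.C b * MvPowerSeries.X 0 * MvPowerSeries.X 1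

/-- `(u + b ħ) ^ (-k)`, where `z = u⁻¹`. -/
def negPow (b : ℂ) (k : ℕ) : Scalar := (MvPowerSeries.X 1 * (onePlus b)⁻¹) ^ k

/-- The series `∑_{k > 0} (a k / k) g k`. Every `g k` used below has order at least `k`, so
only the terms with `k ≤ |d|` contribute to the coefficient at the exponent `d`. -/
def bosonSum (a : ℕ → Op₀) (g : ℕ → Scalar) : OpSeries :=
  fun d => ∑ k ∈ Finset.Icc 1 d.degree, (MvPowerSeries.coeff d (g k) / (k : ℂ)) • a k

/-- `exp A = ∑ Aⁿ / n!` for a series `A` with zero constant term; `Aⁿ` has order at least `n`, so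
only the terms with `n ≤ |d|` contribute to the coefficient at the exponent `d`. -/
def expSeries (A : OpSeries) : OpSeries :=
  fun d => ∑ n ∈ Finset.range (d.degree + 1),
    ((n.factorial : ℂ)⁻¹) • MvPowerSeries.coeff d (A ^ n)

/-- `f ^ x = ∑ (x choose n) (f - 1) ^ n` for a scalar series `f` with constant term `1`
and a complex exponent `x`. -/
def scalarPow (f : Scalar) (x : ℂ) : Scalar :=
  (PowerSeries.binomialSeries ℂ x).subst (f - 1)

/-- The series that acts on `f ⊗ e^(λ + q α)` as the scalar series `g q`. -/
def diagSeries (g : ℤ → Scalar) : OpSeries :=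
  fun d => latticeDiag fun q => MvPowerSeries.coeff d (g q)

/-- The operator for `k_j⁺(u)`, a series in `ħ` and `z = u⁻¹`:
`exp[-∑ (a_{j,k}/k) {(u + ħ/2)^(-k) - (u - ħ/2)^(-k)}] ((u - ħ/2)/(u + ħ/2)) ^ ∂_{ε_j}`. -/
def kPlusOp (i : Fin 2) (s : ℂ) (j : Fin 2) : OpSeries :=
  expSeries (-bosonSum (fun k => boson j k) (fun k => negPow (1 / 2) k - negPow (-1 / 2) k)) *
    diagSeries fun q =>
      scalarPow (onePlus (-1 / 2) * (onePlus (1 / 2))⁻¹) (latticePoint i s q j)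

/-- The operator for `k_j⁻(u)`, a series in `ħ` and `z = u`:
`exp[∑_{r<j} (a_{r,-k}/k) {u^k - (u - ħ)^k} + ∑_{r>j} (a_{r,-k}/k) {(u + ħ)^k - u^k}]`. -/
def kMinusOp (j : Fin 2) : OpSeries :=
  expSeries
    ((∑ r ∈ Finset.univ.filter (· < j),
        bosonSum (fun k => boson r (-(k : ℤ))) (fun k => posPow 0 k - posPow (-1) k)) +
      ∑ r ∈ Finset.univ.filter (j < ·),
        bosonSum (fun k => boson r (-(k : ℤ))) (fun k => posPow 1 k - posPow 0 k))

/-- The first exponential of `X⁺(u) / ħ`, a series in `ħ` and `z = u`. -/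
def xPlusCre : OpSeries :=
  expSeries
    (-bosonSum (fun k => boson 0 (-(k : ℤ))) (posPow (-3 / 4)) +
      bosonSum (fun k => boson 1 (-(k : ℤ))) (posPow (1 / 4)))

/-- The remaining factors of `X⁺(u) / ħ` apart from `u ^ ∂_α`, a series in `ħ` and `z = u⁻¹`;
note `[u + ħ/4] ^ ∂_α = (1 + ħ/(4u)) ^ ∂_α u ^ ∂_α`. -/
def xPlusAnn (i : Fin 2) : OpSeries :=
  expSeries (bosonSum (fun k => boson 0 k - boson 1 k) (negPow (1 / 4))) *
    MvPowerSeries.C (latticeShift 1) *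
      diagSeries fun q => scalarPow (onePlus (1 / 4)) (alphaWeight i q : ℂ)

/-- The first exponential of `X⁻(u) / ħ`, a series in `ħ` and `z = u`. -/
def xMinusCre : OpSeries :=
  expSeries
    (bosonSum (fun k => boson 0 (-(k : ℤ))) (posPow (-1 / 4)) -
      bosonSum (fun k => boson 1 (-(k : ℤ))) (posPow (3 / 4)))

/-- The remaining factors of `X⁻(u) / ħ` apart from `u ^ (-∂_α)`, a series in `ħ` and `z = u⁻¹`;
note `[u - ħ/4] ^ (-∂_α) = (1 - ħ/(4u)) ^ (-∂_α) u ^ (-∂_α)`. -/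
def xMinusAnn (i : Fin 2) : OpSeries :=
  expSeries (bosonSum (fun k => -boson 0 k + boson 1 k) (negPow (-1 / 4))) *
    MvPowerSeries.C (latticeShift (-1)) *
      diagSeries fun q => scalarPow (onePlus (-1 / 4)) (-(alphaWeight i q : ℂ))

/-- The coefficient of `u ^ n` of `C(u) A(u⁻¹) u ^ D` applied to `x ∈ Fock₀`, a power series in `ħ`;
here `D` is the operator with the integer eigenvalue `w q` on `f ⊗ e^(λ + q α)`, and
`C`, `A` are series in `ħ, u` and in `ħ, u⁻¹`. The inner sum, over the powers `u ^ r` taken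
from `C` and `u ^ (-l)` taken from `A`, has finitely many nonzero terms for the series used here,
because `A` lowers the degree in the bosons. -/
def vertexCoeff (C A : OpSeries) (w : ℤ → ℤ) (n : ℤ) (x : Fock₀) : Fock :=
  ⟨fun m => ∑ p ∈ Finset.HasAntidiagonal.antidiagonal m, ∑ᶠ rl : ℕ × ℕ,
      MvPowerSeries.coeff (expo p.1 rl.1) C
        (MvPowerSeries.coeff (expo p.2 rl.2) A
          (latticeDiag (fun q => if (rl.1 : ℤ) + w q - rl.2 = n then 1 else 0) x))⟩

/-! ### The Drinfel'd currents of a representation on the Fock space -/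

/-- The `ħ`-adically convergent sum `∑_m ħ^m g m` of operators on the Fock space. -/
def hSum (g : ℕ → Op) : Op where
  toFun x := ⟨fun N => ∑ p ∈ Finset.HasAntidiagonal.antidiagonal N, (g p.1 x).coeff p.2⟩
  map_add' x y := by
    ext1
    funext N
    simp only [map_add, HSeries.coeff_add, Finset.sum_add_distrib]
  map_smul' a x := by
    ext1
    funext N
    simp only [map_smul, HSeries.coeff_smul, RingHom.id_apply, Finset.smul_sum, Finset.sum_sigma']
    apply Finset.sum_nbij' (fun ⟨⟨i, _⟩, ⟨k, l⟩⟩ => ⟨(k, i + l), (i, l)⟩)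
      (fun ⟨⟨i, _⟩, ⟨k, l⟩⟩ => ⟨(k, i + l), (i, l)⟩) <;> aesop
    all_goals omega

/-- The coefficient of `u ^ n` of `f(u + b ħ c)`, where `f n` is the coefficient of `u ^ n`
of `f(u)` and `c` commutes with all `f n`; the powers of `u + b ħ c` are expanded in `ħ`. -/
def shift (b : ℂ) (c : Op) (f : ℤ → Op) (n : ℤ) : Op :=
  hSum fun m =>
    (PowerSeries.C (((Ring.choose (n + m) m : ℤ) : ℂ) * b ^ m) : Base) • (c ^ m * f (n + m))

/-- The coefficient of `u ^ n` of a power series in `u`. -/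
def posCoeff (f : PowerSeries Op) (n : ℤ) : Op := if 0 ≤ n then PowerSeries.coeff n.toNat f else 0

/-- The coefficient of `u ^ n` of a power series in `u⁻¹`. -/
def negCoeff (f : PowerSeries Op) (n : ℤ) : Op :=
  if n ≤ 0 then PowerSeries.coeff (-n).toNat f else 0

/-- `k₁ = t₁₁` and `k₂ = t₂₂ - t₂₁ t₁₁⁻¹ t₁₂` for a matrix `T` of power series with `t₁₁`
invertible. -/
def gaussK (T : Matrix (Fin 2) (Fin 2) (PowerSeries Op)) (j : Fin 2) : PowerSeries Op :=
  if j = 0 then T 0 0 else T 1 1 - T 1 0 * Ring.inverse (T 0 0) * T 0 1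

/-- `t₁₁⁻¹ t₁₂`. -/
def gaussE (T : Matrix (Fin 2) (Fin 2) (PowerSeries Op)) : PowerSeries Op :=
  Ring.inverse (T 0 0) * T 0 1

/-- `t₂₁ t₁₁⁻¹`. -/
def gaussF (T : Matrix (Fin 2) (Fin 2) (PowerSeries Op)) : PowerSeries Op :=
  T 1 0 * Ring.inverse (T 0 0)

variable (ρ : DY →ₐ[Base] Op)

/-- The action of `T⁺(u)`, as a power series in `u⁻¹`. -/
def repTplus : Matrix (Fin 2) (Fin 2) (PowerSeries Op) :=
  Matrix.of fun i j => PowerSeries.mk fun n => Tplus (fun i j k => ρ (DY.t i j k)) (-(n : ℤ)) i j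

/-- The action of `T⁻(u)`, as a power series in `u`. -/
def repTminus : Matrix (Fin 2) (Fin 2) (PowerSeries Op) :=
  Matrix.of fun i j => PowerSeries.mk fun n => Tminus (fun i j k => ρ (DY.t i j k)) n i j

/-- The action of `k_j⁺(u)`, as a power series in `u⁻¹`. -/
def repKplus (j : Fin 2) : PowerSeries Op := gaussK (repTplus ρ) j

/-- The action of `k_j⁻(u)`, as a power series in `u`. -/
def repKminus (j : Fin 2) : PowerSeries Op := gaussK (repTminus ρ) j

/-- The action of the coefficient of `u ^ n` of
`X⁺(u) = t⁺₁₁(u₋)⁻¹ t⁺₁₂(u₋) - t⁻₁₁(u₊)⁻¹ t⁻₁₂(u₊)`. -/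
def repXplus (n : ℤ) : Op :=
  shift (-1 / 4) (ρ DY.c) (negCoeff (gaussE (repTplus ρ))) n -
    shift (1 / 4) (ρ DY.c) (posCoeff (gaussE (repTminus ρ))) n

/-- The action of the coefficient of `u ^ n` of
`X⁻(u) = t⁺₂₁(u₊) t⁺₁₁(u₊)⁻¹ - t⁻₂₁(u₋) t⁻₁₁(u₋)⁻¹`. -/
def repXminus (n : ℤ) : Op :=
  shift (1 / 4) (ρ DY.c) (negCoeff (gaussF (repTplus ρ))) n -
    shift (-1 / 4) (ρ DY.c) (posCoeff (gaussF (repTminus ρ))) n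

/-- A level one action of `DY` on the Fock space in which the Drinfel'd currents are the
explicit vertex operators. The equations are between coefficients of powers of `u`, as
operators on the Fock space; both sides are `𝒜`-linear, and so determined by their values on the
vectors `x ∈ Fock₀`. -/
structure IsBosonization (i : Fin 2) (s : ℂ) : Prop where
  level_one : ρ DY.c = 1
  kPlus : ∀ (j : Fin 2) (n m : ℕ) (x : Fock₀),
    (PowerSeries.coeff n (repKplus ρ j) (HSeries.const x)).coeff m =
      MvPowerSeries.coeff (expo m n) (kPlusOp i s j) x
  kMinus : ∀ (j : Fin 2) (n m : ℕ) (x : Fock₀),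
    (PowerSeries.coeff n (repKminus ρ j) (HSeries.const x)).coeff m =
      MvPowerSeries.coeff (expo m n) (kMinusOp j) x
  xPlus : ∀ (n : ℤ) (x : Fock₀), repXplus ρ n (HSeries.const x) =
    hbar • vertexCoeff xPlusCre (xPlusAnn i) (alphaWeight i) n x
  xMinus : ∀ (n : ℤ) (x : Fock₀), repXminus ρ n (HSeries.const x) =
    hbar • vertexCoeff xMinusCre (xMinusAnn i) (fun q => -alphaWeight i q) n x

end YangianDouble

end

open scoped Kronecker

noncomputable section

namespace YangianDouble

set_option linter.unusedSectionVars false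

/-! Existence. Let `E = vE i 0` and `F = vF i 0` be the coefficients of `u⁻¹` in the proposed
`X⁺(u)/ħ` and `X⁻(u)/ħ`, and let `k(u)` be the proposed `k₁^±(u)`. In the Yangian double the zero
modes act on the entries of `T^±(u)` as matrix units act on matrices. This dictates the entries:
`t₁₁ = k`, `t₁₂ = [E, k]`, `t₂₁ = [k, F]`, `t₂₂ = k + [[E, k], F]` (`tMat`). It remains to see that
they satisfy the quadratic relations and that their Gauss coordinates are the given currents.

The difference of the two sides of a quadratic relation is a tensor with four indices, equivariant
under `E` and `F` (`lie_rttDefect`). Brackets with `E` and `F` therefore reduce its sixteen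
components to four (`rttDefect_eq_zero`). These four express that the `k₁` commute, that `k₁` and
`k₂` have the expected exchange factor, that `k(u)` and `[E, k(v)]` (likewise `[k(v), F]`) satisfy
an exchange relation, and that `t₂₂` has the Gauss form. The third follows from the exchange of `k`
with the modes of `X^±` by eliminating the mode next to the zero mode (`lie_E_exchange`,
`lie_F_exchange`). Equivariance itself needs that `[E, F]` acts as `∂_α` and the Serre relations
`[[E, k], E] = 0 = [[k, F], F]`; the latter come from the exchange of `X⁺` (of `X⁻`) with itself and
with `k` (`lie_lie_eq_zero`).

For the Gauss coordinates, multiply the exchange of `k` with the modes `V_n` of `X⁺/ħ` by `k⁻¹`. The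
series `e_n = k⁻¹ V_n k - V_n` then satisfy `(u + βħ) e_n = e_{n+1} + ħ V_n`. Among series with
support on one side this recursion has only one solution, a shifted half of the current
(`eq_zero_of_linU_smul`, `shift_fd_unser`). So `e_0 = t₁₁⁻¹ t₁₂` is a half of `X⁺`, and the two
halves, shifted back by `u_±`, add up to `X⁺`. The brackets `[e_n, F]` obey the same recursion with
the source `ħ [V_n, F]`, which is the `n`-th mode of a difference `ψ⁺ - ψ⁻`; its halves are
`k₂^±/k₁^± - 1` up to a shift (`lie_halfE_vF`), and this is the Gauss form of `t₂₂`.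

All the exchange relations are statements about vertex operators. An exponent is encoded by a list
of triples `(j, b, n)`, each standing for `n ∑ a_{j,∓k} (u + bħ)^{±k} / k`. The commutators of a
vertex operator with the bosons are scalar multiples of it. Since the Fock space is irreducible, a
distribution with prescribed such multiples is determined by its vacuum expectation (`Primary.ext`).
Exchange relations thus reduce to two-point functions, which are products of factors `1 - (v +
bħ)/(u + aħ)` and their inverses (`vacG_mul_ratProd`). The commutator of `X⁺` and `X⁻` is the
difference of the two expansions of one rational function with poles at `v = u ± ħ/2`, hence a sum
of two delta functions (`vertexP_commutator`).

Uniqueness. In `X^±` the part from `T⁺` has only negative and the part from `T⁻` only non-negative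
powers of `u`, and shifts preserve this; so `X^±` determines both halves (`halves_unique`). With the
`k_j^±` they give the Gauss decompositions, hence `T^±`. The generators enter `T^±` multiplied by
`ħ`, and `ħ` is not a zero divisor on operators. -/

/-! ### Formal distributions -/

/-- Formal distributions with coefficients in `V`: `f m g` is the coefficient of `ħ ^ m` times the
monomial with exponent `g`. -/
def Fld (G V : Type*) : Type _ := ℕ → G → V

/-- The scalars: power series in `ħ` over Laurent polynomials. -/
abbrev Ser (G : Type*) [AddCommGroup G] : Type _ := PowerSeries (AddMonoidAlgebra ℂ G)

section Fld


variable {G H V W : Type*} [AddCommGroup G] [AddCommGroup H]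
  [AddCommGroup V] [Module ℂ V] [AddCommGroup W] [Module ℂ W]

instance : AddCommGroup (Fld G V) := inferInstanceAs (AddCommGroup (ℕ → G → V))

theorem Fld.add_apply (f g : Fld G V) (m : ℕ) (x : G) : (f + g) m x = f m x + g m x := rfl

/-- Multiplication of distributions without `ħ` by Laurent polynomials. -/
def conv (G V : Type*) [AddCommGroup G] [AddCommGroup V] [Module ℂ V] :
    AddMonoidAlgebra ℂ G →ₐ[ℂ] Module.End ℂ (G → V) :=
  AddMonoidAlgebra.lift ℂ _ G
    { toFun := fun g => LinearMap.funLeft ℂ V (fun x => x - g.toAdd)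
      map_one' := by ext f x; simp [LinearMap.funLeft]
      map_mul' := fun a b => by
        ext f x; simp [LinearMap.funLeft, sub_sub] }

theorem conv_single (g : G) (c : ℂ) (f : G → V) (x : G) :
    conv G V (AddMonoidAlgebra.single g c) f x = c • f (x - g) := by
  simp [conv, LinearMap.funLeft]

/-- A coefficient in `ħ` is an arbitrary function of the exponent, so only Laurent polynomials can
act on it; the convolution in `ħ` is finite. Over this ring `x + a ħ` is a unit for every monomial
`x`, whereas `u - v + c ħ` is not and annihilates delta functions. -/
instance : Module (Ser G) (Fld G V) where
  smul p f := fun m => ∑ a ∈ Finset.HasAntidiagonal.antidiagonal m,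
    conv G V (PowerSeries.coeff a.1 p) (f a.2)
  one_smul f := by
    funext m
    change ∑ a ∈ Finset.HasAntidiagonal.antidiagonal m, _ = _
    rw [Finset.sum_eq_single (0, m)]
    · simp
    · rintro ⟨p, q⟩ hp hne
      have hp0 : p ≠ 0 := by
        rintro rfl
        simp_all
      simp [PowerSeries.coeff_one, hp0]
    · simp
  mul_smul p q f := by
    funext m
    change ∑ a ∈ Finset.HasAntidiagonal.antidiagonal m, _ =
      ∑ a ∈ Finset.HasAntidiagonal.antidiagonal m, conv G V _
        (∑ b ∈ Finset.HasAntidiagonal.antidiagonal a.2, _)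
    simp only [PowerSeries.coeff_mul, map_sum, map_mul, Module.End.mul_apply, LinearMap.sum_apply,
      Finset.sum_sigma']
    apply Finset.sum_nbij' (fun ⟨⟨_, j⟩, ⟨k, l⟩⟩ => ⟨(k, l + j), (l, j)⟩)
      (fun ⟨⟨i, _⟩, ⟨k, l⟩⟩ => ⟨(i + k, l), (i, k)⟩) <;> simp <;> grind
  smul_zero p := by
    funext m
    exact Finset.sum_eq_zero fun a _ => map_zero (conv G V _)
  zero_smul f := by
    funext m
    refine Finset.sum_eq_zero fun a _ => ?_
    simp
  smul_add p f g := by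
    funext m
    change ∑ a ∈ Finset.HasAntidiagonal.antidiagonal m, conv G V _ (f a.2 + g a.2) = _
    simp only [map_add, Finset.sum_add_distrib]
    rfl
  add_smul p q f := by
    funext m
    change ∑ a ∈ Finset.HasAntidiagonal.antidiagonal m, _ = _
    simp only [map_add, LinearMap.add_apply, Finset.sum_add_distrib]
    rfl

theorem Fld.smul_def (p : Ser G) (f : Fld G V) (m : ℕ) :
    (p • f) m = ∑ a ∈ Finset.HasAntidiagonal.antidiagonal m,
      conv G V (PowerSeries.coeff a.1 p) (f a.2) := rfl

theorem Fld.C_smul (a : AddMonoidAlgebra ℂ G) (f : Fld G V) (m : ℕ) :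
    ((PowerSeries.C a : Ser G) • f) m = conv G V a (f m) := by
  rw [Fld.smul_def, Finset.sum_eq_single (0, m)]
  · simp
  · rintro ⟨p, q⟩ hp hne
    have hp0 : p ≠ 0 := by
      rintro rfl
      simp_all
    simp [PowerSeries.coeff_C, hp0]
  · simp

/-- The formal variable `ħ` in the scalars. -/
abbrev hS (G : Type*) [AddCommGroup G] : Ser G := PowerSeries.X

theorem Fld.X_smul_zero (f : Fld G V) : (hS G • f) 0 = 0 := by
  rw [Fld.smul_def]; simp

theorem Fld.X_smul_succ (f : Fld G V) (m : ℕ) : (hS G • f) (m + 1) = f m := by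
  rw [Fld.smul_def, Finset.sum_eq_single (1, m)]
  · simp
  · rintro ⟨p, q⟩ hp hne
    have hp0 : p ≠ 1 := by
      rintro rfl
      simp_all [add_comm]
    simp [PowerSeries.coeff_X, hp0]
  · simp [add_comm]

/-- The monomial with exponent `g` in the scalars. -/
def mon (g : G) : Ser G := PowerSeries.C (AddMonoidAlgebra.single g 1)

theorem mon_smul (g : G) (f : Fld G V) (m : ℕ) (x : G) : (mon g • f) m x = f m (x - g) := by
  rw [mon, Fld.C_smul, conv_single, one_smul]

theorem mon_add (g g' : G) : mon (g + g') = mon g * mon g' := by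
  rw [mon, mon, mon, ← map_mul, AddMonoidAlgebra.single_mul_single, one_mul]

theorem mon_zero : (mon (0 : G) : Ser G) = 1 := by
  rw [mon]; exact map_one PowerSeries.C

/-- A complex number in the scalars. -/
def cS (c : ℂ) : Ser G := PowerSeries.C (AddMonoidAlgebra.single 0 c)

theorem cS_smul (c : ℂ) (f : Fld G V) (m : ℕ) (x : G) : ((cS c : Ser G) • f) m x = c • f m x := by
  rw [cS, Fld.C_smul, conv_single, sub_zero]

theorem cS_add (a b : ℂ) : (cS (a + b) : Ser G) = cS a + cS b := by
  simp [cS]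

theorem cS_one : (cS 1 : Ser G) = 1 := mon_zero (G := G)

theorem cS_zero : (cS 0 : Ser G) = 0 := by simp [cS]

theorem cS_neg (a : ℂ) : (cS (-a) : Ser G) = -cS a := by simp [cS]

theorem cS_sub (a b : ℂ) : (cS (a - b) : Ser G) = cS a - cS b := by
  rw [sub_eq_add_neg, cS_add, cS_neg, sub_eq_add_neg]

/-- Applying a linear map to all coefficients. -/
def Fld.map (L : V →ₗ[ℂ] W) (f : Fld G V) : Fld G W := fun m x => L (f m x)

theorem Fld.map_apply (L : V →ₗ[ℂ] W) (f : Fld G V) (m : ℕ) (x : G) :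
    Fld.map L f m x = L (f m x) := rfl

theorem Fld.map_sub (L : V →ₗ[ℂ] W) (f g : Fld G V) :
    Fld.map L (f - g) = Fld.map L f - Fld.map L g := by
  funext m x; exact _root_.map_sub L _ _

theorem conv_comp (L : V →ₗ[ℂ] W) (a : AddMonoidAlgebra ℂ G) (f : G → V) :
    conv G W a (fun x => L (f x)) = fun x => L (conv G V a f x) := by
  induction a using AddMonoidAlgebra.induction_linear with
  | zero => funext x; simp
  | add a b ha hb => funext x; simp [ha, hb]
  | single g c => funext x; simp [conv_single]

theorem Fld.map_smul (L : V →ₗ[ℂ] W) (p : Ser G) (f : Fld G V) :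
    Fld.map L (p • f) = p • Fld.map L f := by
  funext m x
  rw [Fld.map_apply, Fld.smul_def, Fld.smul_def, Finset.sum_apply, Finset.sum_apply, map_sum]
  refine Finset.sum_congr rfl fun a _ => ?_
  rw [← congrFun (conv_comp L (PowerSeries.coeff a.1 p) (f a.2)) x]
  rfl

/-- The homomorphism of scalars induced by a homomorphism of exponents. -/
def Ser.map (φ : G →+ H) : Ser G →+* Ser H :=
  PowerSeries.map (AddMonoidAlgebra.mapDomainRingHom ℂ φ)

theorem Ser.map_mon (φ : G →+ H) (g : G) : Ser.map φ (mon g) = mon (φ g) := by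
  simp [Ser.map, mon]

theorem Ser.map_cS (φ : G →+ H) (c : ℂ) : Ser.map φ (cS c) = cS c := by
  simp [Ser.map, cS]

theorem Ser.map_X (φ : G →+ H) : Ser.map φ (hS G) = hS H := by
  simp [Ser.map]

/-- An additive family of maps that intertwines the monomials intertwines all scalars. -/
theorem conv_intertwine (φ : G →+ H) (T : (G → V) →ₗ[ℂ] (H → W))
    (hT : ∀ g f, T (conv G V (AddMonoidAlgebra.single g 1) f) =
      conv H W (AddMonoidAlgebra.single (φ g) 1) (T f))
    (a : AddMonoidAlgebra ℂ G) (f : G → V) :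
    T (conv G V a f) = conv H W (AddMonoidAlgebra.mapDomainRingHom ℂ φ a) (T f) := by
  induction a using AddMonoidAlgebra.induction_linear with
  | zero => simp
  | add a b ha hb => simp only [map_add, LinearMap.add_apply, ha, hb]
  | single g c =>
    have hc : AddMonoidAlgebra.single g c = c • AddMonoidAlgebra.single g (1 : ℂ) := by simp
    rw [hc]
    have := hT g f
    simp only [map_smul, LinearMap.smul_apply, this]
    rw [show AddMonoidAlgebra.mapDomainRingHom ℂ φ (c • AddMonoidAlgebra.single g 1)
      = c • AddMonoidAlgebra.single (φ g) 1 by simp]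
    simp only [map_smul, LinearMap.smul_apply]

/-- Maps of distributions given by a linear map for each pair of powers of `ħ`, convolved. -/
theorem smul_intertwine (φ : G →+ H) (T : ℕ → (G → V) →ₗ[ℂ] (H → W))
    (hT : ∀ n g f, T n (conv G V (AddMonoidAlgebra.single g 1) f) =
      conv H W (AddMonoidAlgebra.single (φ g) 1) (T n f)) (p : Ser G) (f : Fld G V) :
    (fun m => ∑ a ∈ Finset.HasAntidiagonal.antidiagonal m, T a.2 ((p • f) a.1)) =
      Ser.map φ p • (id (fun m => ∑ a ∈ Finset.HasAntidiagonal.antidiagonal m, T a.2 (f a.1)) :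
        Fld H W) := by
  funext m
  rw [Fld.smul_def]
  simp only [Fld.smul_def, id, map_sum, Finset.sum_sigma', Ser.map, PowerSeries.coeff_map]
  simp only [conv_intertwine φ (T _) (hT _)]
  apply Finset.sum_nbij' (fun ⟨⟨_, j⟩, ⟨k, l⟩⟩ => ⟨(k, l + j), (l, j)⟩)
      (fun ⟨⟨i, _⟩, ⟨k, l⟩⟩ => ⟨(i + k, l), (i, k)⟩) <;> simp <;> grind

end Fld

/-! ### The units `x + a ħ` and their integer powers -/

section Units

variable {G H V W : Type*} [AddCommGroup G] [AddCommGroup H]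
  [AddCommGroup V] [Module ℂ V] [AddCommGroup W] [Module ℂ W]

/-- Modulo `ħ` the series is a monomial, which is invertible among Laurent polynomials. Inverse
powers are thereby expanded in non-negative powers of `ħ`, the convention of the theorem. -/
theorem isUnit_lin (g : G) (a : ℂ) : IsUnit (mon g + cS a * hS G : Ser G) := by
  rw [PowerSeries.isUnit_iff_constantCoeff]
  simp only [map_add, map_mul, PowerSeries.constantCoeff_X, mul_zero, add_zero, mon,
    PowerSeries.constantCoeff_C]
  exact ⟨⟨AddMonoidAlgebra.single g 1, AddMonoidAlgebra.single (-g) 1,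
    by simp [AddMonoidAlgebra.single_mul_single, AddMonoidAlgebra.one_def],
    by simp [AddMonoidAlgebra.single_mul_single, AddMonoidAlgebra.one_def]⟩, rfl⟩

/-- The unit `x + a ħ`, where `x` is the monomial with exponent `g`. -/
def linU (g : G) (a : ℂ) : (Ser G)ˣ := (isUnit_lin g a).unit

theorem linU_val (g : G) (a : ℂ) : (linU g a : Ser G) = mon g + cS a * hS G := rfl

theorem linU_zero (g : G) : (linU g 0 : Ser G) = mon g := by
  rw [linU_val, cS_zero, zero_mul, add_zero]

theorem Ser.map_linU (φ : G →+ H) (g : G) (a : ℂ) :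
    Units.map (Ser.map φ : Ser G →* Ser H) (linU g a) = linU (φ g) a := by
  ext1
  simp only [Units.coe_map, MonoidHom.coe_coe, linU_val, map_add, map_mul, Ser.map_mon,
    Ser.map_cS, Ser.map_X]

theorem Ser.map_linU_zpow (φ : G →+ H) (g : G) (a : ℂ) (k : ℤ) :
    Ser.map φ (linU g a ^ k : (Ser G)ˣ) = (linU (φ g) a ^ k : (Ser H)ˣ) := by
  rw [← Ser.map_linU, ← map_zpow]; rfl

/-- Two commuting units that agree on an element have powers that agree on it. -/
theorem zpow_smul_eq {R M : Type*} [CommRing R] [AddCommGroup M] [Module R M] {x y : Rˣ} {z : M}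
    (h : (x : R) • z = (y : R) • z) (k : ℤ) :
    ((x ^ k : Rˣ) : R) • z = ((y ^ k : Rˣ) : R) • z := by
  have hn : ∀ {x y : Rˣ} (_ : (x : R) • z = (y : R) • z) (n : ℕ),
      ((x ^ n : Rˣ) : R) • z = ((y ^ n : Rˣ) : R) • z := by
    intro x y h n
    induction n with
    | zero => simp
    | succ n ih =>
      rw [pow_succ, pow_succ', Units.val_mul, Units.val_mul, mul_smul, mul_smul, h,
        smul_comm, ih]
  have hi : ((x⁻¹ : Rˣ) : R) • z = ((y⁻¹ : Rˣ) : R) • z := by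
    have h1 : z = ((x⁻¹ : Rˣ) : R) • (y : R) • z := by
      rw [← h, smul_smul, Units.inv_mul, one_smul]
    conv_rhs => rw [h1]
    rw [smul_comm, smul_smul _ (y : R), Units.inv_mul, one_smul]
  obtain ⟨n, rfl | rfl⟩ := k.eq_nat_or_neg
  · simpa using hn h n
  · have := hn hi n
    simpa using this

/-- A map that intertwines two units intertwines their powers. -/
theorem zpow_intertwine {R S M N : Type*} [CommRing R] [CommRing S] [AddCommGroup M] [Module R M]
    [AddCommGroup N] [Module S N] {x : Rˣ} {y : Sˣ} (T : M → N)
    (h : ∀ z, T ((x : R) • z) = (y : S) • T z) (k : ℤ) (z : M) :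
    T (((x ^ k : Rˣ) : R) • z) = ((y ^ k : Sˣ) : S) • T z := by
  have hi : ∀ z, T (((x⁻¹ : Rˣ) : R) • z) = ((y⁻¹ : Sˣ) : S) • T z := by
    intro z
    have h1 := h (((x⁻¹ : Rˣ) : R) • z)
    rw [smul_smul, Units.mul_inv, one_smul] at h1
    rw [h1, smul_smul, Units.inv_mul, one_smul]
  obtain ⟨n, rfl | rfl⟩ := k.eq_nat_or_neg
  · induction n generalizing z with
    | zero => simp
    | succ n ih =>
      have h2 := ih ((x : R) • z)
      simp only [zpow_natCast] at h2 ⊢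
      rw [pow_succ, Units.val_mul, mul_smul, h2, h, pow_succ, Units.val_mul, mul_smul]
  · induction n generalizing z with
    | zero => simp
    | succ n ih =>
      have h2 := ih (((x⁻¹ : Rˣ) : R) • z)
      simp only [zpow_neg, zpow_natCast, ← inv_pow] at h2 ⊢
      rw [pow_succ, Units.val_mul, mul_smul, h2, hi, pow_succ, Units.val_mul, mul_smul]

end Units

/-! ### Products of distributions in independent variables -/

section Products

variable {G H A B D : Type*} [AddCommGroup G] [AddCommGroup H] [AddCommGroup A] [Module ℂ A]
  [AddCommGroup B] [Module ℂ B] [AddCommGroup D] [Module ℂ D]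

/-- The product of two distributions in independent variables. -/
def Fld.bil (μ : A →ₗ[ℂ] B →ₗ[ℂ] D) (f : Fld G A) (f' : Fld H B) : Fld (G × H) D :=
  fun m x => ∑ a ∈ Finset.HasAntidiagonal.antidiagonal m, μ (f a.1 x.1) (f' a.2 x.2)

theorem Fld.bil_apply (μ : A →ₗ[ℂ] B →ₗ[ℂ] D) (f : Fld G A) (f' : Fld H B) (m : ℕ) (x : G × H) :
    Fld.bil μ f f' m x =
      ∑ a ∈ Finset.HasAntidiagonal.antidiagonal m, μ (f a.1 x.1) (f' a.2 x.2) := rfl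

theorem Fld.bil_smul_left (μ : A →ₗ[ℂ] B →ₗ[ℂ] D) (p : Ser G) (f : Fld G A) (f' : Fld H B) :
    Fld.bil μ (p • f) f' = Ser.map (AddMonoidHom.inl G H) p • Fld.bil μ f f' := by
  let T : ℕ → (G → A) →ₗ[ℂ] (G × H → D) := fun n =>
    { toFun := fun F x => μ (F x.1) (f' n x.2)
      map_add' := fun a b => by ext x; simp
      map_smul' := fun a b => by ext x; simp }
  have h := smul_intertwine (AddMonoidHom.inl G H) T (fun n g F => by
    ext x
    simp [T, conv_single]) p f
  have e : ∀ f : Fld G A, Fld.bil μ f f' =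
      fun m => ∑ a ∈ Finset.HasAntidiagonal.antidiagonal m, T a.2 (f a.1) := by
    intro f
    funext m x
    simp only [Fld.bil_apply, Finset.sum_apply, T]
    rfl
  rw [e, e]
  exact h

theorem Fld.bil_smul_right (μ : A →ₗ[ℂ] B →ₗ[ℂ] D) (p : Ser H) (f : Fld G A) (f' : Fld H B) :
    Fld.bil μ f (p • f') = Ser.map (AddMonoidHom.inr G H) p • Fld.bil μ f f' := by
  let T : ℕ → (H → B) →ₗ[ℂ] (G × H → D) := fun n =>
    { toFun := fun F x => μ (f n x.1) (F x.2)
      map_add' := fun a b => by ext x; simp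
      map_smul' := fun a b => by ext x; simp }
  have h := smul_intertwine (AddMonoidHom.inr G H) T (fun n g F => by
    ext x
    simp [T, conv_single]) p f'
  have e : ∀ f' : Fld H B, Fld.bil μ f f' =
      fun m => ∑ a ∈ Finset.HasAntidiagonal.antidiagonal m, T a.2 (f' a.1) := by
    intro f'
    funext m x
    rw [← Finset.Nat.sum_antidiagonal_swap]
    simp only [Fld.bil_apply, Finset.sum_apply, T]
    rfl
  rw [e, e]
  exact h

end Products

/-! ### The substitution `u ↦ u + b ħ` -/

section Shift

variable {V W : Type*} [AddCommGroup V] [Module ℂ V] [AddCommGroup W] [Module ℂ W]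

/-- The substitution `u ↦ u + b ħ`, expanded in `ħ`. -/
def Fld.shift (b : ℂ) (f : Fld ℤ V) : Fld ℤ V := fun m n =>
  ∑ a ∈ Finset.HasAntidiagonal.antidiagonal m,
    (((Ring.choose (n + a.1) a.1 : ℤ) : ℂ) * b ^ a.1) • f a.2 (n + a.1)

theorem Fld.shift_apply (b : ℂ) (f : Fld ℤ V) (m : ℕ) (n : ℤ) : Fld.shift b f m n =
  ∑ a ∈ Finset.HasAntidiagonal.antidiagonal m,
    (((Ring.choose (n + a.1) a.1 : ℤ) : ℂ) * b ^ a.1) • f a.2 (n + a.1) := rfl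

theorem Fld.shift_add (b : ℂ) (f g : Fld ℤ V) :
    Fld.shift b (f + g) = Fld.shift b f + Fld.shift b g := by
  funext m n
  simp only [Fld.shift_apply, Fld.add_apply, smul_add, Finset.sum_add_distrib]

theorem Fld.shift_zero (b : ℂ) : Fld.shift b (0 : Fld ℤ V) = 0 := by
  funext m n
  exact Finset.sum_eq_zero fun a _ => smul_zero _

theorem Fld.shift_neg (b : ℂ) (f : Fld ℤ V) : Fld.shift b (-f) = -Fld.shift b f := by
  rw [eq_neg_iff_add_eq_zero, ← Fld.shift_add, neg_add_cancel, Fld.shift_zero]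

theorem Fld.shift_sub (b : ℂ) (f g : Fld ℤ V) :
    Fld.shift b (f - g) = Fld.shift b f - Fld.shift b g := by
  rw [sub_eq_add_neg, Fld.shift_add, Fld.shift_neg, sub_eq_add_neg]

theorem Fld.map_shift (L : V →ₗ[ℂ] W) (b : ℂ) (f : Fld ℤ V) :
    Fld.map L (Fld.shift b f) = Fld.shift b (Fld.map L f) := by
  funext m n
  simp only [Fld.map_apply, Fld.shift_apply, map_sum, _root_.map_smul]

theorem Fld.shift_X (b : ℂ) (f : Fld ℤ V) : Fld.shift b (hS ℤ • f) = hS ℤ • Fld.shift b f := by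
  funext m n
  cases m with
  | zero => simp [Fld.shift_apply, Fld.X_smul_zero]
  | succ m =>
    rw [Fld.shift_apply, Finset.Nat.sum_antidiagonal_succ', Fld.X_smul_succ, Fld.shift_apply]
    simp [Fld.X_smul_succ, Fld.X_smul_zero]

theorem Fld.shift_cS (b c : ℂ) (f : Fld ℤ V) :
    Fld.shift b ((cS c : Ser ℤ) • f) = (cS c : Ser ℤ) • Fld.shift b f := by
  funext m n
  simp only [cS_smul, Fld.shift_apply, Finset.smul_sum, smul_smul, mul_comm c]

/-- This is Pascal's rule for the coefficients of `(u + b ħ) ^ (n + a)`. Together with the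
invertibility of `u + c ħ` it makes the shift compatible with all integer powers of such factors. -/
theorem Fld.shift_mon (b : ℂ) (f : Fld ℤ V) :
    Fld.shift b ((mon (1 : ℤ) : Ser ℤ) • f) = (linU (1 : ℤ) b : Ser ℤ) • Fld.shift b f := by
  funext m n
  rw [linU_val, add_smul, mul_smul, Fld.add_apply, mon_smul, cS_smul, Fld.shift_apply,
    Fld.shift_apply]
  simp only [mon_smul]
  cases m with
  | zero => simp [Fld.X_smul_zero]
  | succ m =>
    rw [Fld.X_smul_succ, Fld.shift_apply, Finset.Nat.sum_antidiagonal_succ,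
      Finset.Nat.sum_antidiagonal_succ, Finset.smul_sum, add_assoc, ← Finset.sum_add_distrib]
    congr 1
    · simp
    · refine Finset.sum_congr rfl fun a _ => ?_
      have e : n + ((a.1 + 1 : ℕ) : ℤ) - 1 = n + a.1 := by push_cast; ring
      have e' : n - 1 + ((a.1 + 1 : ℕ) : ℤ) = n + a.1 := by push_cast; ring
      have e'' : n + ((a.1 + 1 : ℕ) : ℤ) = (n + a.1) + 1 := by push_cast; ring
      rw [e, e', e'', smul_smul, ← add_smul, Ring.choose_succ_succ]
      congr 1
      push_cast
      ring

theorem Fld.shift_linU (b c : ℂ) (f : Fld ℤ V) :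
    Fld.shift b ((linU (1 : ℤ) c : Ser ℤ) • f) =
      (linU (1 : ℤ) (b + c) : Ser ℤ) • Fld.shift b f := by
  rw [linU_val _ c, add_smul, mul_smul, Fld.shift_add, Fld.shift_mon, Fld.shift_cS, Fld.shift_X,
    ← mul_smul, ← add_smul, linU_val, linU_val, cS_add, add_mul, add_assoc]

theorem Fld.shift_linU_zpow (b c : ℂ) (f : Fld ℤ V) (k : ℤ) :
    Fld.shift b (((linU (1 : ℤ) c ^ k : (Ser ℤ)ˣ) : Ser ℤ) • f) =
      ((linU (1 : ℤ) (b + c) ^ k : (Ser ℤ)ˣ) : Ser ℤ) • Fld.shift b f :=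
  zpow_intertwine _ (Fld.shift_linU b c) k f

/-- The substitution is the identity modulo `ħ`, so the lowest coefficient in `ħ` of a distribution
in the kernel is already zero. -/
theorem Fld.shift_injective (b : ℂ) : Function.Injective (Fld.shift b (V := V)) := by
  intro f g h
  rw [← sub_eq_zero, ← Fld.shift_sub] at h
  rw [← sub_eq_zero]
  generalize f - g = f at h
  funext m
  induction m using Nat.strong_induction_on with
  | _ m ih =>
    funext n
    have h1 := congrFun (congrFun h m) n
    rw [Fld.shift_apply, Finset.sum_eq_single (0, m)] at h1
    · simpa using h1
    · rintro ⟨p, q⟩ hp hne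
      have hq : q < m := by
        have hpq := Finset.HasAntidiagonal.mem_antidiagonal.1 hp
        rcases Nat.eq_zero_or_pos p with rfl | hp0
        · exact absurd (by simpa using hpq) (fun h : q = m => hne (by rw [h]))
        · exact Nat.lt_of_lt_of_le (Nat.lt_add_of_pos_left hp0) hpq.le
      rw [show f (p, q).2 = 0 from ih q hq]
      exact smul_zero _
    · simp

/-- Distributions with only negative exponents. -/
def Fld.IsNeg (f : Fld ℤ V) : Prop := ∀ m (n : ℤ), 0 ≤ n → f m n = 0

/-- Distributions with only non-negative exponents. -/
def Fld.IsNonneg (f : Fld ℤ V) : Prop := ∀ m (n : ℤ), n < 0 → f m n = 0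

theorem Fld.IsNeg.shift {f : Fld ℤ V} (hf : f.IsNeg) (b : ℂ) : (Fld.shift b f).IsNeg := by
  intro m n hn
  exact Finset.sum_eq_zero fun a _ => by rw [hf _ _ (by omega), smul_zero]

theorem Fld.IsNonneg.shift {f : Fld ℤ V} (hf : f.IsNonneg) (b : ℂ) :
    (Fld.shift b f).IsNonneg := by
  intro m n hn
  refine Finset.sum_eq_zero fun a _ => ?_
  rcases lt_or_ge (n + a.1) 0 with h | h
  · rw [hf _ _ h, smul_zero]
  · obtain ⟨k, hk⟩ := Int.eq_ofNat_of_zero_le h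
    -- Here `0 ≤ n + a < a`, so this is a binomial coefficient of natural numbers that vanishes: a
    -- substitution into non-negative powers creates no negative ones.
    rw [hk, Ring.choose_natCast, Nat.choose_eq_zero_of_lt (by omega)]
    simp

/-- The constant distribution. -/
def Fld.single0 {G : Type*} [Zero G] [DecidableEq G] (f : ℕ → V) : Fld G V :=
  fun m n => if n = 0 then f m else 0

theorem Fld.shift_single0 (b : ℂ) (f : ℕ → V) :
    Fld.shift b (Fld.single0 f) = Fld.single0 f := by
  funext m n
  rw [Fld.shift_apply, Finset.sum_eq_single (0, m)]
  · simp
  · rintro ⟨p, q⟩ hp hne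
    have hp0 : p ≠ 0 := by
      rintro rfl
      simp_all
    simp only [Fld.single0]
    split_ifs with h
    · rw [h, Ring.choose_zero_pos _ (Nat.pos_of_ne_zero hp0)]
      simp
    · simp
  · simp

end Shift

/-! ### Primary distributions on the polynomial Fock space -/

/-- The bosonic Fock space without the lattice part. -/
abbrev Pol : Type := MvPolynomial (Fin 2 × ℕ+) ℂ

/-- Linear operators on the bosonic Fock space. -/
abbrev OpP : Type := Module.End ℂ Pol

/-- The boson `a_{j,k}` on `Pol`. -/
def bosonP (j : Fin 2) (k : ℤ) : OpP :=
  if k < 0 then LinearMap.mulLeft ℂ (MvPolynomial.X (j, k.natAbs.toPNat'))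
    else (k : ℂ) • (MvPolynomial.pderiv (R := ℂ) (j, k.natAbs.toPNat')).toLinearMap

theorem bosonP_neg (j : Fin 2) (k : ℕ+) (f : Pol) :
    bosonP j (-(k : ℤ)) f = MvPolynomial.X (j, k) * f := by
  have : (-(k : ℤ)) < 0 := by have := k.pos; omega
  simp [bosonP]

theorem bosonP_pos (j : Fin 2) (k : ℕ+) (f : Pol) :
    bosonP j (k : ℤ) f = (k : ℂ) • MvPolynomial.pderiv (j, k) f := by
  have : ¬ ((k : ℤ) < 0) := by omega
  rw [bosonP, if_neg this]
  simp

/-! ### Commutators as derivations of products -/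

section Ad

variable {A : Type*} [Ring A] [Algebra ℂ A]

/-- The commutator with `a`. -/
def adL (a : A) : A →ₗ[ℂ] A := LinearMap.mulLeft ℂ a - LinearMap.mulRight ℂ a

theorem adL_apply (a b : A) : adL a b = a * b - b * a := rfl

/-- Multiplication of operators. -/
abbrev mulB (A : Type*) [Ring A] [Algebra ℂ A] : A →ₗ[ℂ] A →ₗ[ℂ] A := LinearMap.mul ℂ A

variable {G H : Type*} [AddCommGroup G] [AddCommGroup H]

theorem map_adL_bil (a : A) (f : Fld G A) (f' : Fld H A) :
    Fld.map (adL a) (Fld.bil (mulB A) f f') =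
      Fld.bil (mulB A) (Fld.map (adL a) f) f' + Fld.bil (mulB A) f (Fld.map (adL a) f') := by
  funext m x
  simp only [Fld.map_apply, Fld.bil_apply, Fld.add_apply, map_sum, ← Finset.sum_add_distrib]
  refine Finset.sum_congr rfl fun i _ => ?_
  simp only [adL_apply, LinearMap.mul_apply']
  noncomm_ring

theorem map_adL_bil_flip (a : A) (f : Fld G A) (f' : Fld H A) :
    Fld.map (adL a) (Fld.bil (mulB A).flip f f') =
      Fld.bil (mulB A).flip (Fld.map (adL a) f) f' +
        Fld.bil (mulB A).flip f (Fld.map (adL a) f') := by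
  funext m x
  simp only [Fld.map_apply, Fld.bil_apply, Fld.add_apply, map_sum, ← Finset.sum_add_distrib]
  refine Finset.sum_congr rfl fun i _ => ?_
  simp only [adL_apply, LinearMap.flip_apply, LinearMap.mul_apply']
  noncomm_ring

end Ad

/-- The coefficient at `d` of the image of the vacuum. -/
def vacCoeff (d : Fin 2 × ℕ+ →₀ ℕ) : OpP →ₗ[ℂ] ℂ :=
  MvPolynomial.lcoeff ℂ d ∘ₗ LinearMap.applyₗ (1 : Pol)

theorem vacCoeff_apply (d : Fin 2 × ℕ+ →₀ ℕ) (T : OpP) :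
    vacCoeff d T = MvPolynomial.coeff d (T 1) := rfl

/-- The vacuum expectation. -/
abbrev vac : OpP →ₗ[ℂ] ℂ := vacCoeff 0

section Primary

variable {G H : Type*} [AddCommGroup G] [AddCommGroup H]

/-- Distributions whose commutators with the bosons are scalar multiples. -/
def Primary (φ : Fin 2 → ℤ → Ser G) (D : Fld G OpP) : Prop :=
  ∀ j k, k ≠ 0 → Fld.map (adL (bosonP j k)) D = φ j k • D

theorem Primary.sub {φ : Fin 2 → ℤ → Ser G} {D D' : Fld G OpP} (h : Primary φ D)
    (h' : Primary φ D') : Primary φ (D - D') := fun j k hk => by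
  rw [Fld.map_sub, h j k hk, h' j k hk, smul_sub]

theorem Primary.smul {φ : Fin 2 → ℤ → Ser G} {D : Fld G OpP} (h : Primary φ D) (p : Ser G) :
    Primary φ (p • D) := fun j k hk => by
  rw [Fld.map_smul, h j k hk, smul_comm]

theorem Primary.bil {φ : Fin 2 → ℤ → Ser G} {φ' : Fin 2 → ℤ → Ser H} {D : Fld G OpP}
    {D' : Fld H OpP} (h : Primary φ D) (h' : Primary φ' D') :
    Primary (fun j k => Ser.map (AddMonoidHom.inl G H) (φ j k) +
      Ser.map (AddMonoidHom.inr G H) (φ' j k)) (Fld.bil (mulB OpP) D D') := fun j k hk => by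
  rw [map_adL_bil, h j k hk, h' j k hk, Fld.bil_smul_left, Fld.bil_smul_right, add_smul]

theorem Primary.bil_flip {φ : Fin 2 → ℤ → Ser G} {φ' : Fin 2 → ℤ → Ser H} {D : Fld G OpP}
    {D' : Fld H OpP} (h : Primary φ D) (h' : Primary φ' D') :
    Primary (fun j k => Ser.map (AddMonoidHom.inl G H) (φ j k) +
      Ser.map (AddMonoidHom.inr G H) (φ' j k)) (Fld.bil (mulB OpP).flip D D') := fun j k hk => by
  rw [map_adL_bil_flip, h j k hk, h' j k hk, Fld.bil_smul_left, Fld.bil_smul_right, add_smul]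

/-- An annihilation operator kills the vacuum and differentiates, so bracketing with it reads off
the image of the vacuum one degree higher. The factor is nonzero, which makes this a recursion for
that image. -/
theorem vacCoeff_succ (j : Fin 2) (k : ℕ+) (d : Fin 2 × ℕ+ →₀ ℕ) (T : OpP) :
    vacCoeff d (adL (bosonP j k) T) =
      ((k : ℂ) * (d (j, k) + 1)) * vacCoeff (d + Finsupp.single (j, k) 1) T := by
  rw [vacCoeff_apply, vacCoeff_apply, adL_apply, LinearMap.sub_apply, Module.End.mul_apply,
    Module.End.mul_apply, bosonP_pos, bosonP_pos]
  simp [MvPolynomial.coeff_pderiv]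
  ring

/-- The Fock space is irreducible: a primary distribution is determined by its vacuum
expectation. -/
theorem Primary.eq_zero {φ : Fin 2 → ℤ → Ser G} {D : Fld G OpP} (h : Primary φ D)
    (h0 : Fld.map vac D = 0) : D = 0 := by
  -- The positive modes show, by induction on the degree, that `D` kills the vacuum.
  have h1 : ∀ (n : ℕ) (d : Fin 2 × ℕ+ →₀ ℕ), d.degree = n → Fld.map (vacCoeff d) D = 0 := by
    intro n
    induction n with
    | zero =>
      intro d hd
      rw [Finsupp.degree_eq_zero_iff] at hd
      rw [hd]; exact h0
    | succ n ih =>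
      intro d hd
      obtain ⟨⟨j, k⟩, hjk⟩ : ∃ i, d i ≠ 0 := by
        by_contra hcon
        push Not at hcon
        have : d = 0 := Finsupp.ext hcon
        simp [this] at hd
      obtain ⟨e, rfl⟩ : ∃ e, d = e + Finsupp.single (j, k) 1 :=
        ⟨d - Finsupp.single (j, k) 1, by
          rw [tsub_add_cancel_of_le]
          simpa [Nat.one_le_iff_ne_zero] using hjk⟩
      have he : e.degree = n := by
        have : e.degree + 1 = n + 1 := by simpa [map_add] using hd
        omega
      have h2 := congrArg (Fld.map (vacCoeff e)) (h j k (by exact_mod_cast k.ne_zero))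
      rw [Fld.map_smul, ih e he, smul_zero] at h2
      funext m x
      have h3 := congrFun (congrFun h2 m) x
      simp only [Fld.map_apply, vacCoeff_succ] at h3
      have h4 : ((k : ℂ) * (e (j, k) + 1)) ≠ 0 := by
        exact mul_ne_zero (by exact_mod_cast k.ne_zero) (Nat.cast_add_one_ne_zero _)
      exact (mul_eq_zero.1 h3).resolve_left h4
  -- The negative modes generate the Fock space from the vacuum, and their commutators with `D`
  -- carry the vanishing from `f` to its product with a variable.
  have h2 : ∀ f : Pol, Fld.map (LinearMap.applyₗ f) D = 0 := by
    intro f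
    induction f using MvPolynomial.induction_on with
    | C c =>
      funext m x
      rw [Fld.map_apply, LinearMap.applyₗ_apply_apply, MvPolynomial.C_eq_smul_one, map_smul]
      have : D m x 1 = 0 := by
        ext d
        exact congrFun (congrFun (h1 _ d rfl) m) x
      rw [this, smul_zero]
      rfl
    | add f g hf hg =>
      funext m x
      have hf' := congrFun (congrFun hf m) x
      have hg' := congrFun (congrFun hg m) x
      simp only [Fld.map_apply, LinearMap.applyₗ_apply_apply] at hf' hg' ⊢
      rw [map_add, hf', hg']
      exact add_zero (0 : Pol)
    | mul_X f i hf =>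
      obtain ⟨j, k⟩ := i
      have h2 := congrArg (Fld.map (LinearMap.applyₗ f)) (h j (-(k : ℤ)) (by simp))
      rw [Fld.map_smul, hf, smul_zero] at h2
      funext m x
      have h3 := congrFun (congrFun h2 m) x
      have h4 := congrFun (congrFun hf m) x
      simp only [Fld.map_apply, LinearMap.applyₗ_apply_apply, adL_apply, LinearMap.sub_apply,
        Module.End.mul_apply, bosonP_neg] at h3 h4 ⊢
      rw [h4] at h3
      rw [mul_comm f]
      have h5 : (0 : Fld G Pol) m x = 0 := rfl
      simpa [h5] using h3
  funext m x
  refine LinearMap.ext fun f => ?_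
  exact congrFun (congrFun (h2 f) m) x

theorem Primary.ext {φ : Fin 2 → ℤ → Ser G} {D D' : Fld G OpP} (h : Primary φ D)
    (h' : Primary φ D') (h0 : Fld.map vac D = Fld.map vac D') : D = D' :=
  sub_eq_zero.1 ((h.sub h').eq_zero (by rw [Fld.map_sub, h0, sub_self]))

theorem Primary.shift {φ ψ : Fin 2 → ℤ → Ser ℤ} {D : Fld ℤ OpP} (h : Primary φ D) (b : ℂ)
    (hψ : ∀ j k, Fld.shift b (φ j k • D) = ψ j k • Fld.shift b D) :
    Primary ψ (Fld.shift b D) := fun j k hk => by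
  rw [Fld.map_shift, h j k hk, hψ]

end Primary

/-! ### Exponentials -/

section Exp

variable {A B : Type*} [Ring A] [Algebra ℂ A] [Ring B] [Algebra ℂ B]

theorem expo_apply_zero (m n : ℕ) : expo m n 0 = m := by simp [expo]

theorem expo_apply_one (m n : ℕ) : expo m n 1 = n := by simp [expo]

theorem expo_eta (d : Fin 2 →₀ ℕ) : expo (d 0) (d 1) = d := by
  ext i
  fin_cases i <;> simp [expo]

theorem expo_inj {m n m' n' : ℕ} (h : expo m n = expo m' n') : m = m' ∧ n = n' :=
  ⟨by rw [← expo_apply_zero m n, h, expo_apply_zero], by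
    rw [← expo_apply_one m n, h, expo_apply_one]⟩

theorem expo_add (m n m' n' : ℕ) : expo m n + expo m' n' = expo (m + m') (n + n') := by
  simp [expo, add_add_add_comm]

theorem coeff_expo_mul (X Y : MvPowerSeries (Fin 2) A) (m n : ℕ) :
    MvPowerSeries.coeff (expo m n) (X * Y) =
      ∑ p ∈ Finset.HasAntidiagonal.antidiagonal m, ∑ q ∈ Finset.HasAntidiagonal.antidiagonal n,
        MvPowerSeries.coeff (expo p.1 q.1) X * MvPowerSeries.coeff (expo p.2 q.2) Y := by
  rw [MvPowerSeries.coeff_mul, Finset.sum_sigma']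
  refine Finset.sum_bij' (fun x _ => ⟨(x.1 0, x.2 0), (x.1 1, x.2 1)⟩)
    (fun x _ => (expo x.1.1 x.2.1, expo x.1.2 x.2.2)) ?_ ?_ ?_ ?_ ?_
  · rintro ⟨a, b⟩ h
    have h := Finset.HasAntidiagonal.mem_antidiagonal.1 h
    simp only [Finset.mem_sigma, Finset.HasAntidiagonal.mem_antidiagonal]
    simp only at h
    constructor
    · rw [← Finsupp.add_apply, h, expo_apply_zero]
    · rw [← Finsupp.add_apply, h, expo_apply_one]
  · rintro ⟨⟨a, b⟩, c, d⟩ h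
    simp only [Finset.mem_sigma, Finset.HasAntidiagonal.mem_antidiagonal] at h
    simp only [Finset.HasAntidiagonal.mem_antidiagonal]
    rw [expo_add, h.1, h.2]
  · rintro ⟨a, b⟩ h
    simp only [expo_eta]
  · rintro ⟨⟨a, b⟩, c, d⟩ h
    simp only [expo_apply_zero, expo_apply_one]
  · rintro ⟨a, b⟩ h
    simp only [expo_eta]

/-- `exp X = ∑ Xⁿ / n!` for a series with zero constant term. -/
def expS (X : MvPowerSeries (Fin 2) A) : MvPowerSeries (Fin 2) A :=
  fun d => ∑ n ∈ Finset.range (d.degree + 1),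
    ((n.factorial : ℂ)⁻¹) • MvPowerSeries.coeff d (X ^ n)

theorem expSeries_eq (X : OpSeries) : expSeries X = expS X := rfl

theorem coeff_pow_eq_zero {X : MvPowerSeries (Fin 2) A} (hX : MvPowerSeries.constantCoeff X = 0)
    {d : Fin 2 →₀ ℕ} {n : ℕ} (h : d.degree < n) : MvPowerSeries.coeff d (X ^ n) = 0 := by
  apply MvPowerSeries.coeff_of_lt_order
  refine lt_of_lt_of_le ?_ (MvPowerSeries.le_order_pow_of_constantCoeff_eq_zero n hX)
  exact_mod_cast h

theorem coeff_expS {X : MvPowerSeries (Fin 2) A} (hX : MvPowerSeries.constantCoeff X = 0)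
    (d : Fin 2 →₀ ℕ) {N : ℕ} (hN : d.degree < N) :
    MvPowerSeries.coeff d (expS X) =
      ∑ n ∈ Finset.range N, ((n.factorial : ℂ)⁻¹) • MvPowerSeries.coeff d (X ^ n) := by
  change ∑ n ∈ Finset.range (d.degree + 1), _ = _
  refine Finset.sum_subset (Finset.range_mono hN) fun n _ hn => ?_
  rw [coeff_pow_eq_zero hX (by simpa using hn), smul_zero]

theorem constantCoeff_expS (X : MvPowerSeries (Fin 2) A) :
    MvPowerSeries.constantCoeff (expS X) = 1 := by
  rw [← MvPowerSeries.coeff_zero_eq_constantCoeff_apply]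
  change ∑ n ∈ Finset.range ((0 : Fin 2 →₀ ℕ).degree + 1), _ = _
  simp

theorem map_expS (L : A →ₐ[ℂ] B) (X : MvPowerSeries (Fin 2) A) :
    MvPowerSeries.map (L : A →+* B) (expS X) = expS (MvPowerSeries.map (L : A →+* B) X) := by
  ext d
  rw [MvPowerSeries.coeff_map]
  change L (∑ n ∈ Finset.range (d.degree + 1), _) = ∑ n ∈ Finset.range (d.degree + 1), _
  simp only [map_sum, map_smul, ← map_pow, MvPowerSeries.coeff_map]
  rfl

/-- Derivations that do not lower degrees act on exponentials in the usual way. -/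
theorem deriv_expS (D : MvPowerSeries (Fin 2) A →ₗ[ℂ] MvPowerSeries (Fin 2) A)
    (hD : ∀ f g, D (f * g) = D f * g + f * D g)
    (hloc : ∀ f d, (∀ e, e.degree ≤ d.degree → MvPowerSeries.coeff e f = 0) →
      MvPowerSeries.coeff d (D f) = 0)
    {X : MvPowerSeries (Fin 2) A} (hX : MvPowerSeries.constantCoeff X = 0)
    (hc : Commute X (D X)) : D (expS X) = D X * expS X := by
  have h1 : D 1 = 0 := by
    have := hD 1 1
    simpa using this
  have hpow : ∀ n : ℕ, D (X ^ (n + 1)) = ((n : ℂ) + 1) • (D X * X ^ n) := by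
    intro n
    induction n with
    | zero => simp
    | succ n ih =>
      rw [pow_succ, hD, ih, (hc.pow_left (n + 1)).eq, smul_mul_assoc, mul_assoc, ← pow_succ]
      push_cast
      rw [add_smul, add_smul, one_smul, add_smul, one_smul]
  ext d
  set N := d.degree + 1 with hN
  -- By `hloc` the exponential may be truncated before `D` is applied at `d`. One term more than `N`
  -- is kept because `D` turns the power `n + 1` into the power `n`.
  set S : MvPowerSeries (Fin 2) A :=
    ∑ n ∈ Finset.range (N + 1), ((n.factorial : ℂ)⁻¹) • X ^ n with hS
  have e1 : MvPowerSeries.coeff d (D (expS X)) = MvPowerSeries.coeff d (D S) := by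
    rw [← sub_eq_zero, ← map_sub, ← map_sub]
    refine hloc _ _ fun e he => ?_
    rw [map_sub, coeff_expS hX e (N := N + 1) (by omega), hS, map_sum, sub_eq_zero]
    rfl
  have e2 : D S = ∑ n ∈ Finset.range N, ((n.factorial : ℂ)⁻¹) • (D X * X ^ n) := by
    rw [hS, map_sum, Finset.sum_range_succ']
    simp only [map_smul, hpow, pow_zero, h1, smul_zero, add_zero]
    refine Finset.sum_congr rfl fun n _ => ?_
    rw [smul_smul, Nat.factorial_succ]
    congr 1
    have : ((n : ℂ) + 1) ≠ 0 := Nat.cast_add_one_ne_zero n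
    have : (n.factorial : ℂ) ≠ 0 := by exact_mod_cast n.factorial_ne_zero
    push_cast
    field_simp
  rw [e1, e2, MvPowerSeries.coeff_mul, map_sum]
  have e3 : ∀ n ∈ Finset.range N, MvPowerSeries.coeff d (((n.factorial : ℂ)⁻¹) • (D X * X ^ n)) =
      ∑ p ∈ Finset.HasAntidiagonal.antidiagonal d, MvPowerSeries.coeff p.1 (D X) *
        (((n.factorial : ℂ)⁻¹) • MvPowerSeries.coeff p.2 (X ^ n)) := by
    intro n _
    rw [← mul_smul_comm, MvPowerSeries.coeff_mul]
    rfl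
  rw [Finset.sum_congr rfl e3, Finset.sum_comm]
  refine Finset.sum_congr rfl fun p hp => ?_
  have hp := Finset.HasAntidiagonal.mem_antidiagonal.1 hp
  have hdeg : p.2.degree < N := by
    rw [hN, ← hp, map_add]; omega
  rw [coeff_expS hX p.2 hdeg, Finset.mul_sum]

/-- The scalar series acts by its image under `algebraMap`. -/
abbrev scal (A : Type*) [Ring A] [Algebra ℂ A] : Scalar →+* MvPowerSeries (Fin 2) A :=
  MvPowerSeries.map (algebraMap ℂ A)

theorem scal_commute (s : Scalar) (X : MvPowerSeries (Fin 2) A) : Commute (scal A s) X := by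
  classical
  change scal A s * X = X * scal A s
  ext d
  rw [MvPowerSeries.coeff_mul, MvPowerSeries.coeff_mul]
  rw [Finsupp.sum_antidiagonal_swap d fun a b =>
    MvPowerSeries.coeff a (scal A s) * MvPowerSeries.coeff b X]
  refine Finset.sum_congr rfl fun p _ => ?_
  simp only [MvPowerSeries.coeff_map]
  exact Algebra.commutes _ _

theorem coeff_adL_C (a : A) (f : MvPowerSeries (Fin 2) A) (d : Fin 2 →₀ ℕ) :
    MvPowerSeries.coeff d (adL (MvPowerSeries.C a) f) = adL a (MvPowerSeries.coeff d f) := by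
  rw [adL_apply, adL_apply, map_sub, MvPowerSeries.coeff_C_mul, MvPowerSeries.coeff_mul_C]

/-- A bracket with a fixed operator is a derivation, and a scalar series commutes with everything;
so the exponential is an eigenvector of the bracket. Vertex operators are primary for this reason.
-/
theorem adL_expS (a : A) {X : MvPowerSeries (Fin 2) A}
    (hX : MvPowerSeries.constantCoeff X = 0) {s : Scalar}
    (h : adL (MvPowerSeries.C a) X = scal A s) :
    adL (MvPowerSeries.C a) (expS X) = scal A s * expS X := by
  have := deriv_expS (adL (MvPowerSeries.C a)) (fun f g => by simp only [adL_apply]; noncomm_ring)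
    (fun f d hf => by rw [coeff_adL_C, hf d le_rfl, map_zero]) hX
    (by rw [h]; exact (scal_commute s X).symm)
  rw [this, h]

/-- The degree derivation. -/
def theta : MvPowerSeries (Fin 2) A →ₗ[ℂ] MvPowerSeries (Fin 2) A where
  toFun f := fun d => (d.degree : ℂ) • MvPowerSeries.coeff d f
  map_add' f g := by
    ext d
    exact smul_add _ _ _
  map_smul' c f := by
    ext d
    exact smul_comm _ _ _

theorem coeff_theta (f : MvPowerSeries (Fin 2) A) (d : Fin 2 →₀ ℕ) :
    MvPowerSeries.coeff d (theta f) = (d.degree : ℂ) • MvPowerSeries.coeff d f := rfl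

theorem theta_mul (f g : MvPowerSeries (Fin 2) A) :
    theta (f * g) = theta f * g + f * theta g := by
  ext d
  rw [map_add, coeff_theta, MvPowerSeries.coeff_mul, MvPowerSeries.coeff_mul,
    MvPowerSeries.coeff_mul, Finset.smul_sum, ← Finset.sum_add_distrib]
  refine Finset.sum_congr rfl fun p hp => ?_
  have hp := Finset.HasAntidiagonal.mem_antidiagonal.1 hp
  rw [coeff_theta, coeff_theta, ← hp, smul_mul_assoc, mul_smul_comm, ← add_smul, map_add]
  push_cast
  rfl

theorem theta_expS {X : MvPowerSeries (Fin 2) A} (hX : MvPowerSeries.constantCoeff X = 0)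
    (hc : Commute X (theta X)) : theta (expS X) = theta X * expS X :=
  deriv_expS theta theta_mul
    (fun f d hf => by rw [coeff_theta, hf d le_rfl, smul_zero]) hX hc

/-- A series with given logarithmic derivative is determined by its constant term. -/
theorem eq_of_theta {t f g : MvPowerSeries (Fin 2) A} (hf : theta f = t * f)
    (hg : theta g = t * g) (ht : MvPowerSeries.constantCoeff t = 0)
    (h0 : MvPowerSeries.constantCoeff f = MvPowerSeries.constantCoeff g) : f = g := by
  rw [← sub_eq_zero]
  have h1 : theta (f - g) = t * (f - g) := by rw [map_sub, hf, hg, mul_sub]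
  have h2 : MvPowerSeries.constantCoeff (f - g) = 0 := by rw [map_sub, h0, sub_self]
  generalize f - g = k at h1 h2
  have h3 : ∀ (n : ℕ) (d : Fin 2 →₀ ℕ), d.degree = n → MvPowerSeries.coeff d k = 0 := by
    intro n
    induction n using Nat.strong_induction_on with
    | _ n ih =>
      intro d hd
      rcases Nat.eq_zero_or_pos n with rfl | hn
      · rw [Finsupp.degree_eq_zero_iff] at hd
        rw [hd, MvPowerSeries.coeff_zero_eq_constantCoeff_apply, h2]
      -- Since `t` has no constant term, the right side involves only coefficients of `k` of lower
      -- degree; on the left the degree `n` can be cancelled.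
      · have h4 := congrArg (MvPowerSeries.coeff d) h1
        rw [coeff_theta, MvPowerSeries.coeff_mul, Finset.sum_eq_zero] at h4
        · refine (smul_eq_zero.1 h4).resolve_left ?_
          rw [hd]; exact_mod_cast hn.ne'
        · rintro ⟨a, b⟩ hab
          have hab := Finset.HasAntidiagonal.mem_antidiagonal.1 hab
          simp only at hab ⊢
          rcases Nat.eq_zero_or_pos a.degree with ha | ha
          · rw [Finsupp.degree_eq_zero_iff] at ha
            rw [ha, MvPowerSeries.coeff_zero_eq_constantCoeff_apply, ht, zero_mul]
          · rw [ih b.degree (by rw [← hd, ← hab, map_add]; omega) b rfl, mul_zero]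
  ext d
  exact h3 _ d rfl

/-- The generic form of `bosonSum`. -/
def bosonSumG (a : ℕ → A) (g : ℕ → Scalar) : MvPowerSeries (Fin 2) A :=
  fun d => ∑ k ∈ Finset.Icc 1 d.degree, (MvPowerSeries.coeff d (g k) / (k : ℂ)) • a k

theorem bosonSum_eq (a : ℕ → Op₀) (g : ℕ → Scalar) : bosonSum a g = bosonSumG a g := rfl

theorem coeff_bosonSumG (a : ℕ → A) (g : ℕ → Scalar) (d : Fin 2 →₀ ℕ) :
    MvPowerSeries.coeff d (bosonSumG a g) =
      ∑ k ∈ Finset.Icc 1 d.degree, (MvPowerSeries.coeff d (g k) / (k : ℂ)) • a k := rfl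

theorem constantCoeff_bosonSumG (a : ℕ → A) (g : ℕ → Scalar) :
    MvPowerSeries.constantCoeff (bosonSumG a g) = 0 := by
  rw [← MvPowerSeries.coeff_zero_eq_constantCoeff_apply, coeff_bosonSumG]
  simp

theorem map_bosonSumG (L : A →ₐ[ℂ] B) (a : ℕ → A) (g : ℕ → Scalar) :
    MvPowerSeries.map (L : A →+* B) (bosonSumG a g) = bosonSumG (fun k => L (a k)) g := by
  ext d
  rw [MvPowerSeries.coeff_map, coeff_bosonSumG, coeff_bosonSumG]
  simp

theorem bosonSumG_sub_right (a : ℕ → A) (g g' : ℕ → Scalar) :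
    bosonSumG a (fun k => g k - g' k) = bosonSumG a g - bosonSumG a g' := by
  ext d
  simp only [map_sub, coeff_bosonSumG, sub_div, sub_smul, Finset.sum_sub_distrib]

theorem bosonSumG_sub_left (a a' : ℕ → A) (g : ℕ → Scalar) :
    bosonSumG (fun k => a k - a' k) g = bosonSumG a g - bosonSumG a' g := by
  ext d
  simp only [map_sub, coeff_bosonSumG, smul_sub, Finset.sum_sub_distrib]

theorem commute_of_coeff {X Y : MvPowerSeries (Fin 2) A}
    (h : ∀ d e, Commute (MvPowerSeries.coeff d X) (MvPowerSeries.coeff e Y)) : Commute X Y := by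
  change X * Y = Y * X
  ext d
  rw [MvPowerSeries.coeff_mul, MvPowerSeries.coeff_mul, Finsupp.sum_antidiagonal_swap d fun a b =>
    MvPowerSeries.coeff a X * MvPowerSeries.coeff b Y]
  exact Finset.sum_congr rfl fun p _ => (h _ _).eq

end Exp

/-! ### Powers of `u + b ħ` -/

theorem posPow_eq_pow (b : ℂ) (k : ℕ) : posPow b k = posPow b 1 ^ k := by
  simp [posPow]

theorem negPow_eq_pow (a : ℂ) (k : ℕ) : negPow a k = negPow a 1 ^ k := by
  simp [negPow]

theorem constantCoeff_posPow_one (b : ℂ) : MvPowerSeries.constantCoeff (posPow b 1) = 0 := by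
  simp [posPow]

theorem constantCoeff_negPow_one (a : ℂ) : MvPowerSeries.constantCoeff (negPow a 1) = 0 := by
  simp [negPow]

theorem coeff_posPow_eq_zero (b : ℂ) {k : ℕ} {d : Fin 2 →₀ ℕ} (h : d.degree < k) :
    MvPowerSeries.coeff d (posPow b k) = 0 := by
  rw [posPow_eq_pow]
  exact coeff_pow_eq_zero (constantCoeff_posPow_one b) h

theorem coeff_negPow_eq_zero (a : ℂ) {k : ℕ} {d : Fin 2 →₀ ℕ} (h : d.degree < k) :
    MvPowerSeries.coeff d (negPow a k) = 0 := by
  rw [negPow_eq_pow]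
  exact coeff_pow_eq_zero (constantCoeff_negPow_one a) h

theorem constantCoeff_onePlus (a : ℂ) : MvPowerSeries.constantCoeff (onePlus a) = 1 := by
  simp [onePlus]

theorem onePlus_mul_inv (a : ℂ) : onePlus a * (onePlus a)⁻¹ = 1 :=
  MvPowerSeries.mul_inv_cancel _ (by rw [constantCoeff_onePlus]; exact one_ne_zero)

theorem onePlus_mul_negPow_succ (a : ℂ) (k : ℕ) :
    onePlus a * negPow a (k + 1) = MvPowerSeries.X 1 * negPow a k := by
  rw [negPow, pow_succ, ← negPow]
  linear_combination (negPow a k * MvPowerSeries.X 1) * onePlus_mul_inv a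

/-! ### Locally finite sums of operators -/

section LocFin

variable {V : Type*} [AddCommGroup V] [Module ℂ V]

/-- A sequence of operators such that all but finitely many vanish on each vector. -/
def LocFin (T : ℕ → Module.End ℂ V) : Prop := ∀ f, ∃ N, ∀ l ≥ N, T l f = 0

theorem LocFin.add {T T' : ℕ → Module.End ℂ V} (h : LocFin T) (h' : LocFin T') :
    LocFin fun l => T l + T' l := fun f => by
  obtain ⟨N, hN⟩ := h f
  obtain ⟨N', hN'⟩ := h' f
  exact ⟨max N N', fun l hl => by
    rw [LinearMap.add_apply, hN l (le_trans (le_max_left _ _) hl),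
      hN' l (le_trans (le_max_right _ _) hl), add_zero]⟩

theorem LocFin.sum {ι : Type*} {T : ι → ℕ → Module.End ℂ V} (s : Finset ι)
    (h : ∀ i, LocFin (T i)) : LocFin fun l => ∑ i ∈ s, T i l := by
  classical
  induction s using Finset.induction_on with
  | empty => exact fun f => ⟨0, fun l _ => by simp⟩
  | insert i s hi ih =>
    simp only [Finset.sum_insert hi]
    exact (h i).add ih

theorem LocFin.mul_left {T : ℕ → Module.End ℂ V} (h : LocFin T) (A : ℕ → Module.End ℂ V) :
    LocFin fun l => A l * T l := fun f => by
  obtain ⟨N, hN⟩ := h f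
  exact ⟨N, fun l hl => by rw [Module.End.mul_apply, hN l hl, map_zero]⟩

theorem LocFin.mul_right {T : ℕ → Module.End ℂ V} (h : LocFin T) (A : Module.End ℂ V) :
    LocFin fun l => T l * A := fun f => h (A f)

theorem finite_of_forall_ge {f : ℕ → V} {N : ℕ} (hN : ∀ l ≥ N, f l = 0) :
    (Function.support f).Finite :=
  (Set.finite_lt_nat N).subset fun l hl => by
    by_contra hc
    exact hl (hN l (not_lt.1 hc))

open Classical in
/-- The sum of a locally finite sequence of operators. -/
def lsum (T : ℕ → Module.End ℂ V) : Module.End ℂ V :=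
  if h : LocFin T then
    { toFun := fun f => ∑ᶠ l, T l f
      map_add' := fun f g => by
        simp only [map_add]
        exact finsum_add_distrib (finite_of_forall_ge (h f).choose_spec)
          (finite_of_forall_ge (h g).choose_spec)
      map_smul' := fun c f => by
        simp only [map_smul, RingHom.id_apply]
        exact (smul_finsum c _).symm }
  else 0

theorem lsum_apply {T : ℕ → Module.End ℂ V} (h : LocFin T) (f : V) :
    lsum T f = ∑ᶠ l, T l f := by
  rw [lsum, dif_pos h]; rfl

theorem lsum_apply_range {T : ℕ → Module.End ℂ V} (h : LocFin T) {f : V} {N : ℕ}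
    (hN : ∀ l ≥ N, T l f = 0) : lsum T f = ∑ l ∈ Finset.range N, T l f := by
  rw [lsum_apply h]
  refine finsum_eq_sum_of_support_subset _ fun l hl => ?_
  rw [Finset.coe_range, Set.mem_Iio]
  by_contra hc
  exact hl (hN l (not_lt.1 hc))

theorem lsum_add {T T' : ℕ → Module.End ℂ V} (h : LocFin T) (h' : LocFin T') :
    lsum (fun l => T l + T' l) = lsum T + lsum T' := by
  refine LinearMap.ext fun f => ?_
  rw [LinearMap.add_apply, lsum_apply h, lsum_apply h', lsum_apply (h.add h')]
  exact finsum_add_distrib (finite_of_forall_ge (h f).choose_spec)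
          (finite_of_forall_ge (h' f).choose_spec)

theorem lsum_mul_left {T : ℕ → Module.End ℂ V} (h : LocFin T) (A : Module.End ℂ V) :
    lsum (fun l => A * T l) = A * lsum T := by
  refine LinearMap.ext fun f => ?_
  obtain ⟨N, hN⟩ := h f
  rw [Module.End.mul_apply, lsum_apply_range h hN,
    lsum_apply_range (h.mul_left fun _ => A) (f := f) (N := N)
      (fun l hl => by rw [Module.End.mul_apply, hN l hl, map_zero]), map_sum]
  rfl

theorem lsum_mul_right {T : ℕ → Module.End ℂ V} (h : LocFin T) (A : Module.End ℂ V) :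
    lsum (fun l => T l * A) = lsum T * A := by
  refine LinearMap.ext fun f => ?_
  rw [Module.End.mul_apply, lsum_apply h, lsum_apply (h.mul_right A)]
  rfl

theorem lsum_zero : lsum (fun _ => (0 : Module.End ℂ V)) = 0 := by
  refine LinearMap.ext fun f => ?_
  rw [lsum_apply (fun f => ⟨0, fun _ _ => rfl⟩)]
  simp

theorem lsum_succ {T : ℕ → Module.End ℂ V} (h : LocFin fun l => T (l + 1)) (h0 : T 0 = 0) :
    lsum T = lsum fun l => T (l + 1) := by
  have hT : LocFin T := fun f => by
    obtain ⟨N, hN⟩ := h f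
    refine ⟨N + 1, fun l hl => ?_⟩
    obtain ⟨k, rfl⟩ : ∃ k, l = k + 1 := ⟨l - 1, by omega⟩
    exact hN k (by omega)
  refine LinearMap.ext fun f => ?_
  obtain ⟨N, hN⟩ := h f
  rw [lsum_apply_range h hN, lsum_apply_range hT (f := f) (N := N + 1), Finset.sum_range_succ', h0]
  · simp
  · intro l hl
    obtain ⟨k, rfl⟩ : ∃ k, l = k + 1 := ⟨l - 1, by omega⟩
    exact hN k (by omega)

end LocFin

/-! ### Products of a series in `u` and a series in `u⁻¹` -/

section Wick

variable {V : Type*} [AddCommGroup V] [Module ℂ V]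

/-- Operator-valued series in two variables. -/
abbrev EndSeries (V : Type*) [AddCommGroup V] [Module ℂ V] : Type _ :=
  MvPowerSeries (Fin 2) (Module.End ℂ V)

/-- The coefficient of `ħ ^ m u ^ n` of a series in `ħ, u`. -/
def posF {A : Type*} [Ring A] (C : MvPowerSeries (Fin 2) A) (m : ℕ) (n : ℤ) : A :=
  if 0 ≤ n then MvPowerSeries.coeff (expo m n.toNat) C else 0

/-- Each coefficient in `ħ` of the series in `u⁻¹` is locally finite. -/
def SerFin (E : EndSeries V) : Prop := ∀ m, LocFin fun l => MvPowerSeries.coeff (expo m l) E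

/-- The product of a series in `u` and a series in `u⁻¹`. -/
def wick (C E : EndSeries V) : Fld ℤ (Module.End ℂ V) := fun m n =>
  lsum fun l => ∑ p ∈ Finset.HasAntidiagonal.antidiagonal m,
    posF C p.1 (n + l) * MvPowerSeries.coeff (expo p.2 l) E

theorem wick_apply (C E : EndSeries V) (m : ℕ) (n : ℤ) : wick C E m n =
  lsum fun l => ∑ p ∈ Finset.HasAntidiagonal.antidiagonal m,
    posF C p.1 (n + l) * MvPowerSeries.coeff (expo p.2 l) E := rfl

theorem SerFin.wick {E : EndSeries V} (h : SerFin E) (C : EndSeries V) (m : ℕ) (n : ℤ) :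
    LocFin fun l : ℕ => ∑ p ∈ Finset.HasAntidiagonal.antidiagonal m,
      posF C p.1 (n + l) * MvPowerSeries.coeff (expo p.2 l) E :=
  LocFin.sum _ fun p => (h p.2).mul_left _

theorem SerFin.add {E E' : EndSeries V} (h : SerFin E) (h' : SerFin E') : SerFin (E + E') :=
  fun m => by simpa only [map_add] using (h m).add (h' m)

theorem SerFin.mul_left {E : EndSeries V} (h : SerFin E) (a : Module.End ℂ V) :
    SerFin (MvPowerSeries.C a * E) := fun m => by
  simpa only [MvPowerSeries.coeff_C_mul] using (h m).mul_left fun _ => a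

theorem SerFin.mul_right {E : EndSeries V} (h : SerFin E) (a : Module.End ℂ V) :
    SerFin (E * MvPowerSeries.C a) := fun m => by
  simpa only [MvPowerSeries.coeff_mul_C] using (h m).mul_right a

theorem SerFin.neg {E : EndSeries V} (h : SerFin E) : SerFin (-E) := by
  have := h.mul_left (-1)
  simpa using this

theorem SerFin.sub {E E' : EndSeries V} (h : SerFin E) (h' : SerFin E') : SerFin (E - E') := by
  rw [sub_eq_add_neg]
  exact h.add h'.neg

section PosF

variable {A : Type*} [Ring A] [Algebra ℂ A]

theorem posF_add (C C' : MvPowerSeries (Fin 2) A) (m : ℕ) (n : ℤ) :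
    posF (C + C') m n = posF C m n + posF C' m n := by
  unfold posF; split_ifs <;> simp

theorem posF_C_mul (a : A) (C : MvPowerSeries (Fin 2) A) (m : ℕ) (n : ℤ) :
    posF (MvPowerSeries.C a * C) m n = a * posF C m n := by
  unfold posF; split_ifs <;> simp

theorem posF_mul_C (a : A) (C : MvPowerSeries (Fin 2) A) (m : ℕ) (n : ℤ) :
    posF (C * MvPowerSeries.C a) m n = posF C m n * a := by
  unfold posF; split_ifs <;> simp

theorem coeff_X_zero_mul_zero (C : MvPowerSeries (Fin 2) A) (n : ℕ) :
    MvPowerSeries.coeff (expo 0 n) (MvPowerSeries.X 0 * C) = 0 := by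
  classical
  rw [MvPowerSeries.X, MvPowerSeries.coeff_monomial_mul, if_neg]
  intro h
  have := h 0
  rw [expo_apply_zero] at this
  simp at this

theorem coeff_X_zero_mul_succ (C : MvPowerSeries (Fin 2) A) (m n : ℕ) :
    MvPowerSeries.coeff (expo (m + 1) n) (MvPowerSeries.X 0 * C) =
      MvPowerSeries.coeff (expo m n) C := by
  rw [show expo (m + 1) n = Finsupp.single 0 1 + expo m n by
    rw [show (Finsupp.single 0 1 : Fin 2 →₀ ℕ) = expo 1 0 by simp [expo], expo_add]
    congr 1 <;> omega]
  rw [MvPowerSeries.X, MvPowerSeries.coeff_add_monomial_mul, one_mul]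

theorem coeff_X_one_mul_zero (C : MvPowerSeries (Fin 2) A) (m : ℕ) :
    MvPowerSeries.coeff (expo m 0) (MvPowerSeries.X 1 * C) = 0 := by
  classical
  rw [MvPowerSeries.X, MvPowerSeries.coeff_monomial_mul, if_neg]
  intro h
  have := h 1
  rw [expo_apply_one] at this
  simp at this

theorem coeff_X_one_mul_succ (C : MvPowerSeries (Fin 2) A) (m n : ℕ) :
    MvPowerSeries.coeff (expo m (n + 1)) (MvPowerSeries.X 1 * C) =
      MvPowerSeries.coeff (expo m n) C := by
  rw [show expo m (n + 1) = Finsupp.single 1 1 + expo m n by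
    rw [show (Finsupp.single 1 1 : Fin 2 →₀ ℕ) = expo 0 1 by simp [expo], expo_add]
    congr 1 <;> omega]
  rw [MvPowerSeries.X, MvPowerSeries.coeff_add_monomial_mul, one_mul]

theorem posF_X_zero_mul_zero (C : MvPowerSeries (Fin 2) A) (n : ℤ) :
    posF (MvPowerSeries.X 0 * C) 0 n = 0 := by
  unfold posF; split_ifs <;> simp [coeff_X_zero_mul_zero]

theorem posF_X_zero_mul_succ (C : MvPowerSeries (Fin 2) A) (m : ℕ) (n : ℤ) :
    posF (MvPowerSeries.X 0 * C) (m + 1) n = posF C m n := by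
  unfold posF; split_ifs <;> simp [coeff_X_zero_mul_succ]

theorem posF_X_one_mul (C : MvPowerSeries (Fin 2) A) (m : ℕ) (n : ℤ) :
    posF (MvPowerSeries.X 1 * C) m n = posF C m (n - 1) := by
  unfold posF
  rcases lt_trichotomy n 0 with h | rfl | h
  · rw [if_neg (by omega), if_neg (by omega)]
  · simp [coeff_X_one_mul_zero]
  · obtain ⟨k, rfl⟩ : ∃ k : ℕ, n = k + 1 := ⟨(n - 1).toNat, by omega⟩
    rw [if_pos (by omega), if_pos (by omega), show ((k : ℤ) + 1).toNat = k + 1 by omega,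
      coeff_X_one_mul_succ]
    simp

end PosF

theorem SerFin.X_zero_mul {E : EndSeries V} (h : SerFin E) : SerFin (MvPowerSeries.X 0 * E) := by
  intro m
  cases m with
  | zero => exact fun f => ⟨0, fun l _ => by simp only [coeff_X_zero_mul_zero]; rfl⟩
  | succ m => simpa only [coeff_X_zero_mul_succ] using h m

theorem SerFin.X_one_mul {E : EndSeries V} (h : SerFin E) : SerFin (MvPowerSeries.X 1 * E) := by
  intro m f
  obtain ⟨N, hN⟩ := h m f
  refine ⟨N + 1, fun l hl => ?_⟩
  obtain ⟨k, rfl⟩ : ∃ k, l = k + 1 := ⟨l - 1, by omega⟩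
  simp only [coeff_X_one_mul_succ]
  exact hN k (by omega)

theorem wick_add_left (C C' : EndSeries V) {E : EndSeries V} (h : SerFin E) :
    wick (C + C') E = wick C E + wick C' E := by
  funext m n
  rw [Fld.add_apply, wick_apply, wick_apply, wick_apply, ← lsum_add (h.wick _ _ _) (h.wick _ _ _)]
  simp only [posF_add, add_mul, Finset.sum_add_distrib]

theorem wick_add_right (C : EndSeries V) {E E' : EndSeries V} (h : SerFin E) (h' : SerFin E') :
    wick C (E + E') = wick C E + wick C E' := by
  funext m n
  rw [Fld.add_apply, wick_apply, wick_apply, wick_apply, ← lsum_add (h.wick _ _ _) (h'.wick _ _ _)]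
  simp only [map_add, mul_add, Finset.sum_add_distrib]

theorem wick_C_mul_left (a : Module.End ℂ V) (C : EndSeries V) {E : EndSeries V} (h : SerFin E) :
    wick (MvPowerSeries.C a * C) E = fun m n => a * wick C E m n := by
  funext m n
  rw [wick_apply, wick_apply, ← lsum_mul_left (h.wick _ _ _)]
  simp only [posF_C_mul, Finset.mul_sum, mul_assoc]

theorem wick_mul_C_right (a : Module.End ℂ V) (C : EndSeries V) {E : EndSeries V} (h : SerFin E) :
    wick C (E * MvPowerSeries.C a) = fun m n => wick C E m n * a := by
  funext m n
  rw [wick_apply, wick_apply, ← lsum_mul_right (h.wick _ _ _)]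
  simp only [MvPowerSeries.coeff_mul_C, Finset.sum_mul, mul_assoc]

theorem wick_middle (a : Module.End ℂ V) (C E : EndSeries V) :
    wick (C * MvPowerSeries.C a) E = wick C (MvPowerSeries.C a * E) := by
  funext m n
  simp only [wick_apply, posF_mul_C, MvPowerSeries.coeff_C_mul, mul_assoc]

/-- The operator `a` is moved from the left end through the middle, where `wick_middle` lets it
change sides, to the right end. Each half of the way leaves one commutator, and the infinite sum
need not be rearranged. -/
theorem map_adL_wick (a : Module.End ℂ V) (C : EndSeries V) {E : EndSeries V} (h : SerFin E) :
    Fld.map (adL a) (wick C E) =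
      wick (adL (MvPowerSeries.C a) C) E + wick C (adL (MvPowerSeries.C a) E) := by
  have h1 : wick (MvPowerSeries.C a * C) E =
      wick (adL (MvPowerSeries.C a) C) E + wick (C * MvPowerSeries.C a) E := by
    rw [← wick_add_left _ _ h, adL_apply, sub_add_cancel]
  have hE : SerFin (adL (MvPowerSeries.C a) E) := (h.mul_left a).sub (h.mul_right a)
  have h2 : wick C (MvPowerSeries.C a * E) =
      wick C (adL (MvPowerSeries.C a) E) + wick C (E * MvPowerSeries.C a) := by
    rw [← wick_add_right _ hE (h.mul_right a), adL_apply, sub_add_cancel]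
  rw [wick_middle, h2, wick_C_mul_left _ _ h, wick_mul_C_right _ _ h] at h1
  funext m n
  have h3 : a * wick C E m n = wick (adL (MvPowerSeries.C a) C) E m n +
      (wick C (adL (MvPowerSeries.C a) E) m n + wick C E m n * a) := congrFun (congrFun h1 m) n
  rw [Fld.map_apply, adL_apply, h3, ← add_assoc]
  exact add_sub_cancel_right _ _

theorem wick_X_zero_left (C : EndSeries V) (E : EndSeries V) :
    wick (MvPowerSeries.X 0 * C) E = hS ℤ • wick C E := by
  funext m n
  cases m with
  | zero =>
    rw [Fld.X_smul_zero, wick_apply]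
    simp only [Finset.Nat.antidiagonal_zero, Finset.sum_singleton, posF_X_zero_mul_zero, zero_mul]
    exact lsum_zero
  | succ m =>
    rw [Fld.X_smul_succ, wick_apply, wick_apply]
    simp only [Finset.Nat.sum_antidiagonal_succ, posF_X_zero_mul_succ, posF_X_zero_mul_zero,
      zero_mul, zero_add]

theorem wick_X_zero_right (C : EndSeries V) (E : EndSeries V) :
    wick C (MvPowerSeries.X 0 * E) = hS ℤ • wick C E := by
  funext m n
  cases m with
  | zero =>
    rw [Fld.X_smul_zero, wick_apply]
    simp only [Finset.Nat.antidiagonal_zero, Finset.sum_singleton, coeff_X_zero_mul_zero, mul_zero]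
    exact lsum_zero
  | succ m =>
    rw [Fld.X_smul_succ, wick_apply, wick_apply]
    simp only [Finset.Nat.sum_antidiagonal_succ', coeff_X_zero_mul_succ, coeff_X_zero_mul_zero,
      mul_zero, zero_add]

theorem wick_X_one_left (C : EndSeries V) (E : EndSeries V) :
    wick (MvPowerSeries.X 1 * C) E = (mon (1 : ℤ) : Ser ℤ) • wick C E := by
  funext m n
  rw [mon_smul, wick_apply, wick_apply]
  simp only [posF_X_one_mul, sub_add_eq_add_sub]

theorem wick_X_one_right (C : EndSeries V) {E : EndSeries V} (h : SerFin E) :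
    wick C (MvPowerSeries.X 1 * E) = (mon (-1 : ℤ) : Ser ℤ) • wick C E := by
  funext m n
  rw [mon_smul, wick_apply, wick_apply, lsum_succ]
  · congr 1
    funext l
    refine Finset.sum_congr rfl fun p _ => ?_
    rw [coeff_X_one_mul_succ]
    congr 2
    push_cast
    ring
  · have := h.wick C m (n - -1)
    convert this using 4 with l p hp
    · congr 1
      push_cast
      ring
    · rw [coeff_X_one_mul_succ]
  · simp [coeff_X_one_mul_zero]

theorem C_smul_one_mul (c : ℂ) (E : EndSeries V) :
    scal (Module.End ℂ V) (MvPowerSeries.C c) * E = MvPowerSeries.C (algebraMap ℂ _ c) * E := by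
  simp [scal]

theorem wick_C_left (c : ℂ) (C : EndSeries V) {E : EndSeries V} (h : SerFin E) :
    wick (scal _ (MvPowerSeries.C c) * C) E = (cS c : Ser ℤ) • wick C E := by
  rw [C_smul_one_mul, wick_C_mul_left _ _ h]
  funext m n
  rw [cS_smul, Algebra.smul_def]

theorem wick_C_right (c : ℂ) (C : EndSeries V) {E : EndSeries V} (h : SerFin E) :
    wick C (scal _ (MvPowerSeries.C c) * E) = (cS c : Ser ℤ) • wick C E := by
  rw [C_smul_one_mul, ← wick_middle, ← wick_C_left _ _ h, C_smul_one_mul]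
  congr 1
  ext d
  rw [MvPowerSeries.coeff_mul_C, MvPowerSeries.coeff_C_mul, Algebra.commutes]

theorem scal_X (i : Fin 2) : scal (Module.End ℂ V) (MvPowerSeries.X i) = MvPowerSeries.X i := by
  simp [scal]

theorem wick_posPow_one (b : ℂ) (C : EndSeries V) {E : EndSeries V} (h : SerFin E) :
    wick (scal _ (posPow b 1) * C) E = (linU (1 : ℤ) b : Ser ℤ) • wick C E := by
  rw [posPow, pow_one, map_add, map_mul, add_mul, mul_assoc, wick_add_left _ _ h, scal_X, scal_X,
    wick_X_one_left, wick_C_left _ _ h, wick_X_zero_left, linU_val, add_smul, mul_smul]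

theorem wick_posPow (b : ℂ) (k : ℕ) (C : EndSeries V) {E : EndSeries V} (h : SerFin E) :
    wick (scal _ (posPow b k) * C) E = ((linU (1 : ℤ) b ^ (k : ℤ) : (Ser ℤ)ˣ) : Ser ℤ) • wick C E := by
  induction k with
  | zero => simp [posPow]
  | succ k ih =>
    rw [posPow_eq_pow, pow_succ', map_mul, mul_assoc, ← posPow_eq_pow, wick_posPow_one _ _ h, ih]
    push_cast
    rw [zpow_add_one, mul_comm, Units.val_mul, mul_smul]

theorem linU_eq_mon_mul (a : ℂ) :
    (linU (1 : ℤ) a : Ser ℤ) = mon 1 * (1 + cS a * (hS ℤ * mon (-1))) := by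
  rw [linU_val, mul_add, mul_one]
  have : (mon (1 : ℤ) : Ser ℤ) * mon (-1) = 1 := by rw [← mon_add, add_neg_cancel, mon_zero]
  linear_combination (-(cS a * hS ℤ)) * this

theorem wick_onePlus (a : ℂ) (C : EndSeries V) {E : EndSeries V} (h : SerFin E) :
    (mon (1 : ℤ) : Ser ℤ) • wick C (scal _ (onePlus a) * E) =
      (linU (1 : ℤ) a : Ser ℤ) • wick C E := by
  rw [onePlus, map_add, map_mul, map_mul, map_one, add_mul, mul_assoc, mul_assoc, one_mul, scal_X,
    scal_X]
  have h1 : SerFin (scal _ (MvPowerSeries.C a) * (MvPowerSeries.X 0 * (MvPowerSeries.X 1 * E))) := by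
    rw [C_smul_one_mul]
    exact (h.X_one_mul.X_zero_mul).mul_left _
  rw [wick_add_right _ h h1, wick_C_right _ _ h.X_one_mul.X_zero_mul, wick_X_zero_right,
    wick_X_one_right _ h, linU_eq_mon_mul, mul_smul, add_smul, mul_smul, mul_smul, one_smul]

/-- The order in the second variable is bounded by the order in the first, up to a constant. -/
def Tame (s : Scalar) : Prop := ∃ k, ∀ m l, m + k < l → MvPowerSeries.coeff (expo m l) s = 0

theorem Tame.mul {s t : Scalar} (hs : Tame s) (ht : Tame t) : Tame (s * t) := by
  obtain ⟨k, hk⟩ := hs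
  obtain ⟨k', hk'⟩ := ht
  refine ⟨k + k', fun m l hl => ?_⟩
  rw [coeff_expo_mul]
  refine Finset.sum_eq_zero fun p hp => Finset.sum_eq_zero fun q hq => ?_
  have hp : p.1 + p.2 = m := Finset.HasAntidiagonal.mem_antidiagonal.1 hp
  have hq : q.1 + q.2 = l := Finset.HasAntidiagonal.mem_antidiagonal.1 hq
  rcases lt_or_ge (p.1 + k) q.1 with h | h
  · rw [hk _ _ h, zero_mul]
  · rw [hk' _ _ (by omega), mul_zero]

theorem tame_X_one : Tame (MvPowerSeries.X 1) := by
  classical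
  refine ⟨1, fun m l hl => ?_⟩
  rw [MvPowerSeries.coeff_X, if_neg]
  intro h
  have := DFunLike.congr_fun h 1
  rw [expo_apply_one] at this
  simp at this
  omega

theorem tame_onePlus_inv (a : ℂ) : Tame (onePlus a)⁻¹ := by
  refine ⟨0, fun m => ?_⟩
  have h := onePlus_mul_inv a
  generalize (onePlus a)⁻¹ = g at h
  rw [onePlus, add_mul, one_mul, mul_assoc, mul_assoc] at h
  induction m with
  | zero =>
    intro l hl
    have h1 := congrArg (MvPowerSeries.coeff (expo 0 l)) h
    rw [map_add, MvPowerSeries.coeff_C_mul, coeff_X_zero_mul_zero, mul_zero, add_zero] at h1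
    classical
    rw [h1, MvPowerSeries.coeff_one, if_neg]
    intro h2
    have := DFunLike.congr_fun h2 1
    rw [expo_apply_one] at this
    simp at this
    omega
  | succ m ih =>
    intro l hl
    obtain ⟨l, rfl⟩ : ∃ k, l = k + 1 := ⟨l - 1, by omega⟩
    have h1 := congrArg (MvPowerSeries.coeff (expo (m + 1) (l + 1))) h
    rw [map_add, MvPowerSeries.coeff_C_mul, coeff_X_zero_mul_succ, coeff_X_one_mul_succ,
      ih l (by omega), mul_zero, add_zero] at h1
    classical
    rw [h1, MvPowerSeries.coeff_one, if_neg]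
    intro h2
    have := DFunLike.congr_fun h2 1
    rw [expo_apply_one] at this
    simp at this

theorem tame_negPow (a : ℂ) (k : ℕ) : Tame (negPow a k) := by
  induction k with
  | zero =>
    refine ⟨0, fun m l hl => ?_⟩
    classical
    rw [negPow, pow_zero, MvPowerSeries.coeff_one, if_neg]
    intro h2
    have := DFunLike.congr_fun h2 1
    rw [expo_apply_one] at this
    simp at this
    omega
  | succ k ih =>
    rw [negPow, pow_succ, ← negPow]
    exact ih.mul (tame_X_one.mul (tame_onePlus_inv a))

/-- An arbitrary scalar series would destroy local finiteness. A tame one contributes at order `m`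
in `ħ` at most `m + k` powers of the second variable, and `E` contributes on `f` fewer than the
largest of the bounds `N i`, `i ≤ m`, here estimated by their sum. -/
theorem Tame.apply_eq_zero {s : Scalar} (hs : Tame s) {E : EndSeries V} {f : V}
    (h : ∀ m, ∃ N, ∀ l ≥ N, MvPowerSeries.coeff (expo m l) E f = 0) (m : ℕ) :
    ∃ N, ∀ l ≥ N, MvPowerSeries.coeff (expo m l) (scal (Module.End ℂ V) s * E) f = 0 := by
  obtain ⟨k, hk⟩ := hs
  choose N hN using h
  refine ⟨m + k + ∑ i ∈ Finset.range (m + 1), N i + 1, fun l hl => ?_⟩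
  rw [coeff_expo_mul, LinearMap.sum_apply]
  refine Finset.sum_eq_zero fun p hp => ?_
  rw [LinearMap.sum_apply]
  refine Finset.sum_eq_zero fun q hq => ?_
  have hp : p.1 + p.2 = m := Finset.HasAntidiagonal.mem_antidiagonal.1 hp
  have hq : q.1 + q.2 = l := Finset.HasAntidiagonal.mem_antidiagonal.1 hq
  rw [MvPowerSeries.coeff_map]
  rcases lt_or_ge (p.1 + k) q.1 with h | h
  · rw [hk _ _ h, map_zero, zero_mul]; rfl
  · have h1 : N p.2 ≤ ∑ i ∈ Finset.range (m + 1), N i :=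
      Finset.single_le_sum (f := N) (fun _ _ => Nat.zero_le _)
        (Finset.mem_range.2 (show p.2 < m + 1 by omega))
    rw [Module.End.mul_apply, hN p.2 q.2 (by omega), map_zero]

theorem SerFin.scal_mul {E : EndSeries V} (h : SerFin E) {s : Scalar} (hs : Tame s) :
    SerFin (scal _ s * E) := fun m f => hs.apply_eq_zero (fun m => h m f) m

/-- Inductively `(u + a ħ)` times the left side for `k + 1` is the left side for `k`, by
`onePlus_mul_negPow_succ`; the unit `u + a ħ` is then inverted. -/
theorem wick_negPow (a : ℂ) (k : ℕ) (C : EndSeries V) {E : EndSeries V} (h : SerFin E) :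
    wick C (scal _ (negPow a k) * E) =
      ((linU (1 : ℤ) a ^ (-k : ℤ) : (Ser ℤ)ˣ) : Ser ℤ) • wick C E := by
  induction k with
  | zero => simp [negPow]
  | succ k ih =>
    have h1 := wick_onePlus a C (h.scal_mul (tame_negPow a (k + 1)))
    rw [← mul_assoc, ← map_mul, onePlus_mul_negPow_succ, map_mul, mul_assoc, scal_X,
      wick_X_one_right _ (h.scal_mul (tame_negPow a k)), ← mul_smul, ← mon_add, add_neg_cancel,
      mon_zero, one_smul, ih] at h1
    have h2 : ((linU (1 : ℤ) a ^ (-1 : ℤ) : (Ser ℤ)ˣ) : Ser ℤ) * (linU (1 : ℤ) a : Ser ℤ) = 1 := by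
      rw [← Units.val_mul]
      simp
    have h3 := congrArg (fun x => ((linU (1 : ℤ) a ^ (-1 : ℤ) : (Ser ℤ)ˣ) : Ser ℤ) • x) h1
    simp only [← mul_smul, h2, one_smul] at h3
    rw [← h3, ← Units.val_mul, ← zpow_add]
    push_cast
    congr 3
    ring

end Wick

/-! ### Bosonic exponentials -/

theorem adL_bosonP_pos_neg (j j' : Fin 2) {k l : ℕ} (hk : 1 ≤ k) (hl : 1 ≤ l) :
    adL (bosonP j k) (bosonP j' (-(l : ℤ))) =
      if j' = j ∧ l = k then (k : ℂ) • (1 : OpP) else 0 := by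
  lift k to ℕ+ using hk
  lift l to ℕ+ using hl
  refine LinearMap.ext fun f => ?_
  have h1 := bosonP_pos j k
  have h2 := bosonP_neg j' l
  simp only [adL_apply, LinearMap.sub_apply, Module.End.mul_apply]
  rw [h1, h2, h1, h2, Derivation.leibniz, MvPolynomial.pderiv_X]
  by_cases h : j' = j ∧ l = k
  · obtain ⟨rfl, rfl⟩ := h
    simp [MvPolynomial.smul_eq_C_mul]
    ring
  · rw [Pi.single_eq_of_ne (by simpa [Prod.ext_iff] using h),
      if_neg (by simpa using h)]
    simp [MvPolynomial.smul_eq_C_mul]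
    ring

theorem adL_bosonP_pos_pos (j j' : Fin 2) {k l : ℕ} (hk : 1 ≤ k) (hl : 1 ≤ l) :
    adL (bosonP j k) (bosonP j' l) = 0 := by
  lift k to ℕ+ using hk
  lift l to ℕ+ using hl
  refine LinearMap.ext fun f => ?_
  have hd : ⁅(MvPolynomial.pderiv (j, k) : Derivation ℂ Pol Pol),
      (MvPolynomial.pderiv (j', l) : Derivation ℂ Pol Pol)⁆ = 0 := by
    apply MvPolynomial.derivation_ext
    intro i
    rw [Derivation.commutator_apply, MvPolynomial.pderiv_X, MvPolynomial.pderiv_X]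
    simp only [Pi.single_apply]
    split_ifs <;> simp
  have h := congrArg (fun d => d f) hd
  simp only [Derivation.commutator_apply, Derivation.zero_apply] at h
  have h1 := bosonP_pos j k
  have h2 := bosonP_pos j' l
  simp only [adL_apply, LinearMap.sub_apply, Module.End.mul_apply, LinearMap.zero_apply]
  rw [h1, h2, h1, h2, Derivation.map_smul, Derivation.map_smul, smul_comm, ← smul_sub, ← smul_sub, h, smul_zero,
    smul_zero]

theorem adL_bosonP_neg_neg (j j' : Fin 2) {k l : ℕ} (hk : 1 ≤ k) (hl : 1 ≤ l) :
    adL (bosonP j (-(k : ℤ))) (bosonP j' (-(l : ℤ))) = 0 := by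
  lift k to ℕ+ using hk
  lift l to ℕ+ using hl
  refine LinearMap.ext fun f => ?_
  simp only [adL_apply, LinearMap.sub_apply, Module.End.mul_apply, LinearMap.zero_apply]
  rw [bosonP_neg, bosonP_neg, bosonP_neg, bosonP_neg]
  ring


/-- Only the mode `k` fails to commute with `a`, and the `1 / k` in the sum cancels the `k` of the
Heisenberg relation. By `hg` the truncation of the sum at `|d|` loses nothing. -/
theorem adL_bosonSumG {A : Type*} [Ring A] [Algebra ℂ A] {a : A} {x : ℕ → A} {g : ℕ → Scalar}
    (hg : ∀ k d, d.degree < k → MvPowerSeries.coeff d (g k) = 0) {k : ℕ} (hk : 1 ≤ k) {c : ℂ}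
    (h : ∀ l, 1 ≤ l → adL a (x l) = if l = k then (c * k) • (1 : A) else 0) :
    adL (MvPowerSeries.C a) (bosonSumG x g) = scal A (MvPowerSeries.C c * g k) := by
  ext d
  rw [coeff_adL_C, coeff_bosonSumG, map_sum, MvPowerSeries.coeff_map, MvPowerSeries.coeff_C_mul]
  have hk0 : (k : ℂ) ≠ 0 := by exact_mod_cast (by omega : k ≠ 0)
  have h1 : ∀ l ∈ Finset.Icc 1 d.degree,
      adL a ((MvPowerSeries.coeff d (g l) / (l : ℂ)) • x l) =
        if l = k then algebraMap ℂ A (c * MvPowerSeries.coeff d (g k)) else 0 := by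
    intro l hl
    rw [map_smul, h l (Finset.mem_Icc.1 hl).1]
    split_ifs with hlk
    · subst hlk
      rw [smul_smul, Algebra.algebraMap_eq_smul_one]
      congr 1
      field_simp
    · rw [smul_zero]
  rw [Finset.sum_congr rfl h1, Finset.sum_ite_eq']
  split_ifs with hm
  · rfl
  · rw [hg k d (by simp at hm; omega), mul_zero, map_zero]

theorem adL_bosonSumG_zero {A : Type*} [Ring A] [Algebra ℂ A] {a : A} {x : ℕ → A} {g : ℕ → Scalar}
    (h : ∀ l, 1 ≤ l → adL a (x l) = 0) :
    adL (MvPowerSeries.C a) (bosonSumG x g) = 0 := by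
  ext d
  rw [coeff_adL_C, coeff_bosonSumG, map_sum]
  refine Finset.sum_eq_zero fun l hl => ?_
  rw [map_smul, h l (Finset.mem_Icc.1 hl).1, smul_zero]

/-- The sum over the entries `(j, b, n)` of a list, with `j` fixed, of `n g(b)`. -/
def jsum {M : Type*} [AddCommGroup M] (l : List (Fin 2 × ℂ × ℤ)) (j : Fin 2) (g : ℂ → M) : M :=
  (l.map fun x => if x.1 = j then x.2.2 • g x.2.1 else 0).sum

theorem jsum_nil {M : Type*} [AddCommGroup M] (j : Fin 2) (g : ℂ → M) : jsum [] j g = 0 := rfl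

theorem jsum_cons {M : Type*} [AddCommGroup M] (x : Fin 2 × ℂ × ℤ) (l : List (Fin 2 × ℂ × ℤ))
    (j : Fin 2) (g : ℂ → M) :
    jsum (x :: l) j g = (if x.1 = j then x.2.2 • g x.2.1 else 0) + jsum l j g := by
  simp [jsum]

theorem map_jsum {M N : Type*} [AddCommGroup M] [AddCommGroup N] (L : M →+ N)
    (l : List (Fin 2 × ℂ × ℤ)) (j : Fin 2) (g : ℂ → M) :
    L (jsum l j g) = jsum l j fun b => L (g b) := by
  induction l with
  | nil => simp [jsum_nil]
  | cons x l ih =>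
    rw [jsum_cons, jsum_cons, map_add, ih]
    split_ifs <;> simp

theorem jsum_mem {M : Type*} [AddCommGroup M] (S : AddSubgroup M)
    (l : List (Fin 2 × ℂ × ℤ)) (j : Fin 2) {g : ℂ → M} (hg : ∀ b, g b ∈ S) : jsum l j g ∈ S := by
  induction l with
  | nil => exact S.zero_mem
  | cons x l ih =>
    rw [jsum_cons]
    refine S.add_mem ?_ ih
    split_ifs
    · exact S.zsmul_mem (hg _) _
    · exact S.zero_mem

/-- The part of the exponent with the creation operators. -/
def creExp (l : List (Fin 2 × ℂ × ℤ)) : MvPowerSeries (Fin 2) OpP :=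
  (l.map fun x => x.2.2 • bosonSumG (fun k => bosonP x.1 (-(k : ℤ))) (posPow x.2.1)).sum

/-- The part of the exponent with the annihilation operators. -/
def annExp (l : List (Fin 2 × ℂ × ℤ)) : MvPowerSeries (Fin 2) OpP :=
  (l.map fun x => x.2.2 • bosonSumG (fun k => bosonP x.1 k) (negPow x.2.1)).sum

theorem constantCoeff_creExp (l : List (Fin 2 × ℂ × ℤ)) :
    MvPowerSeries.constantCoeff (creExp l) = 0 := by
  induction l with
  | nil => simp [creExp]
  | cons x l ih =>
    rw [creExp] at ih ⊢
    rw [List.map_cons, List.sum_cons, map_add, ih, map_zsmul, constantCoeff_bosonSumG, smul_zero,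
      add_zero]

theorem constantCoeff_annExp (l : List (Fin 2 × ℂ × ℤ)) :
    MvPowerSeries.constantCoeff (annExp l) = 0 := by
  induction l with
  | nil => simp [annExp]
  | cons x l ih =>
    rw [annExp] at ih ⊢
    rw [List.map_cons, List.sum_cons, map_add, ih, map_zsmul, constantCoeff_bosonSumG, smul_zero,
      add_zero]

theorem adL_pos_creExp (l : List (Fin 2 × ℂ × ℤ)) (j : Fin 2) {k : ℕ} (hk : 1 ≤ k) :
    adL (MvPowerSeries.C (bosonP j k)) (creExp l) = scal OpP (jsum l j fun b => posPow b k) := by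
  induction l with
  | nil => simp [creExp, jsum_nil]
  | cons x l ih =>
    rw [creExp] at ih ⊢
    rw [List.map_cons, List.sum_cons, map_add, ih, map_zsmul, jsum_cons, map_add]
    congr 1
    have h := adL_bosonSumG (a := bosonP j k) (x := fun k => bosonP x.1 (-(k : ℤ)))
      (g := posPow x.2.1) (fun k d => coeff_posPow_eq_zero _) hk
      (c := if x.1 = j then 1 else 0) (fun l hl => by
        rw [adL_bosonP_pos_neg _ _ hk hl]
        by_cases h : x.1 = j <;> simp [h])
    rw [h]
    split_ifs <;> simp

theorem adL_neg_annExp (l : List (Fin 2 × ℂ × ℤ)) (j : Fin 2) {k : ℕ} (hk : 1 ≤ k) :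
    adL (MvPowerSeries.C (bosonP j (-(k : ℤ)))) (annExp l) =
      scal OpP (-jsum l j fun a => negPow a k) := by
  induction l with
  | nil => simp [annExp, jsum_nil]
  | cons x l ih =>
    rw [annExp] at ih ⊢
    rw [List.map_cons, List.sum_cons, map_add, ih, map_zsmul, jsum_cons, neg_add, map_add]
    congr 1
    have h := adL_bosonSumG (a := bosonP j (-(k : ℤ))) (x := fun k => bosonP x.1 (k : ℤ))
      (g := negPow x.2.1) (fun k d => coeff_negPow_eq_zero _) hk
      (c := if x.1 = j then -1 else 0) (fun l hl => by
        have h1 := adL_bosonP_pos_neg x.1 j hl hk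
        rw [adL_apply] at h1
        rw [adL_apply, ← neg_sub, h1]
        by_cases h : x.1 = j
        · by_cases h' : l = k
          · subst h'; simp [h]
          · simp [h, h', Ne.symm h']
        · simp [h, Ne.symm h])
    rw [h]
    split_ifs
    · rw [map_neg, map_one, neg_one_mul, map_neg, map_neg, map_zsmul]
      exact smul_neg _ _
    · simp

theorem adL_neg_creExp (l : List (Fin 2 × ℂ × ℤ)) (j : Fin 2) {k : ℕ} (hk : 1 ≤ k) :
    adL (MvPowerSeries.C (bosonP j (-(k : ℤ)))) (creExp l) = scal OpP 0 := by
  rw [map_zero]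
  induction l with
  | nil => simp [creExp]
  | cons x l ih =>
    rw [creExp] at ih ⊢
    rw [List.map_cons, List.sum_cons, map_add, ih, map_zsmul,
      adL_bosonSumG_zero fun l hl => adL_bosonP_neg_neg _ _ hk hl, add_zero]
    exact smul_zero _

theorem adL_pos_annExp (l : List (Fin 2 × ℂ × ℤ)) (j : Fin 2) {k : ℕ} (hk : 1 ≤ k) :
    adL (MvPowerSeries.C (bosonP j k)) (annExp l) = scal OpP 0 := by
  rw [map_zero]
  induction l with
  | nil => simp [annExp]
  | cons x l ih =>
    rw [annExp] at ih ⊢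
    rw [List.map_cons, List.sum_cons, map_add, ih, map_zsmul,
      adL_bosonSumG_zero fun l hl => adL_bosonP_pos_pos _ _ hk hl, add_zero]
    exact smul_zero _

/-- The vacuum is fixed by the annihilation exponentials. -/
theorem coeff_expS_apply_of_kill {X : MvPowerSeries (Fin 2) OpP} {v : Pol}
    (hX : ∀ d, MvPowerSeries.coeff d X v = 0) (d : Fin 2 →₀ ℕ) :
    MvPowerSeries.coeff d (expS X) v = if d = 0 then v else 0 := by
  classical
  change (∑ n ∈ Finset.range (d.degree + 1), _ : OpP) v = _
  rw [LinearMap.sum_apply, Finset.sum_range_succ', Finset.sum_eq_zero]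
  · simp [MvPowerSeries.coeff_one]
    split_ifs <;> rfl
  · intro n _
    rw [LinearMap.smul_apply, pow_succ, MvPowerSeries.coeff_mul, LinearMap.sum_apply,
      Finset.sum_eq_zero, smul_zero]
    intro p _
    rw [Module.End.mul_apply, hX, map_zero]

/-- The dual vacuum is fixed by the creation exponentials. -/
theorem apply_coeff_expS_of_kill {X : MvPowerSeries (Fin 2) OpP} {L : Pol →ₗ[ℂ] ℂ}
    (hX : ∀ d f, L (MvPowerSeries.coeff d X f) = 0) (d : Fin 2 →₀ ℕ) (f : Pol) :
    L (MvPowerSeries.coeff d (expS X) f) = if d = 0 then L f else 0 := by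
  classical
  change L ((∑ n ∈ Finset.range (d.degree + 1), _ : OpP) f) = _
  rw [LinearMap.sum_apply, Finset.sum_range_succ', map_add, map_sum, Finset.sum_eq_zero]
  · simp [MvPowerSeries.coeff_one]
    split_ifs <;> simp
  · intro n _
    rw [LinearMap.smul_apply, pow_succ', MvPowerSeries.coeff_mul, LinearMap.sum_apply, map_smul,
      map_sum, Finset.sum_eq_zero, smul_zero]
    intro p _
    rw [Module.End.mul_apply, hX]

theorem coeff_annExp_one (l : List (Fin 2 × ℂ × ℤ)) (d : Fin 2 →₀ ℕ) :
    MvPowerSeries.coeff d (annExp l) (1 : Pol) = 0 := by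
  induction l with
  | nil => simp [annExp]
  | cons x l ih =>
    rw [annExp] at ih ⊢
    rw [List.map_cons, List.sum_cons, map_add, LinearMap.add_apply, ih, map_zsmul,
      coeff_bosonSumG, LinearMap.smul_apply, LinearMap.sum_apply, Finset.sum_eq_zero, smul_zero,
      add_zero]
    intro k hk
    have hk := (Finset.mem_Icc.1 hk).1
    lift k to ℕ+ using hk
    have h := bosonP_pos x.1 k 1
    rw [LinearMap.smul_apply, h]
    simp

/-- The constant term of a polynomial. -/
abbrev coeff0 : Pol →ₗ[ℂ] ℂ := MvPolynomial.lcoeff ℂ 0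

theorem coeff0_bosonP_neg (j : Fin 2) {k : ℕ} (hk : 1 ≤ k) (f : Pol) :
    coeff0 (bosonP j (-(k : ℤ)) f) = 0 := by
  lift k to ℕ+ using hk
  have h := bosonP_neg j k f
  rw [h]
  simp [← MvPolynomial.constantCoeff_eq]

theorem coeff0_coeff_creExp (l : List (Fin 2 × ℂ × ℤ)) (d : Fin 2 →₀ ℕ) (f : Pol) :
    coeff0 (MvPowerSeries.coeff d (creExp l) f) = 0 := by
  induction l with
  | nil => simp [creExp]
  | cons x l ih =>
    rw [creExp] at ih ⊢
    rw [List.map_cons, List.sum_cons, map_add, LinearMap.add_apply, map_add, ih, map_zsmul,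
      coeff_bosonSumG, LinearMap.smul_apply, LinearMap.sum_apply, map_zsmul, map_sum,
      Finset.sum_eq_zero, smul_zero, add_zero]
    intro k hk
    rw [LinearMap.smul_apply, map_smul, coeff0_bosonP_neg _ (Finset.mem_Icc.1 hk).1, smul_zero]

theorem adL_neg_expS_annExp (l : List (Fin 2 × ℂ × ℤ)) (j : Fin 2) {k : ℕ} (hk : 1 ≤ k) :
    adL (MvPowerSeries.C (bosonP j (-(k : ℤ)))) (expS (annExp l)) =
      scal OpP (-jsum l j fun a => negPow a k) * expS (annExp l) :=
  adL_expS _ (constantCoeff_annExp l) (adL_neg_annExp l j hk)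

/-- Tame series, as a subgroup. -/
def tameSubgroup : AddSubgroup Scalar where
  carrier := {s | Tame s}
  zero_mem' := ⟨0, fun m l _ => by simp⟩
  add_mem' := by
    rintro s t ⟨k, hk⟩ ⟨k', hk'⟩
    exact ⟨max k k', fun m l hl => by rw [map_add, hk _ _ (by omega), hk' _ _ (by omega), add_zero]⟩
  neg_mem' := by
    rintro s ⟨k, hk⟩
    exact ⟨k, fun m l hl => by rw [map_neg, hk _ _ hl, neg_zero]⟩

/-- On the vacuum only the constant term of the exponential survives. Passing a creation operator to
its left adds a multiple by a tame scalar series, so local finiteness spreads over all polynomials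
by induction. -/
theorem serFin_expS_annExp (l : List (Fin 2 × ℂ × ℤ)) : SerFin (expS (annExp l)) := by
  intro m f
  revert m
  induction f using MvPolynomial.induction_on with
  | C c =>
    intro m
    refine ⟨1, fun n hn => ?_⟩
    have h := coeff_expS_apply_of_kill (coeff_annExp_one l) (expo m n)
    rw [if_neg (fun h => by
      have := DFunLike.congr_fun h 1
      rw [expo_apply_one] at this
      simp at this
      omega)] at h
    rw [MvPolynomial.C_eq_smul_one, map_smul, h, smul_zero]
  | add f g hf hg =>
    intro m
    obtain ⟨N, hN⟩ := hf m
    obtain ⟨N', hN'⟩ := hg m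
    exact ⟨max N N', fun l hl => by
      rw [map_add, hN l (le_trans (le_max_left _ _) hl),
        hN' l (le_trans (le_max_right _ _) hl)]
      exact add_zero (0 : Pol)⟩
  | mul_X f i hf =>
    obtain ⟨j, k⟩ := i
    intro m
    have h := adL_neg_expS_annExp l j k.pos
    have ht : Tame (-jsum l j fun a => negPow a k) :=
      tameSubgroup.neg_mem (jsum_mem tameSubgroup l j fun a => tame_negPow a k)
    obtain ⟨N, hN⟩ := hf m
    obtain ⟨N', hN'⟩ := ht.apply_eq_zero hf m
    refine ⟨max N N', fun n hn => ?_⟩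
    have h1 := congrArg (fun T : EndSeries Pol => MvPowerSeries.coeff (expo m n) T f) h
    rw [hN' n (le_trans (le_max_right _ _) hn), coeff_adL_C, adL_apply, LinearMap.sub_apply,
      Module.End.mul_apply, Module.End.mul_apply, hN n (le_trans (le_max_left _ _) hn), map_zero,
      zero_sub, neg_eq_zero] at h1
    have h2 := bosonP_neg j k f
    rw [h2] at h1
    rw [mul_comm f, h1]

/-- The vertex operator with the given exponents. -/
def vertexP (cre ann : List (Fin 2 × ℂ × ℤ)) : Fld ℤ OpP :=
  wick (expS (creExp cre)) (expS (annExp ann))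

/-- The commutators of a vertex operator with the bosons. -/
def vertexWt (cre ann : List (Fin 2 × ℂ × ℤ)) (j : Fin 2) (k : ℤ) : Ser ℤ :=
  if 0 < k then jsum cre j fun b => ((linU (1 : ℤ) b ^ k : (Ser ℤ)ˣ) : Ser ℤ)
  else -jsum ann j fun a => ((linU (1 : ℤ) a ^ k : (Ser ℤ)ˣ) : Ser ℤ)

/-- The pairs of scalars that act alike through the left factor. -/
def leftSub {V : Type*} [AddCommGroup V] [Module ℂ V] (C : EndSeries V) {E : EndSeries V}
    (h : SerFin E) : AddSubgroup (Scalar × Ser ℤ) where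
  carrier := {p | wick (scal _ p.1 * C) E = p.2 • wick C E}
  zero_mem' := by
    have := wick_C_left 0 C h
    rw [map_zero, map_zero] at this
    change wick (scal _ 0 * C) E = _
    rw [map_zero, this, cS_zero]
    rfl
  add_mem' := by
    intro p q hp hq
    change wick (scal _ (p.1 + q.1) * C) E = (p.2 + q.2) • _
    rw [map_add, add_mul, wick_add_left _ _ h, hp, hq, add_smul]
  neg_mem' := by
    intro p hp
    have h1 := wick_C_left (-1) (scal _ p.1 * C) h
    rw [hp] at h1
    change wick (scal _ (-p.1) * C) E = (-p.2) • _
    rw [← mul_assoc, ← map_mul, map_neg, map_one, neg_one_mul] at h1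
    rw [h1, cS_neg, cS_one, neg_smul, neg_smul, one_smul]

/-- The pairs of scalars that act alike through the right factor. -/
def rightSub {V : Type*} [AddCommGroup V] [Module ℂ V] (C : EndSeries V) {E : EndSeries V}
    (h : SerFin E) : AddSubgroup (Scalar × Ser ℤ) where
  carrier := {p | Tame p.1 ∧ wick C (scal _ p.1 * E) = p.2 • wick C E}
  zero_mem' := by
    have := wick_C_right 0 C h
    rw [map_zero, map_zero] at this
    refine ⟨tameSubgroup.zero_mem, ?_⟩
    change wick C (scal _ 0 * E) = _
    rw [map_zero, this, cS_zero]
    rfl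
  add_mem' := by
    intro p q hp hq
    refine ⟨tameSubgroup.add_mem hp.1 hq.1, ?_⟩
    change wick C (scal _ (p.1 + q.1) * E) = (p.2 + q.2) • _
    rw [map_add, add_mul, wick_add_right _ (h.scal_mul hp.1) (h.scal_mul hq.1), hp.2, hq.2,
      add_smul]
  neg_mem' := by
    intro p hp
    have h1 := wick_C_right (-1) C (h.scal_mul hp.1)
    rw [hp.2] at h1
    refine ⟨tameSubgroup.neg_mem hp.1, ?_⟩
    change wick C (scal _ (-p.1) * E) = (-p.2) • _
    rw [← mul_assoc, ← map_mul, map_neg, map_one, neg_one_mul] at h1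
    rw [h1, cS_neg, cS_one, neg_smul, neg_smul, one_smul]

/-- The pairs of scalars with the same action form a subgroup, so the case of a single power `(u + b
ħ) ^ k` suffices. -/
theorem wick_jsum_posPow (l : List (Fin 2 × ℂ × ℤ)) (j : Fin 2) (k : ℕ) (C : EndSeries Pol)
    {E : EndSeries Pol} (h : SerFin E) :
    wick (scal _ (jsum l j fun b => posPow b k) * C) E =
      (jsum l j fun b => ((linU (1 : ℤ) b ^ (k : ℤ) : (Ser ℤ)ˣ) : Ser ℤ)) • wick C E := by
  have h1 := jsum_mem (leftSub C h) l j
    (g := fun b => (posPow b k, ((linU (1 : ℤ) b ^ (k : ℤ) : (Ser ℤ)ˣ) : Ser ℤ)))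
    fun b => wick_posPow b k C h
  have e1 := map_jsum (AddMonoidHom.fst Scalar (Ser ℤ)) l j
    (fun b => (posPow b k, ((linU (1 : ℤ) b ^ (k : ℤ) : (Ser ℤ)ˣ) : Ser ℤ)))
  have e2 := map_jsum (AddMonoidHom.snd Scalar (Ser ℤ)) l j
    (fun b => (posPow b k, ((linU (1 : ℤ) b ^ (k : ℤ) : (Ser ℤ)ˣ) : Ser ℤ)))
  simp only [AddMonoidHom.coe_fst, AddMonoidHom.coe_snd] at e1 e2
  rw [← e1, ← e2]
  exact h1

theorem wick_jsum_negPow (l : List (Fin 2 × ℂ × ℤ)) (j : Fin 2) (k : ℕ) (C : EndSeries Pol)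
    {E : EndSeries Pol} (h : SerFin E) :
    wick C (scal _ (-jsum l j fun b => negPow b k) * E) =
      (-jsum l j fun b => ((linU (1 : ℤ) b ^ (-k : ℤ) : (Ser ℤ)ˣ) : Ser ℤ)) • wick C E := by
  have h1 := jsum_mem (rightSub C h) l j
    (g := fun b => (negPow b k, ((linU (1 : ℤ) b ^ (-k : ℤ) : (Ser ℤ)ˣ) : Ser ℤ)))
    fun b => ⟨tame_negPow b k, wick_negPow b k C h⟩
  have e1 := map_jsum (AddMonoidHom.fst Scalar (Ser ℤ)) l j
    (fun b => (negPow b k, ((linU (1 : ℤ) b ^ (-k : ℤ) : (Ser ℤ)ˣ) : Ser ℤ)))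
  have e2 := map_jsum (AddMonoidHom.snd Scalar (Ser ℤ)) l j
    (fun b => (negPow b k, ((linU (1 : ℤ) b ^ (-k : ℤ) : (Ser ℤ)ˣ) : Ser ℤ)))
  simp only [AddMonoidHom.coe_fst, AddMonoidHom.coe_snd] at e1 e2
  rw [← e1, ← e2]
  exact ((rightSub C h).neg_mem h1).2

theorem wick_zero_left {V : Type*} [AddCommGroup V] [Module ℂ V] (E : EndSeries V) :
    wick 0 E = 0 := by
  funext m n
  rw [wick_apply]
  have : ∀ (k : ℕ) (n : ℤ), posF (0 : EndSeries V) k n = 0 := fun k n => by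
    unfold posF; split_ifs <;> simp
  simp only [this, zero_mul, Finset.sum_const_zero]
  exact lsum_zero

theorem wick_zero_right {V : Type*} [AddCommGroup V] [Module ℂ V] (C : EndSeries V) :
    wick C 0 = 0 := by
  funext m n
  rw [wick_apply]
  simp only [map_zero, mul_zero, Finset.sum_const_zero]
  exact lsum_zero

/-- A positive mode commutes with the annihilation exponential and a negative mode with the creation
exponential; the bracket with the other factor multiplies it by a sum of powers of the `u + b ħ`. -/
theorem primary_vertexP (cre ann : List (Fin 2 × ℂ × ℤ)) :
    Primary (vertexWt cre ann) (vertexP cre ann) := by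
  intro j k hk
  have hE := serFin_expS_annExp ann
  rw [vertexP, map_adL_wick _ _ hE, vertexWt]
  rcases lt_or_gt_of_ne hk with h | h
  · obtain ⟨n, rfl⟩ : ∃ n : ℕ, k = -n := ⟨(-k).toNat, by omega⟩
    have hn : 1 ≤ n := by omega
    rw [if_neg (by omega), adL_expS _ (constantCoeff_creExp cre) (adL_neg_creExp cre j hn),
      adL_neg_expS_annExp ann j hn, map_zero, zero_mul, wick_zero_left, zero_add,
      wick_jsum_negPow _ _ _ _ hE]
  · obtain ⟨n, rfl⟩ : ∃ n : ℕ, k = n := ⟨k.toNat, by omega⟩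
    have hn : 1 ≤ n := by omega
    rw [if_pos h, adL_expS _ (constantCoeff_creExp cre) (adL_pos_creExp cre j hn),
      adL_expS _ (constantCoeff_annExp ann) (adL_pos_annExp ann j hn), map_zero, zero_mul,
      wick_zero_right, add_zero, wick_jsum_posPow _ _ _ _ hE]

/-! ### Two-point functions -/

theorem bosonSumG_add_left {A : Type*} [Ring A] [Algebra ℂ A] (a a' : ℕ → A) (g : ℕ → Scalar) :
    bosonSumG (a + a') g = bosonSumG a g + bosonSumG a' g := by
  ext d
  simp only [map_add, coeff_bosonSumG, Pi.add_apply, smul_add, Finset.sum_add_distrib]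

theorem jsum_bosonSumG {A : Type*} [Ring A] [Algebra ℂ A] (l : List (Fin 2 × ℂ × ℤ)) (j : Fin 2)
    (f : ℂ → ℕ → A) (g : ℕ → Scalar) :
    jsum l j (fun a => bosonSumG (f a) g) = bosonSumG (fun k => jsum l j fun a => f a k) g := by
  have h := map_jsum (AddMonoidHom.mk' (fun a : ℕ → A => bosonSumG a g)
    fun a a' => bosonSumG_add_left a a' g) l j f
  have h1 : (fun k => jsum l j fun a => f a k) = jsum l j f := by
    funext k
    exact (map_jsum (Pi.evalAddMonoidHom _ k) l j f).symm
  rw [h1]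
  exact h.symm

/-- The sum over pairs of entries with the same `j`. -/
def pairSum {M : Type*} [AddCommGroup M] (ann cre : List (Fin 2 × ℂ × ℤ)) (g : ℂ → ℂ → M) : M :=
  (cre.map fun x => x.2.2 • jsum ann x.1 fun a => g a x.2.1).sum

/-- The logarithm of the elementary two-point function. -/
def ellS (a b : ℂ) : MvPowerSeries (Fin 2) Scalar := bosonSumG (fun k => negPow a k) (posPow b)

/-- The ratio `(v + b ħ) / (u + a ħ)`. -/
def ratS (a b : ℂ) : MvPowerSeries (Fin 2) Scalar :=
  MvPowerSeries.C (negPow a 1) * scal Scalar (posPow b 1)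

theorem theta_X (i : Fin 2) : theta (MvPowerSeries.X i : Scalar) = MvPowerSeries.X i := by
  classical
  ext d
  rw [coeff_theta, MvPowerSeries.coeff_X]
  split_ifs with h
  · simp [h]
  · simp

theorem theta_posPow (b : ℂ) (k : ℕ) : theta (posPow b k) = (k : ℂ) • posPow b k := by
  induction k with
  | zero =>
    have h := theta_mul (1 : Scalar) 1
    simp only [mul_one, one_mul, left_eq_add] at h
    simpa [posPow] using h
  | succ k ih =>
    rw [posPow_eq_pow, pow_succ, ← posPow_eq_pow, theta_mul, ih]
    have h1 : theta (posPow b 1) = posPow b 1 := by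
      rw [posPow, pow_one, map_add, theta_X, ← MvPowerSeries.smul_eq_C_mul, map_smul, theta_X]
    rw [h1]
    push_cast
    rw [add_smul, one_smul, smul_mul_assoc]

theorem ratS_pow (a b : ℂ) (k : ℕ) :
    ratS a b ^ k = MvPowerSeries.C (negPow a k) * scal Scalar (posPow b k) := by
  rw [ratS, mul_pow, ← map_pow, ← map_pow, ← posPow_eq_pow, ← negPow_eq_pow]

theorem coeff_ratS_pow (a b : ℂ) (k : ℕ) (d : Fin 2 →₀ ℕ) :
    MvPowerSeries.coeff d (ratS a b ^ k) = MvPowerSeries.coeff d (posPow b k) • negPow a k := by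
  rw [ratS_pow, MvPowerSeries.coeff_C_mul, MvPowerSeries.coeff_map, mul_comm, Algebra.smul_def]

theorem constantCoeff_ratS (a b : ℂ) : MvPowerSeries.constantCoeff (ratS a b) = 0 := by
  rw [ratS, map_mul, scal, MvPowerSeries.constantCoeff_map, constantCoeff_posPow_one, map_zero,
    mul_zero]

theorem coeff_theta_ellS (a b : ℂ) (d : Fin 2 →₀ ℕ) : MvPowerSeries.coeff d (theta (ellS a b)) =
    ∑ k ∈ Finset.Icc 1 d.degree, MvPowerSeries.coeff d (ratS a b ^ k) := by
  rw [coeff_theta, ellS, coeff_bosonSumG, Finset.smul_sum]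
  refine Finset.sum_congr rfl fun k hk => ?_
  have hk0 : (k : ℂ) ≠ 0 := by
    have := (Finset.mem_Icc.1 hk).1
    exact_mod_cast (by omega : k ≠ 0)
  have h := congrArg (MvPowerSeries.coeff d) (theta_posPow b k)
  rw [coeff_theta, map_smul, smul_eq_mul, smul_eq_mul] at h
  rw [smul_smul, coeff_ratS_pow]
  congr 1
  field_simp
  linear_combination h

/-- The degree derivation multiplies `(v + b ħ) ^ k` by `k`, so it turns `ellS` into the geometric
series `r + r² + ...` with `r = ratS a b`. This identifies `ellS` with `-log (1 - r)` without a
logarithm. -/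
theorem theta_ellS (a b : ℂ) : theta (ellS a b) * (1 - ratS a b) = ratS a b := by
  ext1 d
  have h1 : ∀ e : Fin 2 →₀ ℕ, e.degree ≤ d.degree → MvPowerSeries.coeff e (theta (ellS a b)) =
      MvPowerSeries.coeff e (∑ k ∈ Finset.Icc 1 d.degree, ratS a b ^ k) := by
    intro e he
    rw [coeff_theta_ellS, map_sum]
    refine Finset.sum_subset (Finset.Icc_subset_Icc le_rfl he) fun k hk hk' => ?_
    rw [coeff_ratS_pow, coeff_posPow_eq_zero, zero_smul]
    simp only [Finset.mem_Icc, not_and, not_le] at hk hk'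
    exact hk' hk.1
  have h2 : ∀ N : ℕ, (∑ k ∈ Finset.Icc 1 N, ratS a b ^ k) * (1 - ratS a b) =
      ratS a b - ratS a b ^ (N + 1) := by
    intro N
    induction N with
    | zero => simp
    | succ N ih =>
      rw [Finset.sum_Icc_succ_top (by omega), add_mul, ih]
      ring
  have h3 : MvPowerSeries.coeff d (theta (ellS a b) * (1 - ratS a b)) =
      MvPowerSeries.coeff d ((∑ k ∈ Finset.Icc 1 d.degree, ratS a b ^ k) * (1 - ratS a b)) := by
    rw [MvPowerSeries.coeff_mul, MvPowerSeries.coeff_mul]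
    refine Finset.sum_congr rfl fun p hp => ?_
    have hp := Finset.HasAntidiagonal.mem_antidiagonal.1 hp
    rw [h1 p.1 (by rw [← hp, map_add]; omega)]
  rw [h3, h2, map_sub, coeff_ratS_pow, coeff_posPow_eq_zero _ (Nat.lt_succ_self _), zero_smul,
    sub_zero]

/-- The vacuum expectations of products. -/
def vacG (E F : EndSeries Pol) : MvPowerSeries (Fin 2) Scalar := fun d => (fun e =>
  coeff0 (MvPowerSeries.coeff e E (MvPowerSeries.coeff d F 1)) : Scalar)

theorem coeff_vacG (E F : EndSeries Pol) (d e : Fin 2 →₀ ℕ) :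
    MvPowerSeries.coeff e (MvPowerSeries.coeff d (vacG E F)) =
      coeff0 (MvPowerSeries.coeff e E (MvPowerSeries.coeff d F 1)) := rfl

theorem coeff_scal_mul_apply (s : Scalar) (E : EndSeries Pol) (e : Fin 2 →₀ ℕ) (v : Pol) :
    MvPowerSeries.coeff e (scal OpP s * E) v =
      ∑ p ∈ Finset.HasAntidiagonal.antidiagonal e,
        MvPowerSeries.coeff p.1 s • MvPowerSeries.coeff p.2 E v := by
  rw [MvPowerSeries.coeff_mul, LinearMap.sum_apply]
  refine Finset.sum_congr rfl fun p _ => ?_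
  rw [MvPowerSeries.coeff_map, ← Algebra.smul_def]
  rfl

theorem coeff_scal_smul_mul_apply (c : ℂ) (s : Scalar) (E : EndSeries Pol) (e : Fin 2 →₀ ℕ)
    (v : Pol) : MvPowerSeries.coeff e (scal OpP (c • s) * E) v =
      c • MvPowerSeries.coeff e (scal OpP s * E) v := by
  rw [coeff_scal_mul_apply, coeff_scal_mul_apply, Finset.smul_sum]
  exact Finset.sum_congr rfl fun p _ => by rw [MvPowerSeries.coeff_smul, smul_smul]

/-- The dual vacuum annihilates the creation operator once it stands on the left, so only the
commutator with the exponential remains. -/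
theorem coeff0_annS_bosonP (ann : List (Fin 2 × ℂ × ℤ)) (j : Fin 2) {k : ℕ} (hk : 1 ≤ k)
    (e : Fin 2 →₀ ℕ) (v : Pol) :
    coeff0 (MvPowerSeries.coeff e (expS (annExp ann)) (bosonP j (-(k : ℤ)) v)) =
      coeff0 (MvPowerSeries.coeff e
        (scal OpP (jsum ann j fun a => negPow a k) * expS (annExp ann)) v) := by
  have h := congrArg (fun T : EndSeries Pol => coeff0 (MvPowerSeries.coeff e T v))
    (adL_neg_expS_annExp ann j hk)
  rw [coeff_adL_C, adL_apply, LinearMap.sub_apply, map_sub, Module.End.mul_apply,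
    Module.End.mul_apply, coeff0_bosonP_neg j hk, zero_sub,
    ← neg_one_smul ℂ (jsum ann j fun a => negPow a k), coeff_scal_smul_mul_apply, map_smul,
    neg_one_smul] at h
  exact neg_injective h

theorem coeff0_annS_creExp (ann cre : List (Fin 2 × ℂ × ℤ)) (d e : Fin 2 →₀ ℕ) (v : Pol) :
    coeff0 (MvPowerSeries.coeff e (expS (annExp ann)) (MvPowerSeries.coeff d (creExp cre) v)) =
      coeff0 (MvPowerSeries.coeff e
        (scal OpP (MvPowerSeries.coeff d (pairSum ann cre ellS)) * expS (annExp ann)) v) := by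
  induction cre with
  | nil => simp [creExp, pairSum]
  | cons x l ih =>
    rw [creExp, pairSum] at ih ⊢
    rw [List.map_cons, List.map_cons, List.sum_cons, List.sum_cons, map_add, map_add, map_add,
      add_mul, map_add, LinearMap.add_apply, LinearMap.add_apply, map_add, map_add, map_add, ih]
    congr 1
    have h1 : coeff0 (MvPowerSeries.coeff e (expS (annExp ann)) (MvPowerSeries.coeff d
        (bosonSumG (fun k => bosonP x.1 (-(k : ℤ))) (posPow x.2.1)) v)) =
      coeff0 (MvPowerSeries.coeff e
        (scal OpP (MvPowerSeries.coeff d (jsum ann x.1 fun a => ellS a x.2.1)) *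
          expS (annExp ann)) v) := by
      unfold ellS
      rw [jsum_bosonSumG, coeff_bosonSumG, coeff_bosonSumG, LinearMap.sum_apply, map_sum, map_sum,
        map_sum, Finset.sum_mul, map_sum, LinearMap.sum_apply, map_sum]
      refine Finset.sum_congr rfl fun k hk => ?_
      rw [LinearMap.smul_apply, map_smul, map_smul,
        coeff0_annS_bosonP ann x.1 (Finset.mem_Icc.1 hk).1, coeff_scal_smul_mul_apply, map_smul]
    rw [map_zsmul, map_zsmul, map_zsmul, smul_mul_assoc, map_zsmul, LinearMap.smul_apply,
      LinearMap.smul_apply, map_zsmul, map_zsmul, map_zsmul, h1]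

theorem commute_coeff_creExp (l : List (Fin 2 × ℂ × ℤ)) (j : Fin 2) {k : ℕ} (hk : 1 ≤ k)
    (d : Fin 2 →₀ ℕ) :
    Commute (bosonP j (-(k : ℤ))) (MvPowerSeries.coeff d (creExp l)) := by
  have h := congrArg (MvPowerSeries.coeff d) (adL_neg_creExp l j hk)
  rw [coeff_adL_C, adL_apply, map_zero, map_zero, sub_eq_zero] at h
  exact h

theorem commute_creExp (l l' : List (Fin 2 × ℂ × ℤ)) (d e : Fin 2 →₀ ℕ) :
    Commute (MvPowerSeries.coeff d (creExp l)) (MvPowerSeries.coeff e (creExp l')) := by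
  induction l with
  | nil => simp [creExp]
  | cons x l ih =>
    rw [creExp, List.map_cons, List.sum_cons, map_add]
    refine Commute.add_left ?_ ih
    rw [map_zsmul]
    refine Commute.smul_left ?_ _
    rw [coeff_bosonSumG]
    exact Commute.sum_left _ _ _ fun k hk =>
      (commute_coeff_creExp l' x.1 (Finset.mem_Icc.1 hk).1 e).smul_left _

/-- Differentiating the creation exponential brings down its exponent, and inside the vacuum
expectation each creation operator is replaced by its contraction with the annihilation exponent.
Hence the expectation has the logarithmic derivative of `exp (pairSum ann cre ellS)`. -/
theorem theta_vacG (ann cre : List (Fin 2 × ℂ × ℤ)) :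
    theta (vacG (expS (annExp ann)) (expS (creExp cre))) =
      theta (pairSum ann cre ellS) * vacG (expS (annExp ann)) (expS (creExp cre)) := by
  set F := expS (creExp cre) with hF
  have hth : theta F = theta (creExp cre) * F := theta_expS (constantCoeff_creExp cre)
    (commute_of_coeff fun d e => by
      rw [coeff_theta]; exact (commute_creExp cre cre d e).smul_right _)
  ext d e
  rw [coeff_theta, MvPowerSeries.coeff_smul, coeff_vacG, MvPowerSeries.coeff_mul, map_sum,
    ← smul_eq_mul]
  have h1 : (d.degree : ℂ) • MvPowerSeries.coeff d F =
      ∑ p ∈ Finset.HasAntidiagonal.antidiagonal d,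
        (p.1.degree : ℂ) • (MvPowerSeries.coeff p.1 (creExp cre) * MvPowerSeries.coeff p.2 F) := by
    rw [← coeff_theta, hth, MvPowerSeries.coeff_mul]
    refine Finset.sum_congr rfl fun p _ => ?_
    rw [coeff_theta, smul_mul_assoc]
  rw [← map_smul, ← map_smul, ← LinearMap.smul_apply, h1, LinearMap.sum_apply, map_sum, map_sum]
  refine Finset.sum_congr rfl fun p _ => ?_
  rw [LinearMap.smul_apply, map_smul, map_smul, Module.End.mul_apply, coeff0_annS_creExp,
    coeff_scal_mul_apply, map_sum, coeff_theta, smul_mul_assoc, MvPowerSeries.coeff_smul,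
    MvPowerSeries.coeff_mul]
  rfl

theorem coeff_zero_vacG (ann cre : List (Fin 2 × ℂ × ℤ)) :
    MvPowerSeries.constantCoeff (vacG (expS (annExp ann)) (expS (creExp cre))) = 1 := by
  classical
  rw [← MvPowerSeries.coeff_zero_eq_constantCoeff_apply]
  ext e
  rw [coeff_vacG, MvPowerSeries.coeff_zero_eq_constantCoeff_apply, constantCoeff_expS,
    Module.End.one_apply, coeff_expS_apply_of_kill (coeff_annExp_one ann), MvPowerSeries.coeff_one]
  split_ifs <;> simp

/-- The product of the factors `1 - (v + b ħ) / (u + a ħ)`. -/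
def ratProd (l : List (ℂ × ℂ)) : MvPowerSeries (Fin 2) Scalar :=
  (l.map fun p => 1 - ratS p.1 p.2).prod

/-- The sum of the elementary logarithms. -/
def ellSum (l : List (ℂ × ℂ)) : MvPowerSeries (Fin 2) Scalar :=
  (l.map fun p => ellS p.1 p.2).sum

theorem theta_one {A : Type*} [Ring A] [Algebra ℂ A] : theta (1 : MvPowerSeries (Fin 2) A) = 0 := by
  have h := theta_mul (1 : MvPowerSeries (Fin 2) A) 1
  simpa only [mul_one, one_mul, left_eq_add] using h

theorem theta_ratS (a b : ℂ) : theta (ratS a b) = ratS a b := by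
  ext1 d
  have h1 := coeff_ratS_pow a b 1 d
  rw [pow_one] at h1
  have h2 := congrArg (MvPowerSeries.coeff d) (theta_posPow b 1)
  rw [coeff_theta, Nat.cast_one, one_smul, smul_eq_mul] at h2
  rw [coeff_theta, h1, smul_smul, h2]

theorem theta_ratProd (l : List (ℂ × ℂ)) :
    theta (ratProd l) = -theta (ellSum l) * ratProd l := by
  induction l with
  | nil => simp [ratProd, ellSum, theta_one]
  | cons p l ih =>
    rw [ratProd, ellSum] at ih ⊢
    rw [List.map_cons, List.prod_cons, List.map_cons, List.sum_cons, theta_mul, ih, map_add,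
      map_sub, theta_one, theta_ratS]
    linear_combination ((List.map (fun p => 1 - ratS p.1 p.2) l).prod) * theta_ellS p.1 p.2

theorem constantCoeff_ratProd (l : List (ℂ × ℂ)) :
    MvPowerSeries.constantCoeff (ratProd l) = 1 := by
  induction l with
  | nil => simp [ratProd]
  | cons p l ih =>
    rw [ratProd] at ih ⊢
    rw [List.map_cons, List.prod_cons, map_mul, ih, map_sub, constantCoeff_ratS, map_one, sub_zero,
      mul_one]

/-- Both sides have the logarithmic derivative `-theta (ellSum num)` and the constant term `1`, so
`eq_of_theta` applies. The denominators are kept on the left because they become non-invertible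
after expansion. -/
theorem vacG_mul_ratProd (ann cre : List (Fin 2 × ℂ × ℤ)) (num den : List (ℂ × ℂ))
    (h : pairSum ann cre ellS = ellSum den - ellSum num) :
    vacG (expS (annExp ann)) (expS (creExp cre)) * ratProd den = ratProd num := by
  have h1 := theta_vacG ann cre
  have h0 := coeff_zero_vacG ann cre
  generalize vacG (expS (annExp ann)) (expS (creExp cre)) = G at h1 h0
  refine eq_of_theta (t := -theta (ellSum num)) ?_ (theta_ratProd num) ?_ ?_
  · rw [theta_mul, h1, theta_ratProd, h, map_sub]
    ring
  · rw [map_neg, neg_eq_zero, ← MvPowerSeries.coeff_zero_eq_constantCoeff_apply, coeff_theta]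
    simp
  · rw [map_mul, h0, constantCoeff_ratProd, constantCoeff_ratProd, one_mul]

/-! ### Expansions of two-point functions -/

/-- The expansion of a two-point function in the domain `|u| > |v|`. -/
def omega (G : MvPowerSeries (Fin 2) Scalar) : Fld (ℤ × ℤ) ℂ := fun m x =>
  ∑ p ∈ Finset.HasAntidiagonal.antidiagonal m, posF (posF G p.2 x.2) p.1 (-x.1)

theorem omega_apply (G : MvPowerSeries (Fin 2) Scalar) (m : ℕ) (x : ℤ × ℤ) : omega G m x =
  ∑ p ∈ Finset.HasAntidiagonal.antidiagonal m, posF (posF G p.2 x.2) p.1 (-x.1) := rfl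

theorem posF_zero {A : Type*} [Ring A] (m : ℕ) (n : ℤ) :
    posF (0 : MvPowerSeries (Fin 2) A) m n = 0 := by
  unfold posF; split_ifs <;> simp

theorem omega_add (G G' : MvPowerSeries (Fin 2) Scalar) : omega (G + G') = omega G + omega G' := by
  funext m x
  simp only [omega_apply, Fld.add_apply, posF_add, Finset.sum_add_distrib]

theorem omega_outer_X_one (G : MvPowerSeries (Fin 2) Scalar) :
    omega (MvPowerSeries.X 1 * G) = (mon ((0, 1) : ℤ × ℤ) : Ser (ℤ × ℤ)) • omega G := by
  funext m x
  simp [mon_smul, omega_apply, posF_X_one_mul]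

theorem omega_inner_X_one (G : MvPowerSeries (Fin 2) Scalar) :
    omega (MvPowerSeries.C (MvPowerSeries.X 1) * G) =
      (mon ((-1, 0) : ℤ × ℤ) : Ser (ℤ × ℤ)) • omega G := by
  funext m x
  simp only [mon_smul, omega_apply, posF_C_mul, posF_X_one_mul]
  refine Finset.sum_congr rfl fun p _ => ?_
  congr 2
  · simp
  · simp; ring

/-- A two-point series carries one copy of `ħ` for each of the two operators. `omega` adds the two
exponents, so both copies act as the same `ħ`. -/
theorem omega_outer_X_zero (G : MvPowerSeries (Fin 2) Scalar) :
    omega (MvPowerSeries.X 0 * G) = hS (ℤ × ℤ) • omega G := by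
  funext m x
  cases m with
  | zero =>
    rw [Fld.X_smul_zero]
    simp [omega_apply, posF_X_zero_mul_zero, posF_zero]
  | succ m =>
    rw [Fld.X_smul_succ, omega_apply, omega_apply, Finset.Nat.sum_antidiagonal_succ']
    simp only [posF_X_zero_mul_succ, posF_X_zero_mul_zero, posF_zero, zero_add]

theorem omega_inner_X_zero (G : MvPowerSeries (Fin 2) Scalar) :
    omega (MvPowerSeries.C (MvPowerSeries.X 0) * G) = hS (ℤ × ℤ) • omega G := by
  funext m x
  cases m with
  | zero =>
    rw [Fld.X_smul_zero]
    simp [omega_apply, posF_X_zero_mul_zero, posF_C_mul]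
  | succ m =>
    rw [Fld.X_smul_succ, omega_apply, omega_apply, Finset.Nat.sum_antidiagonal_succ]
    simp only [posF_C_mul, posF_X_zero_mul_succ, posF_X_zero_mul_zero, zero_add]

theorem omega_C (c : ℂ) (G : MvPowerSeries (Fin 2) Scalar) :
    omega (MvPowerSeries.C (MvPowerSeries.C c) * G) = (cS c : Ser (ℤ × ℤ)) • omega G := by
  funext m x
  simp only [cS_smul, omega_apply, posF_C_mul, smul_eq_mul, Finset.mul_sum]

/-- The scalar `u - v + c ħ`. -/
def diffS (c : ℂ) : Ser (ℤ × ℤ) := mon (1, 0) - mon (0, 1) + cS c * hS (ℤ × ℤ)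

/-- This is `(u + a ħ) (1 - (v + b ħ) / (u + a ħ)) = u - v + (a - b) ħ`, with the denominator
cleared. -/
theorem omega_one_sub_ratS (a b : ℂ) (G : MvPowerSeries (Fin 2) Scalar) :
    (linU ((1, 0) : ℤ × ℤ) a : Ser (ℤ × ℤ)) • omega ((1 - ratS a b) * G) =
      diffS (a - b) • omega G := by
  have h1 : omega (MvPowerSeries.C (onePlus a) * ((1 - ratS a b) * G)) =
      omega (MvPowerSeries.C (onePlus a) * G) +
        omega (-(MvPowerSeries.C (MvPowerSeries.X 1) * (scal Scalar (posPow b 1) * G))) := by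
    rw [← omega_add]
    congr 1
    have h2 := congrArg (MvPowerSeries.C (σ := Fin 2)) (onePlus_mul_negPow_succ a 0)
    rw [zero_add, map_mul, map_mul, show negPow a 0 = 1 by simp [negPow], map_one] at h2
    rw [ratS]
    linear_combination (-(scal Scalar (posPow b 1) * G)) * h2
  have h2 : ∀ G, (mon ((1, 0) : ℤ × ℤ) : Ser (ℤ × ℤ)) • omega (MvPowerSeries.C (onePlus a) * G) =
      (linU ((1, 0) : ℤ × ℤ) a : Ser (ℤ × ℤ)) • omega G := by
    intro G
    rw [onePlus, map_add, map_mul, map_mul, map_one, add_mul, one_mul, omega_add, mul_assoc,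
      mul_assoc, omega_C, omega_inner_X_zero, omega_inner_X_one, linU_val, add_smul, smul_add,
      ← mul_smul, ← mul_smul, ← mul_smul]
    have : (mon ((1, 0) : ℤ × ℤ) : Ser (ℤ × ℤ)) * mon (-1, 0) = 1 := by
      rw [← mon_add]; exact mon_zero
    rw [show (mon (1, 0) * cS a * hS (ℤ × ℤ) * mon (-1, 0) : Ser (ℤ × ℤ)) = cS a * hS (ℤ × ℤ) by
      linear_combination (cS a * hS (ℤ × ℤ)) * this]
  have h3 : omega (scal Scalar (posPow b 1) * G) =
      ((mon (0, 1) + cS b * hS (ℤ × ℤ) : Ser (ℤ × ℤ))) • omega G := by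
    rw [posPow, pow_one, map_add, map_mul, add_mul, mul_assoc, omega_add]
    simp only [scal, MvPowerSeries.map_X, MvPowerSeries.map_C]
    rw [omega_outer_X_one]
    have h4 := omega_C b (MvPowerSeries.X 0 * G)
    rw [omega_outer_X_zero, ← mul_smul] at h4
    rw [add_smul, ← h4]
    rfl
  have h5 : omega (-(MvPowerSeries.C (MvPowerSeries.X 1) * (scal Scalar (posPow b 1) * G))) =
      (-(mon ((-1, 0) : ℤ × ℤ) * (mon (0, 1) + cS b * hS (ℤ × ℤ))) : Ser (ℤ × ℤ)) • omega G := by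
    have h6 := omega_C (-1) (MvPowerSeries.C (MvPowerSeries.X 1) * (scal Scalar (posPow b 1) * G))
    rw [map_neg, map_neg, map_one, map_one, neg_one_mul] at h6
    rw [h6, omega_inner_X_one, h3, ← mul_smul, ← mul_smul, cS_neg, cS_one]
    refine congrArg (· • omega G) ?_
    ring
  rw [← h2, h1, h5, smul_add, h2, ← mul_smul, ← add_smul]
  refine congrArg (· • omega G) ?_
  have : (mon ((1, 0) : ℤ × ℤ) : Ser (ℤ × ℤ)) * mon (-1, 0) = 1 := by
    rw [← mon_add]; exact mon_zero
  rw [linU_val, diffS, cS_sub]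
  linear_combination (-(mon (0, 1) + cS b * hS (ℤ × ℤ))) * this

/-- The product of the scalars `u - v + (a - b) ħ`. -/
def diffProd (l : List (ℂ × ℂ)) : Ser (ℤ × ℤ) := (l.map fun p => diffS (p.1 - p.2)).prod

/-- The product of the scalars `x + a ħ`. -/
def linProd (g : ℤ × ℤ) (l : List (ℂ × ℂ)) : Ser (ℤ × ℤ) :=
  (l.map fun p => (linU g p.1 : Ser (ℤ × ℤ))).prod

theorem omega_ratProd (l : List (ℂ × ℂ)) (G : MvPowerSeries (Fin 2) Scalar) :
    linProd (1, 0) l • omega (ratProd l * G) = diffProd l • omega G := by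
  induction l generalizing G with
  | nil => simp [linProd, ratProd, diffProd]
  | cons p l ih =>
    rw [linProd, ratProd, diffProd] at ih ⊢
    rw [List.map_cons, List.prod_cons, List.map_cons, List.prod_cons, List.map_cons, List.prod_cons,
      mul_assoc (1 - _), mul_smul, smul_comm, omega_one_sub_ratS, smul_comm, ih, mul_smul]

/-- The constant distribution `1`. -/
def unitFld : Fld (ℤ × ℤ) ℂ := fun m x => if m = 0 ∧ x = 0 then 1 else 0

theorem omega_one : omega 1 = unitFld := by
  classical
  funext m x
  obtain ⟨i, j⟩ := x
  have h1 : ∀ (A : Type) [CommRing A] (k : ℕ) (n : ℤ),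
      posF (1 : MvPowerSeries (Fin 2) A) k n = if k = 0 ∧ n = 0 then 1 else 0 := by
    intro A _ k n
    unfold posF
    by_cases hn : 0 ≤ n
    · rw [if_pos hn, MvPowerSeries.coeff_one]
      congr 1
      refine propext ⟨fun h => ⟨?_, ?_⟩, fun h => ?_⟩
      · rw [← expo_apply_zero k n.toNat, h]; rfl
      · have := expo_apply_one k n.toNat
        rw [h] at this
        simp at this
        omega
      · rw [h.1, h.2]; simp [expo]
    · rw [if_neg hn, if_neg]
      rintro ⟨_, rfl⟩
      exact hn le_rfl
  have h2 : ∀ (P : Prop) [Decidable P] (k : ℕ) (n : ℤ), posF (if P then (1 : Scalar) else 0) k n =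
      if P ∧ k = 0 ∧ n = 0 then 1 else 0 := by
    intro P _ k n
    split_ifs with h h' h'
    · rw [h1, if_pos h'.2]
    · rw [h1, if_neg (fun hh => h' ⟨h, hh⟩)]
    · exact absurd h'.1 h
    · exact posF_zero _ _
  rw [omega_apply]
  simp only [h1, h2, unitFld]
  rw [Finset.sum_eq_single (m, 0)]
  · congr 1
    simp [Prod.ext_iff]
    tauto
  · rintro ⟨p, q⟩ hp hne
    rw [if_neg]
    rintro ⟨⟨h3, _⟩, h4, _⟩
    have hp := Finset.HasAntidiagonal.mem_antidiagonal.1 hp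
    simp at h3 h4 hp
    exact hne (by rw [h3, ← hp, h3]; rfl)
  · simp

theorem wick_apply_one (C : EndSeries Pol) (ann : List (Fin 2 × ℂ × ℤ)) (m : ℕ) (n : ℤ) :
    wick C (expS (annExp ann)) m n 1 = posF C m n 1 := by
  have hE := serFin_expS_annExp ann
  have h0 : ∀ (k l : ℕ), MvPowerSeries.coeff (expo k l) (expS (annExp ann)) (1 : Pol) =
      if k = 0 ∧ l = 0 then 1 else 0 := by
    intro k l
    rw [coeff_expS_apply_of_kill (coeff_annExp_one ann)]
    congr 1
    refine propext ⟨fun h => ⟨?_, ?_⟩, fun h => ?_⟩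
    · rw [← expo_apply_zero k l, h]; rfl
    · rw [← expo_apply_one k l, h]; rfl
    · rw [h.1, h.2]; simp [expo]
  rw [wick_apply, lsum_apply_range (hE.wick C m n) (N := 1)]
  · rw [Finset.sum_range_one, LinearMap.sum_apply, Finset.sum_eq_single (m, 0)]
    · rw [Module.End.mul_apply, h0, if_pos ⟨rfl, rfl⟩]
      simp
    · rintro ⟨p, q⟩ hp hne
      rw [Module.End.mul_apply, h0, if_neg, map_zero]
      rintro ⟨h, -⟩
      have hp := Finset.HasAntidiagonal.mem_antidiagonal.1 hp
      simp at h hp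
      exact hne (by rw [← hp, h]; rfl)
    · simp
  · intro l hl
    rw [LinearMap.sum_apply]
    refine Finset.sum_eq_zero fun p _ => ?_
    rw [Module.End.mul_apply, h0, if_neg (by omega), map_zero]

theorem coeff0_wick (cre : List (Fin 2 × ℂ × ℤ)) {E : EndSeries Pol} (hE : SerFin E) (m : ℕ)
    (n : ℤ) (f : Pol) : coeff0 (wick (expS (creExp cre)) E m n f) = coeff0 (posF E m (-n) f) := by
  have h0 : ∀ (k : ℕ) (l : ℤ) (f : Pol), coeff0 (posF (expS (creExp cre)) k l f) =
      if k = 0 ∧ l = 0 then coeff0 f else 0 := by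
    intro k l f
    unfold posF
    split_ifs with h h' h'
    · rw [apply_coeff_expS_of_kill (coeff0_coeff_creExp cre), if_pos]
      rw [h'.1, h'.2]; simp [expo]
    · rw [apply_coeff_expS_of_kill (coeff0_coeff_creExp cre), if_neg]
      intro h2
      refine h' ⟨?_, ?_⟩
      · rw [← expo_apply_zero k l.toNat, h2]; rfl
      · have := expo_apply_one k l.toNat
        rw [h2] at this
        simp at this
        omega
    · exact absurd (by rw [h'.2]) h
    · simp
  obtain ⟨N, hN⟩ := (hE.wick (expS (creExp cre)) m n) f
  have hN' : ∀ l ≥ max N ((-n).toNat + 1), (∑ p ∈ Finset.HasAntidiagonal.antidiagonal m,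
      posF (expS (creExp cre)) p.1 (n + l) * MvPowerSeries.coeff (expo p.2 l) E) f = 0 :=
    fun l hl => hN l (le_trans (le_max_left _ _) hl)
  rw [wick_apply, lsum_apply_range (hE.wick _ m n) hN', map_sum]
  have h1 : ∀ l ∈ Finset.range (max N ((-n).toNat + 1)),
      coeff0 ((∑ p ∈ Finset.HasAntidiagonal.antidiagonal m,
      posF (expS (creExp cre)) p.1 (n + l) * MvPowerSeries.coeff (expo p.2 l) E) f) =
      if (l : ℤ) = -n then coeff0 (MvPowerSeries.coeff (expo m l) E f) else 0 := by
    intro l _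
    rw [LinearMap.sum_apply, map_sum, Finset.sum_eq_single (0, m)]
    · rw [Module.End.mul_apply, h0]
      congr 1
      simp
      omega
    · rintro ⟨p, q⟩ hp hne
      rw [Module.End.mul_apply, h0, if_neg]
      rintro ⟨h, -⟩
      have hp := Finset.HasAntidiagonal.mem_antidiagonal.1 hp
      simp at h hp
      exact hne (by rw [← hp, h, zero_add])
    · simp
  rw [Finset.sum_congr rfl h1]
  unfold posF
  split_ifs with hn
  · rw [Finset.sum_eq_single (-n).toNat]
    · rw [if_pos (by omega)]
    · intro l _ hl
      rw [if_neg (by omega)]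
    · intro h
      exact absurd (Finset.mem_range.2 (lt_of_lt_of_le (Nat.lt_succ_self _) (le_max_right _ _))) h
  · rw [Finset.sum_eq_zero]
    · simp
    · intro l _
      rw [if_neg (by omega)]

/-- The dual vacuum absorbs the left creation exponential and the vacuum absorbs the right
annihilation exponential. Only the pairing of the two inner exponentials is left, in powers of `u⁻¹`
and `v`. -/
theorem vac_bil_vertexP (cre ann cre' ann' : List (Fin 2 × ℂ × ℤ)) :
    Fld.map vac (Fld.bil (mulB OpP) (vertexP cre ann) (vertexP cre' ann')) =
      omega (vacG (expS (annExp ann)) (expS (creExp cre'))) := by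
  funext m x
  rw [Fld.map_apply, Fld.bil_apply, omega_apply, map_sum]
  refine Finset.sum_congr rfl fun p _ => ?_
  rw [vertexP, vertexP, LinearMap.mul_apply', vacCoeff_apply, Module.End.mul_apply, wick_apply_one]
  have h := coeff0_wick cre (serFin_expS_annExp ann) p.1 x.1 (posF (expS (creExp cre')) p.2 x.2 1)
  refine h.trans ?_
  unfold posF
  by_cases h1 : 0 ≤ -x.1 <;> by_cases h2 : 0 ≤ x.2
  · rw [if_pos h1, if_pos h2, if_pos h1, if_pos h2, coeff_vacG]
  · rw [if_neg h2, if_neg h2]; simp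
  · rw [if_neg h1, if_neg h1]; simp
  · rw [if_neg h1, if_neg h1]; simp

/-- The vacuum expectation of a product of vertex operators. -/
theorem two_point (cre ann cre' ann' : List (Fin 2 × ℂ × ℤ)) (num den : List (ℂ × ℂ))
    (h : pairSum ann cre' ellS = ellSum den - ellSum num) :
    (diffProd den * linProd (1, 0) num) •
        Fld.map vac (Fld.bil (mulB OpP) (vertexP cre ann) (vertexP cre' ann')) =
      (diffProd num * linProd (1, 0) den) • unitFld := by
  have h1 := vacG_mul_ratProd ann cre' num den h
  rw [vac_bil_vertexP, mul_comm, mul_smul, ← omega_ratProd, mul_comm (ratProd den), h1, smul_comm,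
    ← mul_one (ratProd num), omega_ratProd, omega_one, ← mul_smul, mul_comm]

/-- The exchange of the two variables. -/
def Fld.swap {V : Type*} (f : Fld (ℤ × ℤ) V) : Fld (ℤ × ℤ) V := fun m x => f m x.swap

/-- The exchange of the two variables, on exponents. -/
abbrev swapHom : ℤ × ℤ →+ ℤ × ℤ := (AddEquiv.prodComm (M := ℤ) (N := ℤ)).toAddMonoidHom

theorem Fld.swap_smul {V : Type*} [AddCommGroup V] [Module ℂ V] (p : Ser (ℤ × ℤ))
    (f : Fld (ℤ × ℤ) V) : Fld.swap (p • f) = Ser.map swapHom p • Fld.swap f := by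
  funext m x
  let T : (ℤ × ℤ → V) →ₗ[ℂ] (ℤ × ℤ → V) := LinearMap.funLeft ℂ V Prod.swap
  have h := fun (a : AddMonoidAlgebra ℂ (ℤ × ℤ)) f => conv_intertwine swapHom T (fun g f => by
    funext x
    simp only [T, LinearMap.funLeft, LinearMap.coe_mk, AddHom.coe_mk, Function.comp_apply,
      conv_single]
    congr 2) a f
  rw [Fld.swap, Fld.smul_def, Fld.smul_def, Finset.sum_apply, Finset.sum_apply]
  refine Finset.sum_congr rfl fun a _ => ?_
  rw [Ser.map, PowerSeries.coeff_map]
  exact congrFun (h _ _) x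

theorem Fld.bil_flip_eq_swap {A : Type*} [Ring A] [Algebra ℂ A] (f g : Fld ℤ A) :
    Fld.bil (mulB A).flip f g = Fld.swap (Fld.bil (mulB A) g f) := by
  funext m x
  rw [Fld.swap, Fld.bil_apply, Fld.bil_apply, ← Finset.Nat.sum_antidiagonal_swap]
  rfl

theorem swap_diffProd (l : List (ℂ × ℂ)) :
    Ser.map swapHom (diffProd l) = (l.map fun p => -diffS (p.2 - p.1)).prod := by
  rw [diffProd, map_list_prod, List.map_map]
  congr 2
  funext p
  simp only [Function.comp_apply, diffS, map_add, map_sub, map_mul, Ser.map_mon, Ser.map_cS,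
    Ser.map_X, cS_sub]
  simp [swapHom]
  ring

theorem swap_linProd (l : List (ℂ × ℂ)) :
    Ser.map swapHom (linProd (1, 0) l) = linProd (0, 1) l := by
  rw [linProd, linProd, map_list_prod, List.map_map]
  congr 2
  funext p
  exact congrArg Units.val (Ser.map_linU swapHom ((1, 0) : ℤ × ℤ) p.1)

/-- The product in the opposite order is `two_point` with the variables exchanged, which turns `u -
v + (a - b) ħ` into `-(u - v + (b - a) ħ)`. Its expansion is in powers of `v⁻¹` and `u`. -/
theorem two_point_flip (cre ann cre' ann' : List (Fin 2 × ℂ × ℤ)) (num den : List (ℂ × ℂ))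
    (h : pairSum ann' cre ellS = ellSum den - ellSum num) :
    ((den.map fun p => -diffS (p.2 - p.1)).prod * linProd (0, 1) num) •
        Fld.map vac (Fld.bil (mulB OpP).flip (vertexP cre ann) (vertexP cre' ann')) =
      ((num.map fun p => -diffS (p.2 - p.1)).prod * linProd (0, 1) den) • unitFld := by
  have h1 := congrArg Fld.swap (two_point cre' ann' cre ann num den h)
  rw [Fld.swap_smul, Fld.swap_smul, map_mul, map_mul, swap_diffProd, swap_diffProd, swap_linProd,
    swap_linProd] at h1
  rw [Fld.bil_flip_eq_swap]
  have h2 : unitFld.swap = unitFld := by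
    funext m x
    obtain ⟨i, j⟩ := x
    simp only [Fld.swap, unitFld, Prod.swap_prod_mk, Prod.mk_eq_zero]
    congr 1
    rw [and_comm (a := i = 0)]
  rw [h2] at h1
  exact h1

/-- Exchange relations follow from the relations between vacuum expectations. -/
theorem exchange_vertexP (cre ann cre' ann' : List (Fin 2 × ℂ × ℤ)) (p q : Ser (ℤ × ℤ))
    (h : p • Fld.map vac (Fld.bil (mulB OpP) (vertexP cre ann) (vertexP cre' ann')) =
      q • Fld.map vac (Fld.bil (mulB OpP).flip (vertexP cre ann) (vertexP cre' ann'))) :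
    p • Fld.bil (mulB OpP) (vertexP cre ann) (vertexP cre' ann') =
      q • Fld.bil (mulB OpP).flip (vertexP cre ann) (vertexP cre' ann') := by
  refine Primary.ext (((primary_vertexP cre ann).bil (primary_vertexP cre' ann')).smul p)
    (((primary_vertexP cre ann).bil_flip (primary_vertexP cre' ann')).smul q) ?_
  rw [Fld.map_smul, Fld.map_smul, h]

/-! ### Series in `ħ / u` -/

/-- The substitution `t ↦ ħ u⁻¹` with values in the scalars. -/
def kap : PowerSeries ℂ →+* Ser ℤ :=
  (PowerSeries.rescale (AddMonoidAlgebra.single (-1 : ℤ) (1 : ℂ))).comp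
    (PowerSeries.map (algebraMap ℂ (AddMonoidAlgebra ℂ ℤ)))

theorem kap_X : kap PowerSeries.X = mon (-1) * hS ℤ := by
  rw [kap, RingHom.comp_apply, PowerSeries.map_X, PowerSeries.rescale_X, mon]

theorem kap_C (c : ℂ) : kap (PowerSeries.C c) = cS c := by
  rw [kap, RingHom.comp_apply, PowerSeries.map_C, cS]
  ext n : 1
  rw [PowerSeries.coeff_rescale, PowerSeries.coeff_C]
  split_ifs with h
  · subst h; simp
  · simp [PowerSeries.coeff_C, h]

theorem hasSubst_X_mul_X :
    PowerSeries.HasSubst (MvPowerSeries.X 0 * MvPowerSeries.X 1 : Scalar) :=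
  PowerSeries.HasSubst.of_constantCoeff_zero (by simp)

/-- The substitution `t ↦ ħ z`, `z = u⁻¹`. -/
def tz : PowerSeries ℂ →+* Scalar :=
  (PowerSeries.substAlgHom (R := ℂ) hasSubst_X_mul_X : PowerSeries ℂ →ₐ[ℂ] Scalar)

theorem tz_apply (F : PowerSeries ℂ) :
    tz F = F.subst (MvPowerSeries.X 0 * MvPowerSeries.X 1 : Scalar) := by
  rw [← PowerSeries.coe_substAlgHom hasSubst_X_mul_X]; rfl

theorem tz_X : tz PowerSeries.X = MvPowerSeries.X 0 * MvPowerSeries.X 1 := by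
  rw [tz_apply, PowerSeries.subst_X hasSubst_X_mul_X]

theorem tz_C (c : ℂ) : tz (PowerSeries.C c) = MvPowerSeries.C c := by
  rw [tz_apply, PowerSeries.subst_C]

theorem tame_tz (F : PowerSeries ℂ) : Tame (tz F) := by
  classical
  refine ⟨0, fun m l hl => ?_⟩
  rw [tz_apply, PowerSeries.coeff_subst hasSubst_X_mul_X]
  refine finsum_eq_zero_of_forall_eq_zero fun d => ?_
  have h : (MvPowerSeries.X 0 * MvPowerSeries.X 1 : Scalar) ^ d =
      MvPowerSeries.monomial (expo d d) 1 := by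
    rw [mul_pow, MvPowerSeries.X_pow_eq, MvPowerSeries.X_pow_eq,
      MvPowerSeries.monomial_mul_monomial, one_mul]
    rfl
  rw [h, MvPowerSeries.coeff_monomial, if_neg, smul_zero]
  intro h1
  have := expo_inj h1
  omega

theorem X_pow_smul_apply {G V : Type*} [AddCommGroup G] [AddCommGroup V] [Module ℂ V]
    (f : Fld G V) {m N : ℕ} (h : m < N) : (hS G ^ N • f) m = 0 := by
  induction N generalizing m with
  | zero => omega
  | succ N ih =>
    rw [pow_succ', mul_smul]
    cases m with
    | zero => exact Fld.X_smul_zero _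
    | succ m => rw [Fld.X_smul_succ, ih (by omega)]

/-- Polynomials in `t` are covered by the rules for `ħ`, `u⁻¹` and constants. At order `m` in `ħ`
the remainder `t ^ (m + 1) F` does not contribute, since `t ↦ ħ / u`. -/
theorem wick_tz {V : Type*} [AddCommGroup V] [Module ℂ V] (C : EndSeries V) {E : EndSeries V}
    (hE : SerFin E) (F : PowerSeries ℂ) :
    wick C (scal _ (tz F) * E) = kap F • wick C E := by
  have hmul : ∀ n F, wick C (scal _ (tz (PowerSeries.X ^ n * F)) * E) =
      (mon (-1) * hS ℤ) ^ n • wick C (scal _ (tz F) * E) := by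
    intro n F
    induction n with
    | zero => simp
    | succ n ih =>
      rw [pow_succ', mul_assoc, map_mul, tz_X, map_mul, map_mul, mul_assoc, mul_assoc, scal_X,
        scal_X, wick_X_zero_right, wick_X_one_right _ (hE.scal_mul (tame_tz _)), ih, ← mul_smul,
        ← mul_smul, pow_succ', mul_comm (hS ℤ)]
  have hpol : ∀ p : Polynomial ℂ, wick C (scal _ (tz (p : PowerSeries ℂ)) * E) =
      kap p • wick C E := by
    intro p
    induction p using Polynomial.induction_on' with
    | add p q hp hq =>
      rw [Polynomial.coe_add, map_add, map_add, add_mul,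
        wick_add_right _ (hE.scal_mul (tame_tz _)) (hE.scal_mul (tame_tz _)), hp, hq, map_add,
        add_smul]
    | monomial n a =>
      rw [← Polynomial.C_mul_X_pow_eq_monomial, Polynomial.coe_mul, Polynomial.coe_pow,
        Polynomial.coe_X, Polynomial.coe_C, mul_comm, hmul, tz_C, wick_C_right _ _ hE, map_mul,
        map_pow, kap_X, kap_C, mul_smul]
  funext m
  have hF := PowerSeries.eq_X_pow_mul_shift_add_trunc (m + 1) F
  rw [hF, map_add, map_add, add_mul,
        wick_add_right _ (hE.scal_mul (tame_tz _)) (hE.scal_mul (tame_tz _)), hpol, hmul,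
        map_add, add_smul, map_mul, map_pow, kap_X, mul_pow, mul_comm (mon (-1) ^ _), mul_smul,
        mul_assoc, mul_smul]
  have e : ∀ f g h : Fld ℤ (Module.End ℂ V), (hS ℤ ^ (m + 1) • f + h) m =
      (hS ℤ ^ (m + 1) • g + h) m := by
    intro f g h
    funext n
    rw [Fld.add_apply, Fld.add_apply, X_pow_smul_apply _ (Nat.lt_succ_self m),
      X_pow_smul_apply _ (Nat.lt_succ_self m)]
  exact e _ _ _

/-- The power `(1 + h) ^ x`. -/
def powS (h : PowerSeries ℂ) (x : ℂ) : PowerSeries ℂ := (PowerSeries.binomialSeries ℂ x).subst h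

theorem powS_add_one {h : PowerSeries ℂ} (hh : PowerSeries.constantCoeff h = 0) (x : ℂ) :
    powS h (x + 1) = powS h x * (1 + h) := by
  have hs : PowerSeries.HasSubst h := PowerSeries.HasSubst.of_constantCoeff_zero' hh
  have h1 : PowerSeries.binomialSeries ℂ (1 : ℂ) = 1 + PowerSeries.X := by
    have := PowerSeries.binomialSeries_nat (R := ℂ) (A := ℂ) 1
    simpa using this
  rw [powS, PowerSeries.binomialSeries_add, PowerSeries.subst_mul hs, h1, PowerSeries.subst_add hs,
    PowerSeries.subst_X hs, powS]
  congr 2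
  rw [← PowerSeries.coe_substAlgHom hs, map_one]

theorem powS_zero {h : PowerSeries ℂ} (hh : PowerSeries.constantCoeff h = 0) : powS h 0 = 1 := by
  have hs : PowerSeries.HasSubst h := PowerSeries.HasSubst.of_constantCoeff_zero' hh
  rw [powS, PowerSeries.binomialSeries_zero, ← PowerSeries.coe_substAlgHom hs, map_one]

theorem scalarPow_tz {h : PowerSeries ℂ} (hh : PowerSeries.constantCoeff h = 0) (x : ℂ) :
    scalarPow (tz (1 + h)) x = tz (powS h x) := by
  have hs : PowerSeries.HasSubst h := PowerSeries.HasSubst.of_constantCoeff_zero' hh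
  rw [scalarPow, map_add, map_one, add_sub_cancel_left, tz_apply, tz_apply, powS,
    PowerSeries.subst_comp_subst_apply hs hasSubst_X_mul_X]

/-- The series `1 + a t`. -/
def oneT (a : ℂ) : PowerSeries ℂ := 1 + PowerSeries.C a * PowerSeries.X

theorem tz_oneT (a : ℂ) : tz (oneT a) = onePlus a := by
  rw [oneT, map_add, map_one, map_mul, tz_C, tz_X, onePlus, mul_assoc]

theorem mon_mul_kap_oneT (a : ℂ) : mon 1 * kap (oneT a) = (linU (1 : ℤ) a : Ser ℤ) := by
  rw [oneT, map_add, map_one, map_mul, kap_C, kap_X, linU_eq_mon_mul, mul_comm (hS ℤ)]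

/-- The series `(1 - t/2) / (1 + t/2) - 1`. -/
def halfT : PowerSeries ℂ := oneT (-1 / 2) * (oneT (1 / 2))⁻¹ - 1

theorem constantCoeff_oneT (a : ℂ) : PowerSeries.constantCoeff (oneT a) = 1 := by simp [oneT]

theorem constantCoeff_halfT : PowerSeries.constantCoeff halfT = 0 := by
  simp [halfT, constantCoeff_oneT]

theorem one_add_halfT : (1 + halfT) * oneT (1 / 2) = oneT (-1 / 2) := by
  rw [halfT, add_sub_cancel, mul_assoc, PowerSeries.inv_mul_cancel, mul_one]
  rw [constantCoeff_oneT]; exact one_ne_zero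

theorem tz_one_add_halfT : tz (1 + halfT) = onePlus (-1 / 2) * (onePlus (1 / 2))⁻¹ := by
  rw [MvPowerSeries.eq_mul_inv_iff_mul_eq (by rw [constantCoeff_onePlus]; exact one_ne_zero),
    ← tz_oneT, ← tz_oneT, ← map_mul, one_add_halfT]

/-- The scalar `((u - ħ/2) / (u + ħ/2)) ^ x`. -/
def halfPow (x : ℂ) : Ser ℤ := kap (powS halfT x)

theorem halfPow_add_one (x : ℂ) : halfPow (x + 1) * (linU (1 : ℤ) (1 / 2) : Ser ℤ) =
    halfPow x * (linU (1 : ℤ) (-1 / 2) : Ser ℤ) := by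
  rw [halfPow, powS_add_one constantCoeff_halfT, map_mul, ← mon_mul_kap_oneT, ← mon_mul_kap_oneT,
    ← one_add_halfT, map_mul, halfPow]
  ring

/-- The recursion `powS_add_one` is solved in both directions from `n = 0`. Binomial series are
unavoidable for `∂_{ε_j}`, whose eigenvalues depend on `s`; for the integral eigenvalues of `∂_α`
this lemma returns to powers of a unit. -/
theorem mon_mul_kap_powS (a : ℂ) (n : ℤ) :
    mon n * kap (powS (PowerSeries.C a * PowerSeries.X) n) =
      ((linU (1 : ℤ) a ^ n : (Ser ℤ)ˣ) : Ser ℤ) := by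
  have hh : PowerSeries.constantCoeff (PowerSeries.C a * PowerSeries.X : PowerSeries ℂ) = 0 := by
    simp
  have hs : ∀ n : ℤ, mon (n + 1) * kap (powS (PowerSeries.C a * PowerSeries.X) (n + 1 : ℤ)) =
      (mon n * kap (powS (PowerSeries.C a * PowerSeries.X) n)) * (linU (1 : ℤ) a : Ser ℤ) := by
    intro n
    push_cast
    rw [powS_add_one hh, map_mul, mon_add, ← mon_mul_kap_oneT, oneT]
    ring
  induction n with
  | zero =>
    rw [Int.cast_zero, powS_zero hh, map_one, mul_one, mon_zero, zpow_zero, Units.val_one]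
  | succ n ih => rw [hs, ih, ← Units.val_mul, ← zpow_add_one]
  | pred n ih =>
    have h := hs (-n - 1)
    rw [sub_add_cancel, ih] at h
    rw [zpow_sub_one, Units.val_mul, h, mul_assoc, Units.mul_inv, mul_one]

/-! ### Twisting by the lattice -/

section Twist

variable {G H : Type*} [AddCommGroup G] [AddCommGroup H]

/-- The operators on the lattice Fock space that act by `W`, shift the lattice by `p` and multiply
by the scalar `σ q`. -/
def tw (p : ℤ) (σ : ℤ → Ser G) (W : Fld G OpP) : Fld G Op₀ := fun m x =>
  Finsupp.lsum ℂ fun q => Finsupp.lsingle (q + p) ∘ₗ (σ q • W) m x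

theorem tw_apply_single (p : ℤ) (σ : ℤ → Ser G) (W : Fld G OpP) (m : ℕ) (x : G) (q : ℤ) (f : Pol) :
    tw p σ W m x (Finsupp.single q f) = Finsupp.single (q + p) ((σ q • W) m x f) := by
  rw [tw, Finsupp.lsum_single]; rfl

theorem fldOp_ext {D D' : Fld G Op₀}
    (h : ∀ m x q f, D m x (Finsupp.single q f) = D' m x (Finsupp.single q f)) : D = D' := by
  funext m x
  refine Finsupp.lhom_ext fun q f => h m x q f

theorem smul_tw (P : Ser G) (p : ℤ) (σ : ℤ → Ser G) (W : Fld G OpP) :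
    P • tw p σ W = tw p (fun q => P * σ q) W := by
  refine fldOp_ext fun m x q f => ?_
  have h1 : Fld.map (LinearMap.applyₗ (Finsupp.single q f)) (tw p σ W) =
      Fld.map (Finsupp.lsingle (R := ℂ) (q + p) ∘ₗ LinearMap.applyₗ f) (σ q • W) := by
    funext m x
    exact tw_apply_single p σ W m x q f
  have h2 := Fld.map_smul (LinearMap.applyₗ (R := ℂ) (M₂ := Fock₀) (Finsupp.single q f)) P
    (tw p σ W)
  rw [h1, ← Fld.map_smul, ← mul_smul] at h2
  rw [tw_apply_single]
  exact congrFun (congrFun h2 m) x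

theorem tw_congr {p : ℤ} {σ σ' : ℤ → Ser G} {W W' : Fld G OpP} (h : ∀ q, σ q • W = σ' q • W') :
    tw p σ W = tw p σ' W' := by
  refine fldOp_ext fun m x q f => ?_
  rw [tw_apply_single, tw_apply_single, h]

/-- The right factor acts first, so the scalar of the left factor is evaluated at the lattice point
shifted by `p'`. These shifts produce the lattice part of the exchange factors. -/
theorem bil_tw (p p' : ℤ) (σ : ℤ → Ser G) (σ' : ℤ → Ser H) (W : Fld G OpP) (W' : Fld H OpP) :
    Fld.bil (mulB Op₀) (tw p σ W) (tw p' σ' W') =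
      tw (p + p') (fun q => Ser.map (AddMonoidHom.inl G H) (σ (q + p')) *
        Ser.map (AddMonoidHom.inr G H) (σ' q)) (Fld.bil (mulB OpP) W W') := by
  refine fldOp_ext fun m x q f => ?_
  rw [tw_apply_single, mul_smul, ← Fld.bil_smul_right, ← Fld.bil_smul_left, Fld.bil_apply,
    Fld.bil_apply, LinearMap.sum_apply, LinearMap.sum_apply, Finsupp.single_finsetSum]
  refine Finset.sum_congr rfl fun a _ => ?_
  rw [LinearMap.mul_apply', Module.End.mul_apply, tw_apply_single, tw_apply_single,
    LinearMap.mul_apply', Module.End.mul_apply, add_assoc, add_comm p]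

theorem bil_flip_tw (p p' : ℤ) (σ : ℤ → Ser G) (σ' : ℤ → Ser H) (W : Fld G OpP) (W' : Fld H OpP) :
    Fld.bil (mulB Op₀).flip (tw p σ W) (tw p' σ' W') =
      tw (p + p') (fun q => Ser.map (AddMonoidHom.inl G H) (σ q) *
        Ser.map (AddMonoidHom.inr G H) (σ' (q + p))) (Fld.bil (mulB OpP).flip W W') := by
  refine fldOp_ext fun m x q f => ?_
  rw [tw_apply_single, mul_smul, ← Fld.bil_smul_right, ← Fld.bil_smul_left, Fld.bil_apply,
    Fld.bil_apply, LinearMap.sum_apply, LinearMap.sum_apply, Finsupp.single_finsetSum]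
  refine Finset.sum_congr rfl fun a _ => ?_
  rw [LinearMap.flip_apply, LinearMap.mul_apply', Module.End.mul_apply, tw_apply_single,
    tw_apply_single, LinearMap.flip_apply, LinearMap.mul_apply', Module.End.mul_apply, add_assoc]

end Twist

/-- Exchange relations of twisted vertex operators. -/
theorem exchange_tw {cre ann cre' ann' : List (Fin 2 × ℂ × ℤ)} {p p' : ℤ} {σ σ' : ℤ → Ser ℤ}
    (num den num' den' : List (ℂ × ℂ))
    (h : pairSum ann cre' ellS = ellSum den - ellSum num)
    (h' : pairSum ann' cre ellS = ellSum den' - ellSum num') (P Q : Ser (ℤ × ℤ))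
    (hq : ∀ q, ∃ r r',
      P * (Ser.map (AddMonoidHom.inl ℤ ℤ) (σ (q + p')) * Ser.map (AddMonoidHom.inr ℤ ℤ) (σ' q)) =
        r * (diffProd den * linProd (1, 0) num) ∧
      Q * (Ser.map (AddMonoidHom.inl ℤ ℤ) (σ q) * Ser.map (AddMonoidHom.inr ℤ ℤ) (σ' (q + p))) =
        r' * ((den'.map fun p => -diffS (p.2 - p.1)).prod * linProd (0, 1) num') ∧
      r * (diffProd num * linProd (1, 0) den) =
        r' * ((num'.map fun p => -diffS (p.2 - p.1)).prod * linProd (0, 1) den')) :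
    P • Fld.bil (mulB Op₀) (tw p σ (vertexP cre ann)) (tw p' σ' (vertexP cre' ann')) =
      Q • Fld.bil (D := Op₀) (mulB Op₀).flip (tw p σ (vertexP cre ann)) (tw p' σ' (vertexP cre' ann')) := by
  rw [bil_tw, bil_flip_tw, smul_tw, smul_tw]
  refine tw_congr fun q => ?_
  obtain ⟨r, r', h1, h2, h3⟩ := hq q
  refine exchange_vertexP _ _ _ _ _ _ ?_
  -- On each lattice point both vacuum expectations become multiples of the constant distribution.
  -- `r` and `r'` are what remains after the factors of the two-point functions are split off, and
  -- `h3` compares them.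
  rw [h1, h2, mul_smul, two_point cre ann cre' ann' num den h, ← mul_smul, h3, mul_smul,
    ← two_point_flip cre ann cre' ann' num' den' h', ← mul_smul]

/-! ### The currents -/

/-- The current `k_j⁺`. -/
def kPlusF (i : Fin 2) (s : ℂ) (j : Fin 2) : Fld ℤ Op₀ :=
  tw 0 (fun q => halfPow (latticePoint i s q j)) (vertexP [] [(j, 1 / 2, -1), (j, -1 / 2, 1)])

/-- The exponents of `k_j⁻`. -/
def kMinusCre (j : Fin 2) : List (Fin 2 × ℂ × ℤ) :=
  if j = 0 then [(1, 1, 1), (1, 0, -1)] else [(0, 0, 1), (0, -1, -1)]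

/-- The current `k_j⁻`. -/
def kMinusF (j : Fin 2) : Fld ℤ Op₀ := tw 0 (fun _ => 1) (vertexP (kMinusCre j) [])

/-- The current `X⁺ / ħ`. -/
def vPlusF (i : Fin 2) : Fld ℤ Op₀ :=
  tw 1 (fun q => ((linU (1 : ℤ) (1 / 4) ^ alphaWeight i q : (Ser ℤ)ˣ) : Ser ℤ))
    (vertexP [(0, -3 / 4, -1), (1, 1 / 4, 1)] [(0, 1 / 4, 1), (1, 1 / 4, -1)])

/-- The current `X⁻ / ħ`. -/
def vMinusF (i : Fin 2) : Fld ℤ Op₀ :=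
  tw (-1) (fun q => ((linU (1 : ℤ) (-1 / 4) ^ (-alphaWeight i q) : (Ser ℤ)ˣ) : Ser ℤ))
    (vertexP [(0, -1 / 4, 1), (1, 3 / 4, -1)] [(0, -1 / 4, -1), (1, -1 / 4, 1)])

theorem latticePoint_add_one_zero (i : Fin 2) (s : ℂ) (q : ℤ) :
    latticePoint i s (q + 1) 0 = latticePoint i s q 0 + 1 := by
  simp [latticePoint]; ring

theorem alphaWeight_add (i : Fin 2) (q p : ℤ) :
    alphaWeight i (q + p) = alphaWeight i q + 2 * p := by
  simp [alphaWeight]; ring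

theorem inl_halfPow (x : ℂ) :
    Ser.map (AddMonoidHom.inl ℤ ℤ) (halfPow (x + 1)) *
        (linU ((1, 0) : ℤ × ℤ) (1 / 2) : Ser (ℤ × ℤ)) =
      Ser.map (AddMonoidHom.inl ℤ ℤ) (halfPow x) *
        (linU ((1, 0) : ℤ × ℤ) (-1 / 2) : Ser (ℤ × ℤ)) := by
  have h := congrArg (Ser.map (AddMonoidHom.inl ℤ ℤ)) (halfPow_add_one x)
  rw [map_mul, map_mul] at h
  have e : ∀ a : ℂ, Ser.map (AddMonoidHom.inl ℤ ℤ) (linU (1 : ℤ) a : Ser ℤ) =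
      (linU ((1, 0) : ℤ × ℤ) a : Ser (ℤ × ℤ)) := fun a =>
    congrArg Units.val (Ser.map_linU (AddMonoidHom.inl ℤ ℤ) 1 a)
  rw [e, e] at h
  exact h

/-- The product `f(u) g(v)`. -/
abbrev prodF (f g : Fld ℤ Op₀) : Fld (ℤ × ℤ) Op₀ := Fld.bil (mulB Op₀) f g

/-- The product `g(v) f(u)`. -/
abbrev prodF' (f g : Fld ℤ Op₀) : Fld (ℤ × ℤ) Op₀ := Fld.bil (mulB Op₀).flip f g

/-- The contraction gives the ratio of `u - v + ħ/4` and `u - v + 5ħ/4` times `(u + ħ/2) / (u -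
ħ/2)`. The last factor is compensated by the lattice: `X⁺` raises the eigenvalue of `∂_{ε₁}` by one.
The other order has no contraction. -/
theorem kPlus_vPlus (i : Fin 2) (s : ℂ) : diffS (5 / 4) • prodF (kPlusF i s 0) (vPlusF i) =
    diffS (1 / 4) • prodF' (kPlusF i s 0) (vPlusF i) := by
  refine exchange_tw [(-1 / 2, -3 / 4)] [(1 / 2, -3 / 4)] [] [] ?_ ?_ _ _ fun q => ?_
  · simp [pairSum, jsum, ellSum]; abel
  · simp [pairSum, jsum, ellSum]
  · have h := inl_halfPow (latticePoint i s q 0)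
    have hU := Units.inv_mul (linU ((1, 0) : ℤ × ℤ) (-1 / 2))
    rw [← latticePoint_add_one_zero] at h
    simp only [diffProd, linProd, List.map_cons, List.map_nil, List.prod_cons, List.prod_nil,
      mul_one, add_zero]
    rw [show (1 / 2 - -3 / 4 : ℂ) = 5 / 4 by norm_num,
      show (-1 / 2 - -3 / 4 : ℂ) = 1 / 4 by norm_num]
    generalize Ser.map (AddMonoidHom.inr ℤ ℤ) _ = t
    refine ⟨Ser.map (AddMonoidHom.inl ℤ ℤ) (halfPow (latticePoint i s (q + 1) 0)) * t *
      ((linU ((1, 0) : ℤ × ℤ) (-1 / 2))⁻¹ : (Ser (ℤ × ℤ))ˣ), _, ?_, rfl, ?_⟩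
    · linear_combination (-diffS (5 / 4) * t *
        Ser.map (AddMonoidHom.inl ℤ ℤ) (halfPow (latticePoint i s (q + 1) 0))) * hU
    · linear_combination (t * diffS (1 / 4) *
        ((linU ((1, 0) : ℤ × ℤ) (-1 / 2))⁻¹ : (Ser (ℤ × ℤ))ˣ)) * h + (diffS (1 / 4) * t *
        Ser.map (AddMonoidHom.inl ℤ ℤ) (halfPow (latticePoint i s q 0))) * hU

theorem kPlus_vMinus (i : Fin 2) (s : ℂ) : diffS (-1 / 4) • prodF (kPlusF i s 0) (vMinusF i) =
    diffS (3 / 4) • prodF' (kPlusF i s 0) (vMinusF i) := by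
  refine exchange_tw [(1 / 2, -1 / 4)] [(-1 / 2, -1 / 4)] [] [] ?_ ?_ _ _ fun q => ?_
  · simp [pairSum, jsum, ellSum]; abel
  · simp [pairSum, jsum, ellSum]
  · have h := inl_halfPow (latticePoint i s (q + -1) 0)
    have hU := Units.inv_mul (linU ((1, 0) : ℤ × ℤ) (1 / 2))
    rw [← latticePoint_add_one_zero, neg_add_cancel_right] at h
    simp only [diffProd, linProd, List.map_cons, List.map_nil, List.prod_cons, List.prod_nil,
      mul_one, add_zero]
    rw [show (1 / 2 - -1 / 4 : ℂ) = 3 / 4 by norm_num,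
      show (-1 / 2 - -1 / 4 : ℂ) = -1 / 4 by norm_num]
    generalize Ser.map (AddMonoidHom.inr ℤ ℤ) _ = t
    refine ⟨Ser.map (AddMonoidHom.inl ℤ ℤ) (halfPow (latticePoint i s (q + -1) 0)) * t *
      ((linU ((1, 0) : ℤ × ℤ) (1 / 2))⁻¹ : (Ser (ℤ × ℤ))ˣ), _, ?_, rfl, ?_⟩
    · linear_combination (-diffS (-1 / 4) * t *
        Ser.map (AddMonoidHom.inl ℤ ℤ) (halfPow (latticePoint i s (q + -1) 0))) * hU
    · linear_combination (-t * diffS (3 / 4) *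
        ((linU ((1, 0) : ℤ × ℤ) (1 / 2))⁻¹ : (Ser (ℤ × ℤ))ˣ)) * h + (diffS (3 / 4) * t *
        Ser.map (AddMonoidHom.inl ℤ ℤ) (halfPow (latticePoint i s q 0))) * hU

/-- Here `k₁⁻` has only creation operators, so only the opposite order has a contraction. Its linear
factors in `v` are equal in numerator and denominator, and the lattice does not interfere. -/
theorem kMinus_vPlus (i : Fin 2) : diffS (3 / 4) • prodF (kMinusF 0) (vPlusF i) =
    diffS (-1 / 4) • prodF' (kMinusF 0) (vPlusF i) := by
  refine exchange_tw [] [] [(1 / 4, 1)] [(1 / 4, 0)] ?_ ?_ _ _ fun q => ?_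
  · simp [pairSum, jsum, ellSum]
  · simp [pairSum, jsum, ellSum, kMinusCre]; abel
  · simp only [diffProd, linProd, List.map_cons, List.map_nil, List.prod_cons, List.prod_nil,
      mul_one, add_zero]
    rw [show (1 - 1 / 4 : ℂ) = 3 / 4 by norm_num,
      show (0 - 1 / 4 : ℂ) = -1 / 4 by norm_num]
    have hU := Units.inv_mul (linU ((0, 1) : ℤ × ℤ) (1 / 4))
    generalize Ser.map (AddMonoidHom.inr ℤ ℤ) _ = t
    generalize Ser.map (AddMonoidHom.inl ℤ ℤ) 1 = t'
    refine ⟨_, -(t' * t * ((linU ((0, 1) : ℤ × ℤ) (1 / 4))⁻¹ : (Ser (ℤ × ℤ))ˣ)), rfl, ?_, ?_⟩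
    · linear_combination (-diffS (-1 / 4) * t * t') * hU
    · linear_combination (-diffS (3 / 4) * t * t') * hU

theorem kMinus_vMinus (i : Fin 2) : diffS (1 / 4) • prodF (kMinusF 0) (vMinusF i) =
    diffS (5 / 4) • prodF' (kMinusF 0) (vMinusF i) := by
  refine exchange_tw [] [] [(-1 / 4, 0)] [(-1 / 4, 1)] ?_ ?_ _ _ fun q => ?_
  · simp [pairSum, jsum, ellSum]
  · simp [pairSum, jsum, ellSum, kMinusCre]; abel
  · simp only [diffProd, linProd, List.map_cons, List.map_nil, List.prod_cons, List.prod_nil,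
      mul_one, add_zero]
    rw [show (1 - -1 / 4 : ℂ) = 5 / 4 by norm_num,
      show (0 - -1 / 4 : ℂ) = 1 / 4 by norm_num]
    have hU := Units.inv_mul (linU ((0, 1) : ℤ × ℤ) (-1 / 4))
    generalize Ser.map (AddMonoidHom.inr ℤ ℤ) _ = t
    generalize Ser.map (AddMonoidHom.inl ℤ ℤ) 1 = t'
    refine ⟨_, -(t' * t * ((linU ((0, 1) : ℤ × ℤ) (-1 / 4))⁻¹ : (Ser (ℤ × ℤ))ˣ)), rfl, ?_, ?_⟩
    · linear_combination (-diffS (5 / 4) * t * t') * hU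
    · linear_combination (-diffS (1 / 4) * t * t') * hU

/-- Currents without contractions commute. -/
theorem commute_tw {cre ann cre' ann' : List (Fin 2 × ℂ × ℤ)} {σ σ' : ℤ → Ser ℤ}
    (h : pairSum ann cre' ellS = 0) (h' : pairSum ann' cre ellS = 0) :
    prodF (tw 0 σ (vertexP cre ann)) (tw 0 σ' (vertexP cre' ann')) =
      prodF' (tw 0 σ (vertexP cre ann)) (tw 0 σ' (vertexP cre' ann')) := by
  have := exchange_tw (cre := cre) (ann := ann) (cre' := cre') (ann' := ann') (p := 0) (p' := 0)
    (σ := σ) (σ' := σ') [] [] [] [] (by simp [h, ellSum]) (by simp [h', ellSum]) 1 1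
    (fun q => ⟨_, _, (by simp [diffProd, linProd]; rfl), (by simp [linProd]; rfl),
      (by simp [diffProd, linProd])⟩)
  simpa only [one_smul] using this

theorem kPlus_kPlus (i : Fin 2) (s : ℂ) (j j' : Fin 2) :
    prodF (kPlusF i s j) (kPlusF i s j') = prodF' (kPlusF i s j) (kPlusF i s j') :=
  commute_tw (by simp [pairSum]) (by simp [pairSum])

theorem kMinus_kMinus (j j' : Fin 2) :
    prodF (kMinusF j) (kMinusF j') = prodF' (kMinusF j) (kMinusF j') :=
  commute_tw (by simp [pairSum, jsum]) (by simp [pairSum, jsum])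

theorem kPlus_kMinus_zero (i : Fin 2) (s : ℂ) :
    prodF (kPlusF i s 0) (kMinusF 0) = prodF' (kPlusF i s 0) (kMinusF 0) :=
  commute_tw (by simp [pairSum, jsum, kMinusCre]) (by simp [pairSum])

/-- With `d = 1/2` these are the factors `(u - v + (d + 1) ħ) (u - v - d ħ)` and `(u - v + (1 - d)
ħ) (u - v + d ħ)` that the mixed quadratic relation at level one prescribes for `k₁⁺` and `k₂⁻`. -/
theorem kPlus_kMinus_one (i : Fin 2) (s : ℂ) :
    (diffS (3 / 2) * diffS (-1 / 2)) • prodF (kPlusF i s 0) (kMinusF 1) =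
      (diffS (1 / 2) * diffS (1 / 2)) • prodF' (kPlusF i s 0) (kMinusF 1) := by
  refine exchange_tw [(1 / 2, 0), (-1 / 2, -1)] [(1 / 2, -1), (-1 / 2, 0)] [] [] ?_ ?_ _ _
    fun q => ?_
  · simp [pairSum, jsum, ellSum, kMinusCre]; abel
  · simp [pairSum]
  · simp only [diffProd, linProd, List.map_cons, List.map_nil, List.prod_cons, List.prod_nil,
      mul_one, add_zero]
    rw [show (1 / 2 - -1 : ℂ) = 3 / 2 by norm_num, show (-1 / 2 - 0 : ℂ) = -1 / 2 by norm_num,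
      show (1 / 2 - 0 : ℂ) = 1 / 2 by norm_num, show (-1 / 2 - -1 : ℂ) = 1 / 2 by norm_num]
    have hU := Units.inv_mul (linU ((1, 0) : ℤ × ℤ) (1 / 2))
    have hU' := Units.inv_mul (linU ((1, 0) : ℤ × ℤ) (-1 / 2))
    generalize Ser.map (AddMonoidHom.inr ℤ ℤ) _ = t
    generalize Ser.map (AddMonoidHom.inl ℤ ℤ) _ = t'
    refine ⟨t' * t * ((linU ((1, 0) : ℤ × ℤ) (1 / 2))⁻¹ : (Ser (ℤ × ℤ))ˣ) *
      ((linU ((1, 0) : ℤ × ℤ) (-1 / 2))⁻¹ : (Ser (ℤ × ℤ))ˣ), _, ?_, rfl, ?_⟩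
    · generalize ((linU ((1, 0) : ℤ × ℤ) (1 / 2))⁻¹ : (Ser (ℤ × ℤ))ˣ).val = a at *
      generalize ((linU ((1, 0) : ℤ × ℤ) (-1 / 2))⁻¹ : (Ser (ℤ × ℤ))ˣ).val = b at *
      generalize (linU ((1, 0) : ℤ × ℤ) (1 / 2)).val = c at *
      generalize (linU ((1, 0) : ℤ × ℤ) (-1 / 2)).val = d at *
      linear_combination (-diffS (3 / 2) * diffS (-1 / 2) * t * t') * hU' +
        (-diffS (3 / 2) * diffS (-1 / 2) * t * t' * b * d) * hU
    · generalize ((linU ((1, 0) : ℤ × ℤ) (1 / 2))⁻¹ : (Ser (ℤ × ℤ))ˣ).val = a at *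
      generalize ((linU ((1, 0) : ℤ × ℤ) (-1 / 2))⁻¹ : (Ser (ℤ × ℤ))ˣ).val = b at *
      generalize (linU ((1, 0) : ℤ × ℤ) (1 / 2)).val = c at *
      generalize (linU ((1, 0) : ℤ × ℤ) (-1 / 2)).val = d at *
      linear_combination (diffS (1 / 2) * diffS (1 / 2) * t * t') * hU' +
        (diffS (1 / 2) * diffS (1 / 2) * t * t' * b * d) * hU

theorem Ser.map_linU_zpow_val {G H : Type*} [AddCommGroup G] [AddCommGroup H] (φ : G →+ H) (g : G)
    (a : ℂ) (k : ℤ) : Ser.map φ ((linU g a ^ k : (Ser G)ˣ) : Ser G) =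
      ((linU (φ g) a ^ k : (Ser H)ˣ) : Ser H) := Ser.map_linU_zpow φ g a k

/-- Up to linear factors the contractions are `(u - v)(u - v + ħ)` and `(u - v)(u - v - ħ)`. Since
`e^α` changes `∂_α` by `2`, the lattice supplies `(u + ħ/4)²` or `(v + ħ/4)²`, which removes those
linear factors. -/
theorem vPlus_vPlus (i : Fin 2) : diffS (-1) • prodF (vPlusF i) (vPlusF i) =
    diffS 1 • prodF' (vPlusF i) (vPlusF i) := by
  refine exchange_tw [(1 / 4, -3 / 4), (1 / 4, 1 / 4)] [] [(1 / 4, -3 / 4), (1 / 4, 1 / 4)] [] ?_ ?_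
    _ _ fun q => ?_
  · simp [pairSum, jsum, ellSum]; abel
  · simp [pairSum, jsum, ellSum]; abel
  · simp only [diffProd, linProd, List.map_cons, List.map_nil, List.prod_cons, List.prod_nil,
      mul_one, Ser.map_linU_zpow_val, alphaWeight_add]
    rw [show (1 / 4 - -3 / 4 : ℂ) = 1 by norm_num, show (-3 / 4 - 1 / 4 : ℂ) = -1 by norm_num,
      show (1 / 4 - 1 / 4 : ℂ) = 0 by norm_num]
    simp only [AddMonoidHom.inl_apply, AddMonoidHom.inr_apply]
    generalize alphaWeight i q = w
    refine ⟨diffS (-1) * (linU ((1, 0) : ℤ × ℤ) (1 / 4) ^ w : (Ser (ℤ × ℤ))ˣ) *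
      (linU ((0, 1) : ℤ × ℤ) (1 / 4) ^ w : (Ser (ℤ × ℤ))ˣ),
      diffS 1 * (linU ((1, 0) : ℤ × ℤ) (1 / 4) ^ w : (Ser (ℤ × ℤ))ˣ) *
      (linU ((0, 1) : ℤ × ℤ) (1 / 4) ^ w : (Ser (ℤ × ℤ))ˣ), ?_, ?_, ?_⟩
    · rw [zpow_add, Units.val_mul, zpow_two, Units.val_mul]
      ring
    · rw [zpow_add _ w, Units.val_mul, zpow_two, Units.val_mul]
      ring
    · ring

theorem vMinus_vMinus (i : Fin 2) : diffS 1 • prodF (vMinusF i) (vMinusF i) =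
    diffS (-1) • prodF' (vMinusF i) (vMinusF i) := by
  refine exchange_tw [(-1 / 4, -1 / 4), (-1 / 4, 3 / 4)] [] [(-1 / 4, -1 / 4), (-1 / 4, 3 / 4)] []
    ?_ ?_ _ _ fun q => ?_
  · simp [pairSum, jsum, ellSum]; abel
  · simp [pairSum, jsum, ellSum]; abel
  · simp only [diffProd, linProd, List.map_cons, List.map_nil, List.prod_cons, List.prod_nil,
      mul_one, Ser.map_linU_zpow_val, alphaWeight_add]
    rw [show (-1 / 4 - 3 / 4 : ℂ) = -1 by norm_num, show (3 / 4 - -1 / 4 : ℂ) = 1 by norm_num,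
      show (-1 / 4 - -1 / 4 : ℂ) = 0 by norm_num]
    simp only [AddMonoidHom.inl_apply, AddMonoidHom.inr_apply]
    generalize alphaWeight i q = w
    refine ⟨diffS 1 * (linU ((1, 0) : ℤ × ℤ) (-1 / 4) ^ (-w) : (Ser (ℤ × ℤ))ˣ) *
      (linU ((0, 1) : ℤ × ℤ) (-1 / 4) ^ (-w) : (Ser (ℤ × ℤ))ˣ),
      diffS (-1) * (linU ((1, 0) : ℤ × ℤ) (-1 / 4) ^ (-w) : (Ser (ℤ × ℤ))ˣ) *
      (linU ((0, 1) : ℤ × ℤ) (-1 / 4) ^ (-w) : (Ser (ℤ × ℤ))ˣ), ?_, ?_, ?_⟩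
    · rw [show -(w + 2 * -1) = -w + 2 by ring, zpow_add, Units.val_mul, zpow_two, Units.val_mul]
      ring
    · rw [show -(w + 2 * -1) = -w + 2 by ring, zpow_add _ (-w), Units.val_mul, zpow_two,
        Units.val_mul]
      ring
    · ring

/-! ### Shifts of vertex operators -/

/-- The constant distribution `1` in one variable. -/
def unitF : Fld ℤ ℂ := Fld.single0 fun m => if m = 0 then 1 else 0

theorem vac_vertexP (cre ann : List (Fin 2 × ℂ × ℤ)) :
    Fld.map vac (vertexP cre ann) = unitF := by
  funext m n
  rw [Fld.map_apply, vertexP, vacCoeff_apply]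
  refine (coeff0_wick cre (serFin_expS_annExp ann) m n 1).trans ?_
  unfold posF
  rw [unitF, Fld.single0]
  split_ifs with h h' h'' h'' h'
  · rw [coeff_expS_apply_of_kill (coeff_annExp_one ann), if_pos]
    · simp
    · rw [h', h'']; simp [expo]
  · rw [coeff_expS_apply_of_kill (coeff_annExp_one ann), if_neg]
    · simp
    · intro h2
      exact h'' (by rw [← expo_apply_zero m (-n).toNat, h2]; rfl)
  · rw [coeff_expS_apply_of_kill (coeff_annExp_one ann), if_neg]
    · simp
    · intro h2
      have := expo_apply_one m (-n).toNat
      rw [h2] at this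
      simp at this
      omega
  · omega
  · simp
  · simp

/-- The exponents shifted by `b`. -/
def shl (b : ℂ) (l : List (Fin 2 × ℂ × ℤ)) : List (Fin 2 × ℂ × ℤ) :=
  l.map fun x => (x.1, b + x.2.1, x.2.2)

theorem jsum_shl {M : Type*} [AddCommGroup M] (b : ℂ) (l : List (Fin 2 × ℂ × ℤ)) (j : Fin 2)
    (g : ℂ → M) : jsum (shl b l) j g = jsum l j fun c => g (b + c) := by
  rw [jsum, jsum, shl, List.map_map]
  rfl

theorem jsum_append {M : Type*} [AddCommGroup M] (l l' : List (Fin 2 × ℂ × ℤ)) (j : Fin 2)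
    (g : ℂ → M) : jsum (l ++ l') j g = jsum l j g + jsum l' j g := by
  rw [jsum, jsum, jsum, List.map_append, List.sum_append]

theorem jsum_pair {M N : Type*} [AddCommGroup M] [AddCommGroup N] (l : List (Fin 2 × ℂ × ℤ))
    (j : Fin 2) (g : ℂ → M) (g' : ℂ → N) :
    jsum l j (fun b => (g b, g' b)) = (jsum l j g, jsum l j g') :=
  Prod.ext (map_jsum (AddMonoidHom.fst M N) l j fun b => (g b, g' b))
    (map_jsum (AddMonoidHom.snd M N) l j fun b => (g b, g' b))

theorem shift_vertexWt_smul {V : Type*} [AddCommGroup V] [Module ℂ V] (b : ℂ)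
    (cre ann : List (Fin 2 × ℂ × ℤ)) (j : Fin 2) (k : ℤ) (f : Fld ℤ V) :
    Fld.shift b (vertexWt cre ann j k • f) =
      vertexWt (shl b cre) (shl b ann) j k • Fld.shift b f := by
  let S : AddSubgroup (Ser ℤ × Ser ℤ) :=
    { carrier := {p | Fld.shift b (p.1 • f) = p.2 • Fld.shift b f}
      zero_mem' := by
        change Fld.shift b ((0 : Ser ℤ) • f) = (0 : Ser ℤ) • _
        rw [zero_smul, zero_smul, Fld.shift_zero]
      add_mem' := by
        intro p q hp hq
        change Fld.shift b ((p.1 + q.1) • f) = (p.2 + q.2) • _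
        rw [add_smul, add_smul, Fld.shift_add, hp, hq]
      neg_mem' := by
        intro p hp
        change Fld.shift b ((-p.1) • f) = (-p.2) • _
        rw [neg_smul, neg_smul, Fld.shift_neg, hp] }
  have h : ∀ l, Fld.shift b (jsum l j (fun c => ((linU (1 : ℤ) c ^ k : (Ser ℤ)ˣ) : Ser ℤ)) • f) =
      jsum (shl b l) j (fun c => ((linU (1 : ℤ) c ^ k : (Ser ℤ)ˣ) : Ser ℤ)) • Fld.shift b f := by
    intro l
    have h1 : (jsum l j (fun c => ((linU (1 : ℤ) c ^ k : (Ser ℤ)ˣ) : Ser ℤ)),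
        jsum (shl b l) j (fun c => ((linU (1 : ℤ) c ^ k : (Ser ℤ)ˣ) : Ser ℤ))) ∈ S := by
      rw [jsum_shl, ← jsum_pair]
      exact jsum_mem S l j fun c => Fld.shift_linU_zpow b c f k
    exact h1
  unfold vertexWt
  by_cases hk : 0 < k
  · rw [if_pos hk, if_pos hk, h]
  · rw [if_neg hk, if_neg hk, neg_smul, neg_smul, Fld.shift_neg, h]

/-- The shift changes the commutators with the bosons exactly as it changes the exponents, and it
preserves the vacuum expectation `1`. Irreducibility replaces any expansion of the exponentials. -/
theorem shift_vertexP (b : ℂ) (cre ann : List (Fin 2 × ℂ × ℤ)) :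
    Fld.shift b (vertexP cre ann) = vertexP (shl b cre) (shl b ann) := by
  refine Primary.ext ((primary_vertexP cre ann).shift b fun j k => shift_vertexWt_smul b _ _ j k _)
    (primary_vertexP _ _) ?_
  rw [Fld.map_shift, vac_vertexP, vac_vertexP, unitF, Fld.shift_single0]

/-! ### The delta function -/

section Delta

variable {V W : Type*} [AddCommGroup V] [Module ℂ V] [AddCommGroup W] [Module ℂ W]

/-- The coefficient of `v ^ j`. -/
def slice (j : ℤ) (f : Fld (ℤ × ℤ) V) : Fld ℤ V := fun m i => f m (i, j)

theorem slice_smul (p : Ser ℤ) (f : Fld (ℤ × ℤ) V) (j : ℤ) :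
    slice j (Ser.map (AddMonoidHom.inl ℤ ℤ) p • f) = p • slice j f := by
  have h : ∀ (a : AddMonoidAlgebra ℂ ℤ) (F : ℤ × ℤ → V) (x : ℤ),
      conv (ℤ × ℤ) V (AddMonoidAlgebra.mapDomainRingHom ℂ (AddMonoidHom.inl ℤ ℤ) a) F (x, j) =
        conv ℤ V a (fun i => F (i, j)) x := by
    intro a F x
    induction a using AddMonoidAlgebra.induction_linear with
    | zero => simp
    | add a b ha hb => simp only [map_add, LinearMap.add_apply, Pi.add_apply, ha, hb]
    | single g c =>
      rw [AddMonoidAlgebra.mapDomainRingHom_apply, AddMonoidAlgebra.mapDomain_single, conv_single,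
        conv_single]
      simp
  funext m i
  rw [slice, Fld.smul_def, Fld.smul_def, Finset.sum_apply, Finset.sum_apply]
  refine Finset.sum_congr rfl fun a _ => ?_
  rw [Ser.map, PowerSeries.coeff_map]
  exact h _ _ _

theorem fld_ext_slice {f g : Fld (ℤ × ℤ) V} (h : ∀ j, slice j f = slice j g) : f = g := by
  funext m x
  exact congrFun (congrFun (h x.2) m) x.1

/-- The distribution `δ(u + b ħ - v) f(u)`. -/
def deltaF (b : ℂ) (f : Fld ℤ V) : Fld (ℤ × ℤ) V := fun m x =>
  (((linU (1 : ℤ) b ^ (-x.2 - 1) : (Ser ℤ)ˣ) : Ser ℤ) • f) m x.1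

theorem slice_deltaF (b : ℂ) (f : Fld ℤ V) (j : ℤ) : slice j (deltaF b f) =
    ((linU (1 : ℤ) b ^ (-j - 1) : (Ser ℤ)ˣ) : Ser ℤ) • f := rfl

theorem deltaF_smul (b : ℂ) (p : Ser ℤ) (f : Fld ℤ V) :
    deltaF b (p • f) = Ser.map (AddMonoidHom.inl ℤ ℤ) p • deltaF b f :=
  fld_ext_slice fun j => by rw [slice_smul, slice_deltaF, slice_deltaF, smul_comm]

theorem map_deltaF (L : V →ₗ[ℂ] W) (b : ℂ) (f : Fld ℤ V) :
    Fld.map L (deltaF b f) = deltaF b (Fld.map L f) := by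
  funext m x
  exact congrFun (congrFun (Fld.map_smul L _ f) m) x.1

theorem inl_linU (a : ℂ) : Ser.map (AddMonoidHom.inl ℤ ℤ) (linU (1 : ℤ) a : Ser ℤ) =
    (linU ((1, 0) : ℤ × ℤ) a : Ser (ℤ × ℤ)) :=
  congrArg Units.val (Ser.map_linU (AddMonoidHom.inl ℤ ℤ) 1 a)

/-- On the support of the delta function `v` equals `u + b ħ`: the coefficients of consecutive
powers of `v` differ by this unit. -/
theorem mon_smul_deltaF (b : ℂ) (f : Fld ℤ V) : (mon ((0, 1) : ℤ × ℤ) : Ser (ℤ × ℤ)) • deltaF b f =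
    (linU ((1, 0) : ℤ × ℤ) b : Ser (ℤ × ℤ)) • deltaF b f := by
  refine fld_ext_slice fun j => ?_
  rw [← inl_linU, slice_smul, slice_deltaF, ← mul_smul]
  have e : slice j ((mon ((0, 1) : ℤ × ℤ) : Ser (ℤ × ℤ)) • deltaF b f) =
      slice (j - 1) (deltaF b f) := by
    funext m i
    rw [slice, mon_smul, slice]
    simp
  rw [e, slice_deltaF, ← Units.val_mul, ← zpow_one_add]
  congr 3
  ring

theorem linU_smul_deltaF (b c : ℂ) (f : Fld ℤ V) :
    (linU ((0, 1) : ℤ × ℤ) c : Ser (ℤ × ℤ)) • deltaF b f =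
      (linU ((1, 0) : ℤ × ℤ) (b + c) : Ser (ℤ × ℤ)) • deltaF b f := by
  rw [linU_val, add_smul, mon_smul_deltaF, ← add_smul, linU_val, linU_val, add_assoc, ← add_mul,
    ← cS_add]

theorem linU_zpow_smul_deltaF (b c : ℂ) (k : ℤ) (f : Fld ℤ V) :
    ((linU ((0, 1) : ℤ × ℤ) c ^ k : (Ser (ℤ × ℤ))ˣ) : Ser (ℤ × ℤ)) • deltaF b f =
      ((linU ((1, 0) : ℤ × ℤ) (b + c) ^ k : (Ser (ℤ × ℤ))ˣ) : Ser (ℤ × ℤ)) • deltaF b f :=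
  zpow_smul_eq (linU_smul_deltaF b c f) k

theorem diffS_smul_deltaF (b : ℂ) (f : Fld ℤ V) : diffS b • deltaF b f = 0 := by
  have h := mon_smul_deltaF b f
  rw [← sub_eq_zero, ← sub_smul] at h
  rw [← neg_eq_zero, ← neg_smul, ← h, linU_val, diffS]
  refine congrArg (· • deltaF b f) ?_
  ring

theorem vertexWt_smul_deltaF (b : ℂ) (cre ann cre' ann' : List (Fin 2 × ℂ × ℤ)) (j : Fin 2)
    (k : ℤ) (f : Fld ℤ V) :
    (Ser.map (AddMonoidHom.inl ℤ ℤ) (vertexWt cre ann j k) +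
      Ser.map (AddMonoidHom.inr ℤ ℤ) (vertexWt cre' ann' j k)) • deltaF b f =
      Ser.map (AddMonoidHom.inl ℤ ℤ) (vertexWt (cre ++ shl b cre') (ann ++ shl b ann') j k) •
        deltaF b f := by
  let S : AddSubgroup (Ser ℤ × Ser ℤ) :=
    { carrier := {p | Ser.map (AddMonoidHom.inr ℤ ℤ) p.1 • deltaF b f =
        Ser.map (AddMonoidHom.inl ℤ ℤ) p.2 • deltaF b f}
      zero_mem' := by
        change Ser.map (AddMonoidHom.inr ℤ ℤ) 0 • deltaF b f =
          Ser.map (AddMonoidHom.inl ℤ ℤ) 0 • deltaF b f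
        rw [map_zero, map_zero]
      add_mem' := by
        intro p q hp hq
        change Ser.map (AddMonoidHom.inr ℤ ℤ) (p.1 + q.1) • deltaF b f =
          Ser.map (AddMonoidHom.inl ℤ ℤ) (p.2 + q.2) • deltaF b f
        rw [map_add, map_add, add_smul, add_smul, hp, hq]
      neg_mem' := by
        intro p hp
        change Ser.map (AddMonoidHom.inr ℤ ℤ) (-p.1) • deltaF b f =
          Ser.map (AddMonoidHom.inl ℤ ℤ) (-p.2) • deltaF b f
        rw [map_neg, map_neg, neg_smul, neg_smul, hp] }
  have h : ∀ l, Ser.map (AddMonoidHom.inr ℤ ℤ)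
      (jsum l j (fun c => ((linU (1 : ℤ) c ^ k : (Ser ℤ)ˣ) : Ser ℤ))) • deltaF b f =
      Ser.map (AddMonoidHom.inl ℤ ℤ)
        (jsum (shl b l) j (fun c => ((linU (1 : ℤ) c ^ k : (Ser ℤ)ˣ) : Ser ℤ))) • deltaF b f := by
    intro l
    suffices h1 : (jsum l j (fun c => ((linU (1 : ℤ) c ^ k : (Ser ℤ)ˣ) : Ser ℤ)),
        jsum (shl b l) j (fun c => ((linU (1 : ℤ) c ^ k : (Ser ℤ)ˣ) : Ser ℤ))) ∈ S from h1
    rw [jsum_shl, ← jsum_pair]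
    refine jsum_mem S l j fun c => ?_
    change Ser.map (AddMonoidHom.inr ℤ ℤ) _ • deltaF b f =
      Ser.map (AddMonoidHom.inl ℤ ℤ) _ • deltaF b f
    rw [Ser.map_linU_zpow_val, Ser.map_linU_zpow_val]
    exact linU_zpow_smul_deltaF b c k f
  rw [add_smul]
  unfold vertexWt
  split_ifs
  · rw [jsum_append, map_add, add_smul, h]
  · rw [jsum_append, neg_add, map_add, add_smul, map_neg, map_neg, map_neg, neg_smul, neg_smul,
      neg_smul, h]

/-- At `v = u + b ħ` the two lists of exponents merge into one, in which terms may cancel. A delta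
function times a single vertex operator can therefore have the same commutators with the bosons as a
product of two. -/
theorem primary_deltaF (b : ℂ) {cre ann cre' ann' cre'' ann'' : List (Fin 2 × ℂ × ℤ)}
    (h : ∀ j k, vertexWt cre'' ann'' j k =
      vertexWt (cre ++ shl b cre') (ann ++ shl b ann') j k) :
    Primary (fun j k => Ser.map (AddMonoidHom.inl ℤ ℤ) (vertexWt cre ann j k) +
      Ser.map (AddMonoidHom.inr ℤ ℤ) (vertexWt cre' ann' j k))
      (deltaF b (vertexP cre'' ann'')) := by
  intro j k hk
  rw [map_deltaF, primary_vertexP cre'' ann'' j k hk, deltaF_smul, h, vertexWt_smul_deltaF]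

/-- The part of the delta function with non-negative powers of `v`. -/
def deltaHalf (b : ℂ) (f : Fld ℤ V) : Fld (ℤ × ℤ) V := fun m x =>
  if 0 ≤ x.2 then deltaF b f m x else 0

theorem slice_deltaHalf (b : ℂ) (f : Fld ℤ V) (j : ℤ) :
    slice j (deltaHalf b f) = if 0 ≤ j then slice j (deltaF b f) else 0 := by
  by_cases hj : 0 ≤ j
  · rw [if_pos hj]
    funext m i
    exact if_pos hj
  · rw [if_neg hj]
    funext m i
    exact if_neg hj

end Delta

/-- `deltaHalf b unitF` is the expansion of `1 / (u - v + b ħ)` in non-negative powers of `v`; the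
coefficients telescope and only `v ^ 0` remains. -/
theorem diffS_smul_deltaHalf (b : ℂ) : diffS b • deltaHalf b unitF = unitFld := by
  have e : diffS b = (linU ((1, 0) : ℤ × ℤ) b : Ser (ℤ × ℤ)) - mon (0, 1) := by
    rw [linU_val, diffS]; ring
  have em : ∀ (f : Fld (ℤ × ℤ) ℂ) j, slice j ((mon ((0, 1) : ℤ × ℤ) : Ser (ℤ × ℤ)) • f) =
      slice (j - 1) f := by
    intro f j
    funext m i
    rw [slice, mon_smul, slice]
    simp
  refine fld_ext_slice fun j => ?_
  have es : ∀ (f g : Fld (ℤ × ℤ) ℂ), slice j (f - g) = slice j f - slice j g := fun f g => rfl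
  rw [e, sub_smul, es, ← inl_linU, slice_smul, em, slice_deltaHalf, slice_deltaHalf]
  have h : (linU (1 : ℤ) b : Ser ℤ) • slice j (deltaF b unitF) = slice (j - 1) (deltaF b unitF) := by
    rw [← slice_smul, inl_linU, ← mon_smul_deltaF, em]
  have hu : slice j unitFld = if j = 0 then unitF else 0 := by
    funext m i
    by_cases hj : j = 0 <;> by_cases hm : m = 0 <;> by_cases hi : i = 0 <;>
      simp [slice, unitFld, unitF, Fld.single0, hj, hm, hi] <;> rfl
  rw [hu]
  rcases lt_trichotomy j 0 with h0 | rfl | h0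
  · rw [if_neg (by omega), if_neg (by omega), if_neg (by omega), smul_zero, sub_zero]
  · rw [if_pos le_rfl, if_neg (by omega), if_pos rfl, sub_zero, h, slice_deltaF]
    simp
  · rw [if_pos h0.le, if_pos (by omega), if_neg (by omega), h, sub_self]

theorem diffS_smul_apply {V : Type*} [AddCommGroup V] [Module ℂ V] (c : ℂ) (f : Fld (ℤ × ℤ) V)
    (m : ℕ) (i j : ℤ) :
    (diffS c • f) m (i, j) = f m (i - 1, j) - f m (i, j - 1) + c • (hS (ℤ × ℤ) • f) m (i, j) := by
  rw [diffS, add_smul, sub_smul, mul_smul, Fld.add_apply, cS_smul]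
  congr 1
  change ((mon ((1, 0) : ℤ × ℤ) : Ser (ℤ × ℤ)) • f) m (i, j) -
    ((mon ((0, 1) : ℤ × ℤ) : Ser (ℤ × ℤ)) • f) m (i, j) = _
  rw [mon_smul, mon_smul]
  simp

/-- At the lowest order in `ħ` the equation says that the coefficients depend only on `i + j`. A
one-sided bound on the powers of `v` then forces them to vanish. Without the bound, delta functions
are solutions. -/
theorem eq_zero_of_diffS_smul {c : ℂ} {f : Fld (ℤ × ℤ) ℂ} (h : diffS c • f = 0)
    (hs : (∀ m i j, j < 0 → f m (i, j) = 0) ∨ ∃ N, ∀ m i j, N ≤ j → f m (i, j) = 0) : f = 0 := by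
  funext m
  induction m using Nat.strong_induction_on with
  | _ m ih =>
    have h1 : ∀ i j, f m (i - 1, j) = f m (i, j - 1) := by
      intro i j
      have h2 := congrFun (congrFun h m) (i, j)
      rw [diffS_smul_apply] at h2
      have h3 : (hS (ℤ × ℤ) • f) m = 0 := by
        cases m with
        | zero => exact Fld.X_smul_zero f
        | succ m => rw [Fld.X_smul_succ, ih m (Nat.lt_succ_self m)]; rfl
      rw [h3] at h2
      have h4 : (0 : Fld (ℤ × ℤ) ℂ) m (i, j) = 0 := rfl
      rw [h4, Pi.zero_apply, smul_zero, add_zero, sub_eq_zero] at h2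
      exact h2
    funext x
    obtain ⟨i, j⟩ := x
    change f m (i, j) = 0
    rcases hs with hs | ⟨N, hs⟩
    · have h2 : ∀ (n : ℕ) (i j : ℤ), j < n → f m (i, j) = 0 := by
        intro n
        induction n with
        | zero => intro i j hj; exact hs m i j (by exact_mod_cast hj)
        | succ n ihn =>
          intro i j hj
          have := h1 (i + 1) j
          rw [add_sub_cancel_right] at this
          rw [this]
          exact ihn _ _ (by push_cast at hj; omega)
      exact h2 (j + 1).toNat i j (by omega)
    · have h2 : ∀ (n : ℕ) (i j : ℤ), N ≤ j + n → f m (i, j) = 0 := by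
        intro n
        induction n with
        | zero => intro i j hj; exact hs m i j (by simpa using hj)
        | succ n ihn =>
          intro i j hj
          have := h1 i (j + 1)
          rw [add_sub_cancel_right] at this
          rw [← this]
          exact ihn _ _ (by push_cast at hj; omega)
      exact h2 (N - j).toNat i j (by omega)

/-! ### The commutator of `X⁺` and `X⁻` -/

section Slice

variable {V : Type*} [AddCommGroup V] [Module ℂ V]

theorem slice_sub (j : ℤ) (f g : Fld (ℤ × ℤ) V) : slice j (f - g) = slice j f - slice j g := rfl

theorem Fld.smul_sub {G : Type*} [AddCommGroup G] (p : Ser G) (f g : Fld G V) :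
    p • (f - g) = p • f - p • g := _root_.smul_sub p f g

theorem slice_mon_smul (j : ℤ) (f : Fld (ℤ × ℤ) V) :
    slice j ((mon ((0, 1) : ℤ × ℤ) : Ser (ℤ × ℤ)) • f) = slice (j - 1) f := by
  funext m i
  rw [slice, mon_smul, slice]
  simp

theorem slice_hS_smul (j : ℤ) (f : Fld (ℤ × ℤ) V) : slice j (hS (ℤ × ℤ) • f) = hS ℤ • slice j f := by
  rw [← slice_smul]
  refine congrArg (fun x => slice j (x • f)) ?_
  exact (Ser.map_X _).symm

theorem slice_diffS_smul (c : ℂ) (j : ℤ) (f : Fld (ℤ × ℤ) V) :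
    slice j (diffS c • f) = (linU (1 : ℤ) c : Ser ℤ) • slice j f - slice (j - 1) f := by
  have e : diffS c = (linU ((1, 0) : ℤ × ℤ) c : Ser (ℤ × ℤ)) - mon (0, 1) := by
    rw [linU_val, diffS]; ring
  rw [e, sub_smul, slice_sub, ← inl_linU, slice_smul, slice_mon_smul]

theorem slice_linU_smul (c : ℂ) (j : ℤ) (f : Fld (ℤ × ℤ) V) :
    slice j ((linU ((0, 1) : ℤ × ℤ) c : Ser (ℤ × ℤ)) • f) =
      slice (j - 1) f + (cS c * hS ℤ : Ser ℤ) • slice j f := by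
  have e : Ser.map (AddMonoidHom.inl ℤ ℤ) (cS c * hS ℤ : Ser ℤ) = cS c * hS (ℤ × ℤ) := by
    rw [map_mul, Ser.map_cS, Ser.map_X]
  rw [linU_val, add_smul, ← e]
  change slice j (mon ((0, 1) : ℤ × ℤ) • f) + slice j (_ • f) = _
  rw [slice_mon_smul, slice_smul]

theorem eq_zero_of_diffS_smul_smul {a b : ℂ} {f : Fld (ℤ × ℤ) ℂ} (h : diffS a • diffS b • f = 0)
    (hs : (∀ j < 0, slice j f = 0) ∨ ∃ N, ∀ j ≥ N, slice j f = 0) : f = 0 := by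
  have h0 : ∀ {g : Fld (ℤ × ℤ) ℂ} {j : ℤ}, slice j g = 0 → ∀ m i, g m (i, j) = 0 :=
    fun h m i => congrFun (congrFun h m) i
  rcases hs with hs | ⟨N, hs⟩
  · have h1 : diffS b • f = 0 := by
      refine eq_zero_of_diffS_smul h (Or.inl fun m i j hj => h0 ?_ m i)
      rw [slice_diffS_smul, hs j hj, hs (j - 1) (by omega), smul_zero, sub_zero]
    exact eq_zero_of_diffS_smul h1 (Or.inl fun m i j hj => h0 (hs j hj) m i)
  · have h1 : diffS b • f = 0 := by
      refine eq_zero_of_diffS_smul h (Or.inr ⟨N + 1, fun m i j hj => h0 ?_ m i⟩)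
      rw [slice_diffS_smul, hs j (by omega), hs (j - 1) (by omega), smul_zero, sub_zero]
    exact eq_zero_of_diffS_smul h1 (Or.inr ⟨N, fun m i j hj => h0 (hs j hj) m i⟩)

end Slice

theorem diffS_sub_diffS (a b : ℂ) : diffS a - diffS b = cS (a - b) * hS (ℤ × ℤ) := by
  rw [diffS, diffS, cS_sub]; ring

theorem hS_eq_diffS : hS (ℤ × ℤ) = diffS (1 / 2) - diffS (-1 / 2) := by
  rw [diffS_sub_diffS, show (1 / 2 - -1 / 2 : ℂ) = 1 by norm_num, cS_one, one_mul]

/-- Subtracting the full delta function from the half with `j ≥ 0` leaves the expansion of `1 / (u -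
v + b ħ)` in negative powers of `v`. -/
theorem diffS_smul_deltaDiff (b : ℂ) :
    diffS b • (deltaHalf b unitF - deltaF b unitF) = unitFld := by
  rw [smul_sub, diffS_smul_deltaHalf, diffS_smul_deltaF, sub_zero]

/-- The partial fractions `ħ / ((x + ħ/2)(x - ħ/2)) = 1/(x - ħ/2) - 1/(x + ħ/2)` with `x = u - v`,
expanded in non-negative powers of `v`. The support condition selects this expansion. -/
theorem expansion_right {f : Fld (ℤ × ℤ) ℂ}
    (h : (diffS (1 / 2) * diffS (-1 / 2)) • f = unitFld) (hs : ∀ j < 0, slice j f = 0) :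
    hS (ℤ × ℤ) • f = deltaHalf (-1 / 2) unitF - deltaHalf (1 / 2) unitF := by
  rw [← sub_eq_zero]
  refine eq_zero_of_diffS_smul_smul (a := 1 / 2) (b := -1 / 2) ?_ (Or.inl fun j hj => ?_)
  · rw [← mul_smul, smul_sub, smul_sub, smul_comm, h, mul_smul, diffS_smul_deltaHalf,
      mul_comm (diffS (1 / 2)), mul_smul, diffS_smul_deltaHalf, hS_eq_diffS, sub_smul, sub_self]
  · rw [slice_sub, slice_sub, slice_hS_smul, hs j hj, slice_deltaHalf, slice_deltaHalf,
      if_neg (by omega), if_neg (by omega), smul_zero, sub_zero, sub_zero]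

theorem expansion_left {f : Fld (ℤ × ℤ) ℂ} {c : ℂ}
    (h : (diffS (1 / 2) * diffS (-1 / 2)) • f =
      ((linU ((0, 1) : ℤ × ℤ) c * linU ((0, 1) : ℤ × ℤ) c : (Ser (ℤ × ℤ))ˣ) : Ser (ℤ × ℤ)) • unitFld)
    (hs : ∀ j ≥ 1, slice j f = 0) :
    hS (ℤ × ℤ) • f =
      ((linU ((0, 1) : ℤ × ℤ) c * linU ((0, 1) : ℤ × ℤ) c : (Ser (ℤ × ℤ))ˣ) : Ser (ℤ × ℤ)) •
        ((deltaHalf (-1 / 2) unitF - deltaF (-1 / 2) unitF) -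
          (deltaHalf (1 / 2) unitF - deltaF (1 / 2) unitF)) := by
  rw [← sub_eq_zero]
  have h1 : ∀ b : ℂ, ∀ j ≥ 0, slice j (deltaHalf b unitF - deltaF b unitF) = 0 := by
    intro b j hj
    rw [slice_sub, slice_deltaHalf, if_pos hj, sub_self]
  -- The two factors `v + c ħ` move the support by at most two powers of `v`, so the vanishing of
  -- the half series for `j ≥ 0` becomes vanishing for `j ≥ 2`.
  refine eq_zero_of_diffS_smul_smul (a := 1 / 2) (b := -1 / 2) ?_ (Or.inr ⟨2, fun j hj => ?_⟩)
  · rw [← mul_smul, smul_sub, smul_comm, h]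
    rw [smul_comm (diffS (1 / 2) * diffS (-1 / 2))
      ((linU ((0, 1) : ℤ × ℤ) c * linU ((0, 1) : ℤ × ℤ) c : (Ser (ℤ × ℤ))ˣ) : Ser (ℤ × ℤ)),
      smul_sub (diffS (1 / 2) * diffS (-1 / 2)), mul_smul, diffS_smul_deltaDiff,
      mul_comm (diffS (1 / 2)), mul_smul, diffS_smul_deltaDiff, smul_comm (hS _), hS_eq_diffS,
      sub_smul, sub_self]
  · have h2 : ∀ j ≥ 0, slice j ((deltaHalf (-1 / 2) unitF - deltaF (-1 / 2) unitF) -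
        (deltaHalf (1 / 2) unitF - deltaF (1 / 2) unitF)) = 0 := by
      intro j hj
      rw [slice_sub, h1 _ _ hj, h1 _ _ hj, sub_zero]
    rw [slice_sub, slice_hS_smul, hs j (by omega), Units.val_mul, mul_smul, slice_linU_smul,
      slice_linU_smul, slice_linU_smul, h2 j (by omega), h2 (j - 1) (by omega),
      h2 (j - 1 - 1) (by omega)]
    simp only [sub_zero, smul_zero, add_zero]

theorem slice_vac_bil (cre ann cre' ann' : List (Fin 2 × ℂ × ℤ)) {j : ℤ} (hj : j < 0) :
    slice j (Fld.map vac (Fld.bil (mulB OpP) (vertexP cre ann) (vertexP cre' ann'))) = 0 := by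
  funext m i
  rw [vac_bil_vertexP, slice, omega_apply]
  refine Finset.sum_eq_zero fun p _ => ?_
  have h : ∀ G : MvPowerSeries (Fin 2) Scalar, posF G p.2 j = 0 := fun G => if_neg (by omega)
  rw [h, posF_zero]

theorem slice_vac_bil_flip (cre ann cre' ann' : List (Fin 2 × ℂ × ℤ)) {j : ℤ} (hj : 1 ≤ j) :
    slice j (Fld.map vac (Fld.bil (mulB OpP).flip (vertexP cre ann) (vertexP cre' ann'))) = 0 := by
  have h : Fld.map vac (Fld.bil (mulB OpP).flip (vertexP cre ann) (vertexP cre' ann')) =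
      Fld.swap (Fld.map vac (Fld.bil (mulB OpP) (vertexP cre' ann') (vertexP cre ann))) := by
    rw [Fld.bil_flip_eq_swap]; rfl
  funext m i
  rw [h, vac_bil_vertexP, slice, Fld.swap, omega_apply]
  refine Finset.sum_eq_zero fun p _ => ?_
  exact if_neg (by simp only [Prod.fst_swap]; omega)

/-- The exponents of the bosonic part of `X⁺`. -/
abbrev vpCre : List (Fin 2 × ℂ × ℤ) := [(0, -3 / 4, -1), (1, 1 / 4, 1)]
/-- The exponents of the bosonic part of `X⁺`. -/
abbrev vpAnn : List (Fin 2 × ℂ × ℤ) := [(0, 1 / 4, 1), (1, 1 / 4, -1)]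
/-- The exponents of the bosonic part of `X⁻`. -/
abbrev vmCre : List (Fin 2 × ℂ × ℤ) := [(0, -1 / 4, 1), (1, 3 / 4, -1)]
/-- The exponents of the bosonic part of `X⁻`. -/
abbrev vmAnn : List (Fin 2 × ℂ × ℤ) := [(0, -1 / 4, -1), (1, -1 / 4, 1)]
/-- The exponents of `k₂⁺ / k₁⁺`. -/
abbrev psiAnn : List (Fin 2 × ℂ × ℤ) := [(1, 1 / 4, -1), (1, -3 / 4, 1), (0, 1 / 4, 1), (0, -3 / 4, -1)]
/-- The exponents of `k₂⁻ / k₁⁻`. -/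
abbrev psiCre : List (Fin 2 × ℂ × ℤ) := [(0, 1 / 4, 1), (0, -3 / 4, -1), (1, 5 / 4, -1), (1, 1 / 4, 1)]

/-- After the powers of `u + ħ/4` and `v - ħ/4` contributed by the lattice, both orders have the
same rational two-point function, expanded in opposite domains. The difference is carried by the
poles. At `v = u - ħ/2` the creation exponents cancel and at `v = u + ħ/2` the annihilation
exponents cancel, which leaves series in `u⁻¹` and in `u` respectively. -/
theorem vertexP_commutator :
    hS (ℤ × ℤ) • (((linU ((1, 0) : ℤ × ℤ) (1 / 4) ^ (-2 : ℤ) : (Ser (ℤ × ℤ))ˣ) : Ser (ℤ × ℤ)) •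
        Fld.bil (mulB OpP) (vertexP vpCre vpAnn) (vertexP vmCre vmAnn) -
      ((linU ((0, 1) : ℤ × ℤ) (-1 / 4) ^ (-2 : ℤ) : (Ser (ℤ × ℤ))ˣ) : Ser (ℤ × ℤ)) •
        Fld.bil (D := OpP) (mulB OpP).flip (vertexP vpCre vpAnn) (vertexP vmCre vmAnn)) =
    deltaF (-1 / 2) (vertexP [] psiAnn) - deltaF (1 / 2) (vertexP psiCre []) := by
  refine Primary.ext (Primary.smul (Primary.sub
    (((primary_vertexP _ _).bil (primary_vertexP _ _)).smul _)
    (((primary_vertexP _ _).bil_flip (primary_vertexP _ _)).smul _)) _)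
    (Primary.sub (primary_deltaF _ ?_) (primary_deltaF _ ?_)) ?_
  · intro j k
    refine congrArg₂ (fun x y : Ser ℤ => if 0 < k then x else y) ?_ ?_ <;>
      fin_cases j <;> norm_num [jsum, shl]
  · intro j k
    refine congrArg₂ (fun x y : Ser ℤ => if 0 < k then x else y) ?_ ?_ <;>
      fin_cases j <;> norm_num [jsum, shl] <;> abel
  · have hA := two_point vpCre vpAnn vmCre vmAnn [] [(1 / 4, -1 / 4), (1 / 4, 3 / 4)]
      (by simp [pairSum, jsum, ellSum])
    have hB := two_point_flip vpCre vpAnn vmCre vmAnn [] [(-1 / 4, -3 / 4), (-1 / 4, 1 / 4)]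
      (by simp [pairSum, jsum, ellSum])
    simp only [diffProd, linProd, List.map_cons, List.map_nil, List.prod_cons, List.prod_nil,
      mul_one, one_mul] at hA hB
    rw [show (1 / 4 - -1 / 4 : ℂ) = 1 / 2 by norm_num,
      show (1 / 4 - 3 / 4 : ℂ) = -1 / 2 by norm_num] at hA
    rw [show (-3 / 4 - -1 / 4 : ℂ) = -1 / 2 by norm_num,
      show (1 / 4 - -1 / 4 : ℂ) = 1 / 2 by norm_num, neg_mul_neg, mul_comm (diffS (-1 / 2)),
      ← Units.val_mul] at hB
    have hB' := expansion_left hB fun j hj => slice_vac_bil_flip _ _ _ _ hj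
    have hA' : hS (ℤ × ℤ) • ((linU ((1, 0) : ℤ × ℤ) (1 / 4) ^ (-2 : ℤ) : (Ser (ℤ × ℤ))ˣ) :
        Ser (ℤ × ℤ)) • Fld.map vac (Fld.bil (mulB OpP) (vertexP vpCre vpAnn) (vertexP vmCre vmAnn))
        = _ := expansion_right ?_ ?_
    · rw [Fld.map_smul, Fld.map_sub, Fld.map_smul, Fld.map_smul, smul_sub, hA', smul_comm (hS _),
        hB', ← mul_smul, ← Units.val_mul, Fld.map_sub, map_deltaF, map_deltaF, vac_vertexP,
        vac_vertexP, zpow_neg, zpow_two, inv_mul_cancel, Units.val_one, one_smul]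
      abel
    · rw [smul_comm, hA, ← mul_smul, ← Units.val_mul, ← Units.val_mul, zpow_neg, zpow_two,
        inv_mul_cancel, Units.val_one, one_smul]
    · intro j hj
      rw [← AddMonoidHom.inl_apply, ← Ser.map_linU_zpow_val, slice_smul, slice_vac_bil _ _ _ _ hj,
        smul_zero]

/-- The current `k₂⁺ / k₁⁺`, shifted. -/
def psiPlusF (i : Fin 2) : Fld ℤ Op₀ :=
  tw 0 (fun q => ((linU (1 : ℤ) (1 / 4) ^ alphaWeight i q : (Ser ℤ)ˣ) : Ser ℤ) *
    ((linU (1 : ℤ) (-3 / 4) ^ (-alphaWeight i q) : (Ser ℤ)ˣ) : Ser ℤ)) (vertexP [] psiAnn)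

/-- The current `k₂⁻ / k₁⁻`, shifted. -/
def psiMinusF : Fld ℤ Op₀ := tw 0 (fun _ => 1) (vertexP psiCre [])

/-- The coefficient of `v⁻¹` is the bracket with the zero mode of `X⁻`; the delta functions have
coefficient `1` there. Evaluated on their supports, the lattice scalars become powers of `u + ħ/4`
and `u - 3ħ/4` at the first pole and cancel at the second. -/
theorem vPlus_vMinus_slice (i : Fin 2) :
    slice (-1) (hS (ℤ × ℤ) • (prodF (vPlusF i) (vMinusF i) - prodF' (vPlusF i) (vMinusF i))) =
      psiPlusF i - psiMinusF := by
  have h : hS (ℤ × ℤ) • (prodF (vPlusF i) (vMinusF i) - prodF' (vPlusF i) (vMinusF i)) =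
      tw 0 (fun q => ((linU ((1, 0) : ℤ × ℤ) (1 / 4) ^ alphaWeight i q : (Ser (ℤ × ℤ))ˣ) :
        Ser (ℤ × ℤ)) * ((linU ((0, 1) : ℤ × ℤ) (-1 / 4) ^ (-alphaWeight i q) : (Ser (ℤ × ℤ))ˣ) :
        Ser (ℤ × ℤ))) (deltaF (-1 / 2) (vertexP [] psiAnn) - deltaF (1 / 2) (vertexP psiCre [])) := by
    refine (Fld.smul_sub (hS (ℤ × ℤ)) (prodF (vPlusF i) (vMinusF i)) _).trans ?_
    rw [prodF, prodF', vPlusF, vMinusF, bil_tw, bil_flip_tw, smul_tw, smul_tw,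
      ← vertexP_commutator]
    refine fldOp_ext fun m x q f => ?_
    have e : ∀ (a b : Fld (ℤ × ℤ) Op₀), (a - b) m x = a m x - b m x := fun _ _ => rfl
    rw [e, LinearMap.sub_apply, tw_apply_single, tw_apply_single, tw_apply_single,
      ← Finsupp.single_sub]
    refine congrArg (Finsupp.single (q + 0)) ?_
    have e' : ∀ {a b c : Fld (ℤ × ℤ) OpP}, a - b = c → a m x f - b m x f = c m x f := by
      rintro a b c rfl
      rfl
    refine e' ?_
    simp only [Ser.map_linU_zpow_val, alphaWeight_add]
    rw [smul_comm _ (hS (ℤ × ℤ)), smul_sub, smul_sub, ← mul_smul, ← mul_smul, ← mul_smul,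
      ← mul_smul]
    simp only [AddMonoidHom.inl_apply, AddMonoidHom.inr_apply]
    generalize alphaWeight i q = w
    refine congrArg₂ (· - ·) (congrArg (· • _) ?_) (congrArg (· • _) ?_)
    · rw [show w + 2 * -1 = w + -2 by ring, zpow_add, Units.val_mul]; ring
    · rw [show -(w + 2 * 1) = -w + -2 by ring, zpow_add _ (-w), Units.val_mul]; ring
  rw [h]
  refine fldOp_ext fun m x q f => ?_
  have e : ∀ (a b : Fld ℤ Op₀), (a - b) m x = a m x - b m x := fun _ _ => rfl
  rw [e, LinearMap.sub_apply, slice, tw_apply_single, psiPlusF, psiMinusF, tw_apply_single,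
    tw_apply_single, ← Finsupp.single_sub]
  refine congrArg (Finsupp.single (q + 0)) ?_
  have e' : ∀ {a : Fld (ℤ × ℤ) OpP} {b c : Fld ℤ OpP}, slice (-1) a = b - c →
      a m (x, -1) f = b m x f - c m x f := by
    intro a b c h
    have h1 := congrFun (congrFun h m) x
    exact congrArg (· f) h1
  refine e' ?_
  have h1 : ∀ (b : ℂ) (w : ℤ) (f : Fld ℤ OpP),
      (((linU ((1, 0) : ℤ × ℤ) (1 / 4) ^ w : (Ser (ℤ × ℤ))ˣ) : Ser (ℤ × ℤ)) *
        ((linU ((0, 1) : ℤ × ℤ) (-1 / 4) ^ (-w) : (Ser (ℤ × ℤ))ˣ) : Ser (ℤ × ℤ))) • deltaF b f =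
      deltaF b ((((linU (1 : ℤ) (1 / 4) ^ w : (Ser ℤ)ˣ) : Ser ℤ) *
        ((linU (1 : ℤ) (b + -1 / 4) ^ (-w) : (Ser ℤ)ˣ) : Ser ℤ)) • f) := by
    intro b w f
    rw [mul_smul, linU_zpow_smul_deltaF, deltaF_smul, map_mul, Ser.map_linU_zpow_val,
      Ser.map_linU_zpow_val, AddMonoidHom.inl_apply, mul_smul]
  rw [smul_sub, h1, h1, slice_sub, slice_deltaF, slice_deltaF]
  rw [show (-1 / 2 + -1 / 4 : ℂ) = -3 / 4 by norm_num,
    show (1 / 2 + -1 / 4 : ℂ) = 1 / 4 by norm_num, ← Units.val_mul (linU (1 : ℤ) (1 / 4) ^ _)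
      (linU (1 : ℤ) (1 / 4) ^ _), ← zpow_add, add_neg_cancel, zpow_zero]
  simp only [neg_neg, sub_self, zpow_zero, Units.val_one, one_smul]

/-! ### The quadratic relations from the Gauss decomposition -/

section RTTAlgebra

variable {A : Type*} [Ring A]

/-- The matrix generated from its first entry `k` by `E` and `F`. -/
def tMat (k E F : A) : Fin 2 → Fin 2 → A :=
  ![![k, ⁅E, k⁆], ![⁅k, F⁆, k + ⁅⁅E, k⁆, F⁆]]

@[simp] theorem tMat_00 (k E F : A) : tMat k E F 0 0 = k := rfl
@[simp] theorem tMat_01 (k E F : A) : tMat k E F 0 1 = ⁅E, k⁆ := rfl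
@[simp] theorem tMat_10 (k E F : A) : tMat k E F 1 0 = ⁅k, F⁆ := rfl
@[simp] theorem tMat_11 (k E F : A) : tMat k E F 1 1 = k + ⁅⁅E, k⁆, F⁆ := rfl

/-- The relations that make the entries of `tMat k E F` span a copy of the matrices. -/
structure IsTriple (k E F : A) : Prop where
  lie_k : ⁅⁅E, F⁆, k⁆ = 0
  lie_E : ⁅⁅E, F⁆, E⁆ = 2 * E
  lie_F : ⁅⁅E, F⁆, F⁆ = -2 * F
  serre_E : ⁅⁅E, k⁆, E⁆ = 0
  serre_F : ⁅⁅k, F⁆, F⁆ = 0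

/-- `E` acts on the two indices as on matrices. The entry `00` holds by definition, `01` is the
Serre relation, `10` is the invariance of `k` under `[E, F]` with the Jacobi identity, and `11`
combines these with the weight of `E`. -/
theorem IsTriple.lie_tMat_E (C : Type*) [CommRing C] [Algebra C A] {k E F : A} (h : IsTriple k E F)
    (i j : Fin 2) : ⁅tMat k E F i j, E⁆ = (if i = 1 then (1 : C) else 0) • tMat k E F 0 j -
      (if j = 0 then (1 : C) else 0) • tMat k E F i 1 := by
  obtain ⟨h1, h2, h3, h4, h5⟩ := h
  fin_cases i <;> fin_cases j <;>
    simp [Ring.lie_def] at h1 h2 h3 h4 h5 ⊢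
  · linear_combination (norm := noncomm_ring) h4
  · linear_combination (norm := noncomm_ring) h1
  · linear_combination (norm := noncomm_ring) h4 * F - F * h4 + h2 * k - k * h2 + E * h1 - h1 * E

theorem IsTriple.lie_tMat_F (C : Type*) [CommRing C] [Algebra C A] {k E F : A} (h : IsTriple k E F)
    (i j : Fin 2) : ⁅tMat k E F i j, F⁆ = (if i = 0 then (1 : C) else 0) • tMat k E F 1 j -
      (if j = 1 then (1 : C) else 0) • tMat k E F i 0 := by
  obtain ⟨h1, h2, h3, h4, h5⟩ := h
  fin_cases i <;> fin_cases j <;>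
    simp [Ring.lie_def] at h1 h2 h3 h4 h5 ⊢
  · linear_combination (norm := noncomm_ring) h5
  · linear_combination (norm := noncomm_ring) E * h5 - h5 * E + 2 * (h1 * F - F * h1) + k * h3 - h3 * k

variable {C : Type*} [CommRing C] [Algebra C A]

/-- The defect of the quadratic relation. -/
def rttDefect (P Q Y Y' η : C) (t T : Fin 2 → Fin 2 → A) (i j k l : Fin 2) : A :=
  P • (Y • (t i j * T k l) + η • (t k j * T i l)) -
    Q • (Y' • (T k l * t i j) + η • (T k j * t i l))

/-- By the Leibniz rule the bracket acts on each of the four indices. The permutation term only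
exchanges indices on which `x` acts in the same way for `t` and `T`, so the defect is again a
tensor. -/
theorem lie_rttDefect (P Q Y Y' η : C) {t T : Fin 2 → Fin 2 → A} {x : A} {e e' : Fin 2 → C}
    {r r' : Fin 2} (ht : ∀ i j, ⁅t i j, x⁆ = e i • t r j - e' j • t i r')
    (hT : ∀ i j, ⁅T i j, x⁆ = e i • T r j - e' j • T i r') (i j k l : Fin 2) :
    ⁅rttDefect P Q Y Y' η t T i j k l, x⁆ =
      e i • rttDefect P Q Y Y' η t T r j k l - e' j • rttDefect P Q Y Y' η t T i r' k l +
      e k • rttDefect P Q Y Y' η t T i j r l - e' l • rttDefect P Q Y Y' η t T i j k r' := by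
  have hm : ∀ a b : A, ⁅a * b, x⁆ = a * ⁅b, x⁆ + ⁅a, x⁆ * b := by
    intro a b
    simp only [Ring.lie_def]
    noncomm_ring
  have hs : ∀ (c : C) (a : A), ⁅c • a, x⁆ = c • ⁅a, x⁆ := by
    intro c a
    simp only [Ring.lie_def, smul_mul_assoc, mul_smul_comm, smul_sub]
  have hsub : ∀ a b : A, ⁅a - b, x⁆ = ⁅a, x⁆ - ⁅b, x⁆ := by
    intro a b
    simp only [Ring.lie_def]
    noncomm_ring
  have hadd : ∀ a b : A, ⁅a + b, x⁆ = ⁅a, x⁆ + ⁅b, x⁆ := by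
    intro a b
    simp only [Ring.lie_def]
    noncomm_ring
  simp only [rttDefect, hsub, hadd, hs, hm, ht, hT, mul_sub, sub_mul, smul_mul_assoc,
    mul_smul_comm]
  module

/-- Only `X 0 0 0 0`, `X 0 0 0 1`, `X 0 0 1 0` and `X 0 0 1 1` need the hypotheses on currents.
Bracketing a vanishing component with `E` or `F` gives a linear relation between neighbouring
components, and these relations reach all the others. -/
theorem rttDefect_eq_zero {P Q Y Y' η : C} (hPQ : P * (Y + η) = Q * (Y' + η)) {k K κ K₂ E F : A}
    (h : IsTriple k E F) (H : IsTriple K E F) (hkK : k * K = K * k) (hκ : κ * K = 1) (hκ' : K * κ = 1)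
    (hkK₂ : (P * Y) • (k * K₂) = (Q * Y') • (K₂ * k))
    (h12 : (Y' + η) • (k * ⁅E, K⁆) = Y' • (⁅E, K⁆ * k) + η • (K * ⁅E, k⁆))
    (h21 : Y • (k * ⁅K, F⁆) + η • (⁅k, F⁆ * K) = (Y + η) • (⁅K, F⁆ * k))
    (h22 : K + ⁅⁅E, K⁆, F⁆ = K₂ + ⁅K, F⁆ * κ * ⁅E, K⁆) (i j m n : Fin 2) :
    rttDefect P Q Y Y' η (tMat k E F) (tMat K E F) i j m n = 0 := by
  have hkκ : k * κ = κ * k := by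
    calc k * κ = κ * K * (k * κ) := by rw [hκ, one_mul]
      _ = κ * (K * k) * κ := by noncomm_ring
      _ = κ * k * (K * κ) := by rw [← hkK]; noncomm_ring
      _ = κ * k := by rw [hκ', mul_one]
  set X := rttDefect P Q Y Y' η (tMat k E F) (tMat K E F) with hX
  have hE := lie_rttDefect P Q Y Y' η (h.lie_tMat_E C) (H.lie_tMat_E C)
  have hF := lie_rttDefect P Q Y Y' η (h.lie_tMat_F C) (H.lie_tMat_F C)
  rw [← hX] at hE hF
  have h0 : ∀ x : A, ⁅(0 : A), x⁆ = 0 := fun x => by rw [Ring.lie_def, zero_mul, mul_zero, sub_zero]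
  have e0000 : X 0 0 0 0 = 0 := by
    simp only [hX, rttDefect, tMat_00, ← add_smul, ← mul_smul, hkK, hPQ, sub_self]
  have e0001 : X 0 0 0 1 = 0 := by
    simp only [hX, rttDefect, tMat_00, tMat_01]
    rw [← h12, ← add_smul, ← mul_smul, ← mul_smul, hPQ, sub_self]
  have e0010 : X 0 0 1 0 = 0 := by
    simp only [hX, rttDefect, tMat_00, tMat_10]
    rw [h21, ← add_smul, ← mul_smul, ← mul_smul, hPQ, sub_self]
  have e0011 : X 0 0 1 1 = 0 := by
    simp only [hX, rttDefect, tMat_00, tMat_10, tMat_01, tMat_11]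
    rw [h22]
    -- Multiplying `h21` on the right by `κ [E, K]` gathers the terms that come from the Gauss form
    -- of `T 1 1` into one with coefficient `Y + η`. The next identity does the same from the left
    -- with `h12`, and the two agree by `hPQ`.
    have e1 : Y • (k * (K₂ + ⁅K, F⁆ * κ * ⁅E, K⁆)) + η • (⁅k, F⁆ * ⁅E, K⁆) =
        Y • (k * K₂) + (Y + η) • (⁅K, F⁆ * (k * κ) * ⁅E, K⁆) := by
      have := congrArg (· * (κ * ⁅E, K⁆)) h21
      simp only [add_mul, smul_mul_assoc] at this
      rw [mul_assoc ⁅k, F⁆ K, ← mul_assoc K κ, hκ', one_mul] at this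
      rw [mul_add, smul_add, add_assoc]
      congr 1
      simp only [mul_assoc] at this ⊢
      exact this
    have e2 : Y' • ((K₂ + ⁅K, F⁆ * κ * ⁅E, K⁆) * k) + η • (⁅K, F⁆ * ⁅E, k⁆) =
        Y' • (K₂ * k) + (Y' + η) • (⁅K, F⁆ * (κ * k) * ⁅E, K⁆) := by
      have := congrArg ((⁅K, F⁆ * κ) * ·) h12
      simp only [mul_add, mul_smul_comm] at this
      rw [← mul_assoc (⁅K, F⁆ * κ) K, mul_assoc ⁅K, F⁆ κ K, hκ, mul_one] at this
      rw [add_mul, smul_add, add_assoc]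
      congr 1
      simp only [mul_assoc] at this ⊢
      exact this.symm
    rw [e1, e2, smul_add, smul_add, ← mul_smul, ← mul_smul, ← mul_smul, ← mul_smul, hkK₂, hPQ, hkκ,
      sub_self]
  have e0100 : X 0 1 0 0 = 0 := by simpa [h0, e0000, e0001] using hE 0 0 0 0
  have e1000 : X 1 0 0 0 = 0 := by simpa [h0, e0000, e0010] using (hF 0 0 0 0).symm
  have e0101 : X 0 1 0 1 = 0 := by simpa [h0, e0001] using hE 0 0 0 1
  have e1010 : X 1 0 1 0 = 0 := by simpa [h0, e0010] using (hF 0 0 1 0).symm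
  have e0111 : X 0 1 1 1 = 0 := by simpa [h0, e0011, e0001] using hE 0 0 1 1
  have e1011 : X 1 0 1 1 = 0 := by simpa [h0, e0011, e0010] using (hF 0 0 1 1).symm
  have e1001 : X 1 0 0 1 = 0 := by simpa [h0, e0001, e0011, e0000] using (hF 0 0 0 1).symm
  have e0110 : X 0 1 1 0 = 0 := by simpa [h0, e0010, e0011, e0000] using hE 0 0 1 0
  have e1100 : X 1 1 0 0 = 0 := by simpa [h0, e0100, e0000, e0110] using (hF 0 1 0 0).symm
  have e1111 : X 1 1 1 1 = 0 := by simpa [h0, e0111, e0011, e0110] using (hF 0 1 1 1).symm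
  have e1101 : X 1 1 0 1 = 0 := by simpa [h0, e0101, e0001, e0111, e0100] using (hF 0 1 0 1).symm
  have e1110 : X 1 1 1 0 = 0 := by simpa [h0, e0110, e0010] using (hF 0 1 1 0).symm
  fin_cases i <;> fin_cases j <;> fin_cases m <;> fin_cases n <;> assumption

/-- The relation between the entries `11` and `12`, for currents `V_n` with `V_0 = E`. -/
theorem lie_E_exchange {p q p' q' η : C} {k K E E₁ : A} (hkK : k * K = K * k)
    (h : q • ⁅E₁, k⁆ = p • (E * k) - (p + η * q) • (k * E))
    (h' : q' • ⁅E₁, K⁆ = p' • (E * K) - (p' + η * q') • (K * E)) :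
    (p * q' - p' * q + η * q * q') • (k * ⁅E, K⁆) =
      (p * q' - p' * q) • (⁅E, K⁆ * k) + (η * q * q') • (K * ⁅E, k⁆) := by
  -- As `k` and `K` commute, `[[E₁, k], K] = [[E₁, K], k]`. Both sides are known from the exchange
  -- relations, so the mode `E₁` is eliminated.
  have h1 : q' • (q • ⁅E₁, k⁆ * K - K * (q • ⁅E₁, k⁆)) =
      q • (q' • ⁅E₁, K⁆ * k - k * (q' • ⁅E₁, K⁆)) := by
    simp only [smul_mul_assoc, mul_smul_comm, ← smul_sub]
    rw [smul_comm]
    congr 2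
    simp only [Ring.lie_def]
    linear_combination (norm := noncomm_ring) E₁ * hkK - hkK * E₁
  rw [h, h'] at h1
  simp only [Ring.lie_def, sub_mul, mul_sub, smul_mul_assoc, mul_smul_comm, mul_assoc] at h1 ⊢
  have e1 : ∀ x, K * (k * x) = k * (K * x) := fun x => by rw [← mul_assoc, ← hkK, mul_assoc]
  rw [← hkK] at h1 ⊢
  simp only [e1] at h1 ⊢
  rw [← sub_eq_zero] at h1 ⊢
  rw [← neg_eq_zero, ← h1]
  module

theorem lie_F_exchange {p q p' q' η : C} {k K F F₁ : A} (hkK : k * K = K * k)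
    (h : q • ⁅k, F₁⁆ = p • (k * F) - (p + η * q) • (F * k))
    (h' : q' • ⁅K, F₁⁆ = p' • (K * F) - (p' + η * q') • (F * K)) :
    (p * q' - p' * q) • (k * ⁅K, F⁆) + (η * q * q') • (⁅k, F⁆ * K) =
      (p * q' - p' * q + η * q * q') • (⁅K, F⁆ * k) := by
  have h1 : q' • (K * (q • ⁅k, F₁⁆) - q • ⁅k, F₁⁆ * K) =
      q • (k * (q' • ⁅K, F₁⁆) - q' • ⁅K, F₁⁆ * k) := by
    simp only [smul_mul_assoc, mul_smul_comm, ← smul_sub]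
    rw [smul_comm]
    congr 2
    simp only [Ring.lie_def]
    linear_combination (norm := noncomm_ring) F₁ * hkK - hkK * F₁
  rw [h, h'] at h1
  simp only [Ring.lie_def, sub_mul, mul_sub, smul_mul_assoc, mul_smul_comm, mul_assoc] at h1 ⊢
  have e1 : ∀ x, K * (k * x) = k * (K * x) := fun x => by rw [← mul_assoc, ← hkK, mul_assoc]
  rw [← hkK] at h1 ⊢
  simp only [e1] at h1 ⊢
  rw [← sub_eq_zero] at h1 ⊢
  rw [← h1]
  module

/-- The Serre relation from the exchange relations. -/
theorem lie_lie_eq_zero {p q η : C} (hinj : ∀ Z : ℤ → A, (∀ n, p • Z n = q • Z (n + 1)) → Z = 0)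
    (h2 : ∀ x : A, x + x = 0 → x = 0) {k : A} {V : ℤ → A}
    (h : ∀ n, q • ⁅V (n + 1), k⁆ = p • (V n * k) - (p + η * q) • (k * V n))
    (hV : ∀ m n, V (m + 1) * V n - V m * V (n + 1) - η • (V m * V n) =
      V n * V (m + 1) - V (n + 1) * V m + η • (V n * V m)) : ⁅⁅V 0, k⁆, V 0⁆ = 0 := by
  -- `X 0 0` is minus the Serre element. The symmetrisation `Z` is introduced because `hV` controls
  -- products of modes only up to their order.
  let X : ℤ → ℤ → A := fun m n => V m * V n * k - (2 : C) • (V m * k * V n) + k * V m * V n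
  let Z : ℤ → ℤ → A := fun m n => X m n + X n m
  have hr : ∀ n, p • (V n * k) = q • (V (n + 1) * k) + ((p + η * q) • (k * V n)
      - q • (k * V (n + 1))) := by
    intro n
    have := h n
    rw [Ring.lie_def, smul_sub] at this
    linear_combination (norm := module) -this
  have hX : ∀ m n, p • (p • X m n - q • X m (n + 1)) - q • (p • X (m + 1) n - q • X (m + 1) (n + 1))
      = (η * q) • (k * (η * q) • (V m * V n) - q • (k * (V (m + 1) * V n - V m * V (n + 1)))) := by
    intro m n
    have a1 := fun x => congrArg (V x * ·) (hr n)
    have a2 := fun y => congrArg (· * V y) (hr m)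
    simp only [mul_add, mul_sub, add_mul, sub_mul, mul_smul_comm, smul_mul_assoc, mul_assoc] at a1 a2
    simp only [X, mul_assoc, mul_sub, mul_smul_comm]
    linear_combination (norm := module) p • a1 m - q • a1 (m + 1) - p • a2 n + q • a2 (n + 1) + η • q • a2 n
  -- The operation `p - q · (shift of the mode)`, applied in both indices, reduces `X` to `k` times
  -- a quadratic expression in the modes, and its symmetrisation vanishes by `hV`. Each of the two
  -- operations is injective by `hinj`.
  have hZ : ∀ m n, p • (p • Z m n - q • Z m (n + 1)) - q • (p • Z (m + 1) n - q • Z (m + 1) (n + 1))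
      = 0 := by
    intro m n
    have a1 := congrArg (fun x => (η * q * q) • (k * x)) (hV m n)
    simp only [mul_add, mul_sub, mul_smul_comm] at a1
    have b1 := hX m n
    have b2 := hX n m
    simp only [mul_sub, mul_smul_comm] at b1 b2
    simp only [Z]
    linear_combination (norm := module) b1 + b2 - a1
  have h1 : ∀ m n, p • Z m n - q • Z m (n + 1) = 0 := fun m n =>
    congrFun (hinj (fun m => p • Z m n - q • Z m (n + 1)) fun m => sub_eq_zero.1 (hZ m n)) m
  have h3 : Z 0 0 = 0 := congrFun (hinj (Z 0) fun n => sub_eq_zero.1 (h1 0 n)) 0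
  have h4 := h2 _ h3
  simp only [X, two_smul] at h4
  simp only [Ring.lie_def]
  rw [← neg_eq_zero, ← h4]
  noncomm_ring

/-- The entry `22` of the Gauss decomposition. -/
theorem gauss_entry {k κ K₂ E F : A} (hκ : k * κ = 1)
    (h : ⁅κ * ⁅E, k⁆, F⁆ = κ * K₂ - 1) :
    k + ⁅⁅E, k⁆, F⁆ = K₂ + ⁅k, F⁆ * κ * ⁅E, k⁆ := by
  have h1 := congrArg (k * ·) h
  rw [mul_sub, mul_one, ← mul_assoc, hκ, one_mul] at h1
  rw [← sub_eq_zero]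
  have h2 : k * (⁅E, k⁆ * F - F * ⁅E, k⁆) = k * (⁅E, k⁆ * F - F * ⁅E, k⁆) := rfl
  rw [Ring.lie_def (κ * _), mul_sub, ← mul_assoc k, ← mul_assoc k, hκ, one_mul] at h1
  rw [sub_eq_iff_eq_add] at h1
  rw [Ring.lie_def ⁅E, k⁆ F, h1, Ring.lie_def k F]
  have h3 : (k * F - F * k) * κ * ⁅E, k⁆ = k * F * κ * ⁅E, k⁆ - F * (k * κ) * ⁅E, k⁆ := by
    noncomm_ring
  rw [h3, hκ]
  noncomm_ring

end RTTAlgebra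

/-! ### Operator series on the lattice Fock space -/

/-- The action on the bosonic part. -/
def liftOp : OpP →ₐ[ℂ] Op₀ where
  toFun T := Finsupp.mapRange.linearMap T
  map_one' := Finsupp.lhom_ext fun q f => by simp
  map_mul' S T := Finsupp.lhom_ext fun q f => by simp
  map_zero' := Finsupp.lhom_ext fun q f => by simp
  map_add' S T := Finsupp.lhom_ext fun q f => by simp
  commutes' c := Finsupp.lhom_ext fun q f => by simp [Module.algebraMap_end_apply]

theorem liftOp_single (T : OpP) (q : ℤ) (f : Pol) :
    liftOp T (Finsupp.single q f) = Finsupp.single q (T f) := by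
  change Finsupp.mapRange.linearMap T (Finsupp.single q f) = _
  simp

theorem latticeDiag_single (g : ℤ → ℂ) (q : ℤ) (f : Pol) :
    latticeDiag g (Finsupp.single q f) = Finsupp.single q (g q • f) := by
  rw [latticeDiag, Finsupp.lsum_single]
  simp

theorem latticeShift_single (p q : ℤ) (f : Pol) :
    latticeShift p (Finsupp.single q f) = Finsupp.single (p + q) f := by
  simp [latticeShift]

theorem latticeShift_zero : latticeShift 0 = 1 :=
  Finsupp.lhom_ext fun q f => by rw [latticeShift_single, zero_add]; rfl

section MapSeries

variable {A B : Type*} [Ring A] [Algebra ℂ A] [Ring B] [Algebra ℂ B]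

/-- The map induced on series. -/
def mapS (L : A →ₐ[ℂ] B) : MvPowerSeries (Fin 2) A →+* MvPowerSeries (Fin 2) B :=
  MvPowerSeries.map (L : A →+* B)

theorem coeff_mapS (L : A →ₐ[ℂ] B) (d : Fin 2 →₀ ℕ) (X : MvPowerSeries (Fin 2) A) :
    MvPowerSeries.coeff d (mapS L X) = L (MvPowerSeries.coeff d X) := MvPowerSeries.coeff_map _ _ _

theorem mapS_expS (L : A →ₐ[ℂ] B) (X : MvPowerSeries (Fin 2) A) :
    mapS L (expS X) = expS (mapS L X) := map_expS L X

theorem mapS_bosonSumG (L : A →ₐ[ℂ] B) (a : ℕ → A) (g : ℕ → Scalar) :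
    mapS L (bosonSumG a g) = bosonSumG (fun k => L (a k)) g := map_bosonSumG L a g

end MapSeries

/-- A bosonic series on the lattice Fock space. -/
abbrev liftS : MvPowerSeries (Fin 2) OpP →+* MvPowerSeries (Fin 2) Op₀ :=
  mapS (A := OpP) (B := Op₀) liftOp

theorem coeff_liftS_single (d : Fin 2 →₀ ℕ) (X : MvPowerSeries (Fin 2) OpP) (q : ℤ) (f : Pol) :
    (MvPowerSeries.coeff d (liftS X) : Op₀) (Finsupp.single q f) =
      Finsupp.single q (MvPowerSeries.coeff d X f) := by
  have h := coeff_mapS (A := OpP) (B := Op₀) liftOp d X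
  rw [h, liftOp_single]

theorem liftS_expS (X : MvPowerSeries (Fin 2) OpP) : liftS (expS X) = expSeries (liftS X) := by
  have h := mapS_expS (A := OpP) (B := Op₀) liftOp X
  rw [h, expSeries_eq]

theorem coeff_liftS_mul_diagSeries (X : MvPowerSeries (Fin 2) OpP) (p : ℤ) (g : ℤ → Scalar)
    (d : Fin 2 →₀ ℕ) (q : ℤ) (f : Pol) :
    (MvPowerSeries.coeff d (liftS X * MvPowerSeries.C (latticeShift p) * diagSeries g) : Op₀)
      (Finsupp.single q f) =
    Finsupp.single (p + q) (MvPowerSeries.coeff d (scal OpP (g q) * X) f) := by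
  rw [(scal_commute (g q) X).eq, MvPowerSeries.coeff_mul, MvPowerSeries.coeff_mul,
    LinearMap.sum_apply, LinearMap.sum_apply, Finsupp.single_finsetSum]
  refine Finset.sum_congr rfl fun a _ => ?_
  have h1 : MvPowerSeries.coeff a.2 (diagSeries g) =
    latticeDiag fun q => MvPowerSeries.coeff a.2 (g q) := rfl
  rw [Module.End.mul_apply, Module.End.mul_apply, h1, latticeDiag_single, MvPowerSeries.coeff_mul_C,
    Module.End.mul_apply, latticeShift_single, coeff_liftS_single, MvPowerSeries.coeff_map]
  rfl

/-- The series of annihilation operators with a lattice scalar. -/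
def annOp (l : List (Fin 2 × ℂ × ℤ)) (F : ℤ → PowerSeries ℂ) : OpSeries :=
  liftS (expS (annExp l)) * diagSeries fun q => tz (F q)

/-- The series of creation operators. -/
def creOp (l : List (Fin 2 × ℂ × ℤ)) : OpSeries := liftS (expS (creExp l))

theorem expS_zero {A : Type*} [Ring A] [Algebra ℂ A] : expS (0 : MvPowerSeries (Fin 2) A) = 1 := by
  refine eq_of_theta (t := 0) ?_ ?_ ?_ ?_
  · rw [theta_expS (by simp) (by simp), map_zero]
  · rw [theta_one, zero_mul]
  · simp
  · rw [constantCoeff_expS, map_one]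

theorem serFin_one {V : Type*} [AddCommGroup V] [Module ℂ V] : SerFin (1 : EndSeries V) := by
  intro m f
  refine ⟨1, fun l hl => ?_⟩
  change MvPowerSeries.coeff (expo m l) (1 : EndSeries V) f = 0
  rw [MvPowerSeries.coeff_one, if_neg, LinearMap.zero_apply]
  intro h
  have := expo_apply_one m l
  rw [h] at this
  simp at this
  omega

theorem wick_one_left {V : Type*} [AddCommGroup V] [Module ℂ V] {E : EndSeries V} (h : SerFin E)
    (m : ℕ) (n : ℤ) : wick 1 E m n =
      if n ≤ 0 then MvPowerSeries.coeff (expo m (-n).toNat) E else 0 := by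
  have h1 : ∀ (k : ℕ) (x : ℤ), posF (1 : EndSeries V) k x = if k = 0 ∧ x = 0 then 1 else 0 := by
    intro k x
    unfold posF
    rw [MvPowerSeries.coeff_one]
    by_cases hx : 0 ≤ x
    · rw [if_pos hx]
      refine if_congr ⟨fun h => ?_, fun h => ?_⟩ rfl rfl
      · have h1 := expo_apply_zero k x.toNat
        have h2 := expo_apply_one k x.toNat
        rw [h] at h1 h2
        simp at h1 h2
        omega
      · rw [h.1, h.2]; simp [expo]
    · rw [if_neg hx, if_neg (by omega)]
  have h2 : ∀ l : ℕ, (∑ p ∈ Finset.HasAntidiagonal.antidiagonal m,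
      posF (1 : EndSeries V) p.1 (n + l) * MvPowerSeries.coeff (expo p.2 l) E) =
      if n + l = 0 then MvPowerSeries.coeff (expo m l) E else 0 := by
    intro l
    rw [Finset.sum_eq_single (0, m)]
    · rw [h1]
      by_cases hl : n + l = 0
      · rw [if_pos ⟨rfl, hl⟩, if_pos hl, one_mul]
      · rw [if_neg (fun h => hl h.2), if_neg hl, zero_mul]
    · rintro ⟨p, q⟩ hp hne
      rw [h1, if_neg, zero_mul]
      rintro ⟨h, -⟩
      have hp := Finset.HasAntidiagonal.mem_antidiagonal.1 hp
      simp at h hp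
      exact hne (by rw [← hp, h, zero_add])
    · simp
  refine LinearMap.ext fun f => ?_
  have h3 := h.wick 1 m n
  rw [wick_apply]
  simp only [h2] at h3 ⊢
  rw [lsum_apply_range h3 (N := (-n).toNat + 1)]
  · by_cases hn : n ≤ 0
    · rw [if_pos hn, Finset.sum_eq_single (-n).toNat]
      · rw [if_pos (by omega)]
      · intro l _ hl
        rw [if_neg (by omega), LinearMap.zero_apply]
      · simp
    · rw [if_neg hn]
      refine Finset.sum_eq_zero fun l _ => ?_
      rw [if_neg (by omega), LinearMap.zero_apply]
  · intro l hl
    rw [if_neg (by omega), LinearMap.zero_apply]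

theorem wick_one_right {V : Type*} [AddCommGroup V] [Module ℂ V] (C : EndSeries V)
    (m : ℕ) (n : ℤ) : wick C 1 m n = posF C m n := by
  refine LinearMap.ext fun f => ?_
  have h0 : ∀ k l, MvPowerSeries.coeff (expo k l) (1 : EndSeries V) =
      if k = 0 ∧ l = 0 then 1 else 0 := by
    intro k l
    rw [MvPowerSeries.coeff_one]
    refine if_congr ⟨fun h => ?_, fun h => ?_⟩ rfl rfl
    · have h1 := expo_apply_zero k l
      have h2 := expo_apply_one k l
      rw [h] at h1 h2
      simp at h1 h2
      omega
    · rw [h.1, h.2]; simp [expo]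
  rw [wick_apply, lsum_apply_range (serFin_one.wick C m n) (N := 1)]
  · rw [Finset.sum_range_one, LinearMap.sum_apply, Finset.sum_eq_single (m, 0)]
    · rw [h0, if_pos ⟨rfl, rfl⟩, mul_one]
      simp
    · rintro ⟨p, q⟩ hp hne
      rw [h0, if_neg, mul_zero, LinearMap.zero_apply]
      rintro ⟨h, -⟩
      have hp := Finset.HasAntidiagonal.mem_antidiagonal.1 hp
      simp at h hp
      exact hne (by rw [← hp, h]; rfl)
    · simp
  · intro l hl
    rw [LinearMap.sum_apply]
    refine Finset.sum_eq_zero fun p _ => ?_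
    rw [h0, if_neg (by omega), mul_zero, LinearMap.zero_apply]

theorem tw_annOp (l : List (Fin 2 × ℂ × ℤ)) (F : ℤ → PowerSeries ℂ) (m : ℕ) (n : ℤ) :
    tw 0 (fun q => kap (F q)) (vertexP [] l) m n =
      if n ≤ 0 then MvPowerSeries.coeff (expo m (-n).toNat) (annOp l F) else 0 := by
  refine Finsupp.lhom_ext fun q f => ?_
  have h : creExp [] = 0 := rfl
  rw [tw_apply_single, vertexP, h, expS_zero, ← wick_tz _ (serFin_expS_annExp l),
    wick_one_left ((serFin_expS_annExp l).scal_mul (tame_tz _))]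
  split_ifs
  · have h1 := coeff_liftS_mul_diagSeries (expS (annExp l)) 0 (fun q => tz (F q))
      (expo m (-n).toNat) q f
    rw [latticeShift_zero, map_one, mul_one, zero_add] at h1
    rw [annOp, h1, add_zero]
  · simp

theorem tw_creOp (l : List (Fin 2 × ℂ × ℤ)) (m : ℕ) (n : ℤ) :
    tw 0 (fun _ => 1) (vertexP l []) m n = posF (creOp l) m n := by
  refine Finsupp.lhom_ext fun q f => ?_
  have h : annExp [] = 0 := rfl
  rw [tw_apply_single, one_smul, vertexP, h, expS_zero, wick_one_right, add_zero]
  unfold posF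
  split_ifs
  · rw [creOp, coeff_liftS_single]
  · simp

/-- The sum over the pairs `(r, l)` is really a sum over `l`: on a given lattice point the total
power `n` fixes `r`. This matches it with the locally finite sum in `wick`. -/
theorem vertexCoeff_eq (cre ann : List (Fin 2 × ℂ × ℤ)) (F : ℤ → PowerSeries ℂ) (p : ℤ) (w : ℤ → ℤ)
    (n : ℤ) (x : Fock₀) (m : ℕ) :
    (vertexCoeff (creOp cre) (liftS (expS (annExp ann)) * MvPowerSeries.C (latticeShift p) *
      diagSeries fun q => tz (F q)) w n x).coeff m =
      tw p (fun q => mon (w q) * kap (F q)) (vertexP cre ann) m n x := by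
  set A := liftS (expS (annExp ann)) * MvPowerSeries.C (latticeShift p) *
      diagSeries fun q => tz (F q)
  let T : ℕ × ℕ → ℕ × ℕ → Op₀ := fun a rl => MvPowerSeries.coeff (expo a.1 rl.1) (creOp cre) *
    MvPowerSeries.coeff (expo a.2 rl.2) A *
      latticeDiag fun q => if (rl.1 : ℤ) + w q - rl.2 = n then 1 else 0
  change ∑ a ∈ Finset.HasAntidiagonal.antidiagonal m, ∑ᶠ rl : ℕ × ℕ, T a rl x = _
  have hE : ∀ q, SerFin (scal OpP (tz (F q)) * expS (annExp ann)) := fun q =>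
    (serFin_expS_annExp ann).scal_mul (tame_tz _)
  have hT : ∀ a rl q f, T a rl (Finsupp.single q f) = if (rl.1 : ℤ) + w q - rl.2 = n then
      Finsupp.single (q + p) (MvPowerSeries.coeff (expo a.1 rl.1) (expS (creExp cre))
        (MvPowerSeries.coeff (expo a.2 rl.2) (scal OpP (tz (F q)) * expS (annExp ann)) f)) else 0 := by
    intro a rl q f
    simp only [T]
    rw [Module.End.mul_apply, Module.End.mul_apply, latticeDiag_single]
    split_ifs with h
    · rw [one_smul, coeff_liftS_mul_diagSeries, creOp, coeff_liftS_single, add_comm p]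
    · simp
  -- The condition on the exponents gives `r = n - w q + l`, so a bound on `l` bounds the support.
  have hfin : ∀ (a : ℕ × ℕ) q f N, (∀ l ≥ N, MvPowerSeries.coeff (expo a.2 l)
      (scal OpP (tz (F q)) * expS (annExp ann)) f = 0) → (Function.support fun rl =>
        T a rl (Finsupp.single q f)) ⊆
      ((Finset.range N).image fun l : ℕ => ((n - w q + l).toNat, l) : Finset (ℕ × ℕ)) := by
    intro a q f N hN rl hrl
    rw [Function.mem_support, hT] at hrl
    have h1 : (rl.1 : ℤ) + w q - rl.2 = n := by
      by_contra h
      rw [if_neg h] at hrl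
      exact hrl rfl
    rw [if_pos h1] at hrl
    have h2 : rl.2 < N := by
      by_contra h
      rw [hN _ (by omega)] at hrl
      exact hrl (by simp)
    rw [Finset.mem_coe, Finset.mem_image]
    refine ⟨rl.2, Finset.mem_range.2 h2, Prod.ext ?_ rfl⟩
    change (n - w q + rl.2).toNat = rl.1
    omega
  have hfin' : ∀ a x, (Function.support fun rl => T a rl x).Finite := by
    intro a x
    induction x using Finsupp.induction_linear with
    | zero => simp
    | add x y hx hy =>
      refine (hx.union hy).subset fun rl h => ?_
      rw [Function.mem_support, map_add] at h
      by_contra h1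
      simp only [Set.mem_union, Function.mem_support, not_or, not_not] at h1
      exact h (by rw [h1.1, h1.2, add_zero])
    | single q f =>
      obtain ⟨N, hN⟩ := hE q a.2 f
      exact (Finset.finite_toSet _).subset (hfin a q f N hN)
  induction x using Finsupp.induction_linear with
  | zero => simp
  | add x y hx hy =>
    rw [map_add, ← hx, ← hy, ← Finset.sum_add_distrib]
    refine Finset.sum_congr rfl fun a _ => ?_
    rw [← finsum_add_distrib (hfin' a x) (hfin' a y)]
    simp only [map_add]
  | single q f =>
    rw [tw_apply_single, mul_smul, vertexP, ← wick_tz _ (serFin_expS_annExp ann), mon_smul]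
    have h1 : ∃ N, ∀ a ∈ Finset.HasAntidiagonal.antidiagonal m, ∀ l ≥ N,
        MvPowerSeries.coeff (expo a.2 l) (scal OpP (tz (F q)) * expS (annExp ann)) f = 0 := by
      choose N hN using fun k => hE q k f
      refine ⟨(Finset.HasAntidiagonal.antidiagonal m).sup fun a => N a.2, fun a ha l hl => ?_⟩
      exact hN a.2 l (le_trans (Finset.le_sup (f := fun a : ℕ × ℕ => N a.2) ha) hl)
    obtain ⟨N, hN⟩ := h1
    rw [wick_apply, lsum_apply_range ((hE q).wick _ m (n - w q)) (N := N)]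
    · have h2 : ∀ a ∈ Finset.HasAntidiagonal.antidiagonal m, ∑ᶠ rl : ℕ × ℕ,
          T a rl (Finsupp.single q f) = ∑ l ∈ Finset.range N, Finsupp.single (q + p)
            ((posF (expS (creExp cre)) a.1 (n - w q + l) *
              MvPowerSeries.coeff (expo a.2 l) (scal OpP (tz (F q)) * expS (annExp ann))) f) := by
        intro a ha
        rw [finsum_eq_sum_of_support_subset _ (hfin a q f N (hN a ha)), Finset.sum_image]
        · refine Finset.sum_congr rfl fun l _ => ?_
          rw [hT, Module.End.mul_apply]
          unfold posF
          by_cases h3 : 0 ≤ n - w q + l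
          · rw [if_pos h3, if_pos (by simp only; omega)]
          · rw [if_neg h3, if_neg (by simp only; omega)]
            simp
        · intro l _ l' _ h
          exact congrArg Prod.snd h
      rw [Finset.sum_congr rfl h2, Finset.sum_comm]
      simp only [LinearMap.sum_apply, Finsupp.single_finsetSum]
    · intro l hl
      rw [LinearMap.sum_apply]
      refine Finset.sum_eq_zero fun a ha => ?_
      rw [Module.End.mul_apply, hN a ha l hl, map_zero]

/-! ### The explicit vertex operators -/

theorem liftS_bosonSumG (a : ℕ → OpP) (g : ℕ → Scalar) :
    liftS (bosonSumG a g) = bosonSum (fun k => liftOp (a k)) g :=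
  (mapS_bosonSumG (A := OpP) (B := Op₀) liftOp a g).trans (bosonSum_eq _ _).symm

theorem liftS_annExp (l : List (Fin 2 × ℂ × ℤ)) : liftS (annExp l) =
    (l.map fun x => x.2.2 • bosonSum (fun k => boson x.1 k) (negPow x.2.1)).sum := by
  rw [annExp, map_list_sum, List.map_map]
  congr 2
  funext x
  rw [Function.comp_apply, map_zsmul, liftS_bosonSumG]
  rfl

theorem liftS_creExp (l : List (Fin 2 × ℂ × ℤ)) : liftS (creExp l) =
    (l.map fun x => x.2.2 • bosonSum (fun k => boson x.1 (-(k : ℤ))) (posPow x.2.1)).sum := by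
  rw [creExp, map_list_sum, List.map_map]
  congr 2
  funext x
  rw [Function.comp_apply, map_zsmul, liftS_bosonSumG]
  rfl

theorem bosonSum_sub_right (a : ℕ → Op₀) (g g' : ℕ → Scalar) :
    bosonSum a (fun k => g k - g' k) = bosonSum a g - bosonSum a g' := bosonSumG_sub_right a g g'

theorem bosonSum_sub_left (a a' : ℕ → Op₀) (g : ℕ → Scalar) :
    bosonSum (fun k => a k - a' k) g = bosonSum a g - bosonSum a' g := bosonSumG_sub_left a a' g

theorem kPlusOp_eq (i : Fin 2) (s : ℂ) (j : Fin 2) : kPlusOp i s j =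
    annOp [(j, 1 / 2, -1), (j, -1 / 2, 1)] fun q => powS halfT (latticePoint i s q j) := by
  rw [kPlusOp, annOp, liftS_expS, liftS_annExp, bosonSum_sub_right]
  refine congrArg₂ (· * ·) (congrArg expSeries ?_) (congrArg diagSeries ?_)
  · simp only [List.map_cons, List.map_nil, List.sum_cons, List.sum_nil, add_zero]
    rw [neg_one_zsmul, one_zsmul]
    abel
  · funext q
    rw [← tz_one_add_halfT, scalarPow_tz constantCoeff_halfT]

theorem kMinusOp_eq (j : Fin 2) : kMinusOp j = creOp (kMinusCre j) := by
  rw [kMinusOp, creOp, liftS_expS, liftS_creExp]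
  refine congrArg expSeries ?_
  rw [Finset.sum_filter, Finset.sum_filter, Fin.sum_univ_two, Fin.sum_univ_two]
  simp only [bosonSum_sub_right]
  fin_cases j
  · simp only [kMinusCre, Fin.zero_eta, if_true, List.map_cons, List.map_nil, List.sum_cons,
      List.sum_nil, add_zero]
    rw [neg_one_zsmul, one_zsmul, if_neg (by decide), if_neg (by decide), if_neg (by decide),
      if_pos (by decide)]
    abel
  · simp only [kMinusCre, Fin.mk_one, one_ne_zero, if_false, List.map_cons, List.map_nil,
      List.sum_cons, List.sum_nil, add_zero]
    rw [neg_one_zsmul, one_zsmul, if_pos (by decide), if_neg (by decide), if_neg (by decide),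
      if_neg (by decide)]
    abel

theorem kPlusF_apply (i : Fin 2) (s : ℂ) (j : Fin 2) (m : ℕ) (n : ℤ) : kPlusF i s j m n =
    if n ≤ 0 then MvPowerSeries.coeff (expo m (-n).toNat) (kPlusOp i s j) else 0 := by
  rw [kPlusOp_eq, ← tw_annOp]
  rfl

theorem kMinusF_apply (j : Fin 2) (m : ℕ) (n : ℤ) : kMinusF j m n = posF (kMinusOp j) m n := by
  rw [kMinusOp_eq, ← tw_creOp]
  rfl

theorem scalarPow_onePlus (a x : ℂ) :
    scalarPow (onePlus a) x = tz (powS (PowerSeries.C a * PowerSeries.X) x) := by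
  rw [← scalarPow_tz (by simp), ← tz_oneT, oneT]

theorem vPlusF_apply (i : Fin 2) (n : ℤ) (x : Fock₀) (m : ℕ) :
    (vertexCoeff xPlusCre (xPlusAnn i) (alphaWeight i) n x).coeff m = vPlusF i m n x := by
  have h1 : xPlusCre = creOp vpCre := by
    rw [xPlusCre, creOp, liftS_expS, liftS_creExp]
    simp only [List.map_cons, List.map_nil, List.sum_cons, List.sum_nil, add_zero]
    rw [neg_one_zsmul, one_zsmul]
  have h2 : xPlusAnn i = liftS (expS (annExp vpAnn)) * MvPowerSeries.C (latticeShift 1) *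
      diagSeries fun q => tz (powS (PowerSeries.C (1 / 4) * PowerSeries.X) (alphaWeight i q)) := by
    rw [xPlusAnn, liftS_expS, liftS_annExp, bosonSum_sub_left]
    simp only [scalarPow_onePlus]
    refine congrArg (fun y => expSeries y * _ * _) ?_
    simp only [List.map_cons, List.map_nil, List.sum_cons, List.sum_nil, add_zero]
    rw [neg_one_zsmul, one_zsmul, sub_eq_add_neg]
  rw [h1, h2, vertexCoeff_eq, vPlusF]
  simp only [mon_mul_kap_powS]

theorem vMinusF_apply (i : Fin 2) (n : ℤ) (x : Fock₀) (m : ℕ) :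
    (vertexCoeff xMinusCre (xMinusAnn i) (fun q => -alphaWeight i q) n x).coeff m =
      vMinusF i m n x := by
  have h1 : xMinusCre = creOp vmCre := by
    rw [xMinusCre, creOp, liftS_expS, liftS_creExp]
    simp only [List.map_cons, List.map_nil, List.sum_cons, List.sum_nil, add_zero]
    rw [neg_one_zsmul, one_zsmul, sub_eq_add_neg]
  have h2 : xMinusAnn i = liftS (expS (annExp vmAnn)) * MvPowerSeries.C (latticeShift (-1)) *
      diagSeries fun q => tz (powS (PowerSeries.C (-1 / 4) * PowerSeries.X)
        ((-alphaWeight i q : ℤ) : ℂ)) := by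
    have h3 : (fun k : ℕ => -boson 0 k + boson 1 k) = fun k : ℕ => boson 1 k - boson 0 k := by
      funext k; abel
    rw [xMinusAnn, liftS_expS, liftS_annExp, h3, bosonSum_sub_left]
    simp only [scalarPow_onePlus, Int.cast_neg]
    refine congrArg (fun y => expSeries y * _ * _) ?_
    simp only [List.map_cons, List.map_nil, List.sum_cons, List.sum_nil, add_zero]
    rw [neg_one_zsmul, one_zsmul]
    abel
  rw [h1, h2, vertexCoeff_eq, vMinusF]
  simp only [mon_mul_kap_powS]

/-! ### Products of commuting operator series -/

theorem commute_coeff_annExp (l : List (Fin 2 × ℂ × ℤ)) (j : Fin 2) {k : ℕ} (hk : 1 ≤ k)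
    (d : Fin 2 →₀ ℕ) :
    Commute (bosonP j k) (MvPowerSeries.coeff d (annExp l)) := by
  have h := congrArg (MvPowerSeries.coeff d) (adL_pos_annExp l j hk)
  rw [coeff_adL_C, adL_apply, map_zero, map_zero, sub_eq_zero] at h
  exact h

theorem commute_annExp (l l' : List (Fin 2 × ℂ × ℤ)) (d e : Fin 2 →₀ ℕ) :
    Commute (MvPowerSeries.coeff d (annExp l)) (MvPowerSeries.coeff e (annExp l')) := by
  induction l with
  | nil => simp [annExp]
  | cons x l ih =>
    rw [annExp, List.map_cons, List.sum_cons, map_add]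
    refine Commute.add_left ?_ ih
    rw [map_zsmul]
    refine Commute.smul_left ?_ _
    rw [coeff_bosonSumG]
    exact Commute.sum_left _ _ _ fun k hk =>
      (commute_coeff_annExp l' x.1 (Finset.mem_Icc.1 hk).1 e).smul_left _

section ExpAdd

variable {A : Type*} [Ring A] [Algebra ℂ A]

/-- Both sides have the logarithmic derivative `theta X + theta Y` and the constant term `1`.
Commutation is required of all coefficients since `theta` rescales them individually. -/
theorem expS_add {X Y : MvPowerSeries (Fin 2) A} (hX : MvPowerSeries.constantCoeff X = 0)
    (hY : MvPowerSeries.constantCoeff Y = 0)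
    (h1 : ∀ d e, Commute (MvPowerSeries.coeff d X) (MvPowerSeries.coeff e X))
    (h2 : ∀ d e, Commute (MvPowerSeries.coeff d Y) (MvPowerSeries.coeff e Y))
    (h3 : ∀ d e, Commute (MvPowerSeries.coeff d X) (MvPowerSeries.coeff e Y)) :
    expS (X + Y) = expS X * expS Y := by
  have ht : ∀ {S T : MvPowerSeries (Fin 2) A}, (∀ d e, Commute (MvPowerSeries.coeff d S)
      (MvPowerSeries.coeff e T)) → Commute S (theta T) := fun h => commute_of_coeff fun d e => by
    rw [coeff_theta]
    exact (h d e).smul_right _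
  have hXY : Commute X Y := commute_of_coeff h3
  have hYX' : Commute Y (theta X) := ht fun d e => (h3 e d).symm
  have hexp : Commute (expS X) (theta Y) := by
    refine commute_of_coeff fun d e => ?_
    rw [coeff_theta]
    refine Commute.smul_right ?_ _
    change Commute (∑ n ∈ Finset.range (d.degree + 1),
      ((n.factorial : ℂ)⁻¹) • MvPowerSeries.coeff d (X ^ n)) _
    refine Commute.sum_left _ _ _ fun n _ => Commute.smul_left ?_ _
    have h4 : ∀ (n : ℕ) d, Commute (MvPowerSeries.coeff d (X ^ n)) (MvPowerSeries.coeff e Y) := by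
      intro n
      induction n with
      | zero =>
        intro d
        rw [pow_zero, MvPowerSeries.coeff_one]
        split_ifs
        · exact Commute.one_left _
        · exact Commute.zero_left _
      | succ n ih =>
        intro d
        rw [pow_succ, MvPowerSeries.coeff_mul]
        exact Commute.sum_left _ _ _ fun p _ => (ih _).mul_left (h3 _ _)
    exact h4 n d
  refine eq_of_theta (t := theta X + theta Y) ?_ ?_ ?_ ?_
  · rw [theta_expS (by rw [map_add, hX, hY, add_zero]), map_add]
    rw [map_add]
    exact ((ht h1).add_right (ht h3)).add_left (hYX'.add_right (ht h2))
  · rw [theta_mul, theta_expS hX (ht h1), theta_expS hY (ht h2), ← mul_assoc, hexp.eq]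
    noncomm_ring
  · rw [← MvPowerSeries.coeff_zero_eq_constantCoeff_apply, map_add, coeff_theta, coeff_theta]
    simp
  · rw [map_mul, constantCoeff_expS, constantCoeff_expS, constantCoeff_expS, mul_one]

end ExpAdd

theorem annExp_append (l l' : List (Fin 2 × ℂ × ℤ)) : annExp (l ++ l') = annExp l + annExp l' := by
  rw [annExp, annExp, annExp, List.map_append, List.sum_append]

theorem creExp_append (l l' : List (Fin 2 × ℂ × ℤ)) : creExp (l ++ l') = creExp l + creExp l' := by
  rw [creExp, creExp, creExp, List.map_append, List.sum_append]

theorem expS_annExp_append (l l' : List (Fin 2 × ℂ × ℤ)) :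
    expS (annExp (l ++ l')) = expS (annExp l) * expS (annExp l') := by
  rw [annExp_append]
  exact expS_add (constantCoeff_annExp _) (constantCoeff_annExp _) (commute_annExp _ _)
    (commute_annExp _ _) (commute_annExp _ _)

theorem expS_creExp_append (l l' : List (Fin 2 × ℂ × ℤ)) :
    expS (creExp (l ++ l')) = expS (creExp l) * expS (creExp l') := by
  rw [creExp_append]
  exact expS_add (constantCoeff_creExp _) (constantCoeff_creExp _) (commute_creExp _ _)
    (commute_creExp _ _) (commute_creExp _ _)

theorem coeff_diagSeries (g : ℤ → Scalar) (d : Fin 2 →₀ ℕ) : MvPowerSeries.coeff d (diagSeries g) =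
    latticeDiag fun q => MvPowerSeries.coeff d (g q) := rfl

theorem latticeDiag_mul (g g' : ℤ → ℂ) :
    latticeDiag g * latticeDiag g' = latticeDiag fun q => g q * g' q :=
  Finsupp.lhom_ext fun q f => by
    rw [Module.End.mul_apply, latticeDiag_single, latticeDiag_single, latticeDiag_single, mul_smul]

theorem latticeDiag_sum {ι : Type*} (s : Finset ι) (g : ι → ℤ → ℂ) :
    ∑ a ∈ s, latticeDiag (g a) = latticeDiag fun q => ∑ a ∈ s, g a q :=
  Finsupp.lhom_ext fun q f => by
    rw [LinearMap.sum_apply, latticeDiag_single, Finset.sum_smul, Finsupp.single_finsetSum]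
    exact Finset.sum_congr rfl fun a _ => latticeDiag_single _ _ _

theorem latticeDiag_one : latticeDiag (fun _ => 1) = 1 :=
  Finsupp.lhom_ext fun q f => by rw [latticeDiag_single, one_smul]; rfl

theorem latticeDiag_zero : latticeDiag (fun _ => 0) = 0 :=
  Finsupp.lhom_ext fun q f => by rw [latticeDiag_single, zero_smul, Finsupp.single_zero]; rfl

theorem diagSeries_mul (g g' : ℤ → Scalar) :
    diagSeries g * diagSeries g' = diagSeries fun q => g q * g' q := by
  refine MvPowerSeries.ext fun d => ?_
  rw [MvPowerSeries.coeff_mul, coeff_diagSeries]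
  simp only [coeff_diagSeries, latticeDiag_mul, MvPowerSeries.coeff_mul]
  exact latticeDiag_sum _ _

theorem diagSeries_one : diagSeries (fun _ => 1) = 1 := by
  refine MvPowerSeries.ext fun d => ?_
  rw [coeff_diagSeries, MvPowerSeries.coeff_one]
  simp only [MvPowerSeries.coeff_one]
  split_ifs
  · exact latticeDiag_one
  · exact latticeDiag_zero

theorem liftS_mul_diagSeries (X : MvPowerSeries (Fin 2) OpP) (g : ℤ → Scalar) :
    diagSeries g * liftS X = liftS X * diagSeries g := by
  refine MvPowerSeries.ext fun d => ?_
  rw [MvPowerSeries.coeff_mul, MvPowerSeries.coeff_mul, Finsupp.sum_antidiagonal_swap d fun a b =>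
    MvPowerSeries.coeff a (diagSeries g) * MvPowerSeries.coeff b (liftS X)]
  refine Finset.sum_congr rfl fun p _ => ?_
  rw [coeff_diagSeries]
  refine Finsupp.lhom_ext fun q f => ?_
  rw [Module.End.mul_apply, Module.End.mul_apply, coeff_liftS_single, latticeDiag_single,
    latticeDiag_single, coeff_liftS_single, map_smul]

theorem annOp_mul (l l' : List (Fin 2 × ℂ × ℤ)) (F F' : ℤ → PowerSeries ℂ) :
    annOp l F * annOp l' F' = annOp (l ++ l') fun q => F q * F' q := by
  simp only [annOp, map_mul]
  rw [expS_annExp_append, map_mul, ← diagSeries_mul, mul_assoc, ← mul_assoc (diagSeries _),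
    liftS_mul_diagSeries]
  simp only [mul_assoc]

theorem creOp_mul (l l' : List (Fin 2 × ℂ × ℤ)) : creOp l * creOp l' = creOp (l ++ l') := by
  rw [creOp, creOp, creOp, expS_creExp_append, map_mul]

theorem annOp_eq_one {l : List (Fin 2 × ℂ × ℤ)} {F : ℤ → PowerSeries ℂ} (hl : annExp l = 0)
    (hF : ∀ q, F q = 1) : annOp l F = 1 := by
  rw [annOp, hl, expS_zero, map_one, one_mul]
  simp only [hF, map_one]
  exact diagSeries_one

theorem creOp_eq_one {l : List (Fin 2 × ℂ × ℤ)} (hl : creExp l = 0) : creOp l = 1 := by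
  rw [creOp, hl, expS_zero, map_one]

theorem powS_add {h : PowerSeries ℂ} (hh : PowerSeries.constantCoeff h = 0) (x y : ℂ) :
    powS h (x + y) = powS h x * powS h y := by
  have hs : PowerSeries.HasSubst h := PowerSeries.HasSubst.of_constantCoeff_zero' hh
  rw [powS, PowerSeries.binomialSeries_add, PowerSeries.subst_mul hs]
  rfl

theorem halfPow_intCast (n : ℤ) : halfPow (n : ℂ) =
    ((linU (1 : ℤ) (-1 / 2) ^ n : (Ser ℤ)ˣ) : Ser ℤ) *
      ((linU (1 : ℤ) (1 / 2) ^ (-n) : (Ser ℤ)ˣ) : Ser ℤ) := by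
  have h0 : halfPow 0 = 1 := by rw [halfPow, powS_zero constantCoeff_halfT, map_one]
  have hs : ∀ n : ℤ, halfPow ((n + 1 : ℤ) : ℂ) = halfPow (n : ℂ) *
      ((linU (1 : ℤ) (-1 / 2) * (linU (1 : ℤ) (1 / 2))⁻¹ : (Ser ℤ)ˣ) : Ser ℤ) := by
    intro n
    have := halfPow_add_one (n : ℂ)
    push_cast
    rw [← mul_assoc, ← this, mul_assoc, Units.mul_inv, mul_one]
  rw [← Units.val_mul, zpow_neg, ← inv_zpow, ← mul_zpow]
  induction n with
  | zero => rw [Int.cast_zero, h0, zpow_zero, Units.val_one]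
  | succ n ih => rw [hs, ih, ← Units.val_mul, ← zpow_add_one]
  | pred n ih =>
    have h := hs (-n - 1)
    rw [sub_add_cancel, ih] at h
    rw [zpow_sub_one, Units.val_mul, h, mul_assoc, Units.mul_inv, mul_one]

/-- The sum of the exponents with multiplicities. -/
def wsum {M : Type*} [AddCommGroup M] (g : Fin 2 → ℂ → M) (l : List (Fin 2 × ℂ × ℤ)) : M :=
  (l.map fun x => x.2.2 • g x.1 x.2.1).sum

theorem creExp_eq_wsum (l : List (Fin 2 × ℂ × ℤ)) :
    creExp l = wsum (fun j b => bosonSumG (fun k => bosonP j (-(k : ℤ))) (posPow b)) l := rfl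

theorem annExp_eq_wsum (l : List (Fin 2 × ℂ × ℤ)) :
    annExp l = wsum (fun j a => bosonSumG (fun k => bosonP j k) (negPow a)) l := rfl

theorem wsum_kInv_minus {M : Type*} [AddCommGroup M] (g : Fin 2 → ℂ → M) :
    wsum g ([(1, 1, -1), (1, 0, 1)] ++ kMinusCre 0) = 0 := by
  simp [wsum, kMinusCre]

theorem wsum_kInv_minus' {M : Type*} [AddCommGroup M] (g : Fin 2 → ℂ → M) :
    wsum g (kMinusCre 0 ++ [(1, 1, -1), (1, 0, 1)]) = 0 := by
  simp [wsum, kMinusCre]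

theorem wsum_kInv_plus {M : Type*} [AddCommGroup M] (g : Fin 2 → ℂ → M) :
    wsum g ([(0, 1 / 2, 1), (0, -1 / 2, -1)] ++ [(0, 1 / 2, -1), (0, -1 / 2, 1)]) = 0 := by
  simp [wsum]

theorem wsum_kInv_plus' {M : Type*} [AddCommGroup M] (g : Fin 2 → ℂ → M) :
    wsum g ([(0, 1 / 2, -1), (0, -1 / 2, 1)] ++ [(0, 1 / 2, 1), (0, -1 / 2, -1)]) = 0 := by
  simp [wsum]

theorem wsum_psi_minus {M : Type*} [AddCommGroup M] (g : Fin 2 → ℂ → M) :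
    wsum g (kMinusCre 0 ++ shl (-1 / 4) psiCre) = wsum g (kMinusCre 1) := by
  norm_num [wsum, kMinusCre, shl]
  abel

theorem wsum_psi_plus {M : Type*} [AddCommGroup M] (g : Fin 2 → ℂ → M) :
    wsum g ([(0, 1 / 2, -1), (0, -1 / 2, 1)] ++ shl (1 / 4) psiAnn) =
      wsum g [(1, 1 / 2, -1), (1, -1 / 2, 1)] := by
  norm_num [wsum, shl]
  abel

/-! ### The Gauss coordinates -/

/-- The operator series of `k_j^±`; the sign is `+` for `true`. -/
def kSer (i : Fin 2) (s : ℂ) (e : Bool) (j : Fin 2) : OpSeries :=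
  if e then kPlusOp i s j else kMinusOp j

/-- The inverse of `k_1^±`. -/
def kInvSer (i : Fin 2) (s : ℂ) (e : Bool) : OpSeries :=
  if e then annOp [(0, 1 / 2, 1), (0, -1 / 2, -1)] fun q => powS halfT (-latticePoint i s q 0)
  else creOp [(1, 1, -1), (1, 0, 1)]

/-- The series `k_2^± / k_1^±`. -/
def psiSer (i : Fin 2) (e : Bool) : OpSeries :=
  if e then annOp (shl (1 / 4) psiAnn) fun q => powS halfT ((-alphaWeight i q : ℤ) : ℂ)
  else creOp (shl (-1 / 4) psiCre)

theorem kInvSer_mul (i : Fin 2) (s : ℂ) (e : Bool) : kInvSer i s e * kSer i s e 0 = 1 := by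
  cases e
  · simp only [kInvSer, kSer, Bool.false_eq_true, if_false]
    rw [kMinusOp_eq, creOp_mul]
    exact creOp_eq_one ((creExp_eq_wsum _).trans (wsum_kInv_minus _))
  · simp only [kInvSer, kSer, if_true]
    rw [kPlusOp_eq, annOp_mul]
    refine annOp_eq_one ((annExp_eq_wsum _).trans (wsum_kInv_plus _)) fun q => ?_
    rw [← powS_add constantCoeff_halfT, neg_add_cancel, powS_zero constantCoeff_halfT]

theorem mul_kInvSer (i : Fin 2) (s : ℂ) (e : Bool) : kSer i s e 0 * kInvSer i s e = 1 := by
  cases e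
  · simp only [kInvSer, kSer, Bool.false_eq_true, if_false]
    rw [kMinusOp_eq, creOp_mul]
    exact creOp_eq_one ((creExp_eq_wsum _).trans (wsum_kInv_minus' _))
  · simp only [kInvSer, kSer, if_true]
    rw [kPlusOp_eq, annOp_mul]
    refine annOp_eq_one ((annExp_eq_wsum _).trans (wsum_kInv_plus' _)) fun q => ?_
    rw [← powS_add constantCoeff_halfT, add_neg_cancel, powS_zero constantCoeff_halfT]

theorem kSer_zero_mul_psiSer (i : Fin 2) (s : ℂ) (e : Bool) :
    kSer i s e 0 * psiSer i e = kSer i s e 1 := by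
  cases e
  · simp only [psiSer, kSer, Bool.false_eq_true, if_false]
    rw [kMinusOp_eq, kMinusOp_eq, creOp_mul, creOp, creOp]
    refine congrArg (fun X => liftS (expS X)) ?_
    rw [creExp_eq_wsum, creExp_eq_wsum, wsum_psi_minus]
  · simp only [psiSer, kSer, if_true]
    rw [kPlusOp_eq, kPlusOp_eq, annOp_mul, annOp, annOp]
    refine congrArg₂ (fun X Y => liftS (expS X) * diagSeries Y) ?_ ?_
    · rw [annExp_eq_wsum, annExp_eq_wsum, wsum_psi_plus]
    · funext q
      rw [← powS_add constantCoeff_halfT]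
      have := alphaWeight_eq i s q
      push_cast
      rw [this]
      congr 2
      ring

theorem shift_tw {b : ℂ} {p : ℤ} {σ σ' : ℤ → Ser ℤ} {W : Fld ℤ OpP}
    (h : ∀ q, Fld.shift b (σ q • W) = σ' q • Fld.shift b W) :
    Fld.shift b (tw p σ W) = tw p σ' (Fld.shift b W) := by
  refine fldOp_ext fun m x q f => ?_
  have h1 : Fld.map (LinearMap.applyₗ (Finsupp.single q f)) (tw p σ W) =
      Fld.map (Finsupp.lsingle (R := ℂ) (q + p) ∘ₗ LinearMap.applyₗ f) (σ q • W) := by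
    funext m x
    exact tw_apply_single p σ W m x q f
  have h2 := Fld.map_shift (LinearMap.applyₗ (R := ℂ) (M₂ := Fock₀) (Finsupp.single q f)) b
    (tw p σ W)
  rw [h1, ← Fld.map_shift, h] at h2
  rw [tw_apply_single]
  exact congrFun (congrFun h2 m) x

/-- The shift by `ħ/4` turns `(u + ħ/4)^w (u - 3ħ/4)^(-w)` into `(u + ħ/2)^w (u - ħ/2)^(-w)`, the
scalar by which `k₂⁺/k₁⁺` acts on the lattice. -/
theorem shift_psiPlusF (i : Fin 2) (m : ℕ) (n : ℤ) : Fld.shift (1 / 4) (psiPlusF i) m n =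
    if n ≤ 0 then MvPowerSeries.coeff (expo m (-n).toNat) (psiSer i true) else 0 := by
  have h : Fld.shift (1 / 4) (psiPlusF i) = tw 0
      (fun q => kap (powS halfT ((-alphaWeight i q : ℤ) : ℂ))) (vertexP [] (shl (1 / 4) psiAnn)) := by
    have h1 := shift_vertexP (1 / 4) [] psiAnn
    rw [psiPlusF, shift_tw (σ' := fun q => kap (powS halfT ((-alphaWeight i q : ℤ) : ℂ))), h1]
    · rfl
    · intro q
      have h2 := halfPow_intCast (-alphaWeight i q)
      rw [halfPow] at h2
      rw [h2, mul_smul, Fld.shift_linU_zpow, Fld.shift_linU_zpow, neg_neg, mul_comm, mul_smul]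
      norm_num
  rw [h, tw_annOp]
  rfl

theorem shift_psiMinusF (i : Fin 2) (m : ℕ) (n : ℤ) :
    Fld.shift (-1 / 4) psiMinusF m n = posF (psiSer i false) m n := by
  have h : Fld.shift (-1 / 4) psiMinusF = tw 0 (fun _ => 1) (vertexP (shl (-1 / 4) psiCre) []) := by
    have h1 := shift_vertexP (-1 / 4) psiCre []
    rw [psiMinusF, shift_tw (σ' := fun _ => 1), h1]
    · rfl
    · intro q
      rw [one_smul, one_smul]
  rw [h, tw_creOp]
  rfl

theorem psiMinusF_apply {m : ℕ} {n : ℤ} (hn : n < 0) : psiMinusF m n = 0 := by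
  rw [psiMinusF, tw_creOp]
  exact if_neg (by omega)

/-! ### One-sided series with coefficients in a ring -/

section OneSided

variable {B : Type*} [Ring B]

/-- The direction of a series: in `u⁻¹` for `true`, in `u` for `false`. -/
def sgn (e : Bool) : ℤ := if e then -1 else 1

@[simp] theorem sgn_true : sgn true = -1 := rfl
@[simp] theorem sgn_false : sgn false = 1 := rfl

theorem sgn_mul_sgn (e : Bool) : sgn e * sgn e = 1 := by cases e <;> rfl

theorem sgn_mul_sgn_mul (e : Bool) (x : ℤ) : sgn e * (sgn e * x) = x := by
  rw [← mul_assoc, sgn_mul_sgn, one_mul]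

/-- The coefficients vanish in the wrong direction. -/
def IsSupp (e : Bool) (a : ℤ → B) : Prop := ∀ x, sgn e * x < 0 → a x = 0

/-- The series with the coefficient `a x` at `u ^ x`. -/
def serE (e : Bool) (a : ℤ → B) : PowerSeries B := PowerSeries.mk fun N => a (sgn e * N)

theorem X_mem_center : (PowerSeries.X : PowerSeries B) ∈ Subring.center (PowerSeries B) :=
  Subring.mem_center_iff.2 fun x => (PowerSeries.commute_X x).eq

theorem C_mem_center (b : Subring.center B) :
    (PowerSeries.C (b : B) : PowerSeries B) ∈ Subring.center (PowerSeries B) := by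
  refine Subring.mem_center_iff.2 fun x => ?_
  ext n
  rw [PowerSeries.coeff_mul_C, PowerSeries.coeff_C_mul]
  exact Subring.mem_center_iff.1 b.2 _

/-- A central constant. -/
def cC (b : Subring.center B) : Subring.center (PowerSeries B) := ⟨PowerSeries.C (b : B), C_mem_center b⟩

/-- The normalising factor. -/
def qS (e : Bool) : Subring.center (PowerSeries B) := if e then ⟨PowerSeries.X, X_mem_center⟩ else 1

/-- The variable `u`, multiplied by the normalising factor. -/
def uS (e : Bool) : Subring.center (PowerSeries B) := if e then 1 else ⟨PowerSeries.X, X_mem_center⟩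

/-- The power of `u` at the `N`-th coefficient after multiplication by the normalising factor. -/
def pos (e : Bool) (N : ℕ) : ℤ := if e then 1 - N else N

/-- The relations contain `u` itself, which is not a power series in `u⁻¹`. On that side everything
is multiplied by `u⁻¹`, so that `qS = u⁻¹` and `uS = 1`; the first coefficient then sits at `u ^ 1`,
outside the support. -/
theorem coeff_qS_smul {e : Bool} {a : ℤ → B} (ha : IsSupp e a) (N : ℕ) :
    PowerSeries.coeff N ((qS e : Subring.center (PowerSeries B)) • serE e a) = a (pos e N) := by
  cases e
  · simp [qS, pos, serE]
  · change PowerSeries.coeff N (PowerSeries.X * serE true a) = _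
    cases N with
    | zero =>
      rw [PowerSeries.coeff_zero_X_mul]
      exact (ha _ (by simp [pos])).symm
    | succ N =>
      rw [PowerSeries.coeff_succ_X_mul, serE, PowerSeries.coeff_mk]
      congr 1
      simp [pos]

theorem coeff_uS_smul {e : Bool} {a : ℤ → B} (ha : IsSupp e a) (N : ℕ) :
    PowerSeries.coeff N ((uS e : Subring.center (PowerSeries B)) • serE e a) = a (pos e N - 1) := by
  cases e
  · change PowerSeries.coeff N (PowerSeries.X * serE false a) = _
    cases N with
    | zero =>
      rw [PowerSeries.coeff_zero_X_mul]
      exact (ha _ (by simp [pos])).symm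
    | succ N =>
      rw [PowerSeries.coeff_succ_X_mul, serE, PowerSeries.coeff_mk]
      congr 1
      simp [pos]
  · simp [uS, pos, serE]

theorem coeff_cC_smul (b : Subring.center B) (f : PowerSeries B) (N : ℕ) :
    PowerSeries.coeff N (cC b • f) = b * PowerSeries.coeff N f :=
  PowerSeries.coeff_C_mul N f (b : B)

theorem IsSupp.mul_left {e : Bool} {a : ℤ → B} (ha : IsSupp e a) (v : B) :
    IsSupp e fun x => v * a x := fun x hx => by simp [ha x hx]

theorem IsSupp.mul_right {e : Bool} {a : ℤ → B} (ha : IsSupp e a) (v : B) :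
    IsSupp e fun x => a x * v := fun x hx => by simp [ha x hx]

theorem IsSupp.sub {e : Bool} {a b : ℤ → B} (ha : IsSupp e a) (hb : IsSupp e b) :
    IsSupp e fun x => a x - b x := fun x hx => by simp [ha x hx, hb x hx]

theorem C_mul_serE (e : Bool) (a : ℤ → B) (v : B) :
    PowerSeries.C v * serE e a = serE e fun x => v * a x := by
  ext N
  rw [PowerSeries.coeff_C_mul, serE, serE, PowerSeries.coeff_mk, PowerSeries.coeff_mk]

theorem serE_mul_C (e : Bool) (a : ℤ → B) (v : B) :
    serE e a * PowerSeries.C v = serE e fun x => a x * v := by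
  ext N
  rw [PowerSeries.coeff_mul_C, serE, serE, PowerSeries.coeff_mk, PowerSeries.coeff_mk]

theorem serE_sub (e : Bool) (a b : ℤ → B) : serE e a - serE e b = serE e fun x => a x - b x := rfl

theorem exchange_E_serE {e : Bool} {a : ℤ → B} (ha : IsSupp e a) {b h : Subring.center B} {v v₁ : B}
    (hv : ∀ x, a (x - 1) * v - a x * v₁ + (b + h) * (a x * v) =
      v * a (x - 1) - v₁ * a x + b * (v * a x)) :
    (qS e : Subring.center (PowerSeries B)) • ⁅PowerSeries.C v₁, serE e a⁆ = (uS e + cC b * qS e) • (PowerSeries.C v * serE e a) -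
      (uS e + cC b * qS e + cC h * qS e) • (serE e a * PowerSeries.C v) := by
  simp only [Ring.lie_def, C_mul_serE, serE_mul_C, serE_sub, add_smul, mul_smul]
  ext N
  simp only [map_add, map_sub, coeff_cC_smul]
  rw [coeff_qS_smul ((ha.mul_left v₁).sub (ha.mul_right v₁)), coeff_qS_smul (ha.mul_left v),
    coeff_qS_smul (ha.mul_right v), coeff_uS_smul (ha.mul_left v), coeff_uS_smul (ha.mul_right v)]
  linear_combination (norm := noncomm_ring) hv (pos e N)

theorem exchange_F_serE {e : Bool} {a : ℤ → B} (ha : IsSupp e a) {b h : Subring.center B} {v v₁ : B}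
    (hv : ∀ x, a (x - 1) * v - a x * v₁ + b * (a x * v) =
      v * a (x - 1) - v₁ * a x + (b + h) * (v * a x)) :
    (qS e : Subring.center (PowerSeries B)) • ⁅serE e a, PowerSeries.C v₁⁆ = (uS e + cC b * qS e) • (serE e a * PowerSeries.C v) -
      (uS e + cC b * qS e + cC h * qS e) • (PowerSeries.C v * serE e a) := by
  simp only [Ring.lie_def, C_mul_serE, serE_mul_C, serE_sub, add_smul, mul_smul]
  ext N
  simp only [map_add, map_sub, coeff_cC_smul]
  rw [coeff_qS_smul ((ha.mul_right v₁).sub (ha.mul_left v₁)), coeff_qS_smul (ha.mul_left v),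
    coeff_qS_smul (ha.mul_right v), coeff_uS_smul (ha.mul_left v), coeff_uS_smul (ha.mul_right v)]
  linear_combination (norm := noncomm_ring) -hv (pos e N)

end OneSided

/-! ### Two-variable Laurent series -/

section TwoSided

variable (B : Type*) [Ring B]

/-- Iterated Laurent series; the inner variable is `u^{±1}`, the outer one is `v^{±1}`. -/
def Laurent₂ : Type _ := HahnSeries ℤ (HahnSeries ℤ B)

instance : Ring (Laurent₂ B) := inferInstanceAs (Ring (HahnSeries ℤ (HahnSeries ℤ B)))

/-- Series in the inner variable. -/
def inner₁ : PowerSeries B →+* Laurent₂ B :=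
  (HahnSeries.C : HahnSeries ℤ B →+* HahnSeries ℤ (HahnSeries ℤ B)).comp (HahnSeries.ofPowerSeries ℤ B)

/-- Series in the outer variable. -/
def outer₂ : PowerSeries B →+* Laurent₂ B :=
  (HahnSeries.ofPowerSeries ℤ (HahnSeries ℤ B)).comp (PowerSeries.map HahnSeries.C)

variable {B}

theorem single_mem_center (x : ℤ) {R : Type*} [Ring R] :
    (HahnSeries.single x (1 : R)) ∈ Subring.center (HahnSeries ℤ R) := by
  refine Subring.mem_center_iff.2 fun g => ?_
  ext n
  rw [HahnSeries.coeff_mul_single, HahnSeries.coeff_single_mul, one_mul, mul_one]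

theorem C_mem_center_hahn {R : Type*} [Ring R] {z : R} (hz : z ∈ Subring.center R) :
    (HahnSeries.C z : HahnSeries ℤ R) ∈ Subring.center (HahnSeries ℤ R) := by
  refine Subring.mem_center_iff.2 fun g => ?_
  ext n
  rw [HahnSeries.C_apply, HahnSeries.coeff_mul_single_zero, HahnSeries.coeff_single_zero_mul]
  exact Subring.mem_center_iff.1 hz _

/-- The variable `u`. -/
def uL (e : Bool) : Subring.center (Laurent₂ B) :=
  ⟨(HahnSeries.C (HahnSeries.single (sgn e) 1) : HahnSeries ℤ (HahnSeries ℤ B)),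
    C_mem_center_hahn (single_mem_center _)⟩

/-- The variable `v`. -/
def vL (e : Bool) : Subring.center (Laurent₂ B) :=
  ⟨(HahnSeries.single (sgn e) 1 : HahnSeries ℤ (HahnSeries ℤ B)), single_mem_center _⟩

/-- A central constant. -/
def cL (b : Subring.center B) : Subring.center (Laurent₂ B) :=
  ⟨(HahnSeries.C (HahnSeries.C (b : B)) : HahnSeries ℤ (HahnSeries ℤ B)),
    C_mem_center_hahn (C_mem_center_hahn b.2)⟩

/-- The coefficient of `u ^ m v ^ n`. -/
def cf (e e' : Bool) (z : Laurent₂ B) (m n : ℤ) : B :=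
  (HahnSeries.coeff (HahnSeries.coeff (Γ := ℤ) (R := HahnSeries ℤ B) z (sgn e' * n))) (sgn e * m)

theorem cf_ext {e e' : Bool} {z w : Laurent₂ B} (h : ∀ m n, cf e e' z m n = cf e e' w m n) : z = w := by
  refine HahnSeries.ext (funext fun n => HahnSeries.ext (funext fun m => ?_))
  have := h (sgn e * m) (sgn e' * n)
  rwa [cf, cf, sgn_mul_sgn_mul, sgn_mul_sgn_mul] at this

theorem cf_add (e e' : Bool) (z w : Laurent₂ B) (m n : ℤ) :
    cf e e' (z + w) m n = cf e e' z m n + cf e e' w m n := rfl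

theorem cf_sub (e e' : Bool) (z w : Laurent₂ B) (m n : ℤ) :
    cf e e' (z - w) m n = cf e e' z m n - cf e e' w m n := by
  rw [eq_sub_iff_add_eq, ← cf_add, sub_add_cancel]

theorem cf_uL_smul (e e' : Bool) (z : Laurent₂ B) (m n : ℤ) :
    cf e e' ((uL e : Subring.center (Laurent₂ B)) • z) m n = cf e e' z (m - 1) n := by
  have h := HahnSeries.coeff_single_zero_mul (Γ := ℤ) (r := HahnSeries.single (sgn e) (1 : B))
    (x := z) (a := sgn e' * n)
  refine (congrArg (fun y => HahnSeries.coeff y (sgn e * m)) h).trans ?_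
  rw [HahnSeries.coeff_single_mul, one_mul, cf, mul_sub, mul_one]

theorem cf_vL_smul (e e' : Bool) (z : Laurent₂ B) (m n : ℤ) :
    cf e e' ((vL e' : Subring.center (Laurent₂ B)) • z) m n = cf e e' z m (n - 1) := by
  have h := HahnSeries.coeff_single_mul (r := (1 : HahnSeries ℤ B)) (x := z) (a := sgn e' * n)
    (b := sgn e')
  refine (congrArg (fun y => HahnSeries.coeff y (sgn e * m)) h).trans ?_
  rw [one_mul, cf, mul_sub, mul_one]

theorem cf_cL_smul (e e' : Bool) (b : Subring.center B) (z : Laurent₂ B) (m n : ℤ) :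
    cf e e' (cL b • z) m n = b * cf e e' z m n := by
  have h := HahnSeries.coeff_single_zero_mul (Γ := ℤ) (r := HahnSeries.C (b : B))
    (x := z) (a := sgn e' * n)
  refine (congrArg (fun y => HahnSeries.coeff y (sgn e * m)) h).trans ?_
  exact HahnSeries.coeff_single_zero_mul

theorem coeff_ofPowerSeries_serE {e : Bool} {a : ℤ → B} (ha : IsSupp e a) (x : ℤ) :
    (HahnSeries.ofPowerSeries ℤ B (serE e a)).coeff (sgn e * x) = a x := by
  by_cases hx : sgn e * x < 0
  · rw [ha x hx]
    by_contra h
    rw [HahnSeries.ofPowerSeries_apply, HahnSeries.embDomain_of_notMem_range] at h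
    · exact h rfl
    · rintro ⟨n, hn⟩
      simp at hn
      omega
  · have hN : sgn e * x = ((sgn e * x).toNat : ℤ) := by omega
    rw [hN, HahnSeries.ofPowerSeries_apply_coeff, serE, PowerSeries.coeff_mk, ← hN, sgn_mul_sgn_mul]

theorem outer₂_serE (e : Bool) (a : ℤ → B) : outer₂ B (serE e a) =
    HahnSeries.ofPowerSeries ℤ _ (serE e fun x => (HahnSeries.C (a x) : HahnSeries ℤ B)) :=
  congrArg (HahnSeries.ofPowerSeries ℤ (HahnSeries ℤ B))
    (PowerSeries.ext fun N => by rw [PowerSeries.coeff_map, serE, serE, PowerSeries.coeff_mk,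
      PowerSeries.coeff_mk])

theorem cf_inner_mul_outer {e e' : Bool} {a a' : ℤ → B} (ha : IsSupp e a) (ha' : IsSupp e' a') (m n : ℤ) :
    cf e e' (inner₁ B (serE e a) * outer₂ B (serE e' a')) m n = a m * a' n := by
  have h := HahnSeries.coeff_single_zero_mul (Γ := ℤ) (r := HahnSeries.ofPowerSeries ℤ B (serE e a))
    (x := HahnSeries.ofPowerSeries ℤ _ (serE e' fun x => (HahnSeries.C (a' x) : HahnSeries ℤ B)))
    (a := sgn e' * n)
  rw [coeff_ofPowerSeries_serE (fun x hx => by rw [ha' x hx, map_zero])] at h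
  rw [outer₂_serE]
  refine (congrArg (fun y => HahnSeries.coeff y (sgn e * m)) h).trans ?_
  rw [HahnSeries.C_apply, HahnSeries.coeff_mul_single_zero, coeff_ofPowerSeries_serE ha]

theorem cf_outer_mul_inner {e e' : Bool} {a a' : ℤ → B} (ha : IsSupp e a) (ha' : IsSupp e' a') (m n : ℤ) :
    cf e e' (outer₂ B (serE e' a') * inner₁ B (serE e a)) m n = a' n * a m := by
  have h := HahnSeries.coeff_mul_single_zero (Γ := ℤ) (r := HahnSeries.ofPowerSeries ℤ B (serE e a))
    (x := HahnSeries.ofPowerSeries ℤ _ (serE e' fun x => (HahnSeries.C (a' x) : HahnSeries ℤ B)))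
    (a := sgn e' * n)
  rw [coeff_ofPowerSeries_serE (fun x hx => by rw [ha' x hx, map_zero])] at h
  rw [outer₂_serE]
  refine (congrArg (fun y => HahnSeries.coeff y (sgn e * m)) h).trans ?_
  rw [HahnSeries.C_apply, HahnSeries.coeff_single_zero_mul, coeff_ofPowerSeries_serE ha]

theorem inner₁_apply (f : PowerSeries B) : inner₁ B f =
    (HahnSeries.C (HahnSeries.ofPowerSeries ℤ B f) : HahnSeries ℤ (HahnSeries ℤ B)) := rfl

theorem outer₂_apply (f : PowerSeries B) : outer₂ B f =
    (HahnSeries.ofPowerSeries ℤ (HahnSeries ℤ B) (PowerSeries.map HahnSeries.C f) :) := rfl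

theorem inner₁_cC (b : Subring.center B) : inner₁ B (cC b : Subring.center (PowerSeries B)) =
    (cL b : Subring.center (Laurent₂ B)) :=
  (inner₁_apply _).trans (congrArg HahnSeries.C (HahnSeries.ofPowerSeries_C (b : B)))

theorem outer₂_C (v : B) : outer₂ B (PowerSeries.C v) = inner₁ B (PowerSeries.C v) := by
  rw [inner₁_apply, outer₂_apply, HahnSeries.ofPowerSeries_C, PowerSeries.map_C,
    HahnSeries.ofPowerSeries_C]

theorem inner₁_X : inner₁ B PowerSeries.X =
    (HahnSeries.C (HahnSeries.single 1 1) : HahnSeries ℤ (HahnSeries ℤ B)) :=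
  (inner₁_apply _).trans (congrArg HahnSeries.C HahnSeries.ofPowerSeries_X)

theorem outer₂_X : outer₂ B PowerSeries.X =
    (HahnSeries.single 1 1 : HahnSeries ℤ (HahnSeries ℤ B)) := by
  rw [outer₂_apply, PowerSeries.map_X]
  exact HahnSeries.ofPowerSeries_X

theorem inner_inv {x y : ℤ} (h : x + y = 0) :
    (HahnSeries.C (HahnSeries.single x 1) : HahnSeries ℤ (HahnSeries ℤ B)) *
      HahnSeries.C (HahnSeries.single y 1) = 1 := by
  rw [← map_mul, HahnSeries.single_mul_single, h, mul_one]
  exact map_one _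

theorem outer_inv {x y : ℤ} (h : x + y = 0) :
    (HahnSeries.single x 1 : HahnSeries ℤ (HahnSeries ℤ B)) * HahnSeries.single y 1 = 1 := by
  rw [HahnSeries.single_mul_single, h, mul_one]
  rfl

theorem inner₁_uS (e : Bool) : inner₁ B (uS e : Subring.center (PowerSeries B)) =
    inner₁ B (qS e : Subring.center (PowerSeries B)) * (uL e : Subring.center (Laurent₂ B)) := by
  cases e
  · refine inner₁_X.trans (Eq.symm ?_)
    refine (congrArg (· * _) (map_one (inner₁ B))).trans (one_mul _)
  · refine (map_one (inner₁ B)).trans (Eq.symm ?_)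
    exact (congrArg (· * _) inner₁_X).trans (inner_inv (by norm_num))

theorem outer₂_uS (e : Bool) : outer₂ B (uS e : Subring.center (PowerSeries B)) =
    outer₂ B (qS e : Subring.center (PowerSeries B)) * (vL e : Subring.center (Laurent₂ B)) := by
  cases e
  · refine outer₂_X.trans (Eq.symm ?_)
    refine (congrArg (· * _) (map_one (outer₂ B))).trans (one_mul _)
  · refine (map_one (outer₂ B)).trans (Eq.symm ?_)
    exact (congrArg (· * _) outer₂_X).trans (outer_inv (by norm_num))

theorem exists_inner₁_qS_inv (e : Bool) :
    ∃ r, r * inner₁ B (qS e : Subring.center (PowerSeries B)) = 1 := by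
  cases e
  · exact ⟨1, (one_mul _).trans (map_one _)⟩
  · exact ⟨_, (congrArg _ inner₁_X).trans (inner_inv (x := -1) (by norm_num))⟩

theorem exists_outer₂_qS_inv (e : Bool) :
    ∃ r, r * outer₂ B (qS e : Subring.center (PowerSeries B)) = 1 := by
  cases e
  · exact ⟨1, (one_mul _).trans (map_one _)⟩
  · exact ⟨_, (congrArg _ outer₂_X).trans (outer_inv (x := -1) (by norm_num))⟩

/-- The normalising factor is not a unit among power series in `u⁻¹`, but it becomes one among
Laurent series; dividing by it restores the relation with `u` itself, for both directions at once.
-/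
theorem map_exchange {S A : Type*} [Ring S] [Ring A] (φ : S →+* A) {q u b h : Subring.center S}
    {U b' h' : Subring.center A} (hu : φ u = φ q * U) (hb : φ b = b') (hh : φ h = h')
    (hq : ∃ r, r * φ q = 1) {x y z : S}
    (H : q • x = (u + b * q) • y - (u + b * q + h * q) • z) :
    (1 : Subring.center A) • φ x = (U + b') • φ y - (U + b' + h' * 1) • φ z := by
  obtain ⟨r, hr⟩ := hq
  have h1 := congrArg φ H
  simp only [Subring.smul_def, smul_eq_mul, map_sub, map_mul, Subring.coe_add, Subring.coe_mul, map_add,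
    hu, hb, hh, Subring.coe_one, mul_one, one_mul] at h1 ⊢
  have c1 : (b' : A) * φ q = φ q * b' := (Subring.mem_center_iff.1 b'.2 _).symm
  have c2 : (h' : A) * φ q = φ q * h' := (Subring.mem_center_iff.1 h'.2 _).symm
  rw [c1, c2, ← mul_add, ← mul_add, mul_assoc (φ q), mul_assoc (φ q), ← mul_sub] at h1
  have h2 := congrArg (r * ·) h1
  simpa only [← mul_assoc, hr, one_mul] using h2

end TwoSided

/-! ### The Serre relations -/

section Serre

variable {B : Type*} [Ring B]

/-- Induction on the power of the series variable. In the direction of `u`, once the lower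
coefficients vanish, the next ones satisfy `z (n + 1) = b z n`. In the direction of `u⁻¹`, each
coefficient is expressed through earlier ones and `hb` plays no role. -/
theorem eq_zero_of_exchange (e : Bool) {b : Subring.center B}
    (hb : ∀ z : ℤ → B, (∀ n, z (n + 1) = b * z n) → z = 0) (Z : ℤ → PowerSeries B)
    (h : ∀ n, (uS e + cC b * qS e : Subring.center (PowerSeries B)) • Z n =
      (qS e : Subring.center (PowerSeries B)) • Z (n + 1)) : Z = 0 := by
  suffices ∀ N n, PowerSeries.coeff N (Z n) = 0 from funext fun n => PowerSeries.ext fun N => this N n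
  cases e
  · intro N
    have h' : ∀ n, PowerSeries.X * Z n + PowerSeries.C (b : B) * Z n = Z (n + 1) := by
      intro n
      have := h n
      rw [add_smul, mul_smul] at this
      rw [← one_mul (Z (n + 1)), ← one_mul (PowerSeries.C (b : B) * Z n), ← mul_assoc, one_mul]
      rw [show PowerSeries.C (b : B) * Z n = PowerSeries.C (b : B) * (1 * Z n) by rw [one_mul]]
      exact this
    induction N with
    | zero =>
      refine fun n => congrFun (hb (fun n => PowerSeries.coeff 0 (Z n)) fun n => ?_) n
      have := congrArg (PowerSeries.coeff 0) (h' n)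
      rw [map_add, PowerSeries.coeff_zero_X_mul, PowerSeries.coeff_C_mul, zero_add] at this
      exact this.symm
    | succ N ih =>
      refine fun n => congrFun (hb (fun n => PowerSeries.coeff (N + 1) (Z n)) fun n => ?_) n
      have := congrArg (PowerSeries.coeff (N + 1)) (h' n)
      rw [map_add, PowerSeries.coeff_succ_X_mul, PowerSeries.coeff_C_mul, ih, zero_add] at this
      exact this.symm
  · have h' : ∀ n, Z n + PowerSeries.C (b : B) * (PowerSeries.X * Z n) = PowerSeries.X * Z (n + 1) := by
      intro n
      have := h n
      rw [add_smul, mul_smul] at this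
      rw [show Z n + PowerSeries.C (b : B) * (PowerSeries.X * Z n) =
        1 * Z n + PowerSeries.C (b : B) * (PowerSeries.X * Z n) by rw [one_mul]]
      exact this
    intro N
    induction N with
    | zero =>
      intro n
      have := congrArg (PowerSeries.coeff 0) (h' n)
      rwa [map_add, PowerSeries.coeff_zero_X_mul, PowerSeries.coeff_C_mul, PowerSeries.coeff_zero_X_mul,
        mul_zero, add_zero] at this
    | succ N ih =>
      intro n
      have := congrArg (PowerSeries.coeff (N + 1)) (h' n)
      rwa [map_add, PowerSeries.coeff_succ_X_mul, PowerSeries.coeff_C_mul, PowerSeries.coeff_succ_X_mul,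
        ih, ih, mul_zero, add_zero] at this

variable {e : Bool} {a : ℤ → B} {b h : Subring.center B} {V : ℤ → B}

theorem serre_E_serE (ha : IsSupp e a) (hb : ∀ z : ℤ → B, (∀ n, z (n + 1) = b * z n) → z = 0)
    (h2 : ∀ x : B, x + x = 0 → x = 0)
    (hv : ∀ n x, a (x - 1) * V n - a x * V (n + 1) + (b + h) * (a x * V n) =
      V n * a (x - 1) - V (n + 1) * a x + b * (V n * a x))
    (hV : ∀ m n, V (m + 1) * V n - V m * V (n + 1) - h * (V m * V n) =
      V n * V (m + 1) - V (n + 1) * V m + h * (V n * V m)) :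
    ⁅⁅PowerSeries.C (V 0), serE e a⁆, PowerSeries.C (V 0)⁆ = 0 := by
  refine lie_lie_eq_zero (C := Subring.center (PowerSeries B)) (p := uS e + cC b * qS e) (q := qS e)
    (η := cC h) (V := fun n => PowerSeries.C (V n)) (eq_zero_of_exchange e hb) ?_ ?_ ?_
  · intro x hx
    ext N
    exact h2 _ (by rw [← map_add, hx, map_zero])
  · exact fun n => exchange_E_serE ha (hv n)
  · intro m n
    have := congrArg (PowerSeries.C (R := B)) (hV m n)
    simp only [map_sub, map_add, map_mul] at this
    exact this

theorem serre_F_serE (ha : IsSupp e a) (hb : ∀ z : ℤ → B, (∀ n, z (n + 1) = b * z n) → z = 0)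
    (h2 : ∀ x : B, x + x = 0 → x = 0)
    (hv : ∀ n x, a (x - 1) * V n - a x * V (n + 1) + b * (a x * V n) =
      V n * a (x - 1) - V (n + 1) * a x + (b + h) * (V n * a x))
    (hV : ∀ m n, V (m + 1) * V n - V m * V (n + 1) + h * (V m * V n) =
      V n * V (m + 1) - V (n + 1) * V m - h * (V n * V m)) :
    ⁅⁅serE e a, PowerSeries.C (V 0)⁆, PowerSeries.C (V 0)⁆ = 0 := by
  -- Passing to the opposite ring turns the relations for the modes of `X⁻` into those for the modes
  -- of `X⁺`.
  have key := lie_lie_eq_zero (A := (PowerSeries B)ᵐᵒᵖ) (C := Subring.center (PowerSeries B))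
    (p := uS e + cC b * qS e) (q := qS e) (η := cC h) (k := MulOpposite.op (serE e a))
    (V := fun n => MulOpposite.op (PowerSeries.C (V n))) ?_ ?_ ?_ ?_
  · have h1 := congrArg MulOpposite.unop key
    simp only [Ring.lie_def, MulOpposite.unop_sub, MulOpposite.unop_mul, MulOpposite.unop_op,
      MulOpposite.unop_zero] at h1 ⊢
    rw [← neg_eq_zero, neg_sub]
    exact h1
  · intro Z hZ
    have := eq_zero_of_exchange e hb (fun n => (Z n).unop) fun n => congrArg MulOpposite.unop (hZ n)
    exact funext fun n => MulOpposite.unop_injective (congrFun this n)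
  · intro x hx
    refine MulOpposite.unop_injective (PowerSeries.ext fun N => h2 _ ?_)
    rw [← map_add, ← MulOpposite.unop_add, hx, MulOpposite.unop_zero, map_zero]
  · intro n
    refine MulOpposite.unop_injective ?_
    exact exchange_F_serE ha (hv n)
  · intro m n
    refine MulOpposite.unop_injective ?_
    have := congrArg (PowerSeries.C (R := B)) (hV m n)
    simp only [map_sub, map_add, map_mul] at this
    exact this.symm

end Serre

/-! ### The quadratic relations, coefficient by coefficient -/

section Quadratic

variable {B : Type*} [Ring B]

theorem map_ring_lie {S A : Type*} [Ring S] [Ring A] (φ : S →+* A) (x y : S) :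
    φ ⁅x, y⁆ = ⁅φ x, φ y⁆ := by
  simp only [Ring.lie_def, map_sub, map_mul]

theorem cL_add (x y : Subring.center B) : cL (x + y) = cL x + cL y :=
  Subtype.ext ((congrArg HahnSeries.C (map_add HahnSeries.C (x : B) (y : B))).trans
    (map_add HahnSeries.C _ _))

theorem cL_neg (x : Subring.center B) : cL (-x) = -cL x :=
  Subtype.ext ((congrArg HahnSeries.C (map_neg HahnSeries.C (x : B))).trans
    (map_neg HahnSeries.C _))

theorem cL_zero : (cL (0 : Subring.center B)) = 0 :=
  Subtype.ext ((congrArg HahnSeries.C (map_zero HahnSeries.C)).trans (map_zero HahnSeries.C))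

theorem map_tMat {S A : Type*} [Ring S] [Ring A] (φ : S →+* A) (k E F : S) (i j : Fin 2) :
    φ (tMat k E F i j) = tMat (φ k) (φ E) (φ F) i j := by
  fin_cases i <;> fin_cases j <;> simp [Ring.lie_def]

theorem tMat_serE (e : Bool) (k : ℤ → B) (E F : B) (i j : Fin 2) :
    tMat (serE e k) (PowerSeries.C E) (PowerSeries.C F) i j = serE e fun x => tMat (k x) E F i j := by
  ext N
  fin_cases i <;> fin_cases j <;>
    simp [Ring.lie_def, sub_mul, mul_sub, C_mul_serE, serE_mul_C, ← mul_assoc] <;> simp [serE]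

theorem isSupp_tMat {e : Bool} {k : ℤ → B} (hk : IsSupp e k) (E F : B) (i j : Fin 2) :
    IsSupp e fun x => tMat (k x) E F i j := by
  intro x hx
  fin_cases i <;> fin_cases j <;> simp [hk x hx, Ring.lie_def]

/-- The Gauss coordinates of a matrix of series. -/
structure IsGauss (e : Bool) (b h : Subring.center B) (k K₂ : ℤ → B) (κ : PowerSeries B)
    (E E₁ F F₁ : B) : Prop where
  supp : IsSupp e k
  supp₂ : IsSupp e K₂
  exchange_E : ∀ x, k (x - 1) * E - k x * E₁ + (b + h) * (k x * E) =
      E * k (x - 1) - E₁ * k x + b * (E * k x)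
  exchange_F : ∀ x, k (x - 1) * F - k x * F₁ - b * (k x * F) =
      F * k (x - 1) - F₁ * k x + (h - b) * (F * k x)
  triple : IsTriple (serE e k) (PowerSeries.C E) (PowerSeries.C F)
  inv_mul : κ * serE e k = 1
  mul_inv : serE e k * κ = 1
  entry : serE e k + ⁅⁅PowerSeries.C E, serE e k⁆, PowerSeries.C F⁆ =
    serE e K₂ + ⁅serE e k, PowerSeries.C F⁆ * κ * ⁅PowerSeries.C E, serE e k⁆

theorem IsTriple.map {S A : Type*} [Ring S] [Ring A] (φ : S →+* A) {k E F : S} (h : IsTriple k E F) :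
    IsTriple (φ k) (φ E) (φ F) := by
  obtain ⟨h1, h2, h3, h4, h5⟩ := h
  refine ⟨?_, ?_, ?_, ?_, ?_⟩
  · simpa [Ring.lie_def] using congrArg φ h1
  · simpa [Ring.lie_def, map_ofNat] using congrArg φ h2
  · simpa [Ring.lie_def, map_ofNat] using congrArg φ h3
  · simpa [Ring.lie_def] using congrArg φ h4
  · simpa [Ring.lie_def] using congrArg φ h5

variable {e e' : Bool} {b b' h : Subring.center B} {k k₂ K K₂ : ℤ → B} {κ κ' : PowerSeries B}
  {E E₁ F F₁ : B}

/-- One matrix is put into the inner and the other into the outer variable. The constants `E` and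
`F` have the same image under both embeddings, so they act on both matrices, as the equivariance
argument requires. -/
theorem IsGauss.rttDefect_eq_zero (T : IsGauss e b h k k₂ κ E E₁ F F₁)
    (T' : IsGauss e' b' h K K₂ κ' E E₁ F F₁) {P Q : Subring.center (Laurent₂ B)}
    (hPQ : P * (uL e - vL e' - cL b + cL b' + cL h) = Q * (uL e - vL e' + cL b - cL b' + cL h))
    (hkK : inner₁ B (serE e k) * outer₂ B (serE e' K) = outer₂ B (serE e' K) * inner₁ B (serE e k))
    (hkK₂ : (P * (uL e - vL e' - cL b + cL b')) • (inner₁ B (serE e k) * outer₂ B (serE e' K₂)) =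
      (Q * (uL e - vL e' + cL b - cL b')) • (outer₂ B (serE e' K₂) * inner₁ B (serE e k)))
    (i j l r : Fin 2) : rttDefect P Q (uL e - vL e' - cL b + cL b') (uL e - vL e' + cL b - cL b') (cL h)
      (fun i j => inner₁ B (tMat (serE e k) (PowerSeries.C E) (PowerSeries.C F) i j))
      (fun i j => outer₂ B (tMat (serE e' K) (PowerSeries.C E) (PowerSeries.C F) i j)) i j l r = 0 := by
  have hi := T.triple.map (inner₁ B)
  have ho := T'.triple.map (outer₂ B)
  have exE := exchange_E_serE T.supp T.exchange_E
  have exE' := exchange_E_serE T'.supp T'.exchange_E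
  have exF := exchange_F_serE T.supp (b := -b) (h := h) (v := F) (v₁ := F₁) fun x => by
    have := T.exchange_F x
    rw [Subring.coe_neg]
    linear_combination (norm := noncomm_ring) this
  have exF' := exchange_F_serE T'.supp (b := -b') (h := h) (v := F) (v₁ := F₁) fun x => by
    have := T'.exchange_F x
    rw [Subring.coe_neg]
    linear_combination (norm := noncomm_ring) this
  have hO : ∀ x : Subring.center B, outer₂ B (cC x : Subring.center (PowerSeries B)) =
      (cL x : Subring.center (Laurent₂ B)) := fun x => (outer₂_C _).trans (inner₁_cC x)
  have mE := map_exchange (inner₁ B) (inner₁_uS e) (inner₁_cC b) (inner₁_cC h)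
    (exists_inner₁_qS_inv e) exE
  have mE' := map_exchange (outer₂ B) (outer₂_uS e') (hO b') (hO h) (exists_outer₂_qS_inv e') exE'
  have mF := map_exchange (inner₁ B) (inner₁_uS e) (inner₁_cC (-b)) (inner₁_cC h)
    (exists_inner₁_qS_inv e) exF
  have mF' := map_exchange (outer₂ B) (outer₂_uS e') (hO (-b')) (hO h) (exists_outer₂_qS_inv e') exF'
  simp only [map_ring_lie, map_mul, outer₂_C] at mE mE' mF mF' ho
  have h12 := lie_E_exchange hkK mE mE'
  have h21 := lie_F_exchange hkK mF mF'
  have h22 := congrArg (outer₂ B) T'.entry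
  have hκ := congrArg (outer₂ B) T'.inv_mul
  have hκ' := congrArg (outer₂ B) T'.mul_inv
  simp only [map_add, map_mul, map_one, map_ring_lie, outer₂_C] at h22 hκ hκ'
  simp only [map_tMat, outer₂_C]
  simp only [mul_one] at h12 h21
  have e1 : uL e + cL b - (vL e' + cL b') = uL e - vL e' + cL b - cL b' := by ring
  have e2 : uL e + cL (-b) - (vL e' + cL (-b')) = uL e - vL e' - cL b + cL b' := by
    rw [cL_neg, cL_neg]; ring
  rw [e1] at h12
  rw [e2] at h21
  exact YangianDouble.rttDefect_eq_zero hPQ hi ho hkK hκ hκ' hkK₂ h12 h21 h22 i j l r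

/-- Multiplication of a two-variable series by `u - v + y`. -/
def msc (y : B) (D : ℤ → ℤ → B) (m n : ℤ) : B := D (m - 1) n - D m (n - 1) + y * D m n

theorem cf_shift_smul (e e' : Bool) (y : Subring.center B) (z : Laurent₂ B) (m n : ℤ) :
    cf e e' ((uL e - vL e' + cL y : Subring.center (Laurent₂ B)) • z) m n = msc (y : B) (cf e e' z) m n := by
  rw [add_smul, sub_smul, cf_add, cf_sub, cf_uL_smul, cf_vL_smul, cf_cL_smul, msc]

theorem IsGauss.cf_mul (T : IsGauss e b h k k₂ κ E E₁ F F₁) (T' : IsGauss e' b' h K K₂ κ' E E₁ F F₁)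
    (i j l r : Fin 2) (m n : ℤ) :
    cf e e' (inner₁ B (tMat (serE e k) (PowerSeries.C E) (PowerSeries.C F) i j) *
      outer₂ B (tMat (serE e' K) (PowerSeries.C E) (PowerSeries.C F) l r)) m n =
      tMat (k m) E F i j * tMat (K n) E F l r := by
  rw [tMat_serE, tMat_serE, cf_inner_mul_outer (isSupp_tMat T.supp E F i j) (isSupp_tMat T'.supp E F l r)]

theorem IsGauss.cf_mul' (T : IsGauss e b h k k₂ κ E E₁ F F₁) (T' : IsGauss e' b' h K K₂ κ' E E₁ F F₁)
    (i j l r : Fin 2) (m n : ℤ) :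
    cf e e' (outer₂ B (tMat (serE e' K) (PowerSeries.C E) (PowerSeries.C F) l r) *
      inner₁ B (tMat (serE e k) (PowerSeries.C E) (PowerSeries.C F) i j)) m n =
      tMat (K n) E F l r * tMat (k m) E F i j := by
  rw [tMat_serE, tMat_serE, cf_outer_mul_inner (isSupp_tMat T.supp E F i j) (isSupp_tMat T'.supp E F l r)]

/-- The quadratic relations within one half of the algebra. -/
theorem IsGauss.quadratic_same (T : IsGauss e b h k k₂ κ E E₁ F F₁)
    (T' : IsGauss e b h K K₂ κ' E E₁ F F₁) (hkK : ∀ m n, k m * K n = K n * k m)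
    (hkK₂ : ∀ m n, k m * K₂ n = K₂ n * k m) (i j l r : Fin 2) (m n : ℤ) :
    msc 0 (fun m n => tMat (k m) E F i j * tMat (K n) E F l r) m n +
      h * (tMat (k m) E F l j * tMat (K n) E F i r) =
    msc 0 (fun m n => tMat (K n) E F l r * tMat (k m) E F i j) m n +
      h * (tMat (K n) E F l j * tMat (k m) E F i r) := by
  have key := T.rttDefect_eq_zero T' (P := 1) (Q := 1) (by ring)
    (cf_ext (e := e) (e' := e) fun m n => by
      rw [cf_inner_mul_outer T.supp T'.supp, cf_outer_mul_inner T.supp T'.supp, hkK])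
    (by
      rw [show uL e - vL e - cL b + cL b = uL e - vL e + cL b - cL b by ring]
      congr 1
      exact cf_ext (e := e) (e' := e) fun m n => by
        rw [cf_inner_mul_outer T.supp T'.supp₂, cf_outer_mul_inner T.supp T'.supp₂, hkK₂]) i j l r
  rw [rttDefect, one_smul, one_smul, sub_eq_zero,
    show uL e - vL e - cL b + cL b = uL e - vL e + cL (0 : Subring.center B) by rw [cL_zero]; ring,
    show uL e - vL e + cL b - cL b = uL e - vL e + cL (0 : Subring.center B) by rw [cL_zero]; ring] at key
  have h1 := congrArg (fun z => cf e e z m n) key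
  simp only [cf_add, cf_shift_smul, cf_cL_smul, T.cf_mul T', T.cf_mul' T'] at h1
  have f1 : cf e e (inner₁ B (tMat (serE e k) (PowerSeries.C E) (PowerSeries.C F) i j) *
      outer₂ B (tMat (serE e K) (PowerSeries.C E) (PowerSeries.C F) l r)) =
      fun m n => tMat (k m) E F i j * tMat (K n) E F l r :=
    funext fun m => funext fun n => T.cf_mul T' i j l r m n
  have f2 : cf e e (outer₂ B (tMat (serE e K) (PowerSeries.C E) (PowerSeries.C F) l r) *
      inner₁ B (tMat (serE e k) (PowerSeries.C E) (PowerSeries.C F) i j)) =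
      fun m n => tMat (K n) E F l r * tMat (k m) E F i j :=
    funext fun m => funext fun n => T.cf_mul' T' i j l r m n
  rw [f1, f2] at h1
  exact h1

/-- The quadratic relations between the two halves of the algebra. -/
theorem IsGauss.quadratic_mixed (T : IsGauss e b h k k₂ κ E E₁ F F₁)
    (T' : IsGauss e' b' h K K₂ κ' E E₁ F F₁) {d : Subring.center B} (hd : b - b' = d)
    (hkK : ∀ m n, k m * K n = K n * k m)
    (hkK₂ : ∀ m n, msc ((d : B) + h) (msc (-(d : B)) fun m n => k m * K₂ n) m n =
      msc (-(d : B) + h) (msc (d : B) fun m n => K₂ n * k m) m n) (i j l r : Fin 2) (m n : ℤ) :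
    msc ((d : B) + h) (fun m n => msc (-(d : B)) (fun m n => tMat (k m) E F i j * tMat (K n) E F l r) m n +
      h * (tMat (k m) E F l j * tMat (K n) E F i r)) m n =
    msc (-(d : B) + h) (fun m n => msc (d : B) (fun m n => tMat (K n) E F l r * tMat (k m) E F i j) m n +
      h * (tMat (K n) E F l j * tMat (k m) E F i r)) m n := by
  have hY : uL e - vL e' - cL b + cL b' = uL e - vL e' + cL (-d) := by
    rw [← hd, sub_eq_add_neg b b', cL_neg, cL_add, cL_neg]; ring
  have hY' : uL e - vL e' + cL b - cL b' = uL e - vL e' + cL d := by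
    rw [← hd, sub_eq_add_neg b b', cL_add, cL_neg]; ring
  -- `P` and `Q` are the two cleared denominators. The identity `hPQ` holds because `u - v + (d +
  -- h)` and `u - v + (-d + h)` appear on both sides in opposite roles.
  have key := T.rttDefect_eq_zero T' (P := uL e - vL e' + cL (d + h)) (Q := uL e - vL e' + cL (-d + h))
    (by rw [hY, hY', cL_add, cL_add]; ring)
    (cf_ext (e := e) (e' := e') fun m n => by
      rw [cf_inner_mul_outer T.supp T'.supp, cf_outer_mul_inner T.supp T'.supp, hkK])
    (by
      rw [hY, hY', mul_smul, mul_smul]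
      refine cf_ext (e := e) (e' := e') fun m n => ?_
      rw [cf_shift_smul, cf_shift_smul]
      have g1 : cf e e' ((uL e - vL e' + cL (-d)) • (inner₁ B (serE e k) * outer₂ B (serE e' K₂))) =
          msc (-(d : B)) fun m n => k m * K₂ n := by
        funext m n
        rw [cf_shift_smul]
        congr 1
        exact funext fun m => funext fun n => cf_inner_mul_outer T.supp T'.supp₂ m n
      have g2 : cf e e' ((uL e - vL e' + cL d) • (outer₂ B (serE e' K₂) * inner₁ B (serE e k))) =
          msc (d : B) fun m n => K₂ n * k m := by
        funext m n
        rw [cf_shift_smul]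
        congr 1
        exact funext fun m => funext fun n => cf_outer_mul_inner T.supp T'.supp₂ m n
      rw [g1, g2]
      exact hkK₂ m n) i j l r
  rw [rttDefect, sub_eq_zero, hY, hY'] at key
  have h1 := congrArg (fun z => cf e e' z m n) key
  simp only [cf_shift_smul] at h1
  have f1 : cf e e' ((uL e - vL e' + cL (-d)) •
      (inner₁ B (tMat (serE e k) (PowerSeries.C E) (PowerSeries.C F) i j) *
        outer₂ B (tMat (serE e' K) (PowerSeries.C E) (PowerSeries.C F) l r)) +
      cL h • (inner₁ B (tMat (serE e k) (PowerSeries.C E) (PowerSeries.C F) l j) *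
        outer₂ B (tMat (serE e' K) (PowerSeries.C E) (PowerSeries.C F) i r))) =
      fun m n => msc (-(d : B)) (fun m n => tMat (k m) E F i j * tMat (K n) E F l r) m n +
        h * (tMat (k m) E F l j * tMat (K n) E F i r) := by
    funext m n
    rw [cf_add, cf_shift_smul, cf_cL_smul, T.cf_mul T']
    congr 2
    exact funext fun m => funext fun n => T.cf_mul T' i j l r m n
  have f2 : cf e e' ((uL e - vL e' + cL d) •
      (outer₂ B (tMat (serE e' K) (PowerSeries.C E) (PowerSeries.C F) l r) *
        inner₁ B (tMat (serE e k) (PowerSeries.C E) (PowerSeries.C F) i j)) +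
      cL h • (outer₂ B (tMat (serE e' K) (PowerSeries.C E) (PowerSeries.C F) l j) *
        inner₁ B (tMat (serE e k) (PowerSeries.C E) (PowerSeries.C F) i r))) =
      fun m n => msc (d : B) (fun m n => tMat (K n) E F l r * tMat (k m) E F i j) m n +
        h * (tMat (K n) E F l j * tMat (k m) E F i r) := by
    funext m n
    rw [cf_add, cf_shift_smul, cf_cL_smul, T.cf_mul' T']
    congr 2
    exact funext fun m => funext fun n => T.cf_mul' T' i j l r m n
  rw [f1, f2] at h1
  exact h1

end Quadratic

/-! ### Low order coefficients -/

/-- The series that vanish on a downward closed set of exponents form an ideal. Modulo it `X` is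
zero, so its exponential is `1`. -/
theorem coeff_expS_eq_coeff_one {A : Type*} [Ring A] [Algebra ℂ A] {X : MvPowerSeries (Fin 2) A}
    {D : Set (Fin 2 →₀ ℕ)} (hD : ∀ d ∈ D, ∀ d' ≤ d, d' ∈ D)
    (h : ∀ d ∈ D, MvPowerSeries.coeff d X = 0) {d : Fin 2 →₀ ℕ} (hd : d ∈ D) :
    MvPowerSeries.coeff d (expS X) = MvPowerSeries.coeff d 1 := by
  classical
  change ∑ n ∈ Finset.range (d.degree + 1), _ = _
  rw [Finset.sum_range_succ', Finset.sum_eq_zero]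
  · simp
  · intro n _
    rw [pow_succ', MvPowerSeries.coeff_mul, Finset.sum_eq_zero, smul_zero]
    intro p hp
    rw [h _ (hD d hd _ (Finset.HasAntidiagonal.mem_antidiagonal.1 hp ▸ le_self_add)), zero_mul]

theorem coeff_mul_of_coeff_one {A : Type*} [Ring A] {X : MvPowerSeries (Fin 2) A}
    {D : Set (Fin 2 →₀ ℕ)} (hD : ∀ d ∈ D, ∀ d' ≤ d, d' ∈ D)
    (h : ∀ d ∈ D, MvPowerSeries.coeff d X = MvPowerSeries.coeff d 1) (Y : MvPowerSeries (Fin 2) A)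
    {d : Fin 2 →₀ ℕ} (hd : d ∈ D) :
    MvPowerSeries.coeff d (X * Y) = MvPowerSeries.coeff d Y := by
  classical
  rw [← one_mul Y, ← mul_assoc, mul_one, MvPowerSeries.coeff_mul, MvPowerSeries.coeff_mul]
  refine Finset.sum_congr rfl fun p hp => ?_
  rw [h _ (hD d hd _ (Finset.HasAntidiagonal.mem_antidiagonal.1 hp ▸ le_self_add))]

theorem coeff_creOp_eq_coeff_one {D : Set (Fin 2 →₀ ℕ)} (hD : ∀ d ∈ D, ∀ d' ≤ d, d' ∈ D)
    {l : List (Fin 2 × ℂ × ℤ)} (h : ∀ d ∈ D, MvPowerSeries.coeff d (creExp l) = 0)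
    {d : Fin 2 →₀ ℕ} (hd : d ∈ D) :
    MvPowerSeries.coeff d (creOp l) = MvPowerSeries.coeff d (1 : OpSeries) := by
  have h1 := coeff_mapS (A := OpP) (B := Op₀) liftOp d (expS (creExp l))
  have h2 := coeff_mapS (A := OpP) (B := Op₀) liftOp d 1
  rw [creOp, h1, coeff_expS_eq_coeff_one hD h hd, ← h2, map_one]

theorem coeff_annOp_of_coeff_eq_zero {D : Set (Fin 2 →₀ ℕ)} (hD : ∀ d ∈ D, ∀ d' ≤ d, d' ∈ D)
    {l : List (Fin 2 × ℂ × ℤ)} (h : ∀ d ∈ D, MvPowerSeries.coeff d (annExp l) = 0)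
    (F : ℤ → PowerSeries ℂ) {d : Fin 2 →₀ ℕ} (hd : d ∈ D) :
    MvPowerSeries.coeff d (annOp l F) = latticeDiag fun q => MvPowerSeries.coeff d (tz (F q)) := by
  refine (coeff_mul_of_coeff_one (A := Op₀) hD (fun d hd => ?_) _ hd).trans (coeff_diagSeries _ _)
  have h1 := coeff_mapS (A := OpP) (B := Op₀) liftOp d (expS (annExp l))
  have h2 := coeff_mapS (A := OpP) (B := Op₀) liftOp d 1
  rw [h1, coeff_expS_eq_coeff_one hD h hd, ← h2, map_one]

/-- Changing the shift changes `(u + a ħ)^(-k)` only by multiples of `ħ u⁻²`. Lists whose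
multiplicities add up to zero for each `j` therefore have no exponent at `ħ ^ 0` and none at `u ^ 0`
or `u⁻¹`. -/
theorem dvd_negPow_sub (a : ℂ) (k : ℕ) :
    (MvPowerSeries.X 0 * MvPowerSeries.X 1 ^ 2 : Scalar) ∣ negPow a k - negPow 0 k := by
  have h0 : onePlus 0 = 1 := by simp [onePlus]
  have h1 : (onePlus a)⁻¹ - 1 =
      -(MvPowerSeries.C a * MvPowerSeries.X 0 * MvPowerSeries.X 1) * (onePlus a)⁻¹ := by
    have h2 : onePlus a * (onePlus a)⁻¹ = 1 :=
      MvPowerSeries.mul_inv_cancel _ (by rw [constantCoeff_onePlus]; exact one_ne_zero)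
    have h3 : onePlus a = 1 + MvPowerSeries.C a * MvPowerSeries.X 0 * MvPowerSeries.X 1 := rfl
    have h4 : (1 + MvPowerSeries.C a * MvPowerSeries.X 0 * MvPowerSeries.X 1) * (onePlus a)⁻¹ = 1 := by
      rw [← h3, h2]
    linear_combination h4
  have h5 : (1 : Scalar)⁻¹ = 1 := by
    have := MvPowerSeries.mul_inv_cancel (1 : Scalar) (by simp)
    rwa [one_mul] at this
  refine dvd_trans ?_ (sub_dvd_pow_sub_pow _ _ _)
  rw [h0, h5, ← mul_sub, h1]
  exact ⟨-MvPowerSeries.C a * (onePlus a)⁻¹, by ring⟩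

theorem coeff_negPow_eq (a : ℂ) (k : ℕ) {d : Fin 2 →₀ ℕ} (hd : d 0 = 0 ∨ d 1 ≤ 1) :
    MvPowerSeries.coeff d (negPow a k) = MvPowerSeries.coeff d (negPow 0 k) := by
  rw [← sub_eq_zero, ← map_sub]
  rcases hd with hd | hd
  · exact MvPowerSeries.X_dvd_iff.1 ((dvd_mul_right _ _).trans (dvd_negPow_sub a k)) d hd
  · exact MvPowerSeries.X_pow_dvd_iff.1 ((dvd_mul_left _ _).trans (dvd_negPow_sub a k)) d (by omega)

theorem coeff_posPow_eq (b : ℂ) (k : ℕ) {d : Fin 2 →₀ ℕ} (hd : d 0 = 0) :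
    MvPowerSeries.coeff d (posPow b k) = MvPowerSeries.coeff d (posPow 0 k) := by
  rw [← sub_eq_zero, ← map_sub]
  refine MvPowerSeries.X_dvd_iff.1 (dvd_trans ?_ (sub_dvd_pow_sub_pow _ _ _)) d hd
  exact ⟨MvPowerSeries.C b, by simp; ring⟩

theorem coeff_wsum_bosonSumG {A : Type*} [Ring A] [Algebra ℂ A] (a : Fin 2 → ℕ → A)
    {p : ℂ → ℕ → Scalar} {p₀ : ℕ → Scalar} {d : Fin 2 →₀ ℕ}
    (h : ∀ c k, MvPowerSeries.coeff d (p c k) = MvPowerSeries.coeff d (p₀ k))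
    (l : List (Fin 2 × ℂ × ℤ)) :
    MvPowerSeries.coeff d (wsum (fun j c => bosonSumG (a j) (p c)) l) =
      wsum (fun j _ => MvPowerSeries.coeff d (bosonSumG (a j) p₀)) l := by
  rw [wsum, map_list_sum, List.map_map, wsum]
  congr 2
  funext x
  rw [Function.comp_apply, map_zsmul, coeff_bosonSumG, coeff_bosonSumG]
  simp only [h]

theorem coeff_annExp_eq_zero {l : List (Fin 2 × ℂ × ℤ)}
    (hl : ∀ (M : Type) [AddCommGroup M] (g : Fin 2 → M), wsum (fun j _ => g j) l = 0)
    {d : Fin 2 →₀ ℕ} (hd : d 0 = 0 ∨ d 1 ≤ 1) : MvPowerSeries.coeff d (annExp l) = 0 := by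
  have h := coeff_wsum_bosonSumG (fun j k => bosonP j (k : ℤ)) (p := negPow) (p₀ := negPow 0)
    (fun c k => coeff_negPow_eq c k hd) l
  rw [annExp_eq_wsum, h, hl]

theorem coeff_creExp_eq_zero {l : List (Fin 2 × ℂ × ℤ)}
    (hl : ∀ (M : Type) [AddCommGroup M] (g : Fin 2 → M), wsum (fun j _ => g j) l = 0)
    {d : Fin 2 →₀ ℕ} (hd : d 0 = 0) : MvPowerSeries.coeff d (creExp l) = 0 := by
  have h := coeff_wsum_bosonSumG (fun j k => bosonP j (-(k : ℤ))) (p := posPow) (p₀ := posPow 0)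
    (fun c k => coeff_posPow_eq c k hd) l
  rw [creExp_eq_wsum, h, hl]

theorem coeff_tz (F : PowerSeries ℂ) (m l : ℕ) : MvPowerSeries.coeff (expo m l) (tz F) =
    if m = l then PowerSeries.coeff m F else 0 := by
  classical
  have h : ∀ d, (MvPowerSeries.X 0 * MvPowerSeries.X 1 : Scalar) ^ d =
      MvPowerSeries.monomial (expo d d) 1 := by
    intro d
    rw [mul_pow, MvPowerSeries.X_pow_eq, MvPowerSeries.X_pow_eq,
      MvPowerSeries.monomial_mul_monomial, one_mul]
    rfl
  rw [tz_apply, PowerSeries.coeff_subst hasSubst_X_mul_X, finsum_eq_single _ m]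
  · rw [h, MvPowerSeries.coeff_monomial]
    by_cases hml : m = l
    · simp [hml]
    · rw [if_neg, if_neg hml, smul_zero]
      intro h1
      exact hml (expo_inj h1).2.symm
  · intro d hd
    rw [h, MvPowerSeries.coeff_monomial, if_neg, smul_zero]
    intro h1
    exact hd (expo_inj h1).1.symm

theorem constantCoeff_powS {h : PowerSeries ℂ} (hh : PowerSeries.constantCoeff h = 0) (x : ℂ) :
    PowerSeries.coeff 0 (powS h x) = 1 := by
  rw [powS, PowerSeries.coeff_subst' (PowerSeries.HasSubst.of_constantCoeff_zero' hh),
    finsum_eq_single _ 0]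
  · simp
  · intro n hn
    simp [hh, hn]

theorem coeff_one_powS (a x : ℂ) :
    PowerSeries.coeff 1 (powS (PowerSeries.C a * PowerSeries.X) x) = x * a := by
  have hh : PowerSeries.constantCoeff (PowerSeries.C a * PowerSeries.X : PowerSeries ℂ) = 0 := by
    simp
  rw [powS, PowerSeries.coeff_subst' (PowerSeries.HasSubst.of_constantCoeff_zero' hh),
    finsum_eq_single _ 1]
  · simp
  · intro n hn
    rw [mul_pow, ← map_pow, PowerSeries.coeff_C_mul, PowerSeries.coeff_X_pow, if_neg (Ne.symm hn), mul_zero,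
      smul_zero]

theorem coeff_kSer_zero (i : Fin 2) (s : ℂ) (e : Bool) (j : Fin 2) (n : ℕ) :
    MvPowerSeries.coeff (expo 0 n) (kSer i s e j) = if n = 0 then 1 else 0 := by
  classical
  have hD : ∀ d ∈ {d : Fin 2 →₀ ℕ | d 0 = 0}, ∀ d' ≤ d, d' ∈ {d : Fin 2 →₀ ℕ | d 0 = 0} :=
    fun d hd d' h => Nat.le_zero.1 ((h 0).trans_eq hd)
  cases e
  · simp only [kSer, Bool.false_eq_true, if_false]
    rw [kMinusOp_eq, coeff_creOp_eq_coeff_one hD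
      (fun d hd => coeff_creExp_eq_zero (by intro M _ g; fin_cases j <;> simp [wsum, kMinusCre]) hd)
      (expo_apply_zero 0 n), MvPowerSeries.coeff_one]
    simp [expo]
  · simp only [kSer, if_true]
    rw [kPlusOp_eq, coeff_annOp_of_coeff_eq_zero hD
      (fun d hd => coeff_annExp_eq_zero (by intro M _ g; simp [wsum]) (Or.inl hd)) _ (expo_apply_zero 0 n)]
    simp only [coeff_tz, constantCoeff_powS constantCoeff_halfT, eq_comm (a := 0) (b := n)]
    split_ifs
    · exact latticeDiag_one
    · exact latticeDiag_zero

theorem psiPlusF_eq (i : Fin 2) (m : ℕ) (n : ℤ) : psiPlusF i m n =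
    if n ≤ 0 then MvPowerSeries.coeff (expo m (-n).toNat) (annOp psiAnn fun q =>
      powS (PowerSeries.C (1 / 4) * PowerSeries.X) (alphaWeight i q : ℤ) *
        powS (PowerSeries.C (-3 / 4) * PowerSeries.X) (-alphaWeight i q : ℤ)) else 0 := by
  rw [← tw_annOp, psiPlusF]
  congr 2
  funext q
  rw [map_mul, ← mon_mul_kap_powS, ← mon_mul_kap_powS]
  have h : (mon (alphaWeight i q) : Ser ℤ) * mon (-alphaWeight i q) = 1 := by
    rw [← mon_add, add_neg_cancel, mon_zero]
  linear_combination h * kap (powS (PowerSeries.C (1 / 4) * PowerSeries.X) (alphaWeight i q : ℤ)) *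
    kap (powS (PowerSeries.C (-3 / 4) * PowerSeries.X) (-alphaWeight i q : ℤ))

/-- The bosonic exponent starts at `u⁻²`, so the first two coefficients come from the lattice factor
`((u + ħ/4)/(u - 3ħ/4))^w = 1 + w ħ/u + ...`, with `w` the eigenvalue of `∂_α`. -/
theorem psiPlusF_low (i : Fin 2) (m : ℕ) {n : ℕ} (hn : n ≤ 1) : psiPlusF i m (-n) =
    latticeDiag fun q => if m = n then (if n = 0 then 1 else (alphaWeight i q : ℂ)) else 0 := by
  have hD : ∀ d ∈ {d : Fin 2 →₀ ℕ | d 1 ≤ 1}, ∀ d' ≤ d, d' ∈ {d : Fin 2 →₀ ℕ | d 1 ≤ 1} :=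
    fun d hd d' h => (h 1).trans hd
  have hh : ∀ a : ℂ, PowerSeries.constantCoeff (PowerSeries.C a * PowerSeries.X : PowerSeries ℂ) = 0 := by
    simp
  rw [psiPlusF_eq, if_pos (by omega), neg_neg, Int.toNat_natCast, coeff_annOp_of_coeff_eq_zero hD
    (fun d hd => coeff_annExp_eq_zero (by intro M _ g; simp [wsum]) (Or.inr hd)) _
    ((expo_apply_one m n).trans_le hn)]
  congr 1
  funext q
  rw [coeff_tz]
  split_ifs with h1 h2
  · subst h1 h2
    rw [PowerSeries.coeff_zero_eq_constantCoeff_apply, map_mul,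
      ← PowerSeries.coeff_zero_eq_constantCoeff_apply, ← PowerSeries.coeff_zero_eq_constantCoeff_apply,
      constantCoeff_powS (hh _), constantCoeff_powS (hh _), mul_one]
  · have h3 : n = 1 := by omega
    subst h1 h3
    rw [PowerSeries.coeff_mul, show Finset.HasAntidiagonal.antidiagonal 1 =
      ({(0, 1), (1, 0)} : Finset (ℕ × ℕ)) from rfl, Finset.sum_pair (by simp), coeff_one_powS,
      coeff_one_powS, constantCoeff_powS (hh _), constantCoeff_powS (hh _)]
    push_cast
    ring
  · rfl

theorem psiPlusF_of_pos (i : Fin 2) (m : ℕ) {n : ℤ} (hn : 0 < n) : psiPlusF i m n = 0 := by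
  rw [psiPlusF_eq, if_neg (by omega)]

/-! ### Currents with coefficients in `Op₀⟦ħ⟧` -/

/-- Power series in `ħ` with coefficients in `Op₀`. -/
def OO : Type := PowerSeries Op₀

instance : Ring OO := inferInstanceAs (Ring (PowerSeries Op₀))

namespace OO

/-- The series with given coefficients. -/
def mk (f : ℕ → Op₀) : OO := (PowerSeries.mk f : PowerSeries Op₀)

/-- The coefficient of `ħ ^ m`. -/
def coeff (m : ℕ) : OO →+ Op₀ := (PowerSeries.coeff m : PowerSeries Op₀ →ₗ[Op₀] Op₀).toAddMonoidHom

/-- The constant series. -/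
def C : Op₀ →+* OO := (PowerSeries.C : Op₀ →+* PowerSeries Op₀)

/-- The series `ħ`. -/
def X : OO := (PowerSeries.X : PowerSeries Op₀)

theorem ext {x y : OO} (h : ∀ m, coeff m x = coeff m y) : x = y := PowerSeries.ext h

theorem coeff_mk (m : ℕ) (f : ℕ → Op₀) : coeff m (mk f) = f m := PowerSeries.coeff_mk m f

theorem coeff_mul (m : ℕ) (x y : OO) : coeff m (x * y) =
    ∑ p ∈ Finset.HasAntidiagonal.antidiagonal m, coeff p.1 x * coeff p.2 y := PowerSeries.coeff_mul m x y

theorem coeff_one (m : ℕ) : coeff m 1 = if m = 0 then 1 else 0 := PowerSeries.coeff_one m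

theorem coeff_C (m : ℕ) (a : Op₀) : coeff m (C a) = if m = 0 then a else 0 := PowerSeries.coeff_C m a

theorem coeff_C_mul (m : ℕ) (a : Op₀) (x : OO) : coeff m (C a * x) = a * coeff m x :=
  PowerSeries.coeff_C_mul m x a

theorem coeff_mul_C (m : ℕ) (a : Op₀) (x : OO) : coeff m (x * C a) = coeff m x * a :=
  PowerSeries.coeff_mul_C m x a

theorem coeff_zero_X_mul (x : OO) : coeff 0 (X * x) = 0 := PowerSeries.coeff_zero_X_mul x

theorem coeff_succ_X_mul (m : ℕ) (x : OO) : coeff (m + 1) (X * x) = coeff m x :=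
  PowerSeries.coeff_succ_X_mul m x

theorem X_mul_comm (x : OO) : x * X = X * x := (PowerSeries.commute_X (x : PowerSeries Op₀)).eq

end OO

/-- The modes of a current. -/
def md (f : Fld ℤ Op₀) (x : ℤ) : OO := OO.mk fun m => f m x

/-- The modes of a current in two variables. -/
def md₂ (D : Fld (ℤ × ℤ) Op₀) (x y : ℤ) : OO := OO.mk fun m => D m (x, y)

theorem coeff_md (f : Fld ℤ Op₀) (x : ℤ) (m : ℕ) : OO.coeff m (md f x) = f m x := OO.coeff_mk _ _

theorem coeff_md₂ (D : Fld (ℤ × ℤ) Op₀) (x y : ℤ) (m : ℕ) : OO.coeff m (md₂ D x y) = D m (x, y) :=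
  OO.coeff_mk _ _

/-- The current with given modes. -/
def fd (a : ℤ → OO) : Fld ℤ Op₀ := fun m x => OO.coeff m (a x)

theorem fd_injective {a b : ℤ → OO} (h : fd a = fd b) : a = b :=
  funext fun x => OO.ext fun m => congrFun (congrFun h m) x

/-- The central element `ħ`. -/
def hO : Subring.center OO := ⟨OO.X, Subring.mem_center_iff.2 OO.X_mul_comm⟩

theorem hO_val : (hO : OO) = OO.X := rfl

/-- The central element `c ħ`. -/
def bO (c : ℂ) : Subring.center OO :=
  ⟨OO.C (algebraMap ℂ Op₀ c), Subring.mem_center_iff.2 fun g => OO.ext fun m => by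
    rw [OO.coeff_mul_C, OO.coeff_C_mul, Algebra.commutes]⟩ * hO

theorem bO_val (c : ℂ) : (bO c : OO) = OO.C (algebraMap ℂ Op₀ c) * OO.X := rfl

theorem bO_add (c d : ℂ) : bO (c + d) = bO c + bO d := by
  refine Subtype.ext ?_
  rw [Subring.coe_add, bO_val, bO_val, bO_val, map_add, map_add, add_mul]

theorem bO_one : bO 1 = hO := by
  refine Subtype.ext ?_
  rw [bO_val, map_one, map_one, one_mul]
  rfl

theorem bO_zero : bO 0 = 0 := by
  refine Subtype.ext ?_
  rw [bO_val, map_zero, map_zero, zero_mul]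
  rfl

theorem bO_neg (c : ℂ) : bO (-c) = -bO c := by
  rw [eq_neg_iff_add_eq_zero, ← bO_add, neg_add_cancel, bO_zero]

theorem coeff_bO_mul_zero (c : ℂ) (z : OO) : OO.coeff 0 ((bO c : OO) * z) = 0 := by
  rw [bO_val, mul_assoc, OO.coeff_C_mul, OO.coeff_zero_X_mul, mul_zero]

theorem coeff_bO_mul_succ (c : ℂ) (z : OO) (m : ℕ) :
    OO.coeff (m + 1) ((bO c : OO) * z) = c • OO.coeff m z := by
  rw [bO_val, mul_assoc, OO.coeff_C_mul, OO.coeff_succ_X_mul, Algebra.smul_def]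

theorem md₂_hS_smul (D : Fld (ℤ × ℤ) Op₀) (x y : ℤ) : md₂ (hS (ℤ × ℤ) • D) x y = (hO : OO) * md₂ D x y := by
  refine OO.ext fun m => ?_
  rw [hO_val, coeff_md₂]
  cases m with
  | zero => rw [OO.coeff_zero_X_mul, Fld.X_smul_zero]; rfl
  | succ m => rw [OO.coeff_succ_X_mul, Fld.X_smul_succ, coeff_md₂]

theorem md₂_diffS_smul (c : ℂ) (D : Fld (ℤ × ℤ) Op₀) : md₂ (diffS c • D) = msc (bO c : OO) (md₂ D) := by
  funext x y
  refine OO.ext fun m => ?_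
  rw [msc, map_add, map_sub, coeff_md₂, coeff_md₂, coeff_md₂, diffS_smul_apply]
  refine congrArg _ ?_
  cases m with
  | zero => rw [coeff_bO_mul_zero, Fld.X_smul_zero]; exact smul_zero _
  | succ m => rw [coeff_bO_mul_succ, Fld.X_smul_succ, coeff_md₂]

theorem md₂_prodF (f g : Fld ℤ Op₀) : md₂ (prodF f g) = fun x y => md f x * md g y := by
  funext x y
  refine OO.ext fun m => ?_
  rw [OO.coeff_mul, coeff_md₂]
  change Fld.bil (D := Op₀) (mulB Op₀) f g m (x, y) = _
  rw [Fld.bil_apply]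
  refine Finset.sum_congr rfl fun p _ => ?_
  rw [coeff_md, coeff_md]
  rfl

theorem md₂_prodF' (f g : Fld ℤ Op₀) : md₂ (prodF' f g) = fun x y => md g y * md f x := by
  funext x y
  refine OO.ext fun m => ?_
  rw [OO.coeff_mul, coeff_md₂]
  change Fld.bil (D := Op₀) (mulB Op₀).flip f g m (x, y) = _
  rw [Fld.bil_apply, ← Finset.Nat.sum_antidiagonal_swap]
  refine Finset.sum_congr rfl fun p _ => ?_
  rw [coeff_md, coeff_md]
  rfl

theorem exchange_md {f g : Fld ℤ Op₀} {c c' : ℂ} (h : diffS c • prodF f g = diffS c' • prodF' f g)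
    (x y : ℤ) : msc (bO c : OO) (fun x y => md f x * md g y) x y =
      msc (bO c' : OO) (fun x y => md g y * md f x) x y := by
  rw [← md₂_prodF, ← md₂_prodF', ← md₂_diffS_smul, ← md₂_diffS_smul, h]

theorem commute_md {f g : Fld ℤ Op₀} (h : prodF f g = prodF' f g) (x y : ℤ) :
    md f x * md g y = md g y * md f x := by
  have := congrArg (fun D => md₂ D x y) h
  rwa [md₂_prodF, md₂_prodF'] at this

/-- Each step of the recursion gains a factor `ħ`, and `z n` is reached from arbitrarily many steps
before; so it is divisible by every power of `ħ`. -/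
theorem eq_zero_of_bO {c : ℂ} {z : ℤ → OO} (h : ∀ n, z (n + 1) = (bO c : OO) * z n) : z = 0 := by
  suffices ∀ m n, OO.coeff m (z n) = 0 from
    funext fun n => OO.ext fun m => (this m n).trans (map_zero (OO.coeff m)).symm
  intro m
  induction m with
  | zero =>
    intro n
    rw [← sub_add_cancel n 1, h, coeff_bO_mul_zero]
  | succ m ih =>
    intro n
    rw [← sub_add_cancel n 1, h, coeff_bO_mul_succ, ih, smul_zero]

theorem eq_zero_of_add_self {z : OO} (h : z + z = 0) : z = 0 := by
  refine OO.ext fun m => ?_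
  have h1 := congrArg (OO.coeff m) h
  rw [map_add, map_zero, ← two_smul ℂ] at h1
  have h2 := congrArg (fun x => (2 : ℂ)⁻¹ • x) h1
  rw [map_zero]
  simpa using h2

theorem hO_mul_cancel {x y : OO} (h : (hO : OO) * x = (hO : OO) * y) : x = y := by
  refine OO.ext fun m => ?_
  have h1 := congrArg (OO.coeff (m + 1)) h
  rwa [hO_val, OO.coeff_succ_X_mul, OO.coeff_succ_X_mul] at h1

/-- The modes of a one-sided series. -/
def unser {B : Type*} [Ring B] (e : Bool) (r : PowerSeries B) (x : ℤ) : B :=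
  if 0 ≤ sgn e * x then PowerSeries.coeff (sgn e * x).toNat r else 0

theorem isSupp_unser {B : Type*} [Ring B] (e : Bool) (r : PowerSeries B) : IsSupp e (unser e r) :=
  fun _ hx => if_neg (by omega)

theorem serE_unser {B : Type*} [Ring B] (e : Bool) (r : PowerSeries B) : serE e (unser e r) = r := by
  ext N
  rw [serE, PowerSeries.coeff_mk, unser, sgn_mul_sgn_mul, if_pos (by omega), Int.toNat_natCast]

theorem unser_sub {B : Type*} [Ring B] (e : Bool) (r r' : PowerSeries B) :
    unser e (r - r') = unser e r - unser e r' := by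
  funext x
  rw [Pi.sub_apply, unser, unser, unser]
  split_ifs <;> simp

/-! ### Half currents -/

/-- After the substitution `u ↦ u - a ħ` the recursion is `u S n = S (n + 1)`. A coefficient of one
member is then a coefficient of any other member at a translated exponent, which can be pushed out
of the common one-sided support. -/
theorem eq_zero_of_linU_smul {V : Type*} [AddCommGroup V] [Module ℂ V] {a : ℂ} {S : ℤ → Fld ℤ V}
    (h : ∀ n, (linU (1 : ℤ) a : Ser ℤ) • S n = S (n + 1))
    (hs : (∀ n, (S n).IsNeg) ∨ ∀ n, (S n).IsNonneg) : S = 0 := by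
  have hg : ∀ n m x, Fld.shift (-a) (S n) m (x - 1) = Fld.shift (-a) (S (n + 1)) m x := by
    intro n m x
    rw [← h, Fld.shift_linU, neg_add_cancel, linU_zero, mon_smul]
  have hg' : ∀ (k : ℕ) n m x, Fld.shift (-a) (S n) m (x - k) = Fld.shift (-a) (S (n + k)) m x := by
    intro k
    induction k with
    | zero => intro n m x; simp
    | succ k ih =>
      intro n m x
      push_cast
      rw [← add_assoc, ← hg, ← ih]
      congr 1
      ring
  funext n
  refine Fld.shift_injective (-a) ?_
  change _ = Fld.shift (-a) (0 : Fld ℤ V)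
  rw [Fld.shift_zero]
  funext m x
  change _ = (0 : V)
  rcases hs with hs | hs
  · have := hg' (-x).toNat n m (x + (-x).toNat)
    rw [add_sub_cancel_right] at this
    rw [this]
    exact (hs _).shift _ _ _ (by omega)
  · have := hg' (x.toNat + 1) (n - (x.toNat + 1 : ℕ)) m x
    rw [sub_add_cancel] at this
    rw [← this]
    exact (hs _).shift _ _ _ (by push_cast; omega)

/-- The half of a current on one side. -/
def halfF (e : Bool) (c : ℤ → OO) (n : ℤ) : Fld ℤ Op₀ := fun m j =>
  if e then (if j < 0 then OO.coeff m (c (n - j - 1)) else 0)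
  else (if 0 ≤ j then -OO.coeff m (c (n - j - 1)) else 0)

/-- The two half series are the one-sided solutions of `u h n = h (n + 1) + c n`: with negative
powers it is `∑ c (n + l) u^(-l-1)`, and with non-negative powers the complementary sum with
opposite sign. -/
theorem mon_smul_halfF (e : Bool) (c : ℤ → OO) (n : ℤ) : (mon (1 : ℤ) : Ser ℤ) • halfF e c n =
    halfF e c (n + 1) + Fld.single0 fun m => OO.coeff m (c n) := by
  funext m x
  rw [mon_smul, Fld.add_apply, halfF, halfF, Fld.single0]
  have h1 : n - (x - 1) - 1 = n - x := by ring
  have h2 : n + 1 - x - 1 = n - x := by ring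
  rw [h1, h2]
  rcases lt_trichotomy x 0 with hx | rfl | hx
  · cases e
    · simp [show ¬ (1 ≤ x) by omega, show ¬ (0 ≤ x) by omega, hx.ne]
    · simp [show x < 1 by omega, hx, hx.ne]
  · cases e
    · simp
      exact (neg_add_cancel (OO.coeff m (c n))).symm
    · simp
  · cases e
    · simp [show 1 ≤ x by omega, hx.le, hx.ne']
    · simp [show ¬ (x < 1) by omega, show ¬ (x < 0) by omega, hx.ne']

/-- The recursion that determines a half current. -/
def HalfRel {B : Type*} [Ring B] (e : Bool) (b : Subring.center B) (r r₁ : PowerSeries B) (c : B) : Prop :=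
  (uS e + cC b * qS e : Subring.center (PowerSeries B)) • r =
    (qS e : Subring.center (PowerSeries B)) • (r₁ + PowerSeries.C c)

theorem HalfRel.unser {B : Type*} [Ring B] {e : Bool} {b : Subring.center B} {r r₁ : PowerSeries B} {c : B}
    (h : HalfRel e b r r₁ c) (x : ℤ) : unser e r (x - 1) + b * unser e r x =
      YangianDouble.unser e r₁ x + if x = 0 then c else 0 := by
  have hC : PowerSeries.C c = serE e fun x => if x = 0 then c else 0 := by
    ext1 N
    rw [serE, PowerSeries.coeff_mk, PowerSeries.coeff_C]
    cases e <;> simp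
  have hCs : IsSupp e fun x : ℤ => if x = 0 then c else 0 := by
    intro x hx
    refine if_neg ?_
    rintro rfl
    simp at hx
  have h1 : ∀ N, YangianDouble.unser e r (pos e N - 1) + b * YangianDouble.unser e r (pos e N) =
      YangianDouble.unser e r₁ (pos e N) + if pos e N = 0 then c else 0 := by
    intro N
    have h2 := congrArg (PowerSeries.coeff N) h
    rw [add_smul, mul_smul, smul_add, map_add, map_add, coeff_cC_smul, ← serE_unser e r,
      ← serE_unser e r₁, hC, coeff_uS_smul (isSupp_unser e r), coeff_qS_smul (isSupp_unser e r),
      coeff_qS_smul (isSupp_unser e r₁), coeff_qS_smul hCs] at h2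
    exact h2
  by_cases hx : ∃ N, pos e N = x
  · obtain ⟨N, rfl⟩ := hx
    exact h1 N
  -- Outside the range of `pos e` neither `x` nor `x - 1` lies in the support and `x ≠ 0`, so both
  -- sides vanish.
  · have hx1 : sgn e * x < 0 ∧ sgn e * (x - 1) < 0 ∧ x ≠ 0 := by
      cases e
      · have : x < 0 := by
          by_contra hx0
          exact hx ⟨x.toNat, by simp [pos]; omega⟩
        simp
        omega
      · have : 1 < x := by
          by_contra hx0
          exact hx ⟨(1 - x).toNat, by simp [pos]; omega⟩
        simp
        omega
    rw [isSupp_unser e r _ hx1.1, isSupp_unser e r _ hx1.2.1, isSupp_unser e r₁ _ hx1.1, if_neg hx1.2.2,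
      mul_zero, add_zero]

theorem linU_smul_fd_unser {e : Bool} {β : ℂ} {r r₁ : PowerSeries OO} {c : OO}
    (h : HalfRel e (bO β) r r₁ c) : (linU (1 : ℤ) β : Ser ℤ) • fd (unser e r) =
      fd (unser e r₁) + Fld.single0 fun m => OO.coeff m c := by
  funext m x
  rw [linU_val, add_smul, mul_smul, Fld.add_apply, mon_smul, cS_smul, Fld.add_apply, Fld.single0]
  have h3 := congrArg (OO.coeff m) (h.unser x)
  rw [map_add, map_add] at h3
  have h4 : OO.coeff m ((bO β : OO) * unser e r x) = β • (hS ℤ • fd (unser e r)) m x := by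
    cases m with
    | zero => rw [coeff_bO_mul_zero, Fld.X_smul_zero]; exact (smul_zero _).symm
    | succ m => rw [coeff_bO_mul_succ, Fld.X_smul_succ]; rfl
  rw [h4] at h3
  refine h3.trans ?_
  congr 1
  split_ifs <;> simp

/-- At `u ^ 1` the recursion has no other term than the constant term of `r`, which is therefore
zero: a half current in `u⁻¹` starts at `u⁻¹`. -/
theorem isNeg_fd_unser {β : ℂ} {r r₁ : PowerSeries OO} {c : OO} (h : HalfRel true (bO β) r r₁ c) :
    (fd (unser true r)).IsNeg := by
  intro m x hx
  have h0 : ∀ (r : PowerSeries OO) m x, 0 < x → fd (unser true r) m x = 0 := fun r m x hx => by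
    rw [fd, isSupp_unser true _ _ (by simpa using hx), map_zero]
  rcases hx.lt_or_eq with hx | rfl
  · exact h0 r m x hx
  · have h1 := h.unser 1
    rw [isSupp_unser true _ 1 (by simp), isSupp_unser true _ 1 (by simp), if_neg one_ne_zero, mul_zero,
      add_zero, add_zero, sub_self] at h1
    rw [fd, h1, map_zero]

theorem isNonneg_fd_unser (r : PowerSeries OO) : (fd (unser false r)).IsNonneg := by
  intro m x hx
  rw [fd, isSupp_unser false _ _ (by simpa using hx), map_zero]

theorem Fld.IsNeg.sub {V : Type*} [AddCommGroup V] {f g : Fld ℤ V} (hf : f.IsNeg) (hg : g.IsNeg) :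
    (f - g).IsNeg := fun m n hn => by
  change f m n - g m n = 0
  rw [hf m n hn, hg m n hn, sub_zero]

theorem Fld.IsNonneg.sub {V : Type*} [AddCommGroup V] {f g : Fld ℤ V} (hf : f.IsNonneg)
    (hg : g.IsNonneg) : (f - g).IsNonneg := fun m n hn => by
  change f m n - g m n = 0
  rw [hf m n hn, hg m n hn, sub_zero]

theorem isNeg_halfF (c : ℤ → OO) (n : ℤ) : (halfF true c n).IsNeg := fun _ _ hx => if_neg (not_lt.2 hx)

theorem isNonneg_halfF (c : ℤ → OO) (n : ℤ) : (halfF false c n).IsNonneg :=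
  fun _ _ hx => if_neg (not_le.2 hx)

/-- The shifted series and the half current have the same source and support on the same side, so
their difference is a homogeneous solution of the recursion and vanishes. -/
theorem shift_fd_unser {e : Bool} {β : ℂ} {r : ℤ → PowerSeries OO} {c : ℤ → OO}
    (h : ∀ n, HalfRel e (bO β) (r n) (r (n + 1)) (c n)) (n : ℤ) :
    Fld.shift (-β) (fd (unser e (r n))) = halfF e c n := by
  have key := eq_zero_of_linU_smul (a := 0)
    (S := fun n => Fld.shift (-β) (fd (unser e (r n))) - halfF e c n) ?_ ?_
  · exact sub_eq_zero.1 (congrFun key n)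
  · intro n
    have h1 := Fld.shift_linU (-β) β (fd (unser e (r n)))
    rw [linU_smul_fd_unser (h n), Fld.shift_add, Fld.shift_single0, neg_add_cancel] at h1
    have h2 := mon_smul_halfF e c n
    rw [← linU_zero] at h2
    rw [Fld.smul_sub, ← h1, h2]
    abel
  · cases e
    · exact Or.inr fun n => ((isNonneg_fd_unser _).shift _).sub (isNonneg_halfF c n)
    · exact Or.inl fun n => ((isNeg_fd_unser (h n)).shift _).sub (isNeg_halfF c n)

theorem fd_unser_eq_shift {e : Bool} {β : ℂ} {r : ℤ → PowerSeries OO} {c : ℤ → OO}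
    (h : ∀ n, HalfRel e (bO β) (r n) (r (n + 1)) (c n)) (n : ℤ) :
    fd (unser e (r n)) = Fld.shift β (halfF e c n) := by
  have key := eq_zero_of_linU_smul (a := β)
    (S := fun n => fd (unser e (r n)) - Fld.shift β (halfF e c n)) ?_ ?_
  · exact sub_eq_zero.1 (congrFun key n)
  · intro n
    have h1 := Fld.shift_linU β 0 (halfF e c n)
    rw [linU_zero, mon_smul_halfF, Fld.shift_add, Fld.shift_single0, add_zero] at h1
    rw [Fld.smul_sub, linU_smul_fd_unser (h n), ← h1]
    abel
  · cases e
    · exact Or.inr fun n => (isNonneg_fd_unser _).sub ((isNonneg_halfF c n).shift _)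
    · exact Or.inl fun n => (isNeg_fd_unser (h n)).sub ((isNeg_halfF c n).shift _)

/-! ### The Gauss coordinates on the Fock space -/

/-- An operator series as a series in `u^{±1}` with coefficients in `Op₀⟦ħ⟧`. -/
def curryS (f : OpSeries) : PowerSeries OO :=
  PowerSeries.mk fun N => OO.mk fun m => MvPowerSeries.coeff (expo m N) f

theorem coeff_curryS (f : OpSeries) (N m : ℕ) :
    OO.coeff m (PowerSeries.coeff N (curryS f)) = MvPowerSeries.coeff (expo m N) f := by
  rw [curryS, PowerSeries.coeff_mk, OO.coeff_mk]

theorem curryS_mul (f g : OpSeries) : curryS (f * g) = curryS f * curryS g := by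
  ext1 N
  refine OO.ext fun m => ?_
  have h := coeff_expo_mul (A := Op₀) f g m N
  rw [coeff_curryS, h, PowerSeries.coeff_mul, map_sum, Finset.sum_comm]
  refine Finset.sum_congr rfl fun p _ => ?_
  rw [OO.coeff_mul]
  refine Finset.sum_congr rfl fun q _ => ?_
  rw [coeff_curryS, coeff_curryS]

theorem curryS_one : curryS 1 = 1 := by
  classical
  ext1 N
  refine OO.ext fun m => ?_
  rw [coeff_curryS, MvPowerSeries.coeff_one, PowerSeries.coeff_one]
  by_cases hN : N = 0
  · by_cases hm : m = 0
    · simp [hN, hm, expo, OO.coeff_one]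
    · rw [if_neg, if_pos hN, OO.coeff_one, if_neg hm]
      intro h
      exact hm (by simpa [expo_apply_zero] using congrArg (· 0) h)
  · rw [if_neg, if_neg hN, map_zero]
    intro h
    exact hN (by simpa [expo_apply_one] using congrArg (· 1) h)

/-- The current `k_j^±`. -/
def kF (i : Fin 2) (s : ℂ) (e : Bool) (j : Fin 2) : Fld ℤ Op₀ := if e then kPlusF i s j else kMinusF j

theorem md_kF (i : Fin 2) (s : ℂ) (e : Bool) (j : Fin 2) :
    md (kF i s e j) = unser e (curryS (kSer i s e j)) := by
  funext x
  refine OO.ext fun m => ?_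
  rw [coeff_md, kF, unser, kSer]
  cases e
  · simp only [Bool.false_eq_true, if_false, sgn_false, one_mul]
    rw [kMinusF_apply, posF]
    split_ifs
    · rw [coeff_curryS]
    · exact (map_zero _).symm
  · simp only [if_true, sgn_true, neg_mul, one_mul]
    rw [kPlusF_apply]
    by_cases hx : x ≤ 0
    · rw [if_pos hx, if_pos (by omega), coeff_curryS]
    · rw [if_neg hx, if_neg (by omega), map_zero]

theorem isSupp_md_kF (i : Fin 2) (s : ℂ) (e : Bool) (j : Fin 2) : IsSupp e (md (kF i s e j)) :=
  md_kF i s e j ▸ isSupp_unser _ _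

theorem serE_md_kF (i : Fin 2) (s : ℂ) (e : Bool) (j : Fin 2) :
    serE e (md (kF i s e j)) = curryS (kSer i s e j) := by
  rw [md_kF, serE_unser]

/-- The modes of `X⁺ / ħ`. -/
def vE (i : Fin 2) (n : ℤ) : OO := md (vPlusF i) (-n - 1)

/-- The modes of `X⁻ / ħ`. -/
def vF (i : Fin 2) (n : ℤ) : OO := md (vMinusF i) (-n - 1)

/-- The shift of the argument of `X⁺`. -/
def betaE (e : Bool) : ℂ := if e then 1 / 4 else -1 / 4

/-- This is the coefficient of `v ^ (-n - 1)` of the exchange of `k₁(u)` with `X⁺(v)`;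
multiplication by `v` raises the mode. The constants `5/4, 1/4` and `3/4, -1/4` both differ by one,
so one form with `betaE e` serves both signs. -/
theorem exchange_vE (i : Fin 2) (s : ℂ) (e : Bool) (n x : ℤ) :
    md (kF i s e 0) (x - 1) * vE i n - md (kF i s e 0) x * vE i (n + 1) +
        ((bO (betaE e) : OO) + (hO : OO)) * (md (kF i s e 0) x * vE i n) =
      vE i n * md (kF i s e 0) (x - 1) - vE i (n + 1) * md (kF i s e 0) x +
        (bO (betaE e) : OO) * (vE i n * md (kF i s e 0) x) := by
  rw [← Subring.coe_add, ← bO_one, ← bO_add]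
  have hn : -(n + 1) - 1 = -n - 1 - 1 := by ring
  rw [vE, vE, hn]
  cases e
  · rw [show betaE false = -1 / 4 from rfl, show (-1 / 4 + 1 : ℂ) = 3 / 4 by norm_num]
    exact exchange_md (kMinus_vPlus i) x (-n - 1)
  · rw [show betaE true = 1 / 4 from rfl, show (1 / 4 + 1 : ℂ) = 5 / 4 by norm_num]
    exact exchange_md (kPlus_vPlus i s) x (-n - 1)

theorem exchange_vF (i : Fin 2) (s : ℂ) (e : Bool) (n x : ℤ) :
    md (kF i s e 0) (x - 1) * vF i n - md (kF i s e 0) x * vF i (n + 1) +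
        (bO (-betaE e) : OO) * (md (kF i s e 0) x * vF i n) =
      vF i n * md (kF i s e 0) (x - 1) - vF i (n + 1) * md (kF i s e 0) x +
        ((bO (-betaE e) : OO) + (hO : OO)) * (vF i n * md (kF i s e 0) x) := by
  rw [← Subring.coe_add, ← bO_one, ← bO_add]
  have hn : -(n + 1) - 1 = -n - 1 - 1 := by ring
  rw [vF, vF, hn]
  cases e
  · rw [show betaE false = -1 / 4 from rfl, show (-(-1 / 4) + 1 : ℂ) = 5 / 4 by norm_num,
      show (-(-1 / 4) : ℂ) = 1 / 4 by norm_num]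
    exact exchange_md (kMinus_vMinus i) x (-n - 1)
  · rw [show betaE true = 1 / 4 from rfl, show (-(1 / 4) + 1 : ℂ) = 3 / 4 by norm_num,
      show (-(1 / 4) : ℂ) = -1 / 4 by norm_num]
    exact exchange_md (kPlus_vMinus i s) x (-n - 1)

theorem exchange_vE_vE (i : Fin 2) (m n : ℤ) :
    vE i (m + 1) * vE i n - vE i m * vE i (n + 1) - (hO : OO) * (vE i m * vE i n) =
      vE i n * vE i (m + 1) - vE i (n + 1) * vE i m + (hO : OO) * (vE i n * vE i m) := by
  have h := exchange_md (vPlus_vPlus i) (-m - 1) (-n - 1)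
  rw [msc, msc, show -m - 1 - 1 = -(m + 1) - 1 by ring, show -n - 1 - 1 = -(n + 1) - 1 by ring, bO_neg,
    bO_one, Subring.coe_neg, neg_mul, ← sub_eq_add_neg] at h
  exact h

theorem exchange_vF_vF (i : Fin 2) (m n : ℤ) :
    vF i (m + 1) * vF i n - vF i m * vF i (n + 1) + (hO : OO) * (vF i m * vF i n) =
      vF i n * vF i (m + 1) - vF i (n + 1) * vF i m - (hO : OO) * (vF i n * vF i m) := by
  have h := exchange_md (vMinus_vMinus i) (-m - 1) (-n - 1)
  rw [msc, msc, show -m - 1 - 1 = -(m + 1) - 1 by ring, show -n - 1 - 1 = -(n + 1) - 1 by ring, bO_neg,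
    bO_one, Subring.coe_neg, neg_mul, ← sub_eq_add_neg] at h
  exact h

theorem lie_vE_vF (i : Fin 2) (n : ℤ) : (hO : OO) * ⁅vE i n, vF i 0⁆ =
    md (psiPlusF i) (-n - 1) - md psiMinusF (-n - 1) := by
  have h := congrArg (fun D => md D (-n - 1)) (vPlus_vMinus_slice i)
  have h1 : md (slice (-1) (hS (ℤ × ℤ) • (prodF (vPlusF i) (vMinusF i) - prodF' (vPlusF i) (vMinusF i))))
      (-n - 1) = md₂ (hS (ℤ × ℤ) • (prodF (vPlusF i) (vMinusF i) - prodF' (vPlusF i) (vMinusF i)))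
        (-n - 1) (-1) := rfl
  have h2 : ∀ f g : Fld (ℤ × ℤ) Op₀, ∀ x y, md₂ (f - g) x y = md₂ f x y - md₂ g x y := fun f g x y => by
    refine OO.ext fun m => ?_
    rw [map_sub, coeff_md₂, coeff_md₂, coeff_md₂]
    rfl
  have h3 : ∀ f g : Fld ℤ Op₀, ∀ x, md (f - g) x = md f x - md g x := fun f g x => by
    refine OO.ext fun m => ?_
    rw [map_sub, coeff_md, coeff_md, coeff_md]
    rfl
  simp only [h1, h3] at h
  rw [md₂_hS_smul, h2, md₂_prodF, md₂_prodF'] at h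
  rw [Ring.lie_def]
  exact h

/-- The bracket times `ħ` is the coefficient of `u⁻¹` in `ψ⁺ - ψ⁻`. There `ψ⁻` has none and `ψ⁺` has
`ħ ∂_α`; then `ħ` is cancelled. -/
theorem lie_vE_vF_zero (i : Fin 2) :
    ⁅vE i 0, vF i 0⁆ = OO.C (latticeDiag fun q => (alphaWeight i q : ℂ)) := by
  refine hO_mul_cancel ?_
  rw [lie_vE_vF]
  refine OO.ext fun m => ?_
  have h := psiPlusF_low i m (n := 1) le_rfl
  have h0 : -(0 : ℤ) - 1 = -((1 : ℕ) : ℤ) := by norm_num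
  rw [map_sub, coeff_md, coeff_md, psiMinusF_apply (by norm_num), h0, hO_val]
  refine (sub_zero _).trans (h.trans ?_)
  cases m with
  | zero => rw [OO.coeff_zero_X_mul]; exact latticeDiag_zero
  | succ m =>
    rw [OO.coeff_succ_X_mul, OO.coeff_C]
    by_cases hm : m = 0
    · simp [hm]
    · simp only [Nat.add_eq_right, hm, if_false]
      exact latticeDiag_zero

theorem lie_latticeDiag_tw (i : Fin 2) (p : ℤ) (σ : ℤ → Ser ℤ) (W : Fld ℤ OpP) (x : ℤ) :
    ⁅OO.C (latticeDiag fun q => (alphaWeight i q : ℂ)), md (tw p σ W) x⁆ =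
      ((2 * p : ℤ) : OO) * md (tw p σ W) x := by
  refine OO.ext fun m => ?_
  rw [Ring.lie_def, map_sub, OO.coeff_C_mul, OO.coeff_mul_C, ← zsmul_eq_mul, map_zsmul, coeff_md]
  refine Finsupp.lhom_ext fun q f => ?_
  rw [LinearMap.sub_apply, Module.End.mul_apply, Module.End.mul_apply, LinearMap.smul_apply,
    tw_apply_single, latticeDiag_single, latticeDiag_single, tw_apply_single, map_smul,
    ← Finsupp.single_sub, ← Int.cast_smul_eq_zsmul ℂ, Finsupp.smul_single]
  rw [← sub_smul, alphaWeight_add]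
  congr 2
  push_cast
  ring

/-- `k₁` preserves the lattice and `X^±` shift it by `±α`, which gives the brackets with `[E, F] =
∂_α`. The Serre relations come from the exchange relations. -/
theorem isTriple (i : Fin 2) (s : ℂ) (e : Bool) : IsTriple (serE e (md (kF i s e 0)))
    (PowerSeries.C (vE i 0)) (PowerSeries.C (vF i 0)) := by
  have hH : ⁅(PowerSeries.C (vE i 0) : PowerSeries OO), PowerSeries.C (vF i 0)⁆ =
      PowerSeries.C (OO.C (latticeDiag fun q => (alphaWeight i q : ℂ))) := by
    rw [← map_ring_lie, lie_vE_vF_zero]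
  have hb : ∀ c : ℂ, ∀ z : ℤ → OO, (∀ n, z (n + 1) = (bO c : OO) * z n) → z = 0 :=
    fun c z hz => eq_zero_of_bO hz
  refine ⟨?_, ?_, ?_, ?_, ?_⟩
  · rw [hH, Ring.lie_def, C_mul_serE, serE_mul_C, serE_sub]
    have h : ∀ x, OO.C (latticeDiag fun q => (alphaWeight i q : ℂ)) * md (kF i s e 0) x -
        md (kF i s e 0) x * OO.C (latticeDiag fun q => (alphaWeight i q : ℂ)) = 0 := by
      intro x
      have hx : ∀ (σ : ℤ → Ser ℤ) (W : Fld ℤ OpP),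
          ⁅OO.C (latticeDiag fun q => (alphaWeight i q : ℂ)), md (tw 0 σ W) x⁆ = 0 := by
        intro σ W
        rw [lie_latticeDiag_tw, mul_zero, Int.cast_zero, zero_mul]
      rw [← Ring.lie_def]
      cases e
      · exact hx _ _
      · exact hx _ _
    simp only [h]
    ext N
    simp [serE]
  · rw [hH, ← map_ring_lie, vE, vPlusF, lie_latticeDiag_tw, map_mul]
    simp [map_ofNat]
  · rw [hH, ← map_ring_lie, vF, vMinusF, lie_latticeDiag_tw, map_mul]
    simp [map_ofNat]
  · exact serre_E_serE (isSupp_md_kF i s e 0) (hb _) (fun x => eq_zero_of_add_self)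
      (exchange_vE i s e) (exchange_vE_vE i)
  · exact serre_F_serE (isSupp_md_kF i s e 0) (hb _) (fun x => eq_zero_of_add_self)
      (exchange_vF i s e) (exchange_vF_vF i)

section HalfRel

variable {B : Type*} [Ring B]

theorem C_mul_center (h : Subring.center B) (v : B) :
    (PowerSeries.C ((h : B) * v) : PowerSeries B) = cC h • PowerSeries.C v :=
  map_mul (PowerSeries.C (R := B)) _ _

/-- Multiply the exchange relation on the left by `κ`, the inverse of `k`. The source `h v` is the
difference between the factors `u + b + h` and `u + b`. -/
theorem HalfRel.of_exchange_E {e : Bool} {a : ℤ → B} (ha : IsSupp e a) {κ : PowerSeries B}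
    (hκ : κ * serE e a = 1) {b h : Subring.center B} {v v₁ : B}
    (hv : ∀ x, a (x - 1) * v - a x * v₁ + (b + h) * (a x * v) =
      v * a (x - 1) - v₁ * a x + b * (v * a x)) :
    HalfRel e b (κ * PowerSeries.C v * serE e a - PowerSeries.C v)
      (κ * PowerSeries.C v₁ * serE e a - PowerSeries.C v₁) (h * v) := by
  have H := congrArg (κ * ·) (exchange_E_serE ha hv)
  simp only [mul_sub, mul_smul_comm, Ring.lie_def, ← mul_assoc, hκ, one_mul] at H
  rw [HalfRel, smul_add, H, C_mul_center]
  module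

theorem HalfRel.of_exchange_F {e : Bool} {a : ℤ → B} (ha : IsSupp e a) {κ : PowerSeries B}
    (hκ : serE e a * κ = 1) {b h : Subring.center B} {v v₁ : B}
    (hv : ∀ x, a (x - 1) * v - a x * v₁ + b * (a x * v) =
      v * a (x - 1) - v₁ * a x + (b + h) * (v * a x)) :
    HalfRel e b (serE e a * PowerSeries.C v * κ - PowerSeries.C v)
      (serE e a * PowerSeries.C v₁ * κ - PowerSeries.C v₁) (h * v) := by
  have H := congrArg (· * κ) (exchange_F_serE ha hv)
  simp only [sub_mul, smul_mul_assoc, Ring.lie_def] at H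
  rw [mul_assoc (PowerSeries.C v₁), mul_assoc (PowerSeries.C v), hκ, mul_one, mul_one] at H
  rw [HalfRel, smul_add, H, C_mul_center]
  module

theorem HalfRel.lie {e : Bool} {b : Subring.center B} {r r₁ : PowerSeries B} {c : B}
    (h : HalfRel e b r r₁ c) (w : B) :
    HalfRel e b ⁅r, PowerSeries.C w⁆ ⁅r₁, PowerSeries.C w⁆ ⁅c, w⁆ := by
  have h1 : ∀ (z : Subring.center (PowerSeries B)) (x y : PowerSeries B), z • ⁅x, y⁆ = ⁅z • x, y⁆ := by
    intro z x y
    rw [Ring.lie_def, Ring.lie_def, smul_sub, smul_mul_assoc, mul_smul_comm]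
  have h2 : ∀ x y z : PowerSeries B, ⁅x, z⁆ + ⁅y, z⁆ = ⁅x + y, z⁆ := by
    intro x y z
    simp only [Ring.lie_def]
    noncomm_ring
  rw [HalfRel] at h ⊢
  rw [map_ring_lie, h2, h1, h1, h]

theorem sub_mul_of_neg {b h : Subring.center B} {X Y z w : B}
    (H : X + ((-b : Subring.center B) : B) * z = Y + (((-b : Subring.center B) : B) + h) * w) :
    X - b * z = Y + (h - b) * w := by
  rw [Subring.coe_neg] at H
  rw [sub_eq_add_neg, ← neg_mul, H, sub_eq_neg_add]

end HalfRel

/-- The half currents of `X⁺`. -/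
def halfE (i : Fin 2) (s : ℂ) (e : Bool) (n : ℤ) : PowerSeries OO :=
  curryS (kInvSer i s e) * PowerSeries.C (vE i n) * serE e (md (kF i s e 0)) - PowerSeries.C (vE i n)

/-- The half currents of `X⁻`. -/
def halfFm (i : Fin 2) (s : ℂ) (e : Bool) (n : ℤ) : PowerSeries OO :=
  serE e (md (kF i s e 0)) * PowerSeries.C (vF i n) * curryS (kInvSer i s e) - PowerSeries.C (vF i n)

theorem curryS_kInvSer_mul (i : Fin 2) (s : ℂ) (e : Bool) :
    curryS (kInvSer i s e) * serE e (md (kF i s e 0)) = 1 := by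
  rw [serE_md_kF, ← curryS_mul, kInvSer_mul, curryS_one]

theorem mul_curryS_kInvSer (i : Fin 2) (s : ℂ) (e : Bool) :
    serE e (md (kF i s e 0)) * curryS (kInvSer i s e) = 1 := by
  rw [serE_md_kF, ← curryS_mul, mul_kInvSer, curryS_one]

theorem halfRel_halfE (i : Fin 2) (s : ℂ) (e : Bool) (n : ℤ) :
    HalfRel e (bO (betaE e)) (halfE i s e n) (halfE i s e (n + 1)) (hO * vE i n) :=
  .of_exchange_E (isSupp_md_kF i s e 0) (curryS_kInvSer_mul i s e) (exchange_vE i s e n)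

theorem halfRel_halfFm (i : Fin 2) (s : ℂ) (e : Bool) (n : ℤ) :
    HalfRel e (bO (-betaE e)) (halfFm i s e n) (halfFm i s e (n + 1)) (hO * vF i n) :=
  .of_exchange_F (isSupp_md_kF i s e 0) (mul_curryS_kInvSer i s e) (exchange_vF i s e n)

theorem halfRel_lie (i : Fin 2) (s : ℂ) (e : Bool) (n : ℤ) :
    HalfRel e (bO (betaE e)) ⁅halfE i s e n, PowerSeries.C (vF i 0)⁆
      ⁅halfE i s e (n + 1), PowerSeries.C (vF i 0)⁆
      (md (psiPlusF i) (-n - 1) - md psiMinusF (-n - 1)) := by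
  have h := (halfRel_halfE i s e n).lie (vF i 0)
  have h1 : ⁅(hO : OO) * vE i n, vF i 0⁆ = hO * ⁅vE i n, vF i 0⁆ := by
    rw [Ring.lie_def, Ring.lie_def, mul_sub, mul_assoc, ← mul_assoc (vF i 0),
      Subring.mem_center_iff.1 hO.2 (vF i 0), mul_assoc]
  rwa [h1, lie_vE_vF] at h

/-- The generating function of the Cartan current on one side. -/
def psiF (i : Fin 2) (e : Bool) : Fld ℤ Op₀ := if e then psiPlusF i else psiMinusF

/-- `ψ⁺` has non-positive powers and constant term `1`, `ψ⁻` has non-negative powers. Splitting `ψ⁺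
- ψ⁻` between `u⁻¹` and `u ^ 0` thus gives `ψ⁺ - 1` on one side and, with the sign of the half
current, `ψ⁻ - 1` on the other. -/
theorem halfF_psi (i : Fin 2) (e : Bool) :
    halfF e (fun n => md (psiPlusF i) (-n - 1) - md psiMinusF (-n - 1)) 0 =
      psiF i e - Fld.single0 fun m => if m = 0 then 1 else 0 := by
  have h0 : ∀ m, psiPlusF i m 0 = if m = 0 then 1 else 0 := by
    intro m
    refine (psiPlusF_low i m (n := 0) zero_le_one).trans ?_
    by_cases hm : m = 0
    · simp only [hm, if_true]
      exact latticeDiag_one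
    · simp only [hm, if_false]
      exact latticeDiag_zero
  funext m j
  change _ = psiF i e m j - Fld.single0 (fun m => if m = 0 then 1 else 0) m j
  have hj : -(0 - j - 1) - 1 = j := by ring
  rw [halfF, map_sub, coeff_md, coeff_md, hj, Fld.single0]
  rcases lt_trichotomy j 0 with hj | rfl | hj
  · rw [psiMinusF_apply hj, if_pos hj, if_neg (not_le.2 hj), if_neg hj.ne, sub_zero]
    cases e
    · exact (psiMinusF_apply hj).symm
    · have h1 : ∀ x : Op₀, x - 0 = x := fun x => sub_zero x
      exact h1 _
  · rw [h0, psiF]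
    cases e
    · simp
    · simp only [if_true, lt_irrefl, if_false]
      exact (sub_eq_zero.2 (h0 m)).symm
  · rw [psiPlusF_of_pos i m hj, if_neg hj.not_gt, if_pos hj.le, if_neg hj.ne', sub_zero]
    cases e
    · have h1 : ∀ x : Op₀, -(0 - x) = x := fun x => (neg_sub 0 x).trans (sub_zero x)
      exact h1 _
    · exact (psiPlusF_of_pos i m hj).symm

theorem shift_psiF (i : Fin 2) (e : Bool) :
    Fld.shift (betaE e) (psiF i e) = fd (unser e (curryS (psiSer i e))) := by
  funext m n
  cases e
  · refine (shift_psiMinusF i m n).trans ?_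
    rw [posF, fd, unser, sgn_false, one_mul]
    split_ifs
    · rw [coeff_curryS]
    · rw [map_zero]
  · refine (shift_psiPlusF i m n).trans ?_
    rw [fd, unser, sgn_true, neg_mul, one_mul]
    by_cases hn : n ≤ 0
    · rw [if_pos hn, if_pos (by omega), coeff_curryS]
    · rw [if_neg hn, if_neg (by omega), map_zero]

theorem fd_unser_one (e : Bool) :
    fd (unser e (1 : PowerSeries OO)) = Fld.single0 fun m => if m = 0 then 1 else 0 := by
  funext m n
  rw [fd, unser, Fld.single0, PowerSeries.coeff_one]
  by_cases hn : n = 0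
  · simp [hn, OO.coeff_one]
  · have : ¬ n = 0 := hn
    rw [if_neg hn]
    split_ifs with h1 h2
    · exfalso
      cases e <;> simp at h1 h2 <;> omega
    · exact map_zero _
    · exact map_zero _

/-- The bracket solves the half current recursion whose source is made of the modes of `ψ⁺ - ψ⁻`. By
uniqueness it is the shifted half of that current, namely `k₂/k₁ - 1`. This is where `k₂` enters. -/
theorem lie_halfE_vF (i : Fin 2) (s : ℂ) (e : Bool) :
    ⁅halfE i s e 0, PowerSeries.C (vF i 0)⁆ = curryS (psiSer i e) - 1 := by
  rw [← serE_unser e ⁅halfE i s e 0, PowerSeries.C (vF i 0)⁆, ← serE_unser e (curryS (psiSer i e) - 1)]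
  refine congrArg _ (fd_injective ?_)
  rw [fd_unser_eq_shift (halfRel_lie i s e) 0, halfF_psi, Fld.shift_sub, shift_psiF, Fld.shift_single0,
    ← fd_unser_one e, unser_sub]
  funext m x
  exact (map_sub (OO.coeff m) _ _).symm

theorem isGauss (i : Fin 2) (s : ℂ) (e : Bool) : IsGauss e (bO (betaE e)) hO (md (kF i s e 0))
    (md (kF i s e 1)) (curryS (kInvSer i s e)) (vE i 0) (vE i 1) (vF i 0) (vF i 1) where
  supp := isSupp_md_kF i s e 0
  supp₂ := isSupp_md_kF i s e 1
  exchange_E := exchange_vE i s e 0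
  exchange_F x := by
    have h := exchange_vF i s e 0 x
    rw [bO_neg] at h
    exact sub_mul_of_neg h
  triple := isTriple i s e
  inv_mul := curryS_kInvSer_mul i s e
  mul_inv := mul_curryS_kInvSer i s e
  entry := by
    refine gauss_entry (mul_curryS_kInvSer i s e) ?_
    have h : curryS (kInvSer i s e) * ⁅PowerSeries.C (vE i 0), serE e (md (kF i s e 0))⁆ =
        halfE i s e 0 := by
      rw [Ring.lie_def, mul_sub, ← mul_assoc, ← mul_assoc, curryS_kInvSer_mul, one_mul, halfE]
    rw [h, lie_halfE_vF, serE_md_kF, ← kSer_zero_mul_psiSer, curryS_mul, ← mul_assoc, ← curryS_mul,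
      kInvSer_mul, curryS_one, one_mul]

theorem commute_md_kF_same (i : Fin 2) (s : ℂ) (e : Bool) (j : Fin 2) (m n : ℤ) :
    md (kF i s e 0) m * md (kF i s e j) n = md (kF i s e j) n * md (kF i s e 0) m := by
  cases e
  · exact commute_md (kMinus_kMinus 0 j) m n
  · exact commute_md (kPlus_kPlus i s 0 j) m n

/-- The entries of `T^±(u)`. -/
def tO (i : Fin 2) (s : ℂ) (e : Bool) (n : ℤ) : Matrix (Fin 2) (Fin 2) OO :=
  tMat (md (kF i s e 0) n) (vE i 0) (vF i 0)

theorem tO_same (i : Fin 2) (s : ℂ) (e : Bool) (a b c d : Fin 2) (m n : ℤ) :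
    msc 0 (fun m n => tO i s e m a b * tO i s e n c d) m n + hO * (tO i s e m c b * tO i s e n a d) =
      msc 0 (fun m n => tO i s e n c d * tO i s e m a b) m n + hO * (tO i s e n c b * tO i s e m a d) :=
  (isGauss i s e).quadratic_same (isGauss i s e) (commute_md_kF_same i s e 0) (commute_md_kF_same i s e 1)
    a b c d m n

/-- The shifts of the argument of `X⁺` for the two halves are `ħ/4` and `-ħ/4`; their difference
`ħ/2` is the `ħ c / 2` of the defining relation at `c = 1`. -/
theorem tO_mixed (i : Fin 2) (s : ℂ) (a b c d : Fin 2) (m n : ℤ) :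
    msc ((bO (1 / 2) : OO) + hO) (fun m n =>
      msc (-(bO (1 / 2) : OO)) (fun m n => tO i s true m a b * tO i s false n c d) m n +
        hO * (tO i s true m c b * tO i s false n a d)) m n =
    msc (-(bO (1 / 2) : OO) + hO) (fun m n =>
      msc (bO (1 / 2) : OO) (fun m n => tO i s false n c d * tO i s true m a b) m n +
        hO * (tO i s false n c b * tO i s true m a d)) m n := by
  refine (isGauss i s true).quadratic_mixed (isGauss i s false) (d := bO (1 / 2)) ?_
    (commute_md (kPlus_kMinus_zero i s)) ?_ a b c d m n
  · rw [sub_eq_iff_eq_add, ← bO_add]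
    norm_num [betaE]
  · intro m n
    have h := congrArg (fun D => md₂ D m n) (kPlus_kMinus_one i s)
    simp only [mul_smul, md₂_diffS_smul, md₂_prodF, md₂_prodF'] at h
    have h1 : ((bO (1 / 2) : OO) + hO) = bO (3 / 2) := by
      rw [← bO_one, ← Subring.coe_add, ← bO_add]
      norm_num
    have h2 : (-(bO (1 / 2) : OO) + hO) = bO (1 / 2) := by
      rw [← bO_one, ← Subring.coe_neg, ← bO_neg, ← Subring.coe_add, ← bO_add]
      norm_num
    have h3 : (-(bO (1 / 2) : OO)) = bO (-1 / 2) := by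
      rw [← Subring.coe_neg, ← bO_neg]
      norm_num
    rw [h2, h1, h3]
    exact h

/-! ### Operators on the completed Fock space -/

namespace HSeries

variable {V : Type*} [AddCommGroup V] [Module ℂ V]

theorem coeff_hbar_smul_zero (x : HSeries V) : (hbar • x).coeff 0 = 0 := by
  simp [coeff_smul, hbar]

theorem coeff_hbar_smul_succ (x : HSeries V) (m : ℕ) : (hbar • x).coeff (m + 1) = x.coeff m := by
  rw [coeff_smul, Finset.Nat.sum_antidiagonal_succ, Finset.sum_eq_single (0, m)]
  · simp [hbar]
  · rintro ⟨p, q⟩ hp hne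
    have hp0 : p ≠ 0 := by
      rintro rfl
      simp_all
    simp [hbar, PowerSeries.coeff_X, hp0]
  · simp

theorem coeff_C_smul (c : ℂ) (x : HSeries V) (m : ℕ) :
    ((PowerSeries.C c : Base) • x).coeff m = c • x.coeff m := by
  rw [coeff_smul, Finset.sum_eq_single (0, m)]
  · simp
  · rintro ⟨p, q⟩ hp hne
    have hp0 : p ≠ 0 := by
      rintro rfl
      simp_all
    simp [PowerSeries.coeff_C, hp0]
  · simp

theorem eq_const_add (x : HSeries V) :
    x = const (x.coeff 0) + hbar • (⟨fun m => x.coeff (m + 1)⟩ : HSeries V) := by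
  ext1
  funext m
  rw [coeff_add]
  cases m with
  | zero => rw [coeff_hbar_smul_zero, add_zero]; rfl
  | succ m => rw [coeff_hbar_smul_succ]; exact (zero_add _).symm

theorem coeff_const (x : V) (m : ℕ) : (const x).coeff m = if m = 0 then x else 0 := rfl

theorem const_add (x y : V) : const (x + y) = const x + const y := by
  ext1
  funext m
  rw [coeff_add, coeff_const, coeff_const, coeff_const]
  split_ifs <;> simp

theorem const_smul (c : ℂ) (x : V) : const (c • x) = (PowerSeries.C c : Base) • const x := by
  ext1
  funext m
  rw [coeff_C_smul, coeff_const, coeff_const]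
  split_ifs <;> simp

end HSeries

/-- Write `x` as its constant term plus `ħ` times a series. By linearity the coefficient of `ħ ^ N`
of the image depends only on the value at a constant and on coefficients of lower order, so no
continuity has to be assumed. -/
theorem op_ext {T T' : Op} (h : ∀ (x : Fock₀) m,
    (T (HSeries.const x)).coeff m = (T' (HSeries.const x)).coeff m) : T = T' := by
  have key : ∀ (N : ℕ) (x : Fock), (T x).coeff N = (T' x).coeff N := by
    intro N
    induction N with
    | zero =>
      intro x
      rw [x.eq_const_add, map_add, map_add, HSeries.coeff_add, HSeries.coeff_add, map_smul, map_smul,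
        HSeries.coeff_hbar_smul_zero, HSeries.coeff_hbar_smul_zero, h]
    | succ N ih =>
      intro x
      rw [x.eq_const_add, map_add, map_add, HSeries.coeff_add, HSeries.coeff_add, map_smul, map_smul,
        HSeries.coeff_hbar_smul_succ, HSeries.coeff_hbar_smul_succ, h, ih]
  exact LinearMap.ext fun x => HSeries.ext (funext fun N => key N x)

/-- The operator on the Fock space given by a power series in `ħ`. -/
def opOf (a : OO) : Op where
  toFun x := ⟨fun m => ∑ p ∈ Finset.HasAntidiagonal.antidiagonal m, OO.coeff p.1 a (x.coeff p.2)⟩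
  map_add' x y := by
    ext1
    funext N
    simp only [map_add, HSeries.coeff_add, Finset.sum_add_distrib]
  map_smul' r x := by
    ext1
    funext N
    simp only [map_smul, map_sum, HSeries.coeff_smul, RingHom.id_apply, Finset.smul_sum, Finset.sum_sigma']
    apply Finset.sum_nbij' (fun ⟨⟨i, _⟩, ⟨k, l⟩⟩ => ⟨(k, i + l), (i, l)⟩)
      (fun ⟨⟨i, _⟩, ⟨k, l⟩⟩ => ⟨(k, i + l), (i, l)⟩) <;> aesop
    all_goals omega

theorem opOf_coeff (a : OO) (x : Fock) (m : ℕ) : (opOf a x).coeff m =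
    ∑ p ∈ Finset.HasAntidiagonal.antidiagonal m, OO.coeff p.1 a (x.coeff p.2) := rfl

theorem opOf_const (a : OO) (x : Fock₀) (m : ℕ) : (opOf a (HSeries.const x)).coeff m = OO.coeff m a x := by
  rw [opOf_coeff, Finset.sum_eq_single (m, 0)]
  · rfl
  · rintro ⟨p, q⟩ hp hne
    have hq : q ≠ 0 := by
      rintro rfl
      simp_all
    simp [HSeries.const, hq]
  · simp

/-- Power series in `ħ` as operators on the Fock space. -/
def toOp : OO →+* Op where
  toFun := opOf
  map_one' := op_ext fun x m => by
    rw [opOf_const, OO.coeff_one, Module.End.one_apply, HSeries.coeff_const]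
    split_ifs <;> rfl
  map_mul' a b := op_ext fun x m => by
    rw [opOf_const, Module.End.mul_apply, opOf_coeff, OO.coeff_mul, LinearMap.sum_apply]
    exact Finset.sum_congr rfl fun p _ => by rw [opOf_const]; rfl
  map_zero' := op_ext fun x m => by
    rw [opOf_const, map_zero]
    rfl
  map_add' a b := op_ext fun x m => by
    rw [opOf_const, map_add, LinearMap.add_apply, LinearMap.add_apply, HSeries.coeff_add, opOf_const,
      opOf_const]

theorem toOp_const (a : OO) (x : Fock₀) (m : ℕ) : (toOp a (HSeries.const x)).coeff m = OO.coeff m a x :=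
  opOf_const a x m

theorem toOp_injective : Function.Injective toOp := fun a b h => OO.ext fun m => LinearMap.ext fun x => by
  rw [← toOp_const, h, toOp_const]

/-- The values of an operator on constant vectors form a power series in `ħ` of operators on
`Fock₀`, and by `op_ext` they determine it. Together with injectivity this identifies `OO` with
`Op`. -/
theorem toOp_surjective : Function.Surjective toOp := fun T =>
  ⟨OO.mk fun m => ⟨⟨fun x => (T (HSeries.const x)).coeff m, fun x y => by
      rw [HSeries.const_add, map_add, HSeries.coeff_add]⟩, fun c x => by
      simp only [HSeries.const_smul, map_smul, HSeries.coeff_C_smul, RingHom.id_apply]⟩,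
    op_ext fun x m => by rw [toOp_const, OO.coeff_mk]; rfl⟩

theorem toOp_bO_mul (c : ℂ) (a : OO) : toOp ((bO c : OO) * a) = (PowerSeries.C c * hbar : Base) • toOp a :=
  op_ext fun x m => by
    rw [toOp_const, LinearMap.smul_apply, mul_smul, HSeries.coeff_C_smul]
    cases m with
    | zero => rw [coeff_bO_mul_zero, HSeries.coeff_hbar_smul_zero, smul_zero]; rfl
    | succ m => rw [coeff_bO_mul_succ, HSeries.coeff_hbar_smul_succ, toOp_const]; rfl

theorem toOp_hO_mul (a : OO) : toOp ((hO : OO) * a) = hbar • toOp a := by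
  rw [← bO_one, toOp_bO_mul, map_one, one_mul]

theorem op_hbar_smul_cancel {T T' : Op} (h : hbar • T = hbar • T') : T = T' := by
  obtain ⟨a, rfl⟩ := toOp_surjective T
  obtain ⟨b, rfl⟩ := toOp_surjective T'
  rw [← toOp_hO_mul, ← toOp_hO_mul] at h
  rw [hO_mul_cancel (toOp_injective h)]

theorem shift_toOp (b : ℂ) (a : ℤ → OO) (n : ℤ) :
    shift b 1 (fun n => toOp (a n)) n = toOp (md (Fld.shift b (fd a)) n) := by
  refine op_ext fun x N => ?_
  have h : ∀ f : ℕ × ℕ → Op₀, (∑ p ∈ Finset.HasAntidiagonal.antidiagonal N, f p) x =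
      ∑ p ∈ Finset.HasAntidiagonal.antidiagonal N, f p x := fun f => LinearMap.sum_apply _ _ _
  rw [toOp_const, coeff_md]
  refine Eq.trans ?_ (h _).symm
  change (∑ p ∈ Finset.HasAntidiagonal.antidiagonal N,
    (((PowerSeries.C (((Ring.choose (n + p.1) p.1 : ℤ) : ℂ) * b ^ p.1) : Base) •
      ((1 : Op) ^ p.1 * toOp (a (n + p.1)))) (HSeries.const x)).coeff p.2) = _
  refine Finset.sum_congr rfl fun p _ => ?_
  rw [LinearMap.smul_apply, HSeries.coeff_C_smul, one_pow, one_mul, toOp_const]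
  rfl

theorem negCoeff_map (f : PowerSeries OO) :
    negCoeff (PowerSeries.map toOp f) = fun n => toOp (unser true f n) := by
  funext n
  rw [negCoeff, unser, sgn_true, neg_one_mul, PowerSeries.coeff_map]
  by_cases hn : n ≤ 0
  · rw [if_pos hn, if_pos (by omega)]
  · rw [if_neg hn, if_neg (by omega), map_zero]

theorem posCoeff_map (f : PowerSeries OO) :
    posCoeff (PowerSeries.map toOp f) = fun n => toOp (unser false f n) := by
  funext n
  rw [posCoeff, unser, sgn_false, one_mul, PowerSeries.coeff_map]
  split_ifs
  · rfl
  · rw [map_zero]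

theorem inverse_eq_of_mul_eq_one {R : Type*} [Ring R] {a b : R} (h : a * b = 1) (h' : b * a = 1) :
    Ring.inverse a = b :=
  Ring.inverse_unit ⟨a, b, h, h'⟩

/-- Division by `ħ`. -/
def divH (a : OO) : OO := OO.mk fun m => OO.coeff (m + 1) a

theorem hO_mul_divH {a : OO} (h : OO.coeff 0 a = 0) : (hO : OO) * divH a = a := by
  refine OO.ext fun m => ?_
  rw [hO_val]
  cases m with
  | zero => rw [OO.coeff_zero_X_mul, h]
  | succ m => rw [OO.coeff_succ_X_mul, divH, OO.coeff_mk]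

theorem OO.coeff_zero_mul (a b : OO) : OO.coeff 0 (a * b) = OO.coeff 0 a * OO.coeff 0 b := by
  simp [OO.coeff_mul]

theorem coeff_zero_tMat (k E F : OO) (a b : Fin 2) : OO.coeff 0 (tMat k E F a b) =
    tMat (OO.coeff 0 k) (OO.coeff 0 E) (OO.coeff 0 F) a b := by
  fin_cases a <;> fin_cases b <;> simp [Ring.lie_def, OO.coeff_zero_mul]

theorem coeff_zero_md_kF (i : Fin 2) (s : ℂ) (e : Bool) (j : Fin 2) (n : ℤ) :
    OO.coeff 0 (md (kF i s e j) n) = if n = 0 then 1 else 0 := by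
  rw [md_kF, unser]
  by_cases hn : 0 ≤ sgn e * n
  · rw [if_pos hn, coeff_curryS, coeff_kSer_zero]
    refine if_congr ?_ rfl rfl
    cases e <;> simp at hn ⊢ <;> omega
  · rw [if_neg hn, map_zero, if_neg]
    rintro rfl
    simp at hn

/-- `T⁺(u)` must be the identity at `u = ∞`, as its expansion has no free constant term. The
annihilation exponent has no term in `u ^ 0` and the lattice factor is `1` there. -/
theorem md_kF_true_zero (i : Fin 2) (s : ℂ) : md (kF i s true 0) 0 = 1 := by
  have hD : ∀ d ∈ {d : Fin 2 →₀ ℕ | d 1 = 0}, ∀ d' ≤ d, d' ∈ {d : Fin 2 →₀ ℕ | d 1 = 0} :=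
    fun d hd d' h => Nat.le_zero.1 ((h 1).trans_eq hd)
  refine OO.ext fun m => ?_
  rw [md_kF, unser, mul_zero, if_pos le_rfl, coeff_curryS, OO.coeff_one]
  simp only [kSer, if_true]
  rw [kPlusOp_eq, Int.toNat_zero, coeff_annOp_of_coeff_eq_zero hD
    (fun d hd => coeff_annExp_eq_zero (by intro M _ g; simp [wsum])
      (Or.inr ((show d 1 = 0 from hd).trans_le zero_le_one))) _ (expo_apply_one m 0)]
  simp only [coeff_tz]
  by_cases hm : m = 0
  · subst hm
    simp only [if_true, constantCoeff_powS constantCoeff_halfT]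
    exact latticeDiag_one
  · simp only [hm, if_false]
    exact latticeDiag_zero

theorem tMat_one {A : Type*} [Ring A] (E F : A) (a b : Fin 2) :
    tMat 1 E F a b = if a = b then 1 else 0 := by
  fin_cases a <;> fin_cases b <;> simp [Ring.lie_def]

theorem tMat_zero {A : Type*} [Ring A] (E F : A) (a b : Fin 2) : tMat 0 E F a b = 0 := by
  fin_cases a <;> fin_cases b <;> simp [Ring.lie_def]

theorem tO_true_zero (i : Fin 2) (s : ℂ) (a b : Fin 2) :
    tO i s true 0 a b = if a = b then 1 else 0 := by
  rw [tO, md_kF_true_zero, tMat_one]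

theorem isSupp_tO (i : Fin 2) (s : ℂ) (e : Bool) (a b : Fin 2) : IsSupp e fun n => tO i s e n a b :=
  isSupp_tMat (isSupp_md_kF i s e 0) _ _ a b

/-- Modulo `ħ` the current `k₁` is `1`, so its brackets vanish and `T^±(u)` is the identity. The
generators can therefore be defined by division by `ħ`. -/
theorem coeff_zero_tO (i : Fin 2) (s : ℂ) (e : Bool) (n : ℤ) (a b : Fin 2) :
    OO.coeff 0 (tO i s e n a b) = if n = 0 ∧ a = b then 1 else 0 := by
  rw [tO, coeff_zero_tMat, coeff_zero_md_kF]
  by_cases hn : n = 0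
  · simp only [hn, if_true, true_and]
    exact tMat_one _ _ a b
  · simp only [hn, if_false, false_and]
    exact tMat_zero _ _ a b

/-- The operators for the generators. -/
def tOp (i : Fin 2) (s : ℂ) (a b : Fin 2) (k : ℤ) : Op :=
  if 0 ≤ k then -toOp (divH (tO i s true (-k - 1) a b))
  else toOp (divH (tO i s false (-k - 1) a b - if -k - 1 = 0 ∧ a = b then 1 else 0))

theorem Tplus_tOp (i : Fin 2) (s : ℂ) (n : ℤ) (a b : Fin 2) :
    Tplus (tOp i s) n a b = toOp (tO i s true n a b) := by
  rw [Tplus, Matrix.of_apply]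
  rcases lt_trichotomy n 0 with hn | rfl | hn
  · have h1 : -(-n - 1) - 1 = n := by ring
    rw [if_neg (fun h => hn.ne h.1), if_pos hn, tOp, if_pos (by omega), smul_neg, zero_sub, neg_neg,
      ← toOp_hO_mul, h1, hO_mul_divH]
    rw [coeff_zero_tO, if_neg (fun h => hn.ne h.1)]
  · rw [if_neg (lt_irrefl _), sub_zero, tO_true_zero]
    simp only [true_and]
    split_ifs
    · rw [map_one]
    · rw [map_zero]
  · have h : tO i s true n a b = 0 := isSupp_tO i s true a b n (by simpa using hn)
    rw [if_neg (fun h => hn.ne' h.1), if_neg hn.not_gt, sub_zero, h, map_zero]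

theorem Tminus_tOp (i : Fin 2) (s : ℂ) (n : ℤ) (a b : Fin 2) :
    Tminus (tOp i s) n a b = toOp (tO i s false n a b) := by
  rw [Tminus, Matrix.of_apply]
  by_cases hn : 0 ≤ n
  · have h1 : -(-n - 1) - 1 = n := by ring
    have h2 : (if n = 0 ∧ a = b then (1 : Op) else 0) = toOp (if n = 0 ∧ a = b then 1 else 0) := by
      split_ifs
      · rw [map_one]
      · rw [map_zero]
    rw [if_pos hn, h2, tOp, if_neg (show ¬ 0 ≤ -n - 1 by omega), ← toOp_hO_mul, h1, hO_mul_divH,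
      ← map_add, add_sub_cancel]
    rw [map_sub, coeff_zero_tO]
    split_ifs
    · rw [OO.coeff_one, if_pos rfl, sub_self]
    · rw [map_zero]
      exact sub_self _
  · have h : tO i s false n a b = 0 := isSupp_tO i s false a b n (by simpa using hn)
    rw [if_neg (fun h => hn h.1.ge), if_neg hn, add_zero, h, map_zero]

theorem map_msc {B A : Type*} [Ring B] [Ring A] (φ : B →+* A) (y : B) (D : ℤ → ℤ → B) (m n : ℤ) :
    φ (msc y D m n) = msc (φ y) (fun m n => φ (D m n)) m n := by
  simp [msc]

section Entries

variable {B : Type*} [Ring B] [Algebra Base B]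

theorem prod₁₂_apply (T T' : ℤ → Matrix (Fin 2) (Fin 2) B) (m n : ℤ) (a b c d : Fin 2) :
    prod₁₂ T T' m n (a, c) (b, d) = T m a b * T' n c d := by
  simp [prod₁₂, leg₁, leg₂, Matrix.mul_apply, Fintype.sum_prod_type, Matrix.one_apply]

theorem prod₂₁_apply (T T' : ℤ → Matrix (Fin 2) (Fin 2) B) (m n : ℤ) (a b c d : Fin 2) :
    prod₂₁ T T' m n (a, c) (b, d) = T' n c d * T m a b := by
  simp [prod₂₁, leg₁, leg₂, Matrix.mul_apply, Fintype.sum_prod_type, Matrix.one_apply]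

theorem mulScalar_apply (y : B) (D : Dist B) (m n : ℤ) (x x' : Fin 2 × Fin 2) :
    mulScalar y D m n x x' = msc y (fun m n => D m n x x') m n := rfl

theorem mulYangLeft_apply (y : B) (D : Dist B) (m n : ℤ) (a b c d : Fin 2) :
    mulYangLeft y D m n (a, c) (b, d) =
      msc y (fun m n => D m n (a, c) (b, d)) m n + hbar • D m n (c, a) (b, d) := by
  simp [mulYangLeft, mulScalar, msc, perm, Matrix.mul_apply, Prod.ext_iff, ite_and, Fintype.sum_prod_type]

theorem mulYangRight_apply (y : B) (D : Dist B) (m n : ℤ) (a b c d : Fin 2) :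
    mulYangRight y D m n (a, c) (b, d) =
      msc y (fun m n => D m n (a, c) (b, d)) m n + hbar • D m n (a, c) (d, b) := by
  simp [mulYangRight, mulScalar, msc, perm, Matrix.mul_apply, Prod.ext_iff, ite_and, Fintype.sum_prod_type]

theorem map_Tplus {A : Type*} [Ring A] [Algebra Base A] (φ : B →ₐ[Base] A) (t : Fin 2 → Fin 2 → ℤ → B)
    (n : ℤ) (a b : Fin 2) : φ (Tplus t n a b) = Tplus (fun a b k => φ (t a b k)) n a b := by
  simp only [Tplus, Matrix.of_apply, map_sub, apply_ite φ, map_one, map_zero, map_smul]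

theorem map_Tminus {A : Type*} [Ring A] [Algebra Base A] (φ : B →ₐ[Base] A) (t : Fin 2 → Fin 2 → ℤ → B)
    (n : ℤ) (a b : Fin 2) : φ (Tminus t n a b) = Tminus (fun a b k => φ (t a b k)) n a b := by
  simp only [Tminus, Matrix.of_apply, map_add, apply_ite φ, map_one, map_zero, map_smul]

end Entries

/-! ### The representation -/

/-- The representation of the free algebra. -/
def freeRep (i : Fin 2) (s : ℂ) : FreeAlgebra Base Gen →ₐ[Base] Op :=
  FreeAlgebra.lift Base fun g => match g with
    | .t a b k => tOp i s a b k
    | .c => 1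

theorem freeRep_t (i : Fin 2) (s : ℂ) (a b : Fin 2) (k : ℤ) : freeRep i s (freeT a b k) = tOp i s a b k :=
  FreeAlgebra.lift_ι_apply _ _

theorem freeRep_c (i : Fin 2) (s : ℂ) : freeRep i s freeC = 1 := FreeAlgebra.lift_ι_apply _ _

theorem freeRep_Tplus (i : Fin 2) (s : ℂ) (n : ℤ) (a b : Fin 2) :
    freeRep i s (Tplus freeT n a b) = toOp (tO i s true n a b) := by
  rw [map_Tplus, ← Tplus_tOp]
  simp only [freeRep_t]

theorem freeRep_Tminus (i : Fin 2) (s : ℂ) (n : ℤ) (a b : Fin 2) :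
    freeRep i s (Tminus freeT n a b) = toOp (tO i s false n a b) := by
  rw [map_Tminus, ← Tminus_tOp]
  simp only [freeRep_t]

theorem freeRep_halfHC (i : Fin 2) (s : ℂ) : freeRep i s halfHC = toOp (bO (1 / 2) : OO) := by
  rw [halfHC, map_smul, freeRep_c, ← mul_one (bO (1 / 2) : OO), toOp_bO_mul, map_one]

theorem freeRep_hbar (i : Fin 2) (s : ℂ) : freeRep i s (algebraMap Base _ hbar) = toOp (hO : OO) := by
  rw [AlgHom.commutes, Algebra.algebraMap_eq_smul_one, ← mul_one (hO : OO), toOp_hO_mul, map_one]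

theorem freeRep_msc (i : Fin 2) (s : ℂ) (y : FreeAlgebra Base Gen) (D : ℤ → ℤ → FreeAlgebra Base Gen)
    (m n : ℤ) : freeRep i s (msc y D m n) = msc (freeRep i s y) (fun m n => freeRep i s (D m n)) m n :=
  map_msc (freeRep i s : FreeAlgebra Base Gen →+* Op) y D m n

theorem freeRep_rel (i : Fin 2) (s : ℂ) {x y : FreeAlgebra Base Gen} (h : Rel x y) :
    freeRep i s x = freeRep i s y := by
  cases h with
  | central a b k => rw [map_mul, map_mul, freeRep_c, one_mul, mul_one]
  | plus_plus m n x y =>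
    obtain ⟨a, c⟩ := x
    obtain ⟨b, d⟩ := y
    have h := congrArg toOp (tO_same i s true a b c d m n)
    simp only [map_add, map_msc, toOp_hO_mul, map_zero] at h
    simp only [map_mul] at h
    simp only [mulYangLeft_apply, mulYangRight_apply, prod₁₂_apply, prod₂₁_apply, map_add, map_smul,
      freeRep_msc, map_mul, freeRep_Tplus, map_zero]
    exact h
  | minus_minus m n x y =>
    obtain ⟨a, c⟩ := x
    obtain ⟨b, d⟩ := y
    have h := congrArg toOp (tO_same i s false a b c d m n)
    simp only [map_add, map_msc, toOp_hO_mul, map_zero] at h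
    simp only [map_mul] at h
    simp only [mulYangLeft_apply, mulYangRight_apply, prod₁₂_apply, prod₂₁_apply, map_add, map_smul,
      freeRep_msc, map_mul, freeRep_Tminus, map_zero]
    exact h
  | plus_minus m n x y =>
    obtain ⟨a, c⟩ := x
    obtain ⟨b, d⟩ := y
    have h := congrArg toOp (tO_mixed i s a b c d m n)
    simp only [map_add, map_neg, map_msc, toOp_hO_mul] at h
    simp only [map_mul] at h
    simp only [mulScalar_apply, mulYangLeft_apply, mulYangRight_apply, prod₁₂_apply, prod₂₁_apply, map_add,
      map_neg, map_smul, freeRep_msc, map_mul, freeRep_Tplus, freeRep_Tminus, freeRep_halfHC, freeRep_hbar]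
    exact h

/-- The representation. -/
def rep (i : Fin 2) (s : ℂ) : DY →ₐ[Base] Op :=
  RingQuot.liftAlgHom Base ⟨freeRep i s, fun _ _ h => freeRep_rel i s h⟩

theorem rep_t (i : Fin 2) (s : ℂ) (a b : Fin 2) (k : ℤ) : rep i s (DY.t a b k) = tOp i s a b k := by
  rw [rep, DY.t, RingQuot.liftAlgHom_mkAlgHom_apply, freeRep_t]

theorem rep_c (i : Fin 2) (s : ℂ) : rep i s DY.c = 1 := by
  rw [rep, DY.c, RingQuot.liftAlgHom_mkAlgHom_apply, freeRep_c]

/-- The matrix `T^±(u)`. -/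
def tSer (i : Fin 2) (s : ℂ) (e : Bool) : Matrix (Fin 2) (Fin 2) (PowerSeries OO) :=
  Matrix.of fun a b => serE e fun n => tO i s e n a b

theorem repTplus_rep (i : Fin 2) (s : ℂ) :
    repTplus (rep i s) = (tSer i s true).map (PowerSeries.map toOp) := by
  ext a b n : 3
  rw [repTplus, Matrix.of_apply, PowerSeries.coeff_mk, Matrix.map_apply, tSer, Matrix.of_apply,
    PowerSeries.coeff_map, serE, PowerSeries.coeff_mk, sgn_true, neg_one_mul, ← Tplus_tOp]
  simp only [rep_t]

theorem repTminus_rep (i : Fin 2) (s : ℂ) :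
    repTminus (rep i s) = (tSer i s false).map (PowerSeries.map toOp) := by
  ext a b n : 3
  rw [repTminus, Matrix.of_apply, PowerSeries.coeff_mk, Matrix.map_apply, tSer, Matrix.of_apply,
    PowerSeries.coeff_map, serE, PowerSeries.coeff_mk, sgn_false, one_mul, ← Tminus_tOp]
  simp only [rep_t]

/-- Every generator `tᵢⱼᵏ` occurs once in `T^±`, multiplied by `ħ`, with `k ≥ 0` in `T⁺` and `k < 0`
in `T⁻`. The factor `ħ` can be cancelled on operators. -/
theorem algHom_ext_of_repT {ρ ρ' : DY →ₐ[Base] Op} (hc : ρ DY.c = ρ' DY.c)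
    (hp : repTplus ρ = repTplus ρ') (hm : repTminus ρ = repTminus ρ') : ρ = ρ' := by
  refine RingQuot.ringQuot_ext' Base _ _ (FreeAlgebra.hom_ext (funext fun g => ?_))
  match g with
  | .c => exact hc
  | .t a b k =>
    change ρ (DY.t a b k) = ρ' (DY.t a b k)
    rcases lt_or_ge k 0 with hk | hk
    · have h := congrArg (PowerSeries.coeff (-k - 1).toNat) (congrFun (congrFun hm a) b)
      rw [repTminus, repTminus, Matrix.of_apply, Matrix.of_apply, PowerSeries.coeff_mk,
        PowerSeries.coeff_mk, Tminus, Tminus, Matrix.of_apply, Matrix.of_apply, add_right_inj,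
        Int.toNat_of_nonneg (by omega), if_pos (by omega), if_pos (by omega),
        show -(-k - 1) - 1 = k by ring] at h
      exact op_hbar_smul_cancel h
    · have h := congrArg (PowerSeries.coeff (k + 1).toNat) (congrFun (congrFun hp a) b)
      rw [repTplus, repTplus, Matrix.of_apply, Matrix.of_apply, PowerSeries.coeff_mk,
        PowerSeries.coeff_mk, Tplus, Tplus, Matrix.of_apply, Matrix.of_apply, sub_right_inj,
        Int.toNat_of_nonneg (by omega), if_pos (by omega), if_pos (by omega),
        show -(-(k + 1)) - 1 = k by ring] at h
      exact op_hbar_smul_cancel h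

/-! ### The Gauss decomposition -/

theorem gaussE_map {P : Matrix (Fin 2) (Fin 2) (PowerSeries OO)} {κ : PowerSeries OO}
    (h : P 0 0 * κ = 1) (h' : κ * P 0 0 = 1) :
    gaussE (P.map (PowerSeries.map toOp)) = PowerSeries.map toOp (κ * P 0 1) := by
  rw [gaussE, Matrix.map_apply, Matrix.map_apply, inverse_eq_of_mul_eq_one (b := PowerSeries.map toOp κ)
    (by rw [← map_mul, h, map_one]) (by rw [← map_mul, h', map_one]), map_mul]

theorem gaussF_map {P : Matrix (Fin 2) (Fin 2) (PowerSeries OO)} {κ : PowerSeries OO}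
    (h : P 0 0 * κ = 1) (h' : κ * P 0 0 = 1) :
    gaussF (P.map (PowerSeries.map toOp)) = PowerSeries.map toOp (P 1 0 * κ) := by
  rw [gaussF, Matrix.map_apply, Matrix.map_apply, inverse_eq_of_mul_eq_one (b := PowerSeries.map toOp κ)
    (by rw [← map_mul, h, map_one]) (by rw [← map_mul, h', map_one]), map_mul]

theorem gaussK_zero_map (P : Matrix (Fin 2) (Fin 2) (PowerSeries OO)) :
    gaussK (P.map (PowerSeries.map toOp)) 0 = PowerSeries.map toOp (P 0 0) := by
  rw [gaussK, if_pos rfl, Matrix.map_apply]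

theorem gaussK_one_map {P : Matrix (Fin 2) (Fin 2) (PowerSeries OO)} {κ : PowerSeries OO}
    (h : P 0 0 * κ = 1) (h' : κ * P 0 0 = 1) :
    gaussK (P.map (PowerSeries.map toOp)) 1 = PowerSeries.map toOp (P 1 1 - P 1 0 * κ * P 0 1) := by
  rw [gaussK, if_neg one_ne_zero, Matrix.map_apply, Matrix.map_apply, Matrix.map_apply, Matrix.map_apply,
    inverse_eq_of_mul_eq_one (b := PowerSeries.map toOp κ)
    (by rw [← map_mul, h, map_one]) (by rw [← map_mul, h', map_one]), map_sub, map_mul, map_mul]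

/-- The matrix has the prescribed Gauss decomposition. -/
structure HasGauss (i : Fin 2) (s : ℂ) (e : Bool) (P : Matrix (Fin 2) (Fin 2) (PowerSeries OO)) :
    Prop where
  k₁ : P 0 0 = serE e (md (kF i s e 0))
  k₂ : P 1 1 - P 1 0 * curryS (kInvSer i s e) * P 0 1 = serE e (md (kF i s e 1))
  half_E : curryS (kInvSer i s e) * P 0 1 = halfE i s e 0
  half_F : P 1 0 * curryS (kInvSer i s e) = halfFm i s e 0

theorem HasGauss.unique {i : Fin 2} {s : ℂ} {e : Bool} {P P' : Matrix (Fin 2) (Fin 2) (PowerSeries OO)}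
    (h : HasGauss i s e P) (h' : HasGauss i s e P') : P = P' := by
  have h01 : P 0 1 = P' 0 1 := by
    rw [← one_mul (P 0 1), ← one_mul (P' 0 1), ← mul_curryS_kInvSer i s e, mul_assoc, mul_assoc, h.half_E,
      h'.half_E]
  have h10 : P 1 0 = P' 1 0 := by
    rw [← mul_one (P 1 0), ← mul_one (P' 1 0), ← curryS_kInvSer_mul i s e, ← mul_assoc, ← mul_assoc,
      h.half_F, h'.half_F]
  have h11 : P 1 1 = P' 1 1 := by
    rw [← sub_add_cancel (P 1 1), h.k₂, h01, h10, ← h'.k₂, sub_add_cancel]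
  ext1 a b
  fin_cases a <;> fin_cases b
  · exact h.k₁.trans h'.k₁.symm
  · exact h01
  · exact h10
  · exact h11

theorem hasGauss_tSer (i : Fin 2) (s : ℂ) (e : Bool) : HasGauss i s e (tSer i s e) := by
  have h : ∀ a b, tSer i s e a b =
      tMat (serE e (md (kF i s e 0))) (PowerSeries.C (vE i 0)) (PowerSeries.C (vF i 0)) a b :=
    fun a b => (tMat_serE e _ _ _ a b).symm
  refine ⟨h 0 0, ?_, ?_, ?_⟩
  · rw [h, h, h, tMat_11, tMat_10, tMat_01, (isGauss i s e).entry, add_sub_cancel_right]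
  · rw [h, tMat_01, Ring.lie_def, mul_sub, ← mul_assoc, ← mul_assoc, curryS_kInvSer_mul, one_mul, halfE]
  · rw [h, tMat_10, Ring.lie_def, sub_mul, mul_assoc (PowerSeries.C _), mul_curryS_kInvSer, mul_one, halfFm]

/-- The half current with non-negative powers carries a minus sign, so the difference of the halves
is the whole current. -/
theorem halfF_sub_halfF (f : Fld ℤ Op₀) (n : ℤ) :
    md (halfF true (fun n => (hO : OO) * md f (-n - 1)) 0) n -
      md (halfF false (fun n => (hO : OO) * md f (-n - 1)) 0) n = (hO : OO) * md f n := by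
  refine OO.ext fun m => ?_
  have hn : -(0 - n - 1) - 1 = n := by ring
  rw [map_sub, coeff_md, coeff_md, halfF, halfF, hn, if_pos rfl, if_neg Bool.false_ne_true]
  rcases lt_or_ge n 0 with h | h
  · rw [if_pos h, if_neg (not_le.2 h)]
    have h1 : ∀ x : Op₀, x - 0 = x := fun x => sub_zero x
    exact h1 _
  · rw [if_neg (not_lt.2 h), if_pos h]
    have h1 : ∀ x : Op₀, 0 - -x = x := fun x => (zero_sub (-x)).trans (neg_neg x)
    exact h1 _

/-- The arguments `u_∓` in the definition of `X⁺` undo the shifts by `betaE` in the half currents;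
what remains is the difference of the two unshifted halves. -/
theorem shift_halfE (i : Fin 2) (s : ℂ) (n : ℤ) :
    shift (-1 / 4) 1 (negCoeff (PowerSeries.map toOp (halfE i s true 0))) n -
      shift (1 / 4) 1 (posCoeff (PowerSeries.map toOp (halfE i s false 0))) n =
        hbar • toOp (md (vPlusF i) n) := by
  have h1 := shift_fd_unser (halfRel_halfE i s true) 0
  have h2 := shift_fd_unser (halfRel_halfE i s false) 0
  rw [betaE, if_pos rfl, ← neg_div] at h1
  rw [betaE, if_neg Bool.false_ne_true, ← neg_div, neg_neg] at h2
  rw [negCoeff_map, posCoeff_map, shift_toOp, shift_toOp, h1, h2, ← map_sub, ← toOp_hO_mul]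
  exact congrArg toOp (halfF_sub_halfF (vPlusF i) n)

theorem shift_halfFm (i : Fin 2) (s : ℂ) (n : ℤ) :
    shift (1 / 4) 1 (negCoeff (PowerSeries.map toOp (halfFm i s true 0))) n -
      shift (-1 / 4) 1 (posCoeff (PowerSeries.map toOp (halfFm i s false 0))) n =
        hbar • toOp (md (vMinusF i) n) := by
  have h1 := shift_fd_unser (halfRel_halfFm i s true) 0
  have h2 := shift_fd_unser (halfRel_halfFm i s false) 0
  rw [neg_neg, betaE, if_pos rfl] at h1
  rw [neg_neg, betaE, if_neg Bool.false_ne_true] at h2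
  rw [negCoeff_map, posCoeff_map, shift_toOp, shift_toOp, h1, h2, ← map_sub, ← toOp_hO_mul]
  exact congrArg toOp (halfF_sub_halfF (vMinusF i) n)

theorem hbar_smul_vPlus (i : Fin 2) (n : ℤ) (x : Fock₀) :
    (hbar • toOp (md (vPlusF i) n)) (HSeries.const x) =
      hbar • vertexCoeff xPlusCre (xPlusAnn i) (alphaWeight i) n x := by
  rw [LinearMap.smul_apply]
  congr 1
  refine HSeries.ext (funext fun m => ?_)
  rw [toOp_const, coeff_md, vPlusF_apply]

theorem hbar_smul_vMinus (i : Fin 2) (n : ℤ) (x : Fock₀) :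
    (hbar • toOp (md (vMinusF i) n)) (HSeries.const x) =
      hbar • vertexCoeff xMinusCre (xMinusAnn i) (fun q => -alphaWeight i q) n x := by
  rw [LinearMap.smul_apply]
  congr 1
  refine HSeries.ext (funext fun m => ?_)
  rw [toOp_const, coeff_md, vMinusF_apply]

theorem coeff_map_curryS (f : OpSeries) (n m : ℕ) (x : Fock₀) :
    (PowerSeries.coeff n (PowerSeries.map toOp (curryS f)) (HSeries.const x)).coeff m =
      MvPowerSeries.coeff (expo m n) f x := by
  rw [PowerSeries.coeff_map, toOp_const, coeff_curryS]

theorem isBosonization_rep (i : Fin 2) (s : ℂ) : IsBosonization (rep i s) i s := by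
  have hk : ∀ e, tSer i s e 0 0 * curryS (kInvSer i s e) = 1 := fun e => by
    rw [(hasGauss_tSer i s e).k₁, mul_curryS_kInvSer]
  have hk' : ∀ e, curryS (kInvSer i s e) * tSer i s e 0 0 = 1 := fun e => by
    rw [(hasGauss_tSer i s e).k₁, curryS_kInvSer_mul]
  have hK : ∀ e j, gaussK ((tSer i s e).map (PowerSeries.map toOp)) j =
      PowerSeries.map toOp (curryS (kSer i s e j)) := by
    intro e j
    fin_cases j
    · exact (gaussK_zero_map _).trans (by rw [(hasGauss_tSer i s e).k₁, serE_md_kF]; rfl)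
    · exact (gaussK_one_map (hk e) (hk' e)).trans (by rw [(hasGauss_tSer i s e).k₂, serE_md_kF]; rfl)
  refine ⟨rep_c i s, fun j n m x => ?_, fun j n m x => ?_, fun n x => ?_, fun n x => ?_⟩
  · rw [repKplus, repTplus_rep, hK, coeff_map_curryS]
    rfl
  · rw [repKminus, repTminus_rep, hK, coeff_map_curryS]
    rfl
  · rw [repXplus, repTplus_rep, repTminus_rep, rep_c, gaussE_map (hk _) (hk' _), gaussE_map (hk _) (hk' _),
      (hasGauss_tSer i s true).half_E, (hasGauss_tSer i s false).half_E, shift_halfE, hbar_smul_vPlus]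
  · rw [repXminus, repTplus_rep, repTminus_rep, rep_c, gaussF_map (hk _) (hk' _), gaussF_map (hk _) (hk' _),
      (hasGauss_tSer i s true).half_F, (hasGauss_tSer i s false).half_F, shift_halfFm, hbar_smul_vMinus]

/-! ### Uniqueness: the currents determine the Gauss coordinates -/

theorem map_toOp_injective : Function.Injective (PowerSeries.map toOp) := fun f g h =>
  PowerSeries.ext fun n => toOp_injective (by rw [← PowerSeries.coeff_map, h, PowerSeries.coeff_map])

theorem exists_map_toOp (M : Matrix (Fin 2) (Fin 2) (PowerSeries Op)) :
    ∃ P : Matrix (Fin 2) (Fin 2) (PowerSeries OO), M = P.map (PowerSeries.map toOp) := by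
  choose g hg using toOp_surjective
  refine ⟨Matrix.of fun a b => PowerSeries.mk fun n => g (PowerSeries.coeff n (M a b)), ?_⟩
  ext a b n : 3
  rw [Matrix.map_apply, Matrix.of_apply, PowerSeries.coeff_map, PowerSeries.coeff_mk, hg]

theorem eq_map_curryS {f : PowerSeries OO} {g : OpSeries} (h : ∀ (n m : ℕ) (x : Fock₀),
    (PowerSeries.coeff n (PowerSeries.map toOp f) (HSeries.const x)).coeff m =
      MvPowerSeries.coeff (expo m n) g x) : f = curryS g :=
  map_toOp_injective <| PowerSeries.ext fun n => op_ext fun x m => by rw [h, coeff_map_curryS]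

theorem isNeg_fd_unser_of_coeff_zero {r : PowerSeries OO} (h : PowerSeries.coeff 0 r = 0) :
    (fd (unser true r)).IsNeg := by
  intro m x hx
  rw [fd]
  rcases hx.lt_or_eq with hx | rfl
  · rw [isSupp_unser true r x (by simpa using hx), map_zero]
  · rw [unser, mul_zero, if_pos le_rfl, Int.toNat_zero, h, map_zero]

/-- Shifts preserve negative and non-negative supports, so in an equality of differences the two
halves are separated by the sign of the exponent. `hr` excludes a constant term in the negative
half, which would mix the two. -/
theorem halves_unique {b b' : ℂ} {r r' q q' : PowerSeries OO} (hr : PowerSeries.coeff 0 r = 0)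
    (hr' : (fd (unser true r')).IsNeg)
    (h : ∀ n, shift b 1 (negCoeff (PowerSeries.map toOp r)) n -
        shift b' 1 (posCoeff (PowerSeries.map toOp q)) n =
      shift b 1 (negCoeff (PowerSeries.map toOp r')) n -
        shift b' 1 (posCoeff (PowerSeries.map toOp q')) n) : r = r' ∧ q = q' := by
  simp only [negCoeff_map, posCoeff_map, shift_toOp] at h
  have h1 : Fld.shift b (fd (unser true r) - fd (unser true r')) =
      Fld.shift b' (fd (unser false q) - fd (unser false q')) := by
    rw [Fld.shift_sub, Fld.shift_sub]
    funext m n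
    have h2 := congrArg (fun T => T) (h n)
    rw [sub_eq_sub_iff_sub_eq_sub, ← map_sub, ← map_sub] at h2
    have h3 := congrArg (OO.coeff m) (toOp_injective h2)
    rwa [map_sub, map_sub, coeff_md, coeff_md, coeff_md, coeff_md] at h3
  have hneg := ((isNeg_fd_unser_of_coeff_zero hr).sub hr').shift b
  have hpos := ((isNonneg_fd_unser q).sub (isNonneg_fd_unser q')).shift b'
  have h0 : Fld.shift b (fd (unser true r) - fd (unser true r')) = 0 := by
    funext m n
    rcases lt_or_ge n 0 with hn | hn
    · rw [h1]
      exact hpos m n hn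
    · exact hneg m n hn
  have hz : ∀ (b : ℂ) (f : Fld ℤ Op₀), Fld.shift b f = 0 → f = 0 := fun b f hf =>
    Fld.shift_injective b (hf.trans (Fld.shift_zero b).symm)
  have e1 := fd_injective (sub_eq_zero.1 (hz b _ h0))
  have e2 := fd_injective (sub_eq_zero.1 (hz b' _ (h1.symm.trans h0)))
  exact ⟨by rw [← serE_unser true r, e1, serE_unser], by rw [← serE_unser false q, e2, serE_unser]⟩

theorem IsBosonization.hasGauss {ρ : DY →ₐ[Base] Op} {i : Fin 2} {s : ℂ} (hρ : IsBosonization ρ i s)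
    {P Q : Matrix (Fin 2) (Fin 2) (PowerSeries OO)} (hP : repTplus ρ = P.map (PowerSeries.map toOp))
    (hQ : repTminus ρ = Q.map (PowerSeries.map toOp)) : HasGauss i s true P ∧ HasGauss i s false Q := by
  have hP0 : P 0 0 = serE true (md (kF i s true 0)) := by
    rw [serE_md_kF]
    refine eq_map_curryS fun n m x => ?_
    rw [← gaussK_zero_map, ← hP]
    exact hρ.kPlus 0 n m x
  have hQ0 : Q 0 0 = serE false (md (kF i s false 0)) := by
    rw [serE_md_kF]
    refine eq_map_curryS fun n m x => ?_
    rw [← gaussK_zero_map, ← hQ]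
    exact hρ.kMinus 0 n m x
  have hP1 := mul_curryS_kInvSer i s true
  have hP2 := curryS_kInvSer_mul i s true
  have hQ1 := mul_curryS_kInvSer i s false
  have hQ2 := curryS_kInvSer_mul i s false
  rw [← hP0] at hP1 hP2
  rw [← hQ0] at hQ1 hQ2
  -- The off-diagonal entries of `T⁺` start at `u⁻¹`. This normalisation assigns the constant term
  -- of `X^±` to the half from `T⁻`.
  have hoff : ∀ a b, a ≠ b → PowerSeries.coeff 0 (P a b) = 0 := by
    intro a b hab
    refine toOp_injective ?_
    have h := congrArg (PowerSeries.coeff 0) (congrFun (congrFun hP a) b)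
    rw [Matrix.map_apply, PowerSeries.coeff_map, repTplus, Matrix.of_apply, PowerSeries.coeff_mk] at h
    rw [← h, map_zero]
    simp [Tplus, hab]
  have hE := halves_unique (r := curryS (kInvSer i s true) * P 0 1) (r' := halfE i s true 0)
    (q := curryS (kInvSer i s false) * Q 0 1) (q' := halfE i s false 0) (b := -1 / 4) (b' := 1 / 4)
    (by simp [PowerSeries.coeff_mul, hoff]) (isNeg_fd_unser (halfRel_halfE i s true 0)) fun n => by
      rw [shift_halfE]
      refine op_ext fun x m => ?_
      rw [hbar_smul_vPlus, ← hρ.xPlus, repXplus, hP, hQ, hρ.level_one, gaussE_map hP1 hP2,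
        gaussE_map hQ1 hQ2]
  have hF := halves_unique (r := P 1 0 * curryS (kInvSer i s true)) (r' := halfFm i s true 0)
    (q := Q 1 0 * curryS (kInvSer i s false)) (q' := halfFm i s false 0) (b := 1 / 4) (b' := -1 / 4)
    (by simp [PowerSeries.coeff_mul, hoff]) (isNeg_fd_unser (halfRel_halfFm i s true 0)) fun n => by
      rw [shift_halfFm]
      refine op_ext fun x m => ?_
      rw [hbar_smul_vMinus, ← hρ.xMinus, repXminus, hP, hQ, hρ.level_one, gaussF_map hP1 hP2,
        gaussF_map hQ1 hQ2]
  refine ⟨⟨hP0, ?_, hE.1, hF.1⟩, ⟨hQ0, ?_, hE.2, hF.2⟩⟩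
  · rw [serE_md_kF]
    refine eq_map_curryS fun n m x => ?_
    rw [← gaussK_one_map hP1 hP2, ← hP]
    exact hρ.kPlus 1 n m x
  · rw [serE_md_kF]
    refine eq_map_curryS fun n m x => ?_
    rw [← gaussK_one_map hQ1 hQ2, ← hQ]
    exact hρ.kMinus 1 n m x

end YangianDouble

end

theorem theorem2 (i : Fin 2) (s : ℂ) :
    ∃! ρ : YangianDouble.DY →ₐ[YangianDouble.Base] YangianDouble.Op,
      YangianDouble.IsBosonization ρ i s := by
  refine ⟨YangianDouble.rep i s, YangianDouble.isBosonization_rep i s, fun ρ hρ => ?_⟩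
  obtain ⟨P, hP⟩ := YangianDouble.exists_map_toOp (YangianDouble.repTplus ρ)
  obtain ⟨Q, hQ⟩ := YangianDouble.exists_map_toOp (YangianDouble.repTminus ρ)
  obtain ⟨h1, h2⟩ := hρ.hasGauss hP hQ
  refine YangianDouble.algHom_ext_of_repT ?_ ?_ ?_
  · rw [hρ.level_one, YangianDouble.rep_c]
  · rw [hP, YangianDouble.repTplus_rep, h1.unique (YangianDouble.hasGauss_tSer i s true)]
  · rw [hQ, YangianDouble.repTminus_rep, h2.unique (YangianDouble.hasGauss_tSer i s false)]
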